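/- Let $d\ge 2$, $m>0$, and let $\mathbb R^{1,d-1}=\mathbb R\times\mathbb R^{d-1}$ be Minkowski space, with $x=(x^0,\vec x)$, $xp=-x^0p^0+\vec x\cdot\vec p$, $x^2=-(x^0)^2+\vec x^{\,2}$, $\Box=-\partial_0^2+\partial_1^2+\dots+\partial_{d-1}^2$, $J^{\vee/\wedge}=\{x: x^2\le 0,\ \pm x^0\ge 0\}$ and $\theta$ the Heaviside function. Put $$\mathbf F_\alpha(z)=\sum_{j\ge0}\frac{z^j}{\Gamma(\alpha+1+j)\,j!},$$ and let $U_\alpha$ be the analytic function on the Riemann surface of the logarithm given by $U_\alpha(z)=\frac1{\sqrt\pi}\int_0^\infty e^{-t-z/t}t^{-\alpha-1}\,dt$ for $\operatorname{Re}z>0$. Distributions of $w\in\mathbb R$ are given by their boundary-value regularizations, and a product $\theta(\pm x^0)k(x^2)$, where $k$ is the limit as $\epsilon\searrow0$ of the regularizing functions $k_\epsilon$, denotes the limit as $\epsilon\searrow 0$, in the sense of distributions on $\mathbb R^{1,d-1}$, of $\theta(\pm x^0)k_\epsilon(x^2)$. For non-integer $\lambda$, $$w_-^\lambda=\lim_{\epsilon\searrow0}\frac{1}{2i\sin\pi\lambda}\bigl(-e^{-i\pi\lambda/2}(iw+\epsilon)^\lambda+e^{i\pi\lambda/2}(-iw+\epsilon)^\lambda\bigr),$$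 and $\rho_-^\lambda(w)$ is $\lim_{\epsilon\searrow0}\frac{\Gamma(-\lambda)}{2\pi i}\bigl(e^{-i\pi\lambda/2}(iw+\epsilon)^\lambda-e^{i\pi\lambda/2}(-iw+\epsilon)^\lambda\bigr)$ for $\lambda<0$ and $\theta(-w)|w|^\lambda/\Gamma(\lambda+1)$ for $\lambda\ge0$. Finally, $\theta(\pm x^0)\delta^{(j)}(x^2)$ (needed for even $d$ and $0\le j\le\frac d2-2$) is the distribution $$\phi\mapsto(-1)^j\Bigl(\frac{d}{ds}\Bigr)^{j+1}\Bigl|_{s=0}\int_{\{x^2<s,\ \pm x^0>0\}}\phi(x)\,dx .$$ Theorem. The equation $(-m^2-\Box)G=\delta$ has exactly one distributional solution $G^{\vee}$ (retarded) supported in $J^\vee$ and exactly one, $G^\wedge$ (advanced), supported in $J^\wedge$. Moreover: 1. (Analytic continuation.) There are families $G_z^{\vee/\wedge}$, $z\in\mathbb C$, of distributions, entire in $z$ when paired with any test function, which for every $z=M>0$ are the massive retarded/advanced propagators $$G_M^{\vee/\wedge}(x)=\lim_{\epsilon\searrow0}\int\frac{e^{ipx}}{M^2+p^2\mp i\epsilon\,\mathrm{sgn}\,p^0}\,\frac{dp}{(2\pi)^d},$$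 and $G^{\vee/\wedge}=G^{\vee/\wedge}_{e^{i\pi/2}m}=G^{\vee/\wedge}_{e^{-i\pi/2}m}$. 2. The following three formulas hold: $$G^{\vee/\wedge}(x)=\theta(-x^2)\theta(\pm x^0)\frac{\sqrt\pi\,m^{d-2}i^{d+1}}{(4\pi)^{d/2}}\Bigl(U_{\frac d2-1}\bigl(\tfrac{m^2(-x^2)}4\bigr)-U_{\frac d2-1}\bigl(e^{2\pi i}\tfrac{m^2(-x^2)}4\bigr)\Bigr)$$ $$=\theta(-x^2)\theta(\pm x^0)\frac{\sqrt\pi\,m^{d-2}(-i)^{d+1}}{(4\pi)^{d/2}}\Bigl(U_{\frac d2-1}\bigl(\tfrac{m^2(-x^2)}4\bigr)-U_{\frac d2-1}\bigl(e^{-2\pi i}\tfrac{m^2(-x^2)}4\bigr)\Bigr)$$ $$=\theta(\pm x^0)\frac{2\pi}{(4\pi)^{d/2}}\Bigl(\frac{x^2}4\Bigr)_-^{1-\frac d2}\mathbf F_{1-\frac d2}\Bigl(\frac{m^2|x^2|}4\Bigr).$$ On the set $x^2<0$ the three expressions following the factors $\theta$ agree as functions. As distributions, the bracket in the first line is the boundary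 value $U_\alpha(e^{i\pi}(w-i0))-U_\alpha(e^{i\pi}(w+i0))$ and that in the second line is $U_\alpha(e^{-i\pi}(w+i0))-U_\alpha(e^{-i\pi}(w-i0))$, with $w=m^2x^2/4$, $\alpha=\frac d2-1$. In the third line, with $w=x^2/4$, the distribution $w_-^{1-d/2}\mathbf F_{1-d/2}(m^2|w|)$ is, for odd $d$, the product of $w_-^{1-d/2}$ with the smooth function $\mathbf F_{1-d/2}(-m^2w)$ and, for even $d$, the series $\sum_{j\ge0}\frac{m^{2j}}{j!}\rho_-^{1-d/2+j}(w)$. 3. (Singular and regular part.) $G^{\vee/\wedge}=G^{\vee/\wedge}_{\mathrm{sing}}+G^{\vee/\wedge}_{\mathrm{reg}}$, where $G^{\vee/\wedge}_{\mathrm{reg}}$ is given by a locally integrable function. For $d$ odd $$G_{\mathrm{sing}}^{\vee/\wedge}(x)=\frac{\theta(\pm x^0)}{2\pi^{\frac d2-1}}\sum_{j=0}^{\frac{d-5}2}\frac{1}{j!\,\Gamma(2-\frac d2+j)}\Bigl(\frac{m^2}4\Bigr)^j(x^2)_-^{1-\frac d2+j},$$ $$G_{\mathrm{reg}}^{\vee/\wedge}(x)=\frac{\theta(\pm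 x^0)}{2\pi^{\frac d2-1}}\sum_{j=\frac{d-3}2}^{\infty}\frac{1}{j!\,\Gamma(2-\frac d2+j)}\Bigl(\frac{m^2}4\Bigr)^j(-x^2)^{1-\frac d2+j}\theta(-x^2),$$ and for $d$ even $$G_{\mathrm{sing}}^{\vee/\wedge}(x)=\frac{\theta(\pm x^0)}{2\pi^{\frac d2-1}}\sum_{j=0}^{\frac d2-2}\frac{(-1)^j}{(\frac d2-2-j)!}\Bigl(\frac{m^2}4\Bigr)^{\frac d2-2-j}\delta^{(j)}(x^2),$$ $$G_{\mathrm{reg}}^{\vee/\wedge}(x)=\theta(\pm x^0)\frac{2\pi m^{d-2}}{(4\pi)^{d/2}}\mathbf F_{\frac d2-1}\Bigl(\frac{m^2|x^2|}4\Bigr)\theta(-x^2).$$ -/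

import Mathlib

open MeasureTheory Filter Topology TopologicalSpace
open scoped Distributions LineDeriv

noncomputable section

/-- Minkowski space `ℝ^{1,d-1} = ℝ × ℝ^{d-1}`: the point `x` has time coordinate `x.1 = x⁰` and
spatial part `x.2`. -/
abbrev Mink (d : ℕ) : Type := ℝ × EuclideanSpace ℝ (Fin (d - 1))

/-- Complex distributions on the whole Minkowski space. -/
abbrev MinkDist (d : ℕ) : Type := 𝓓'((⊤ : Opens (Mink d)), ℂ)

/-- Real test functions on Minkowski space. -/
abbrev MinkTest (d : ℕ) : Type := 𝓓((⊤ : Opens (Mink d)), ℝ)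

/-- The Minkowski product `x p = - x⁰ p⁰ + ∑ xⁱ pⁱ`. -/
def minkProd {d : ℕ} (x p : Mink d) : ℝ := -(x.1 * p.1) + ∑ i, x.2 i * p.2 i

/-- The square `x² = x x`. -/
def minkSq {d : ℕ} (x : Mink d) : ℝ := minkProd x x

/-- The cone `J^∨` for `σ = 1` and `J^∧` for `σ = -1`. -/
def causalCone (d : ℕ) (σ : ℝ) : Set (Mink d) := {x | minkSq x ≤ 0 ∧ 0 ≤ σ * x.1}

/-- The Heaviside function `θ`. -/
def heaviside (t : ℝ) : ℝ := if 0 < t then 1 else 0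

/-- The d'Alembertian `□ = -∂₀² + ∑ ∂ᵢ²` on distributions. -/
def dAlembert {d : ℕ} (T : MinkDist d) : MinkDist d :=
  -(∂_{((1, 0) : Mink d)} (∂_{((1, 0) : Mink d)} T)) +
    ∑ i : Fin (d - 1), ∂_{((0, EuclideanSpace.single i 1) : Mink d)}
      (∂_{((0, EuclideanSpace.single i 1) : Mink d)} T)

/-- `G` is a Green function of `c - □`, that is `(c - □) G = δ`. -/
def IsGreenFunction {d : ℕ} (c : ℝ) (G : MinkDist d) : Prop :=
  c • G - dAlembert G = Distribution.mapCLM Complex.ofRealCLM (Distribution.delta (0 : Mink d))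

/-- `T` is the massive retarded (`σ = 1`), resp. advanced (`σ = -1`) propagator of mass `M > 0`:
the inverse Fourier transform
`∫ exp (i p x) / (M² + p² ∓ i0 sgn p⁰) dp / (2π)^d`. -/
def IsMassivePropagator {d : ℕ} (σ M : ℝ) (T : MinkDist d) : Prop :=
  ∀ φ : MinkTest d,
    Tendsto (fun ε : ℝ => ((2 * (Real.pi : ℂ)) ^ d)⁻¹ *
        ∫ p : Mink d, (∫ x : Mink d, Complex.exp (Complex.I * (minkProd p x : ℂ)) * (φ x : ℂ)) /
          ((M : ℂ) ^ 2 + (minkSq p : ℂ) - Complex.I * (σ : ℂ) * (ε : ℂ) * (Real.sign p.1 : ℂ)))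
      (𝓝[>] 0) (𝓝 (T φ))

/-- Given a regularization `k ε w`, `ε > 0`, of a distribution `k₀(w) = lim_{ε ↘ 0} k ε w` on
the real line, `T` is the distribution `θ(σ x⁰) k₀(x²)` on Minkowski space, that is, the limit of
the functions `θ(σ x⁰) k ε (x²)` in the sense of distributions. -/
def IsConeBoundaryValue {d : ℕ} (σ : ℝ) (k : ℝ → ℝ → ℂ) (T : MinkDist d) : Prop :=
  ∀ φ : MinkTest d,
    Tendsto (fun ε : ℝ => ∫ x : Mink d, (heaviside (σ * x.1) : ℂ) * k ε (minkSq x) * (φ x : ℂ))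
      (𝓝[>] 0) (𝓝 (T φ))

/-- `T` is the regular distribution given by the locally integrable function `f`. -/
def IsRegularDist {d : ℕ} (f : Mink d → ℝ) (T : MinkDist d) : Prop :=
  LocallyIntegrable f ∧ ∀ φ : MinkTest d, T φ = ((∫ x : Mink d, f x * φ x : ℝ) : ℂ)

/-- `T = θ(σ x⁰) δ^{(j)}(x²)`. Since `δ^{(j)}` is the derivative of order `j + 1` of the Heaviside
function, it is given by
`⟨T, φ⟩ = (-1)^j (d/ds)^{j+1} ∫_{x² < s, σ x⁰ > 0} φ(x) dx` at `s = 0`; differentiability is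
part of the definition. -/
def IsConeDelta {d : ℕ} (σ : ℝ) (j : ℕ) (T : MinkDist d) : Prop :=
  ∀ φ : MinkTest d,
    ContDiffAt ℝ ((j + 1 : ℕ) : WithTop ℕ∞)
      (fun s : ℝ => ∫ x in {x : Mink d | minkSq x < s ∧ 0 < σ * x.1}, φ x) 0 ∧
    T φ = (((-1) ^ j * iteratedDeriv (j + 1)
      (fun s : ℝ => ∫ x in {x : Mink d | minkSq x < s ∧ 0 < σ * x.1}, φ x) 0 : ℝ) : ℂ)

/-- The Olver normalized hypergeometric function `𝐅_α(z) = ∑ z^j / (Γ(α + 1 + j) j!)`.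
(`Real.Gamma` vanishes at its poles, so that `1 / Γ` has its correct value `0` there.) -/
def boldF (α z : ℝ) : ℝ := ∑' j : ℕ, z ^ j / (Real.Gamma (α + 1 + j) * (j.factorial : ℝ))

/-- The function `U_α` on the Riemann surface of the logarithm: `riemannU α ζ = U_α(e^ζ)`, where
the point `e^ζ` of the Riemann surface is identified by its logarithm `ζ`. It is the integral
`π^{-1/2} ∫ e^{-t - z/t} t^{-α-1} dt`, `z = e^ζ`, over the following contour on the Riemann
surface of `t`: from `0` along the ray of argument `η = Im ζ` to `e^{iη}`, then along (the cover
of) the unit circle to `1`, then along the positive half-line to `∞`. For `η = 0` this is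
`π^{-1/2} ∫_0^∞ e^{-t - z/t} t^{-α-1} dt`. -/
def riemannU (α : ℝ) (ζ : ℂ) : ℂ :=
  ((Real.sqrt Real.pi : ℝ) : ℂ)⁻¹ *
    ((∫ s : ℝ in (0 : ℝ)..1,
        Complex.exp (-((s : ℂ) * Complex.exp (Complex.I * (ζ.im : ℂ))) -
            ((Real.exp ζ.re / s : ℝ) : ℂ)) *
          ((s ^ (-α - 1) : ℝ) : ℂ) * Complex.exp (-(Complex.I * (α : ℂ) * (ζ.im : ℂ)))) +
      (∫ θ : ℝ in ζ.im..0,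
        Complex.exp (-Complex.exp (Complex.I * (θ : ℂ)) - Complex.exp (ζ - Complex.I * (θ : ℂ))) *
          Complex.exp (-(Complex.I * (α : ℂ) * (θ : ℂ))) * Complex.I) +
      ∫ t : ℝ in Set.Ioi (1 : ℝ),
        Complex.exp (-(t : ℂ) - Complex.exp ζ / (t : ℂ)) * ((t ^ (-α - 1) : ℝ) : ℂ))

/-- Regularization of `w_-^l`, `l ≠ -1, -2, …`:
`w_-^l = lim_{ε ↘ 0} (2 i sin(π l))⁻¹ (- e^{-iπl/2} (i w + ε)^l + e^{iπl/2} (- i w + ε)^l)`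
(only used for `l` not an integer). -/
def minusPow (l ε w : ℝ) : ℂ :=
  (2 * Complex.I * (Real.sin (Real.pi * l) : ℂ))⁻¹ *
    (-(Complex.exp (-(Complex.I * ((Real.pi / 2 * l : ℝ) : ℂ))) *
        (Complex.I * (w : ℂ) + (ε : ℂ)) ^ (l : ℂ)) +
      Complex.exp (Complex.I * ((Real.pi / 2 * l : ℝ) : ℂ)) *
        (-(Complex.I * (w : ℂ)) + (ε : ℂ)) ^ (l : ℂ))

/-- Regularization of `ρ_-^l(w) = w_-^l / Γ(l + 1)` for real `l`: for `l < 0` this is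
`lim_{ε ↘ 0} Γ(-l) (2πi)⁻¹ (e^{-iπl/2} (i w + ε)^l - e^{iπl/2} (- i w + ε)^l)`, which makes sense
also for `l = -1, -2, …`; for `l ≥ 0` it is the locally bounded function `θ(-w)|w|^l / Γ(l + 1)`. -/
def rhoMinus (l ε w : ℝ) : ℂ :=
  if l < 0 then
    (Real.Gamma (-l) : ℂ) * (2 * (Real.pi : ℂ) * Complex.I)⁻¹ *
      (Complex.exp (-(Complex.I * ((Real.pi / 2 * l : ℝ) : ℂ))) *
          (Complex.I * (w : ℂ) + (ε : ℂ)) ^ (l : ℂ) -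
        Complex.exp (Complex.I * ((Real.pi / 2 * l : ℝ) : ℂ)) *
          (-(Complex.I * (w : ℂ)) + (ε : ℂ)) ^ (l : ℂ))
  else ((if w < 0 then (-w) ^ l / Real.Gamma (l + 1) else 0 : ℝ) : ℂ)

/-- Regularization of the distribution `(w/4)_-^{1-d/2} 𝐅_{1-d/2}(m²|w|/4)` on the real line.
For `d` odd it is the product of the distribution `(w/4)_-^{1-d/2}`, supported in `w ≤ 0`, with the
smooth function `𝐅_{1-d/2}(-m² w/4)`. For `d` even, the factors `1/Γ` in the power series of `𝐅`
are absorbed into the powers of `w_-`, so that it is the series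
`∑ (m²)^j / j! · ρ_-^{1-d/2+j}(w/4)`. -/
def tachKernel (d : ℕ) (m ε w : ℝ) : ℂ :=
  if Even d then
    ∑' j : ℕ, (((m ^ 2) ^ j / (j.factorial : ℝ) : ℝ) : ℂ) *
      rhoMinus (1 - (d : ℝ) / 2 + j) ε (w / 4)
  else minusPow (1 - (d : ℝ) / 2) ε (w / 4) * (boldF (1 - (d : ℝ) / 2) (-(m ^ 2 * w / 4)) : ℂ)

/-- Coefficients of the singular and the regular part for odd `d`:
`(m²/4)^j / (2 π^{d/2-1} j! Γ(2 - d/2 + j))`. -/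
def oddCoeff (d : ℕ) (m : ℝ) (j : ℕ) : ℝ :=
  (m ^ 2 / 4) ^ j /
    (2 * Real.pi ^ ((d : ℝ) / 2 - 1) * (j.factorial : ℝ) * Real.Gamma (2 - (d : ℝ) / 2 + j))

/-- The regular part for odd `d`: the sum over `j ≥ (d-3)/2` of
`θ(σ x⁰) θ(-x²) (m²/4)^j / (2 π^{d/2-1} j! Γ(2 - d/2 + j)) (-x²)^{1-d/2+j}`. -/
def oddRegular (d : ℕ) (m σ : ℝ) (x : Mink d) : ℝ :=
  heaviside (σ * x.1) * heaviside (-minkSq x) *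
    ∑' k : ℕ, oddCoeff d m ((d - 3) / 2 + k) *
      (-minkSq x) ^ (1 - (d : ℝ) / 2 + (((d - 3) / 2 + k : ℕ) : ℝ))

/-- Coefficients of the singular part for even `d`:
`(-1)^j (m²/4)^{d/2-2-j} / (2 π^{d/2-1} (d/2-2-j)!)`. -/
def evenCoeff (d : ℕ) (m : ℝ) (j : ℕ) : ℝ :=
  (-1) ^ j * (m ^ 2 / 4) ^ (d / 2 - 2 - j) /
    (2 * Real.pi ^ ((d : ℝ) / 2 - 1) * ((d / 2 - 2 - j).factorial : ℝ))

/-- The regular part for even `d`: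
`θ(σ x⁰) 2π m^{d-2} / (4π)^{d/2} 𝐅_{d/2-1}(m²|x²|/4) θ(-x²)`. -/
def evenRegular (d : ℕ) (m σ : ℝ) (x : Mink d) : ℝ :=
  heaviside (σ * x.1) * (2 * Real.pi * m ^ (d - 2) / (4 * Real.pi) ^ ((d : ℝ) / 2)) *
    boldF ((d : ℝ) / 2 - 1) (m ^ 2 * |minkSq x| / 4) * heaviside (-minkSq x)

/-- The prefactor `√π m^{d-2} u^{d+1} / (4π)^{d/2}`, used for `u = i` and `u = -i`. -/
def tachPrefactor (d : ℕ) (m : ℝ) (u : ℂ) : ℂ :=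
  ((Real.sqrt Real.pi * m ^ (d - 2) / (4 * Real.pi) ^ ((d : ℝ) / 2) : ℝ) : ℂ) * u ^ (d + 1)

end

noncomputable section

open scoped FourierTransform

set_option linter.unusedSectionVars false


/-! ### Polar coordinates for integrands that need not be radial. -/

section Polar

variable {E : Type*} [NormedAddCommGroup E] [NormedSpace ℝ E] [MeasurableSpace E] [BorelSpace E]
  [FiniteDimensional ℝ E] [Nontrivial E] {F : Type*} [NormedAddCommGroup F] [NormedSpace ℝ F]

/-! Write d = 2N + 2 + 2a with a = 0 for even d and a = 1/2 for odd d, so that d/2 - 1 = N + a. The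
distributions to be handled have the form θ(σx⁰) k(x²) with k at worst as singular as |w|^{-N-a} at
w = 0. Since x² = r² - t² with r = |x⃗| and t = x⁰, the operator d/dw at fixed t is (2r)⁻¹∂_r.
Hence, if k = (-d/dw)^N K with K = O(|w|^{-1/2}), N integrations by parts in r
(`heaviside_mul_integral_parts`) replace φ by D_N φ, where D_N is a product of N operators (const +
x⃗·∂)/2, at the price of a weight r^{-2N} which the volume element r^{d-2} absorbs. The result is
`coneDist d σ N K`: an absolutely convergent integral, linear in K, through which limits of kernels
pass by dominated convergence (`KernelTendsto.tendsto_coneDist`).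

Existence. The kernel `propKernel N a c` is, up to a constant, the series Σ_j c^j/j! ·
(w/4)_-^{j-a}/Γ(j-a+1), entire in c. With c = -z² it gives the analytic family of propagators: c =
-M² is the mass M, and z = e^{±iπ/2}m both give c = m². For c = -M² one computes its Fourier
transform in space at fixed time. Expanding both the kernel and the image of a plane wave under D_N,
the moments of the sphere and Beta integrals combine with the eigenvalues of D_N, and the binomial
theorem leaves Σ (c - |p⃗|²)^n t^{2n+1}/(2n+1)! (`hasSum_integral_planeWave`), which is sin(ωt)/ω.
Its Laplace transform at η - iσp⁰ is 1/(ω² + (η - iσp⁰)²). With η = ε/(2ω) this differs from the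
prescribed M² + p² ∓ iε sgn p⁰ denominator by a bounded amount that tends to 0 almost everywhere
(`norm_resolvent_sub_le`). So the family consists of the massive propagators
(`isMassivePropagator_coneDist`). These satisfy the Green equation because M² - □ cancels the
denominator. Both sides of the weak equation are entire in c, so the identity theorem gives it for
every real mass squared (`isGreenFunction_coneDist`).

Uniqueness. Let H be the difference of two solutions supported in the cone J. For a test function φ,
the function x ↦ Re G(φ(x + ·)) is smooth, solves the inhomogeneous equation with source φ, and is
supported in supp φ - J, which meets J in a bounded set. A cutoff turns it into a test function u
for which (c - □)u - φ has support disjoint from J, and therefore H φ = H((c - □)u) = 0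
(`eq_zero_of_dsupport_subset`).

The formulas. The function U_{N+a} minus N polar terms z^{j-N-a} is O(|z|^{-1/2}) (`regU_bound`), so
its two boundary values are limits by dominated convergence. The polar terms are N-th derivatives of
milder functions of log z (half-integer powers, or powers times a logarithm), and the jumps of those
across the negative axis are multiples of w_-^{j-a} (`exists_tower`, `tendsto_powInt`). The jump of
U itself is its monodromy around 0. Expanding e^{-t} on the closed contour reduces this to Hankel's
integral for 1/Γ at integers or half-integers (`hankelInt_eq`, `riemannU_sub_monodromy`). The second
formula is the complex conjugate of the first, and the third is treated by the same jumps. Splitting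
the kernel series at j = N gives the singular part (j < N) and the regular part (j ≥ N). For even d
the singular terms are derivatives of δ, because differentiating ∫_{x² < s} φ in s lowers the index
of w_-^p/p! by one. -/

theorem integrable_polar (μ : Measure E) [μ.IsAddHaarMeasure] {f : E → F} (hf : Integrable f μ) :
    Integrable (fun p : Metric.sphere (0 : E) 1 × Set.Ioi (0 : ℝ) => f (p.2.1 • p.1.1))
      (μ.toSphere.prod (.volumeIoiPow (Module.finrank ℝ E - 1))) := by
  have h := μ.measurePreserving_homeomorphUnitSphereProd
  rw [← h.integrable_comp_emb (Homeomorph.measurableEmbedding _)]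
  have h2 : Integrable (fun x : ({(0)}ᶜ : Set E) => f x.1) (μ.comap (↑)) := by
    have := hf.integrableOn (s := ({(0)}ᶜ : Set E))
    rwa [integrableOn_iff_comap_subtypeVal (by measurability)] at this
  refine h2.congr (.of_forall fun x => ?_)
  have hx : ‖x.1‖ ≠ 0 := norm_ne_zero_iff.2 x.2
  simp [smul_smul, hx]

/-- The order of integration matters: the radial integral is inside, so that one-dimensional
calculus can be applied on each ray separately. -/
theorem integral_polar (μ : Measure E) [μ.IsAddHaarMeasure] {f : E → F} (hf : Integrable f μ) :
    ∫ x, f x ∂μ = ∫ ω : Metric.sphere (0 : E) 1, ∫ r in Set.Ioi (0 : ℝ),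
      r ^ (Module.finrank ℝ E - 1) • f (r • ω.1) ∂volume ∂μ.toSphere := by
  calc
    ∫ x, f x ∂μ = ∫ x : ({(0)}ᶜ : Set E), f x.1 ∂(μ.comap (↑)) := by
      rw [integral_subtype_comap (measurableSet_singleton _).compl f, restrict_compl_singleton]
    _ = ∫ p : Metric.sphere (0 : E) 1 × Set.Ioi (0 : ℝ), f (p.2.1 • p.1.1)
        ∂μ.toSphere.prod (.volumeIoiPow (Module.finrank ℝ E - 1)) := by
      rw [← μ.measurePreserving_homeomorphUnitSphereProd.integral_comp
        (Homeomorph.measurableEmbedding _)]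
      refine integral_congr_ae (.of_forall fun x => ?_)
      have hx : ‖x.1‖ ≠ 0 := norm_ne_zero_iff.2 x.2
      simp [smul_smul, hx]
    _ = _ := by
      rw [integral_prod _ (integrable_polar μ hf)]
      refine integral_congr_ae (.of_forall fun ω => ?_)
      simp only [Measure.volumeIoiPow, ENNReal.ofReal]
      rw [integral_withDensity_eq_integral_smul, 
        integral_subtype_comap measurableSet_Ioi fun a ↦
          Real.toNNReal (a ^ (Module.finrank ℝ E - 1)) • f (a • ω.1),
        setIntegral_congr_fun measurableSet_Ioi fun x hx ↦ ?_]
      · rw [NNReal.smul_def, Real.coe_toNNReal _ (pow_nonneg (le_of_lt hx) _)]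
      · exact (measurable_subtype_coe.pow_const _).real_toNNReal

/-- Fubini supplies integrability on almost every ray, which is what the fundamental theorem of
calculus in r will require. -/
theorem ae_integrableOn_polar (μ : Measure E) [μ.IsAddHaarMeasure] {f : E → F}
    (hf : Integrable f μ) :
    ∀ᵐ ω : Metric.sphere (0 : E) 1 ∂μ.toSphere,
      IntegrableOn (fun r : ℝ => r ^ (Module.finrank ℝ E - 1) • f (r • ω.1)) (Set.Ioi 0) := by
  filter_upwards [(integrable_polar μ hf).prod_right_ae] with ω hω
  rw [integrableOn_iff_comap_subtypeVal measurableSet_Ioi]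
  simp only [Measure.volumeIoiPow, ENNReal.ofReal] at hω
  rw [integrable_withDensity_iff_integrable_smul] at hω
  · refine hω.congr (.of_forall fun x => ?_)
    simp only [Function.comp_apply]
    rw [NNReal.smul_def, Real.coe_toNNReal _ (pow_nonneg (le_of_lt x.2) _)]
  · exact (measurable_subtype_coe.pow_const _).real_toNNReal

end Polar

/-! ### Local integrability of |x²|^{-1/2} |x⃗|^{-2N}. -/

theorem integrableOn_abs_rpow_neg_half (R : ℝ) :
    IntegrableOn (fun x : ℝ => |x| ^ (-(1 / 2) : ℝ)) (Metric.ball 0 R) := by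
  have h := integrableOn_fun_norm_addHaar (volume : Measure ℝ) (r := R)
    (f := fun y : ℝ => y ^ (-(1 / 2) : ℝ))
  simp only [Real.norm_eq_abs] at h
  rw [h]
  simp only [Module.finrank_self, Nat.sub_self, pow_zero, one_smul]
  rcases le_or_gt R 0 with hR | hR
  · simp [Set.Ioo_eq_empty_of_le hR]
  · have := (intervalIntegral.intervalIntegrable_rpow' (a := 0) (b := R) (r := -(1 / 2))
      (by norm_num))
    rw [intervalIntegrable_iff_integrableOn_Ioo_of_le hR.le] at this
    exact this

theorem minkSq_eq {d : ℕ} (x : Mink d) : minkSq x = ‖x.2‖ ^ 2 - x.1 ^ 2 := by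
  rw [minkSq, minkProd, EuclideanSpace.norm_sq_eq]
  simp [sq]; ring

theorem continuous_minkSq {d : ℕ} : Continuous (minkSq (d := d)) := by
  have : (minkSq (d := d)) = fun x => ‖x.2‖ ^ 2 - x.1 ^ 2 := funext minkSq_eq
  rw [this]; fun_prop

/-- Factor r² - t² = (r + |t|)(r - |t|) and drop r from the first factor. The singularity on the
light cone is thereby bounded by a product of two singularities of order 1/2, in t and in r - |t|,
each integrable on its own. -/
theorem abs_sq_sub_sq_rpow_le {r t : ℝ} (hr : 0 ≤ r) (ht : t ≠ 0) :
    |r ^ 2 - t ^ 2| ^ (-(1 / 2) : ℝ) ≤ |t| ^ (-(1 / 2) : ℝ) * abs (r - |t|) ^ (-(1 / 2) : ℝ) := by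
  have h : r ^ 2 - t ^ 2 = (r + |t|) * (r - |t|) := by rw [← sq_abs t]; ring
  have ht' : 0 < |t| := abs_pos.2 ht
  rw [h, abs_mul, Real.mul_rpow (abs_nonneg _) (abs_nonneg _)]
  refine mul_le_mul_of_nonneg_right ?_ (Real.rpow_nonneg (abs_nonneg _) _)
  refine Real.rpow_le_rpow_of_nonpos ht' ?_ (by norm_num)
  rw [abs_of_nonneg (by positivity : 0 ≤ r + |t|)]; linarith

theorem nontrivial_space {d N : ℕ} (h : 2 * N + 1 ≤ d - 1) :
    Nontrivial (EuclideanSpace ℝ (Fin (d - 1))) := by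
  have : Nonempty (Fin (d - 1)) := ⟨⟨0, by omega⟩⟩
  infer_instance

/-- The dominating function `|x²|^{-1/2} |y|^{-2N}`. -/
def coneBound (d N : ℕ) (x : Mink d) : ℝ :=
  |minkSq x| ^ (-(1 / 2) : ℝ) * (‖x.2‖ ^ (2 * N))⁻¹

theorem measurable_coneBound (d N : ℕ) : Measurable (coneBound d N) := by
  unfold coneBound
  have := (continuous_minkSq (d := d)).measurable
  fun_prop

/-- In spatial polar coordinates the volume element r^{d-2} absorbs r^{-2N}. What is left is bounded
by a constant times |t|^{-1/2} |r - |t||^{-1/2}; its r-integral is bounded uniformly in t, and the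
t-integral then converges. -/
theorem integrableOn_coneBound {d N : ℕ} (h : 2 * N + 1 ≤ d - 1) {R : ℝ} (hR : 0 < R) :
    IntegrableOn (coneBound d N) (Metric.ball 0 R) := by
  have := nontrivial_space h
  have hfin : Module.finrank ℝ (EuclideanSpace ℝ (Fin (d - 1))) = d - 1 := by simp
  set E := EuclideanSpace ℝ (Fin (d - 1))
  set s : ℝ → ℝ := fun x => |x| ^ (-(1 / 2) : ℝ) with hs
  have hs0 : ∀ x, 0 ≤ s x := fun x => Real.rpow_nonneg (abs_nonneg _) _
  have hsm : Measurable s := by fun_prop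
  set u : ℝ → ℝ → ℝ := fun t r => (Set.Iio R).indicator
    (fun r => s (r ^ 2 - t ^ 2) * (r ^ (2 * N))⁻¹) r with hu
  have hu0 : ∀ t r, 0 ≤ u t r := fun t r => Set.indicator_nonneg (fun r _ => by
    simp only [hs]; rw [pow_mul]; positivity) r
  set v : ℝ × E → ℝ := fun x => (Set.Ioo (-R) R).indicator (fun t => u t ‖x.2‖) x.1 with hv
  have hball : (Metric.ball (0 : Mink d) R).indicator (coneBound d N) = v := by
    ext x
    simp only [hv, hu, Set.indicator, Metric.mem_ball, dist_zero_right, Prod.norm_def, sup_lt_iff,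
      Set.mem_Ioo, Set.mem_Iio, Real.norm_eq_abs, abs_lt, coneBound, minkSq_eq, hs]
    split_ifs <;> simp_all
  rw [← integrable_indicator_iff measurableSet_ball, hball]
  have hvm : Measurable v := by
    rw [← hball]; exact (measurable_coneBound d N).indicator measurableSet_ball
  have hsint : IntegrableOn s (Metric.ball 0 (2 * R)) := integrableOn_abs_rpow_neg_half _
  -- For 0 < r < R and |t| < R the number r - |t| lies in the ball of radius 2R, so by translation
  -- invariance A bounds the radial integral for all t at once.
  set A : ℝ := ∫ x in Metric.ball (0 : ℝ) (2 * R), s x with hA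
  -- the radial majorant
  have hrad : ∀ t ∈ Set.Ioo (-R) R, t ≠ 0 → IntegrableOn
      (fun r : ℝ => (Set.Iio R).indicator (fun r => s (r - |t|)) r) (Set.Ioi 0) ∧
      ∫ r in Set.Ioi 0, (Set.Iio R).indicator (fun r => s (r - |t|)) r ≤ A := by
    intro t ht _
    have htR : |t| < R := abs_lt.2 ht
    set w : ℝ → ℝ := (Metric.ball (0 : ℝ) (2 * R)).indicator s with hw
    have hwi : Integrable w := (integrable_indicator_iff measurableSet_ball).2 hsint
    have hwt : Integrable (fun r => w (r - |t|)) := hwi.comp_sub_right _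
    have hle : ∀ r ∈ Set.Ioi (0 : ℝ), (Set.Iio R).indicator (fun r => s (r - |t|)) r
        ≤ w (r - |t|) := by
      intro r hr
      by_cases h1 : r < R
      · have : r - |t| ∈ Metric.ball (0 : ℝ) (2 * R) := by
          rw [Metric.mem_ball, dist_zero_right, Real.norm_eq_abs, abs_lt]
          have := abs_nonneg t; have := Set.mem_Ioi.1 hr
          constructor <;> linarith
        simp [hw, this, h1]
      · simp only [Set.indicator, Set.mem_Iio, h1, if_false]
        exact Set.indicator_nonneg (fun x _ => hs0 x) _
    have hint : IntegrableOn
      (fun r : ℝ => (Set.Iio R).indicator (fun r => s (r - |t|)) r) (Set.Ioi 0) := by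
      refine Integrable.mono' hwt.integrableOn
        ((hsm.comp (measurable_id.sub_const _)).indicator measurableSet_Iio).aestronglyMeasurable ?_
      filter_upwards [ae_restrict_mem measurableSet_Ioi] with r hr
      rw [Real.norm_of_nonneg (Set.indicator_nonneg (fun x _ => hs0 _) _)]
      exact hle r hr
    refine ⟨hint, ?_⟩
    calc _ ≤ ∫ r in Set.Ioi 0, w (r - |t|) :=
          setIntegral_mono_on hint hwt.integrableOn measurableSet_Ioi hle
      _ ≤ ∫ r, w (r - |t|) := setIntegral_le_integral hwt
          (.of_forall fun r => Set.indicator_nonneg (fun x _ => hs0 x) _)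
      _ = ∫ r, w r := integral_sub_right_eq_self w _
      _ = A := integral_indicator measurableSet_ball
  have hA0 : 0 ≤ A := integral_nonneg fun x => hs0 x
  have hub : ∀ t ∈ Set.Ioo (-R) R, t ≠ 0 → ∀ r ∈ Set.Ioi (0 : ℝ),
      r ^ (d - 1 - 1) * u t r ≤
        (R ^ (d - 2 - 2 * N) * s t) * (Set.Iio R).indicator (fun r => s (r - |t|)) r := by
    intro t _ ht0 r hr
    have hr0 : 0 < r := hr
    by_cases h1 : r < R
    · simp only [hu, Set.indicator, Set.mem_Iio, h1, if_true]
      -- This is where 2N ≤ d - 2 is needed.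
      have e1 : r ^ (d - 1 - 1) = r ^ (d - 2 - 2 * N) * r ^ (2 * N) := by
        rw [← pow_add]; congr 1; omega
      rw [e1]
      have : r ^ (d - 2 - 2 * N) * r ^ (2 * N) * (s (r ^ 2 - t ^ 2) * (r ^ (2 * N))⁻¹)
          = r ^ (d - 2 - 2 * N) * s (r ^ 2 - t ^ 2) := by
        field_simp
      rw [this, mul_assoc]
      refine mul_le_mul (pow_le_pow_left₀ hr0.le h1.le _) (abs_sq_sub_sq_rpow_le hr0.le ht0)
        (hs0 _) (by positivity)
    · simp [hu, Set.indicator, h1]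
  have hradint : ∀ t ∈ Set.Ioo (-R) R, t ≠ 0 →
      IntegrableOn (fun r => r ^ (d - 1 - 1) * u t r) (Set.Ioi 0) ∧
      ∫ r in Set.Ioi 0, r ^ (d - 1 - 1) * u t r ≤ (R ^ (d - 2 - 2 * N) * s t) * A := by
    intro t ht ht0
    obtain ⟨h1, h2⟩ := hrad t ht ht0
    have h3 := h1.const_mul (R ^ (d - 2 - 2 * N) * s t)
    have hint : IntegrableOn (fun r => r ^ (d - 1 - 1) * u t r) (Set.Ioi 0) := by
      refine Integrable.mono' h3 ?_ ?_
      · refine Measurable.aestronglyMeasurable ?_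
        refine (measurable_id.pow_const _).mul (Measurable.indicator ?_ measurableSet_Iio)
        fun_prop
      · filter_upwards [ae_restrict_mem measurableSet_Ioi] with r hr
        rw [Real.norm_of_nonneg (mul_nonneg (pow_nonneg (le_of_lt hr) _) (hu0 _ _))]
        exact hub t ht ht0 r hr
    refine ⟨hint, ?_⟩
    calc _ ≤ ∫ r in Set.Ioi 0, (R ^ (d - 2 - 2 * N) * s t) *
          (Set.Iio R).indicator (fun r => s (r - |t|)) r :=
          setIntegral_mono_on hint h3 measurableSet_Ioi (hub t ht ht0)
      _ ≤ _ := by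
          rw [integral_const_mul]
          exact mul_le_mul_of_nonneg_left h2 (mul_nonneg (by positivity) (hs0 _))
  have hne : ∀ᵐ t : ℝ, t ≠ 0 := by
    rw [ae_iff]; simp
  rw [Measure.volume_eq_prod, integrable_prod_iff hvm.aestronglyMeasurable]
  constructor
  · filter_upwards [hne] with t ht0
    by_cases ht : t ∈ Set.Ioo (-R) R
    · simp only [hv, Set.indicator_of_mem ht]
      rw [integrable_fun_norm_addHaar, hfin]
      simpa using (hradint t ht ht0).1
    · simp [hv, Set.indicator_of_notMem ht]
  · have hsb : IntegrableOn s (Metric.ball 0 R) := integrableOn_abs_rpow_neg_half R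
    have hb := (((integrable_indicator_iff measurableSet_ball).2 hsb).const_mul
      ((Module.finrank ℝ E : ℝ) * ((volume : Measure E).real (Metric.ball 0 1) *
        (R ^ (d - 2 - 2 * N) * A))))
    refine Integrable.mono' hb ?_ ?_
    · exact (hvm.norm.aestronglyMeasurable).integral_prod_right'
    · filter_upwards [hne] with t ht0
      rw [Real.norm_of_nonneg (integral_nonneg fun y => norm_nonneg _)]
      by_cases ht : t ∈ Set.Ioo (-R) R
      · have hmem : t ∈ Metric.ball (0 : ℝ) R := by
          rw [Metric.mem_ball, dist_zero_right, Real.norm_eq_abs]; exact abs_lt.2 ht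
        simp only [hv, Set.indicator_of_mem ht, Set.indicator_of_mem hmem]
        have : ∀ y : E, ‖u t ‖y‖‖ = u t ‖y‖ := fun y => Real.norm_of_nonneg (hu0 _ _)
        simp only [this]
        rw [integral_fun_norm_addHaar (volume : Measure E) (u t), hfin, nsmul_eq_mul, smul_eq_mul]
        have := (hradint t ht ht0).2
        simp only [smul_eq_mul]
        rw [mul_assoc, mul_assoc]
        refine mul_le_mul_of_nonneg_left ?_ (by positivity)
        refine mul_le_mul_of_nonneg_left ?_ (by positivity)
        linarith
      · simp only [hv, Set.indicator_of_notMem ht, norm_zero, integral_zero]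
        exact mul_nonneg (by positivity) (Set.indicator_nonneg (fun x _ => hs0 x) _)

/-! ### Euler operators, admissible kernels and the distributions `coneDist`. -/

/-- The spatial Euler operator `φ ↦ ∑ xⁱ ∂ᵢ φ` on test functions. -/
def eulerCLM (d : ℕ) : MinkTest d →L[ℝ] MinkTest d :=
  have hg : ContDiff ℝ ((⊤ : ℕ∞) : WithTop ℕ∞) (fun x : Mink d => ((0, x.2) : Mink d)) := by
    fun_prop
  (TestFunction.limitCLM ℝ
    (fun φ : 𝓓((⊤ : Opens (Mink d)), Mink d →L[ℝ] ℝ) =>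
      (⟨fun x => φ x (0, x.2), φ.contDiff.clm_apply hg,
        φ.hasCompactSupport.mono (fun x hx h => hx (by simp [h])), fun _ _ => trivial⟩ :
        MinkTest d))
    (fun K hK => TestFunction.ofSupportedInCLM ℝ hK ∘L
      ContDiffMapSupportedIn.bilinLeftCLM (ContinuousLinearMap.id ℝ (Mink d →L[ℝ] ℝ)) hg)
    (fun _ _ _ => by ext; rfl)) ∘L TestFunction.fderivCLM ℝ ⊤ ⊤

theorem eulerCLM_apply {d : ℕ} (φ : MinkTest d) (x : Mink d) :
    eulerCLM d φ x = fderiv ℝ φ x (0, x.2) := by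
  have : eulerCLM d φ x = TestFunction.fderivCLM ℝ ⊤ ⊤ φ x (0, x.2) := rfl
  rw [this, TestFunction.fderivCLM_apply_of_le]
  simp

/-- The operator `φ ↦ (a φ + ∑ xⁱ ∂ᵢ φ) / 2`. -/
def eulerStep (d : ℕ) (a : ℝ) : MinkTest d →L[ℝ] MinkTest d :=
  (1 / 2 : ℝ) • (a • ContinuousLinearMap.id ℝ (MinkTest d) + eulerCLM d)

theorem eulerStep_apply {d : ℕ} (a : ℝ) (φ : MinkTest d) (x : Mink d) :
    eulerStep d a φ x = 1 / 2 * (a * φ x + fderiv ℝ φ x (0, x.2)) := by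
  rw [← eulerCLM_apply]; rfl

/-- The iterated operator with `a = d - 3, d - 5, …` (`k` factors). -/
def eulerIter (d : ℕ) : ℕ → MinkTest d →L[ℝ] MinkTest d
  | 0 => ContinuousLinearMap.id ℝ _
  | k + 1 => eulerStep d ((d : ℝ) - 3 - 2 * k) ∘L eulerIter d k

theorem heaviside_nonneg (t : ℝ) : 0 ≤ heaviside t := by
  unfold heaviside; split_ifs <;> norm_num

theorem heaviside_le_one (t : ℝ) : heaviside t ≤ 1 := by
  unfold heaviside; split_ifs <;> norm_num

theorem measurable_heaviside : Measurable heaviside :=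
  Measurable.ite measurableSet_Ioi measurable_const measurable_const

/-- Kernels on the real line dominated by `|w|^{-1/2}` locally. -/
structure Admissible (K : ℝ → ℂ) : Prop where
  measurable : Measurable K
  bound : ∀ R : ℝ, ∃ C : ℝ, ∀ w : ℝ, |w| ≤ R → w ≠ 0 → ‖K w‖ ≤ C * |w| ^ (-(1 / 2) : ℝ)

/-- Lets any locally bounded term be absorbed into the standard majorant |w|^{-1/2}. -/
theorem one_le_mul_abs_rpow {R w : ℝ} (hw : |w| ≤ R) (h0 : w ≠ 0) :
    1 ≤ R ^ (1 / 2 : ℝ) * |w| ^ (-(1 / 2) : ℝ) := by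
  have h : 0 < |w| := abs_pos.2 h0
  calc (1 : ℝ) = |w| ^ (1 / 2 : ℝ) * |w| ^ (-(1 / 2) : ℝ) := by
        rw [← Real.rpow_add h]; simp
    _ ≤ _ := by gcongr

theorem Admissible.of_bounded {K : ℝ → ℂ} (hm : Measurable K)
    (h : ∀ R : ℝ, ∃ C : ℝ, ∀ w : ℝ, |w| ≤ R → w ≠ 0 → ‖K w‖ ≤ C) : Admissible K := by
  refine ⟨hm, fun R => ?_⟩
  obtain ⟨C, hC⟩ := h R
  refine ⟨|C| * R ^ (1 / 2 : ℝ), fun w hw h0 => (hC w hw h0).trans ?_⟩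
  rw [mul_assoc]
  exact (le_abs_self C).trans (le_mul_of_one_le_right (abs_nonneg _) (one_le_mul_abs_rpow hw h0))

theorem Admissible.of_continuous {K : ℝ → ℂ} (h : Continuous K) : Admissible K := by
  refine .of_bounded h.measurable fun R => ?_
  obtain ⟨C, hC⟩ := (isCompact_Icc (a := -R) (b := R)).exists_bound_of_continuousOn h.continuousOn
  exact ⟨C, fun w hw _ => hC w (abs_le.1 hw)⟩

theorem Admissible.const_mul {K : ℝ → ℂ} (h : Admissible K) (a : ℂ) :
    Admissible (fun w => a * K w) := by
  refine ⟨h.measurable.const_mul a, fun R => ?_⟩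
  obtain ⟨C, hC⟩ := h.bound R
  refine ⟨‖a‖ * C, fun w hw h0 => ?_⟩
  rw [norm_mul, mul_assoc]
  exact mul_le_mul_of_nonneg_left (hC w hw h0) (norm_nonneg _)

theorem Admissible.add {K L : ℝ → ℂ} (h : Admissible K) (h' : Admissible L) :
    Admissible (fun w => K w + L w) := by
  refine ⟨h.measurable.add h'.measurable, fun R => ?_⟩
  obtain ⟨C, hC⟩ := h.bound R
  obtain ⟨C', hC'⟩ := h'.bound R
  refine ⟨C + C', fun w hw h0 => (norm_add_le _ _).trans ?_⟩
  rw [add_mul]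
  exact add_le_add (hC w hw h0) (hC' w hw h0)

theorem Admissible.sum {ι : Type*} (s : Finset ι) {K : ι → ℝ → ℂ}
    (h : ∀ i ∈ s, Admissible (K i)) : Admissible (fun w => ∑ i ∈ s, K i w) := by
  classical
  induction s using Finset.induction_on with
  | empty => simpa using Admissible.of_continuous continuous_const
  | insert a s ha ih =>
    simp only [Finset.sum_insert ha]
    exact (h a (by simp)).add (ih fun i hi => h i (by simp [hi]))

/-- At fixed time the level set is contained in a sphere of the nontrivial space of x⃗, hence null.
Kernels therefore need to be controlled and compared only off a single value of w. -/
theorem volume_minkSq_eq {d : ℕ} (hd : 2 ≤ d) (s : ℝ) :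
    volume {x : Mink d | minkSq x = s} = 0 := by
  have := nontrivial_space (d := d) (N := 0) (by omega)
  have hms : MeasurableSet {x : Mink d | minkSq x = s} :=
    measurableSet_eq_fun continuous_minkSq.measurable measurable_const
  rw [Measure.volume_eq_prod, Measure.measure_prod_null hms]
  refine .of_forall fun t => ?_
  refine measure_mono_null (t := Metric.sphere 0 (√(s + t ^ 2))) (fun y hy => ?_)
    (Measure.addHaar_sphere _ _ _)
  have h : ‖y‖ ^ 2 - t ^ 2 = s := by simpa [minkSq_eq] using hy
  rw [mem_sphere_zero_iff_norm, ← h]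
  simp

theorem ae_minkSq_ne {d : ℕ} (hd : 2 ≤ d) (s : ℝ) : ∀ᵐ x : Mink d, minkSq x ≠ s := by
  rw [ae_iff]; simpa using volume_minkSq_eq hd s

/-- The function `θ(σ x⁰) K(x²) |x⃗|^{-2N}`. -/
def coneWeight {d : ℕ} (σ : ℝ) (N : ℕ) (K : ℝ → ℂ) (x : Mink d) : ℂ :=
  (heaviside (σ * x.1) : ℂ) * K (minkSq x) * (((‖x.2‖ ^ (2 * N))⁻¹ : ℝ) : ℂ)

theorem measurable_coneWeight {d : ℕ} (σ : ℝ) (N : ℕ) {K : ℝ → ℂ} (hK : Measurable K) :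
    Measurable (coneWeight (d := d) σ N K) := by
  unfold coneWeight
  have h1 := measurable_heaviside
  have h2 := (continuous_minkSq (d := d)).measurable
  fun_prop

theorem norm_coneWeight_le {d : ℕ} (σ : ℝ) (N : ℕ) (K : ℝ → ℂ) (x : Mink d) :
    ‖coneWeight σ N K x‖ ≤ ‖K (minkSq x)‖ * (‖x.2‖ ^ (2 * N))⁻¹ := by
  rw [coneWeight, norm_mul, norm_mul, Complex.norm_real, Complex.norm_real,
    Real.norm_of_nonneg (heaviside_nonneg _), Real.norm_of_nonneg (by positivity)]
  refine mul_le_mul_of_nonneg_right ?_ (by positivity)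
  exact mul_le_of_le_one_left (norm_nonneg _) (heaviside_le_one _)

theorem abs_minkSq_le {d : ℕ} {x : Mink d} {R : ℝ} (hx : ‖x‖ ≤ R) : |minkSq x| ≤ R ^ 2 := by
  have h1 : ‖x.2‖ ≤ R := (norm_snd_le x).trans hx
  have h2 : |x.1| ≤ R := (norm_fst_le x).trans hx
  rw [minkSq_eq, abs_le]
  have := sq_abs x.1
  have := abs_nonneg x.1
  have := norm_nonneg x.2
  constructor <;> nlinarith

theorem locallyIntegrable_coneWeight {d N : ℕ} (h : 2 * N + 1 ≤ d - 1) (σ : ℝ) {K : ℝ → ℂ}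
    (hK : Admissible K) : LocallyIntegrable (coneWeight (d := d) σ N K) := by
  intro x
  obtain ⟨C, hC⟩ := hK.bound ((‖x‖ + 1) ^ 2)
  refine ⟨Metric.ball 0 (‖x‖ + 1), Metric.isOpen_ball.mem_nhds (by simp), ?_⟩
  refine Integrable.mono' ((integrableOn_coneBound h
    (R := ‖x‖ + 1) (by positivity)).const_mul |C|)
    (measurable_coneWeight σ N hK.measurable).aestronglyMeasurable ?_
  filter_upwards [ae_restrict_mem measurableSet_ball,
    ae_restrict_of_ae (ae_minkSq_ne (d := d) (by omega) 0)] with y hy hy0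
  refine (norm_coneWeight_le σ N K y).trans ?_
  have := hC _ (abs_minkSq_le (le_of_lt (by simpa using hy))) hy0
  rw [coneBound, ← mul_assoc]
  refine mul_le_mul_of_nonneg_right (this.trans ?_) (by positivity)
  exact mul_le_mul_of_nonneg_right (le_abs_self C) (by positivity)

theorem integrable_coneWeight_mul {d N : ℕ} (h : 2 * N + 1 ≤ d - 1) (σ : ℝ) {K : ℝ → ℂ}
    (hK : Admissible K) (φ : MinkTest d) :
    Integrable (fun x => coneWeight σ N K x * (φ x : ℂ)) := by
  have := φ.integrable_bilin (ContinuousLinearMap.lsmul ℝ ℝ : ℝ →L[ℝ] ℂ →L[ℝ] ℂ)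
    ((locallyIntegrable_coneWeight h σ hK).locallyIntegrableOn _)
  refine this.congr (.of_forall fun x => ?_)
  simp [mul_comm]

/-- The distribution `φ ↦ ∫ θ(σ x⁰) K(x²) |x⃗|^{-2N} (D_N φ)(x) dx`, where `D_N` is `eulerIter`.
Formally, it is `θ(σ x⁰) k(x²)` with `k = (-d/dw)^N K`. -/
def coneDist (d : ℕ) (σ : ℝ) (N : ℕ) (K : ℝ → ℂ) : MinkDist d :=
  let T : MinkTest d →L[ℝ] ℂ := (TestFunction.integralAgainstBilinCLM
    (ContinuousLinearMap.lsmul ℝ ℝ : ℝ →L[ℝ] ℂ →L[ℝ] ℂ) volume (coneWeight σ N K)) ∘L eulerIter d N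
  { toLinearMap := T.toLinearMap, cont := T.cont }

theorem coneDist_apply {d N : ℕ} (h : 2 * N + 1 ≤ d - 1) (σ : ℝ) {K : ℝ → ℂ}
    (hK : Admissible K) (φ : MinkTest d) :
    coneDist d σ N K φ = ∫ x, coneWeight σ N K x * (eulerIter d N φ x : ℂ) := by
  have : coneDist d σ N K φ = TestFunction.integralAgainstBilinCLM
    (ContinuousLinearMap.lsmul ℝ ℝ : ℝ →L[ℝ] ℂ →L[ℝ] ℂ) volume (coneWeight σ N K)
      (eulerIter d N φ) := rfl
  rw [this, TestFunction.integralAgainstBilinCLM_eq_integral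
    ((locallyIntegrable_coneWeight h σ hK).locallyIntegrableOn _)]
  refine integral_congr_ae (.of_forall fun x => ?_)
  simp [mul_comm]

/-- Locally dominated convergence of kernels. -/
structure KernelTendsto (K : ℝ → ℝ → ℂ) (K₀ : ℝ → ℂ) : Prop where
  measurable : ∀ ε > 0, Measurable (K ε)
  bound : ∀ R : ℝ, ∃ C : ℝ, ∀ ε ∈ Set.Ioc (0 : ℝ) 1, ∀ w : ℝ, |w| ≤ R → w ≠ 0 →
    ‖K ε w‖ ≤ C * |w| ^ (-(1 / 2) : ℝ)
  tendsto : ∀ w : ℝ, w ≠ 0 → Tendsto (fun ε => K ε w) (𝓝[>] 0) (𝓝 (K₀ w))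

/-- Dominated convergence with `coneBound` as majorant on a ball containing the support of φ.
Replacing limits of distributions by this statement is the purpose of the whole representation. -/
theorem KernelTendsto.tendsto_integral {d N : ℕ} (h : 2 * N + 1 ≤ d - 1) (σ : ℝ)
    {K : ℝ → ℝ → ℂ} {K₀ : ℝ → ℂ} (hK : KernelTendsto K K₀) (φ : MinkTest d) :
    Tendsto (fun ε => ∫ x, coneWeight σ N (K ε) x * (φ x : ℂ)) (𝓝[>] 0)
      (𝓝 (∫ x, coneWeight σ N K₀ x * (φ x : ℂ))) := by
  obtain ⟨R, hR0, hR⟩ : ∃ R : ℝ, 0 < R ∧ tsupport φ ⊆ Metric.ball 0 R := by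
    obtain ⟨R, hR⟩ := φ.hasCompactSupport.isBounded.subset_ball 0
    exact ⟨max R 1, by positivity, hR.trans (Metric.ball_subset_ball (le_max_left _ _))⟩
  obtain ⟨C, hC⟩ := hK.bound (R ^ 2)
  obtain ⟨B, hB⟩ := φ.continuous.bounded_above_of_compact_support φ.hasCompactSupport
  have hmem : Set.Ioc (0 : ℝ) 1 ∈ 𝓝[>] (0 : ℝ) := Ioc_mem_nhdsGT one_pos
  refine tendsto_integral_filter_of_dominated_convergence
    ((Metric.ball 0 R).indicator fun x => |C| * B * coneBound d N x) ?_ ?_ ?_ ?_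
  · filter_upwards [hmem] with ε hε
    exact ((measurable_coneWeight σ N (hK.measurable ε hε.1)).mul
      (Complex.measurable_ofReal.comp φ.continuous.measurable)).aestronglyMeasurable
  · filter_upwards [hmem] with ε hε
    filter_upwards [ae_minkSq_ne (d := d) (by omega) 0] with x hx0
    by_cases hx : x ∈ Metric.ball (0 : Mink d) R
    · rw [Set.indicator_of_mem hx, norm_mul, Complex.norm_real]
      have h1 := hC ε hε _ (abs_minkSq_le (le_of_lt (by simpa using hx))) hx0
      calc _ ≤ (‖K ε (minkSq x)‖ * (‖x.2‖ ^ (2 * N))⁻¹) * B :=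
            mul_le_mul (norm_coneWeight_le σ N _ x) (hB x) (norm_nonneg _) (by positivity)
        _ ≤ ((|C| * |minkSq x| ^ (-(1 / 2) : ℝ)) * (‖x.2‖ ^ (2 * N))⁻¹) * B := by
            have hB0 : 0 ≤ B := (norm_nonneg _).trans (hB x)
            gcongr
            exact h1.trans (mul_le_mul_of_nonneg_right (le_abs_self C) (by positivity))
        _ = _ := by rw [coneBound]; ring
    · have : φ x = 0 := image_eq_zero_of_notMem_tsupport fun hx' => hx (hR hx')
      simp [this, hx]
  · exact (integrable_indicator_iff measurableSet_ball).2 ((integrableOn_coneBound h hR0).const_mul _)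
  · filter_upwards [ae_minkSq_ne (d := d) (by omega) 0] with x hx0
    exact (((hK.tendsto _ hx0).const_mul _).mul_const _).mul_const _

theorem KernelTendsto.admissible {K : ℝ → ℝ → ℂ} {K₀ : ℝ → ℂ} (hK : KernelTendsto K K₀)
    (hm : Measurable K₀) : Admissible K₀ := by
  refine ⟨hm, fun R => ?_⟩
  obtain ⟨C, hC⟩ := hK.bound R
  refine ⟨C, fun w hw h0 => le_of_tendsto (hK.tendsto w h0).norm ?_⟩
  filter_upwards [Ioc_mem_nhdsGT (one_pos (α := ℝ))] with ε hε using hC ε hε w hw h0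

theorem KernelTendsto.admissible_of_pos {K : ℝ → ℝ → ℂ} {K₀ : ℝ → ℂ} (hK : KernelTendsto K K₀)
    {ε : ℝ} (hε : ε ∈ Set.Ioc (0 : ℝ) 1) : Admissible (K ε) :=
  ⟨hK.measurable ε hε.1, fun R => (hK.bound R).imp fun _ hC => hC ε hε⟩

theorem KernelTendsto.tendsto_coneDist {d N : ℕ} (h : 2 * N + 1 ≤ d - 1) (σ : ℝ)
    {K : ℝ → ℝ → ℂ} {K₀ : ℝ → ℂ} (hK : KernelTendsto K K₀) (hm : Measurable K₀) (φ : MinkTest d) :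
    Tendsto (fun ε => coneDist d σ N (K ε) φ) (𝓝[>] 0) (𝓝 (coneDist d σ N K₀ φ)) := by
  rw [coneDist_apply h σ (hK.admissible hm)]
  refine (hK.tendsto_integral h σ _).congr' ?_
  filter_upwards [Ioc_mem_nhdsGT (one_pos (α := ℝ))] with ε hε
  rw [coneDist_apply h σ (hK.admissible_of_pos hε)]

/-! ### Radial integration by parts. -/

/-- Successive primitives: `f i` is, up to sign, a primitive of `f (i + 1)`, for `i < N`,
up to the exceptional set `c`. -/
structure IsLadder (c : Set ℝ) (N : ℕ) (f : ℕ → ℝ → ℂ) : Prop where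
  continuous : ∀ i < N, Continuous (f i)
  hasDerivAt : ∀ i < N, ∀ w ∉ c, HasDerivAt (f i) (-(f (i + 1) w)) w
  admissible : Admissible (f N)

theorem IsLadder.admissible_of_le {c : Set ℝ} {N : ℕ} {f : ℕ → ℝ → ℂ} (hf : IsLadder c N f)
    {i : ℕ} (hi : i ≤ N) : Admissible (f i) := by
  rcases hi.lt_or_eq with h | rfl
  · exact .of_continuous (hf.continuous i h)
  · exact hf.admissible

/-- At fixed time t and direction, put n = d - 3 - 2k. The difference of the two integrands,
multiplied by r^{d-2}, is the derivative of ½ θ(σt) r^n f(r² - t²) φ: the chain rule produces -2r g,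
and the product rule produces nφ + r∂_rφ, which explains the constant in `eulerStep`. The primitive
vanishes at r = 0 because n ≥ 1, and for large r because φ has compact support. -/
theorem heaviside_mul_integral_parts {d k : ℕ} (hk : 2 * (k + 1) + 1 ≤ d - 1) (σ : ℝ)
    {c : Set ℝ} (hc : c.Countable) {f g : ℝ → ℂ} (hf : Continuous f)
    (hfg : ∀ w ∉ c, HasDerivAt f (-(g w)) w) (hg : Admissible g) (φ : MinkTest d) :
    ∫ x, coneWeight σ k g x * (φ x : ℂ) =
      ∫ x, coneWeight σ (k + 1) f x * (eulerStep d ((d : ℝ) - 3 - 2 * k) φ x : ℂ) := by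
  have hnt := nontrivial_space hk
  set ψ := eulerStep d ((d : ℝ) - 3 - 2 * k) φ with hψ
  have hI1 := integrable_coneWeight_mul (N := k) (by omega) σ hg φ
  have hI2 := integrable_coneWeight_mul hk σ (.of_continuous hf) ψ
  rw [eq_comm, ← sub_eq_zero, ← integral_sub hI2 hI1]
  have hI := hI2.sub hI1
  rw [Measure.volume_eq_prod] at hI ⊢
  refine (integral_prod _ hI).trans (integral_eq_zero_of_ae ?_)
  filter_upwards [hI.prod_right_ae] with t ht
  rw [Pi.zero_apply, integral_polar _ ht]
  refine integral_eq_zero_of_ae ?_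
  filter_upwards [ae_integrableOn_polar _ ht] with ω hω
  have hfin : Module.finrank ℝ (EuclideanSpace ℝ (Fin (d - 1))) = d - 1 := by simp
  simp only [hfin] at hω ⊢
  rw [Pi.zero_apply]
  have hωn : ‖ω.1‖ = 1 := by simp
  obtain ⟨R, hR0, hR⟩ : ∃ R : ℝ, 0 < R ∧ tsupport φ ⊆ Metric.ball 0 R := by
    obtain ⟨R, hR⟩ := φ.hasCompactSupport.isBounded.subset_ball 0
    exact ⟨max R 1, by positivity, hR.trans (Metric.ball_subset_ball (le_max_left _ _))⟩
  have hφ0 : ∀ r, R ≤ r → (t, r • ω.1) ∉ tsupport φ := fun r hr h => by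
    have := hR h
    rw [Metric.mem_ball, dist_zero_right, Prod.norm_def, sup_lt_iff] at this
    have := this.2
    rw [norm_smul, hωn, mul_one, Real.norm_eq_abs] at this
    exact absurd ((le_abs_self r).trans_lt this) (not_lt.2 hr)
  set m : ℕ := d - 3 - 2 * k with hm
  have hm1 : 1 ≤ m := by omega
  set D : ℝ → ℂ := fun r => r ^ (d - 1 - 1) •
    (coneWeight σ (k + 1) f (t, r • ω.1) * (ψ (t, r • ω.1) : ℂ) -
      coneWeight σ k g (t, r • ω.1) * (φ (t, r • ω.1) : ℂ)) with hD
  set P : ℝ → ℂ := fun r => (heaviside (σ * t) / 2 : ℝ) * ((r : ℂ) ^ m *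
    (f (r ^ 2 - t ^ 2) * (φ (t, r • ω.1) : ℂ))) with hP
  have hφd : ContDiff ℝ 1 φ := φ.contDiff.of_le (by simp)
  have hline : ∀ r : ℝ, HasDerivAt (fun r : ℝ => ((t, r • ω.1) : Mink d)) (0, ω.1) r := fun r =>
    (hasDerivAt_const r t).prodMk (by simpa using (hasDerivAt_id r).smul_const ω.1)
  have hφr : ∀ r : ℝ, HasDerivAt (fun r : ℝ => φ (t, r • ω.1))
      (fderiv ℝ φ (t, r • ω.1) (0, ω.1)) r := fun r =>
    ((hφd.differentiable (by simp) _).hasFDerivAt.comp_hasDerivAt r (hline r))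
  have hPc : Continuous P := by
    have : Continuous fun r : ℝ => φ (t, r • ω.1) := φ.continuous.comp (by fun_prop)
    fun_prop
  have hderiv : ∀ r ∈ Set.Ioo 0 R \ {r | 0 < r ∧ r ^ 2 - t ^ 2 ∈ c}, HasDerivAt P (D r) r := by
    intro r ⟨hr, hrc⟩
    have hr0 : 0 < r := hr.1
    have hnc : r ^ 2 - t ^ 2 ∉ c := fun h => hrc ⟨hr0, h⟩
    have h1 : HasDerivAt (fun r : ℝ => f (r ^ 2 - t ^ 2)) ((2 * r : ℝ) • -(g (r ^ 2 - t ^ 2))) r := by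
      refine HasDerivAt.scomp r (hfg _ hnc) ?_
      simpa using (hasDerivAt_pow 2 r).sub_const (t ^ 2)
    have h2 : HasDerivAt (fun r : ℝ => (r : ℂ) ^ m) (((m : ℝ) * r ^ (m - 1) : ℝ) : ℂ) r := by
      have := (hasDerivAt_pow m r).ofReal_comp
      simpa using this
    have h3 := (h2.mul (h1.mul (hφr r).ofReal_comp)).const_mul ((heaviside (σ * t) / 2 : ℝ) : ℂ)
    refine h3.congr_deriv ?_
    have hnr : ‖r • ω.1‖ = r := by rw [norm_smul, hωn, mul_one, Real.norm_of_nonneg hr0.le]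
    have hms : minkSq ((t, r • ω.1) : Mink d) = r ^ 2 - t ^ 2 := by
      rw [minkSq_eq]; simp only [hnr]
    have hfd : fderiv ℝ φ (t, r • ω.1) (0, r • ω.1) = r * fderiv ℝ φ (t, r • ω.1) (0, ω.1) := by
      have : ((0, r • ω.1) : Mink d) = r • (0, ω.1) := by simp
      rw [this, map_smul, smul_eq_mul]
    simp only [hD, coneWeight, Pi.mul_apply, hms, hnr, hψ, eulerStep_apply, hfd]
    have e1 : r ^ (d - 1 - 1) = r ^ (m - 1) * r ^ (2 * (k + 1)) := by
      rw [← pow_add]; congr 1; omega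
    have e2 : r ^ m = r ^ (m - 1) * r := by rw [← pow_succ]; congr 1; omega
    have e3 : (m : ℝ) = (d : ℝ) - 3 - 2 * k := by
      rw [hm, Nat.sub_sub, Nat.cast_sub (by omega)]; push_cast; ring
    have hrC : (r : ℂ) ≠ 0 := by exact_mod_cast hr0.ne'
    rw [e1, ← e3]
    have e2' : (r : ℂ) ^ m = (r : ℂ) ^ (m - 1) * r := by exact_mod_cast e2
    rw [e2', pow_mul, pow_mul]
    simp only [Complex.real_smul]
    push_cast
    field_simp
    ring
  -- A positive r is determined by r² - t², so the countable exceptional set of w stays countable in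
  -- r; there the continuity of P is enough.
  have hcount : {r : ℝ | 0 < r ∧ r ^ 2 - t ^ 2 ∈ c}.Countable := by
    refine Set.Countable.mono ?_ (hc.image fun w => √(w + t ^ 2))
    rintro r ⟨hr0, hr⟩
    exact ⟨_, hr, by simp [Real.sqrt_sq hr0.le]⟩
  have hzero : ∀ r, R ≤ r → D r = 0 := fun r hr => by
    have h1 : φ (t, r • ω.1) = 0 := image_eq_zero_of_notMem_tsupport (hφ0 r hr)
    have h2 : fderiv ℝ φ (t, r • ω.1) = 0 := by
      have := fun h => hφ0 r hr (tsupport_fderiv_subset ℝ (f := φ) h)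
      exact image_eq_zero_of_notMem_tsupport this
    simp [hD, hψ, eulerStep_apply, h1, h2]
  have hDi : IntegrableOn D (Set.Ioi 0) := by
    refine hω.congr (.of_forall fun r => ?_)
    simp [hD]
  have hPR : P R = 0 := by
    simp [hP, image_eq_zero_of_notMem_tsupport (hφ0 R le_rfl)]
  have hP0 : P 0 = 0 := by simp [hP, show m ≠ 0 by omega]
  have key : ∫ r in (0 : ℝ)..R, D r = 0 := by
    rw [integral_eq_of_hasDerivAt_off_countable P D hcount hPc.continuousOn, hPR, hP0, sub_zero]
    · simpa [hR0.le] using hderiv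
    · rw [intervalIntegrable_iff_integrableOn_Ioc_of_le hR0.le]
      exact hDi.mono_set Set.Ioc_subset_Ioi_self
  rw [intervalIntegral.integral_of_le hR0.le] at key
  have : ∫ r in Set.Ioi (0 : ℝ), D r = 0 := by
    rw [← key]
    refine (setIntegral_eq_of_subset_of_forall_sdiff_eq_zero measurableSet_Ioi
      Set.Ioc_subset_Ioi_self fun r hr => ?_)
    exact hzero r (le_of_lt (not_le.1 fun h => hr.2 ⟨hr.1, h⟩))
  rw [← this]
  refine integral_congr_ae (.of_forall fun r => ?_)
  simp [hD]

/-- `N`-fold integration by parts: the distribution `θ(σ x⁰) k(x²)`, where `k = (-d/dw)^N K`. -/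
theorem IsLadder.integral_eq_coneDist {d N : ℕ} (h : 2 * N + 1 ≤ d - 1) (σ : ℝ) {c : Set ℝ}
    (hc : c.Countable) {f : ℕ → ℝ → ℂ} (hf : IsLadder c N f) (φ : MinkTest d) :
    ∫ x : Mink d, (heaviside (σ * x.1) : ℂ) * f N (minkSq x) * (φ x : ℂ) =
      coneDist d σ N (f 0) φ := by
  have key : ∀ k ≤ N, ∫ x : Mink d, (heaviside (σ * x.1) : ℂ) * f N (minkSq x) * (φ x : ℂ) =
      ∫ x, coneWeight σ k (f (N - k)) x * (eulerIter d k φ x : ℂ) := by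
    intro k hk
    induction k with
    | zero => simp [coneWeight, eulerIter]
    | succ k ih =>
      rw [ih (by omega)]
      have e : N - k = N - (k + 1) + 1 := by omega
      have := heaviside_mul_integral_parts (k := k) (by omega) σ hc
        (hf.continuous (N - (k + 1)) (by omega)) (hf.hasDerivAt (N - (k + 1)) (by omega))
        (hf.admissible_of_le (i := N - (k + 1) + 1) (by omega)) (eulerIter d k φ)
      rw [e, this]
      rfl
  rw [key N le_rfl, coneDist_apply h σ (hf.admissible_of_le (Nat.zero_le _)), Nat.sub_self]

/-! ### Termwise integration and Euler's integral in the variable 1/t. -/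

theorem hasSum_intervalIntegral_exp_mul {a b B : ℝ} {w g : ℝ → ℂ} (hw : Continuous w)
    (hB : ∀ t ∈ Set.uIoc a b, ‖w t‖ ≤ B) (hg : IntervalIntegrable g volume a b) :
    HasSum (fun k : ℕ => ∫ t in a..b, w t ^ k / (k.factorial : ℂ) * g t)
      (∫ t in a..b, Complex.exp (w t) * g t) := by
  have hgm : AEStronglyMeasurable g (volume.restrict (Set.uIoc a b)) :=
    hg.def'.aestronglyMeasurable
  refine intervalIntegral.hasSum_integral_of_dominated_convergence
    (fun k t => B ^ k / (k.factorial : ℝ) * ‖g t‖) (fun k => ?_) (fun k => ?_) ?_ ?_ ?_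
  · exact ((hw.pow k).div_const _).aestronglyMeasurable.mul hgm
  · refine .of_forall fun t ht => ?_
    rw [norm_mul, norm_div, norm_pow]
    simp only [Complex.norm_natCast]
    have := hB t ht
    gcongr
  · refine .of_forall fun t _ => ?_
    exact (Real.summable_pow_div_factorial B).mul_right _
  · have : (fun t => ∑' k : ℕ, B ^ k / (k.factorial : ℝ) * ‖g t‖) = fun t =>
        Real.exp B * ‖g t‖ := by
      ext t
      rw [tsum_mul_right, Real.exp_eq_exp_ℝ, NormedSpace.exp_eq_tsum_div]
    rw [this]
    exact hg.norm.const_mul _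
  · refine .of_forall fun t _ => HasSum.mul_right _ ?_
    rw [Complex.exp_eq_exp_ℂ]
    exact NormedSpace.expSeries_div_hasSum_exp (w t)

section InverseGamma

theorem rpow_neg_one_comp_eq {b ρ x : ℝ} (hx : x ∈ Set.Ioi (0 : ℝ)) :
    (|(-1 : ℝ)| * x ^ ((-1 : ℝ) - 1)) • ((x ^ (-1 : ℝ)) ^ (b - 1) * Real.exp (-(ρ * x ^ (-1 : ℝ)))) =
      Real.exp (-(ρ / x)) * x ^ (-b - 1) := by
  have hx0 : (0 : ℝ) < x := hx
  rw [← Real.rpow_mul hx0.le, Real.rpow_neg_one, smul_eq_mul, abs_neg, abs_one, one_mul,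
    ← mul_assoc, ← Real.rpow_add hx0, mul_comm, div_eq_mul_inv]
  congr 2; ring

/-- The substitution x ↦ 1/x carries the integrand to that of Euler's integral for Γ(b). -/
theorem integrableOn_exp_neg_div_mul_rpow {b ρ : ℝ} (hb : 0 < b) (hρ : 0 < ρ) :
    IntegrableOn (fun x : ℝ => Real.exp (-(ρ / x)) * x ^ (-b - 1)) (Set.Ioi 0) := by
  have h := (integrableOn_Ioi_comp_rpow_iff
    (fun t : ℝ => t ^ (b - 1) * Real.exp (-(ρ * t))) (p := -1) (by norm_num)).2 (by
      have := integrableOn_rpow_mul_exp_neg_mul_rpow (s := b - 1) (p := 1) (b := ρ) (by linarith)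
        one_pos hρ
      simpa using this)
  exact h.congr_fun (fun x hx => rpow_neg_one_comp_eq hx) measurableSet_Ioi

theorem integral_exp_neg_div_mul_rpow {b ρ : ℝ} (hb : 0 < b) (hρ : 0 < ρ) :
    ∫ x in Set.Ioi (0 : ℝ), Real.exp (-(ρ / x)) * x ^ (-b - 1) = ρ ^ (-b) * Real.Gamma b := by
  have h := integral_comp_rpow_Ioi
    (fun t : ℝ => t ^ (b - 1) * Real.exp (-(ρ * t))) (p := -1) (by norm_num)
  rw [setIntegral_congr_fun measurableSet_Ioi (fun x hx => rpow_neg_one_comp_eq hx),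
    Real.integral_rpow_mul_exp_neg_mul_Ioi hb hρ] at h
  rw [h, one_div, Real.inv_rpow hρ.le, Real.rpow_neg hρ.le]

/-- On (0, 1] the power x^{-b-1} only increases with b, so b may be replaced by the positive number
|b| + 1. -/
theorem integrableOn_Ioc_exp_neg_div_mul_rpow (b : ℝ) {ρ : ℝ} (hρ : 0 < ρ) :
    IntegrableOn (fun x : ℝ => Real.exp (-(ρ / x)) * x ^ (-b - 1)) (Set.Ioc 0 1) := by
  have h := (integrableOn_exp_neg_div_mul_rpow (b := |b| + 1) (by positivity) hρ).mono_set
    (fun x hx => hx.1 : Set.Ioc (0 : ℝ) 1 ⊆ Set.Ioi 0)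
  refine Integrable.mono' h (by fun_prop) ?_
  filter_upwards [ae_restrict_mem measurableSet_Ioc] with x hx
  rw [Real.norm_of_nonneg (mul_nonneg (Real.exp_pos _).le (Real.rpow_nonneg hx.1.le _))]
  refine mul_le_mul_of_nonneg_left ?_ (Real.exp_pos _).le
  refine Real.rpow_le_rpow_of_exponent_ge hx.1 hx.2 ?_
  have := le_abs_self b
  linarith

theorem intervalIntegrable_exp_neg_div_mul_rpow (b : ℝ) {ρ : ℝ} (hρ : 0 < ρ) :
    IntervalIntegrable (fun x : ℝ => ((Real.exp (-(ρ / x)) * x ^ (-b - 1) : ℝ) : ℂ)) volume 0 1 := by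
  rw [intervalIntegrable_iff_integrableOn_Ioc_of_le zero_le_one]
  exact (integrableOn_Ioc_exp_neg_div_mul_rpow b hρ).ofReal

end InverseGamma

/-! ### Hankel's contour integral at integers and half-integers. -/

section Hankel

/-- The Hankel-type contour integral `∫ e^{-z/t} t^{-b-1} dt` from `0` to `1`, around the unit circle
and back to `0`. -/
def hankelInt (b z : ℝ) : ℂ :=
  (1 - Complex.exp (-(2 * Real.pi * b * Complex.I))) *
      (∫ s in (0 : ℝ)..1, ((Real.exp (-(z / s)) * s ^ (-b - 1) : ℝ) : ℂ)) +
    Complex.I * ∫ θ in (0 : ℝ)..2 * Real.pi,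
      Complex.exp (-(z * Complex.exp (-(Complex.I * θ))) - Complex.I * b * θ)

/-- The value of `hankelInt`. -/
def hankelVal (b z : ℝ) : ℂ :=
  2 * Real.pi * Complex.I * Complex.exp (-(Real.pi * b * Complex.I)) *
    ((z ^ (-b) * (Real.Gamma (1 - b))⁻¹ : ℝ) : ℂ)

/-- Integrate d(e^{-z/t} t^{-b}) along the contour. At the two ends t = 0 the function vanishes
because of e^{-z/t}, and the boundary terms at t = 1 coming from the two rays cancel against those
of the circle. -/
theorem hankelInt_succ (b : ℝ) {z : ℝ} (hz : 0 < z) :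
    z * hankelInt (b + 1) z = b * hankelInt b z := by
  have hper : Complex.exp (-(2 * Real.pi * ((b + 1 : ℝ) : ℂ) * Complex.I)) =
      Complex.exp (-(2 * Real.pi * b * Complex.I)) := by
    have : -(2 * Real.pi * ((b + 1 : ℝ) : ℂ) * Complex.I) =
        -(2 * Real.pi * b * Complex.I) - 2 * Real.pi * Complex.I := by push_cast; ring
    rw [this, Complex.exp_sub, Complex.exp_two_pi_mul_I, div_one]
  -- radial part
  have h1 : (z : ℂ) * (∫ s in (0 : ℝ)..1, ((Real.exp (-(z / s)) * s ^ (-(b + 1) - 1) : ℝ) : ℂ)) -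
      b * (∫ s in (0 : ℝ)..1, ((Real.exp (-(z / s)) * s ^ (-b - 1) : ℝ) : ℂ)) =
        (Real.exp (-z) : ℂ) := by
    rw [← intervalIntegral.integral_const_mul, ← intervalIntegral.integral_const_mul,
      ← intervalIntegral.integral_sub ((intervalIntegrable_exp_neg_div_mul_rpow _ hz).const_mul _)
        ((intervalIntegrable_exp_neg_div_mul_rpow _ hz).const_mul _)]
    set P : ℝ → ℂ := fun s => ((Real.exp (-(z / s)) * s ^ (-b) : ℝ) : ℂ) with hP
    have hlim : Tendsto P (𝓝[>] 0) (𝓝 0) := by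
      have h0 : Tendsto (fun u : ℝ => u ^ b * Real.exp (-z * u)) atTop (𝓝 0) :=
        tendsto_rpow_mul_exp_neg_mul_atTop_nhds_zero b z hz
      have h2 := h0.comp (tendsto_inv_nhdsGT_zero (𝕜 := ℝ))
      have h3 : Tendsto (fun s : ℝ => Real.exp (-(z / s)) * s ^ (-b)) (𝓝[>] 0) (𝓝 0) := by
        refine h2.congr' ?_
        filter_upwards [self_mem_nhdsWithin] with s hs
        have hs0 : (0 : ℝ) < s := hs
        simp only [Function.comp_apply]
        rw [Real.inv_rpow hs0.le, Real.rpow_neg hs0.le, mul_comm, neg_mul, div_eq_mul_inv]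
      have h4 := (Complex.continuous_ofReal.tendsto 0).comp h3
      rwa [Complex.ofReal_zero] at h4
    have hd : ∀ s ∈ Set.Ioo (0 : ℝ) 1, HasDerivAt P
        ((z : ℂ) * ((Real.exp (-(z / s)) * s ^ (-(b + 1) - 1) : ℝ) : ℂ) -
          b * ((Real.exp (-(z / s)) * s ^ (-b - 1) : ℝ) : ℂ)) s := by
      intro s hs
      have hs0 := hs.1
      have e1 : HasDerivAt (fun s : ℝ => -(z / s)) (z / s ^ 2) s := by
        have := ((hasDerivAt_inv hs0.ne').const_mul z).neg
        refine (this.congr_deriv ?_)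
        field_simp
      have e2 := (e1.exp.mul (Real.hasDerivAt_rpow_const (x := s) (p := -b) (Or.inl hs0.ne'))).ofReal_comp
      refine e2.congr_deriv ?_
      have e3 : s ^ (-(b + 1) - 1) = s ^ (-b) / s ^ 2 := by
        rw [← Real.rpow_natCast, ← Real.rpow_sub hs0]; congr 1; push_cast; ring
      rw [e3]; push_cast; ring
    rw [intervalIntegral.integral_eq_sub_of_hasDerivAt_of_tendsto (f := P) zero_lt_one
      (fun s hs => hd s hs) ?_ hlim (fb := (Real.exp (-z) : ℂ)) ?_]
    · simp
    · exact ((intervalIntegrable_exp_neg_div_mul_rpow _ hz).const_mul _).sub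
        ((intervalIntegrable_exp_neg_div_mul_rpow _ hz).const_mul _)
    · have : ContinuousAt P 1 := by
        simp only [hP]
        have : ContinuousAt (fun s : ℝ => Real.exp (-(z / s)) * s ^ (-b)) 1 := by
          refine ContinuousAt.mul ?_ (Real.continuousAt_rpow_const _ _ (Or.inl one_ne_zero))
          exact (continuousAt_const.div continuousAt_id one_ne_zero).neg.rexp
        exact Complex.continuous_ofReal.continuousAt.comp this
      have h := this.tendsto.mono_left (nhdsWithin_le_nhds (s := Set.Iio 1))
      simpa [hP] using h
  -- circular part
  set Q : ℝ → ℂ := fun θ => Complex.exp (-(z * Complex.exp (-(Complex.I * θ))) - Complex.I * b * θ)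
    with hQ
  have hQd : ∀ θ : ℝ, HasDerivAt Q (Complex.I * (z * Complex.exp (-(z * Complex.exp
      (-(Complex.I * θ))) - Complex.I * ((b + 1 : ℝ) : ℂ) * θ) - b * Complex.exp (-(z * Complex.exp
      (-(Complex.I * θ))) - Complex.I * b * θ))) θ := by
    intro θ
    have e0 : HasDerivAt (fun θ : ℝ => (θ : ℂ)) 1 θ := Complex.ofRealCLM.hasDerivAt
    have e1 := ((((e0.const_mul Complex.I).neg.cexp).const_mul (z : ℂ)).neg.sub
      (e0.const_mul (Complex.I * b))).cexp
    refine e1.congr_deriv ?_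
    have e2 : Complex.exp (-(z * Complex.exp (-(Complex.I * θ))) - Complex.I * ((b + 1 : ℝ) : ℂ) * θ)
        = Complex.exp (-(z * Complex.exp (-(Complex.I * θ))) - Complex.I * b * θ) *
          Complex.exp (-(Complex.I * θ)) := by
      rw [← Complex.exp_add]; congr 1; push_cast; ring
    rw [e2]; simp; ring
  have h2 : (z : ℂ) * (Complex.I * ∫ θ in (0 : ℝ)..2 * Real.pi, Complex.exp (-(z * Complex.exp
      (-(Complex.I * θ))) - Complex.I * ((b + 1 : ℝ) : ℂ) * θ)) -
      b * (Complex.I * ∫ θ in (0 : ℝ)..2 * Real.pi, Complex.exp (-(z * Complex.exp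
      (-(Complex.I * θ))) - Complex.I * b * θ)) =
      (Complex.exp (-(2 * Real.pi * b * Complex.I)) - 1) * (Real.exp (-z) : ℂ) := by
    have hint := intervalIntegral.integral_eq_sub_of_hasDerivAt (a := 0) (b := 2 * Real.pi)
      (fun θ _ => hQd θ) (Continuous.intervalIntegrable (by fun_prop) _ _)
    rw [intervalIntegral.integral_const_mul, intervalIntegral.integral_sub
      (Continuous.intervalIntegrable (by fun_prop) _ _)
      (Continuous.intervalIntegrable (by fun_prop) _ _), intervalIntegral.integral_const_mul,
      intervalIntegral.integral_const_mul] at hint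
    have hv : Q (2 * Real.pi) - Q 0 =
        (Complex.exp (-(2 * Real.pi * b * Complex.I)) - 1) * (Real.exp (-z) : ℂ) := by
      simp only [hQ]
      have : Complex.exp (-(Complex.I * ((2 * Real.pi : ℝ) : ℂ))) = 1 := by
        rw [Complex.exp_neg, mul_comm]; push_cast; rw [Complex.exp_two_pi_mul_I, inv_one]
      rw [this, sub_mul, Complex.ofReal_exp, ← Complex.exp_add]
      push_cast
      simp only [mul_zero, neg_zero, Complex.exp_zero, mul_one, sub_zero, one_mul]
      congr 2; ring
    rw [← hv, ← hint]; ring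
  simp only [hankelInt, hper]
  linear_combination (1 - Complex.exp (-(2 * Real.pi * b * Complex.I))) * h1 + h2

/-- The functional equation of Γ, together with the sign that e^{-iπb} acquires under b ↦ b + 1. -/
theorem hankelVal_succ (b : ℝ) {z : ℝ} (hz : 0 < z) :
    z * hankelVal (b + 1) z = b * hankelVal b z := by
  have h1 : Complex.exp (-(Real.pi * ((b + 1 : ℝ) : ℂ) * Complex.I)) =
      -Complex.exp (-(Real.pi * b * Complex.I)) := by
    have : -(Real.pi * ((b + 1 : ℝ) : ℂ) * Complex.I) =
      -(Real.pi * b * Complex.I) - Real.pi * Complex.I := by push_cast; ring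
    rw [this, Complex.exp_sub, Complex.exp_pi_mul_I]; ring
  have h2 : z * -(z ^ (-(b + 1)) * (Real.Gamma (1 - (b + 1)))⁻¹) =
      b * (z ^ (-b) * (Real.Gamma (1 - b))⁻¹) := by
    have e : z ^ (-(b + 1)) = z ^ (-b) / z := by
      rw [neg_add, ← sub_eq_add_neg, Real.rpow_sub_one hz.ne']
    have e2 : 1 - (b + 1) = -b := by ring
    rw [e, e2]
    -- At b = 0 the functional equation is not available. Both sides vanish there, since Γ takes the
    -- value 0 at its pole and so 1/Γ is 0 as it should be.
    rcases eq_or_ne b 0 with rfl | hb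
    · simp
    · have : Real.Gamma (1 - b) = -b * Real.Gamma (-b) := by
        rw [← Real.Gamma_add_one (neg_ne_zero.2 hb)]; congr 1; ring
      rw [this, mul_inv]
      field_simp
  have h2' : (z : ℂ) * -((z ^ (-(b + 1)) * (Real.Gamma (1 - (b + 1)))⁻¹ : ℝ) : ℂ) =
      b * ((z ^ (-b) * (Real.Gamma (1 - b))⁻¹ : ℝ) : ℂ) := by exact_mod_cast h2
  simp only [hankelVal, h1]
  linear_combination (2 * Real.pi * Complex.I * Complex.exp (-(Real.pi * b * Complex.I))) * h2'

theorem hankelInt_arc_hasSum (b z : ℝ) :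
    HasSum (fun k : ℕ => (-z : ℂ) ^ k / (k.factorial : ℂ) *
        ∫ θ in (0 : ℝ)..2 * Real.pi, Complex.exp (-(Complex.I * (k + b) * θ)))
      (∫ θ in (0 : ℝ)..2 * Real.pi,
        Complex.exp (-(z * Complex.exp (-(Complex.I * θ))) - Complex.I * b * θ)) := by
  have h := hasSum_intervalIntegral_exp_mul (a := 0) (b := 2 * Real.pi) (B := |z|)
    (w := fun θ : ℝ => -(z * Complex.exp (-(Complex.I * θ))))
    (g := fun θ : ℝ => Complex.exp (-(Complex.I * b * θ))) (by fun_prop) (fun θ _ => by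
      have : -(Complex.I * (θ : ℂ)) = ((-θ : ℝ) : ℂ) * Complex.I := by push_cast; ring
      rw [norm_neg, norm_mul, this, Complex.norm_exp_ofReal_mul_I]; simp)
    (Continuous.intervalIntegrable (by fun_prop) _ _)
  convert h using 1
  · ext k
    rw [← intervalIntegral.integral_const_mul]
    congr 1; ext θ
    have : -(Complex.I * (k + b) * (θ : ℂ)) =
      (k : ℂ) * (-(Complex.I * θ)) + -(Complex.I * b * θ) := by ring
    rw [this, Complex.exp_add, Complex.exp_nat_mul]
    have e : -((z : ℂ) * Complex.exp (-(Complex.I * θ))) = -z * Complex.exp (-(Complex.I * θ)) := by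
      ring
    rw [e, mul_pow]; ring
  · congr 1; ext θ
    rw [← Complex.exp_add]; congr 1

/-- For b = 0 the two rays cancel, and of the Laurent series on the circle only the constant term
has a nonzero integral. -/
theorem hankelInt_zero (z : ℝ) : hankelInt 0 z = hankelVal 0 z := by
  have h := hankelInt_arc_hasSum 0 z
  have h2 := h.unique (hasSum_single 0 fun k hk => by
    have : ∫ θ in (0 : ℝ)..2 * Real.pi, Complex.exp (-(Complex.I * (k + (0 : ℝ)) * θ)) = 0 := by
      have hne : -(Complex.I * k) ≠ 0 := by simp [hk]
      have := integral_exp_mul_complex (a := 0) (b := 2 * Real.pi) hne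
      simp only [Complex.ofReal_zero, add_zero]
      simp only [neg_mul] at this
      rw [this]
      have e : -(Complex.I * k * ((2 * Real.pi : ℝ) : ℂ)) = -((k : ℂ) * (2 * Real.pi * Complex.I)) := by
        push_cast; ring
      rw [e, Complex.exp_neg, Complex.exp_nat_mul_two_pi_mul_I]; simp
    rw [this, mul_zero])
  rw [hankelInt, h2]
  simp [hankelVal]
  ring

/-- For b = 1/2 the two rays add up. The circle, evaluated through its Laurent series, equals 2∫_0^1
e^{-zu} u^{-1/2} du, and u = 1/s turns this into twice the missing piece s > 1 of the ray integral.
Together they form 2∫_0^∞ e^{-z/s} s^{-3/2} ds = 2 z^{-1/2} Γ(1/2). -/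
theorem hankelInt_half {z : ℝ} (hz : 0 < z) : hankelInt (1 / 2) z = hankelVal (1 / 2) z := by
  have hexp : Complex.exp (-(2 * Real.pi * ((1 / 2 : ℝ) : ℂ) * Complex.I)) = -1 := by
    have : -(2 * Real.pi * ((1 / 2 : ℝ) : ℂ) * Complex.I) = -(Real.pi * Complex.I) := by
      push_cast; ring
    rw [this, Complex.exp_neg, Complex.exp_pi_mul_I]; norm_num
  -- circular part
  have hyi : IntervalIntegrable (fun u : ℝ => u ^ (-(1 / 2) : ℝ)) volume 0 1 :=
    intervalIntegral.intervalIntegrable_rpow' (by norm_num)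
  have hY := hasSum_intervalIntegral_exp_mul (a := 0) (b := 1) (B := z)
    (w := fun u : ℝ => ((-z * u : ℝ) : ℂ))
    (g := fun u : ℝ => ((u ^ (-(1 / 2) : ℝ) : ℝ) : ℂ)) (by fun_prop) (fun u hu => by
      rw [Set.uIoc_of_le zero_le_one] at hu
      rw [Complex.norm_real, Real.norm_eq_abs, abs_mul, abs_neg, abs_of_pos hz, abs_of_pos hu.1]
      exact mul_le_of_le_one_right hz.le hu.2)
    ⟨hyi.1.ofReal, hyi.2.ofReal⟩
  have hX := (hankelInt_arc_hasSum (1 / 2) z).mul_left Complex.I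
  have hXY : Complex.I * (∫ θ in (0 : ℝ)..2 * Real.pi,
        Complex.exp (-(z * Complex.exp (-(Complex.I * θ))) - Complex.I * ((1 / 2 : ℝ) : ℂ) * θ)) =
      2 * ∫ u in (0 : ℝ)..1, Complex.exp ((-z * u : ℝ) : ℂ) * ((u ^ (-(1 / 2) : ℝ) : ℝ) : ℂ) := by
    refine hX.unique ((hY.mul_left 2).congr_fun fun k => ?_)
    have hk : (k : ℝ) + 1 / 2 ≠ 0 := by positivity
    have hkC : (k : ℂ) + ((1 / 2 : ℝ) : ℂ) ≠ 0 := by exact_mod_cast hk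
    have e1 : ∫ θ in (0 : ℝ)..2 * Real.pi, Complex.exp (-(Complex.I * (k + ((1 / 2 : ℝ) : ℂ)) * θ)) =
        2 / (Complex.I * (k + ((1 / 2 : ℝ) : ℂ))) := by
      have := integral_exp_mul_complex (a := 0) (b := 2 * Real.pi)
        (c := -(Complex.I * (k + ((1 / 2 : ℝ) : ℂ)))) (by simpa using hkC)
      simp only [neg_mul] at this
      rw [this]
      have e : -(Complex.I * (k + ((1 / 2 : ℝ) : ℂ)) * ((2 * Real.pi : ℝ) : ℂ)) =
        -((k : ℂ) * (2 * Real.pi * Complex.I)) + -(Real.pi * Complex.I) := by push_cast; ring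
      rw [e, Complex.exp_add, Complex.exp_neg, Complex.exp_nat_mul_two_pi_mul_I, Complex.exp_neg,
        Complex.exp_pi_mul_I]
      simp only [Complex.ofReal_zero, mul_zero, neg_zero, Complex.exp_zero]
      rw [div_neg, ← neg_div]; norm_num
    have e2 : ∫ u in (0 : ℝ)..1, ((-z * u : ℝ) : ℂ) ^ k / (k.factorial : ℂ) *
        ((u ^ (-(1 / 2) : ℝ) : ℝ) : ℂ) =
        (-z : ℂ) ^ k / (k.factorial : ℂ) * (1 / (k + ((1 / 2 : ℝ) : ℂ))) := by
      have : ∀ u ∈ Set.Ioc (0 : ℝ) 1, ((-z * u : ℝ) : ℂ) ^ k / (k.factorial : ℂ) *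
        ((u ^ (-(1 / 2) : ℝ) : ℝ) : ℂ) = (-z : ℂ) ^ k / (k.factorial : ℂ) *
          ((u ^ ((k : ℝ) + 1 / 2 - 1) : ℝ) : ℂ) := by
        intro u hu
        have : u ^ ((k : ℝ) + 1 / 2 - 1) = u ^ k * u ^ (-(1 / 2) : ℝ) := by
          rw [← Real.rpow_natCast, ← Real.rpow_add hu.1]; congr 1; ring
        rw [this]; push_cast; ring
      rw [intervalIntegral.integral_of_le zero_le_one, setIntegral_congr_fun measurableSet_Ioc this,
        ← intervalIntegral.integral_of_le zero_le_one, intervalIntegral.integral_const_mul,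
        intervalIntegral.integral_ofReal, integral_rpow (Or.inl (by linarith [Nat.cast_nonneg (α := ℝ) k]))]
      congr 1
      rw [Real.zero_rpow (by simpa using hk), Real.one_rpow]
      push_cast; ring
    rw [e1]
    refine Eq.trans ?_ (congrArg (fun y => 2 * y) e2.symm)
    have hI := Complex.I_ne_zero
    field_simp
  -- radial part
  have hrad : ∫ s in (0 : ℝ)..1, ((Real.exp (-(z / s)) * s ^ (-(1 / 2) - 1 : ℝ) : ℝ) : ℂ) =
      ((z ^ (-(1 / 2) : ℝ) * √Real.pi : ℝ) : ℂ) -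
      ∫ u in (0 : ℝ)..1, Complex.exp ((-z * u : ℝ) : ℂ) * ((u ^ (-(1 / 2) : ℝ) : ℝ) : ℂ) := by
    have hu : (∫ u in (0 : ℝ)..1, Complex.exp ((-z * u : ℝ) : ℂ) * ((u ^ (-(1 / 2) : ℝ) : ℝ) : ℂ)) =
        ((∫ u in (0 : ℝ)..1, Real.exp (-z * u) * u ^ (-(1 / 2) : ℝ) : ℝ) : ℂ) := by
      rw [← intervalIntegral.integral_ofReal]; simp
    rw [intervalIntegral.integral_ofReal, hu, ← Complex.ofReal_sub, Complex.ofReal_inj,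
      eq_sub_iff_add_eq, ← Real.Gamma_one_half_eq, ← integral_exp_neg_div_mul_rpow (by norm_num) hz,
      ← intervalIntegral.integral_interval_add_Ioi (a := 0) (b := 1)
        (integrableOn_exp_neg_div_mul_rpow (by norm_num) hz)
        ((integrableOn_exp_neg_div_mul_rpow (by norm_num) hz).mono_set
          (Set.Ioi_subset_Ioi zero_le_one))]
    congr 1
    set g : ℝ → ℝ := (Set.Ioc 0 1).indicator fun u => Real.exp (-z * u) * u ^ (-(1 / 2) : ℝ) with hg
    have hsub := integral_comp_rpow_Ioi g (p := -1) (by norm_num)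
    have hr : ∫ y in Set.Ioi (0 : ℝ), g y =
        ∫ u in (0 : ℝ)..1, Real.exp (-z * u) * u ^ (-(1 / 2) : ℝ) := by
      rw [hg, setIntegral_indicator measurableSet_Ioc, intervalIntegral.integral_of_le zero_le_one]
      congr 2
      exact Set.inter_eq_right.2 Set.Ioc_subset_Ioi_self
    rw [← hr, ← hsub]
    have : ∀ x ∈ Set.Ioi (0 : ℝ), (|(-1 : ℝ)| * x ^ ((-1 : ℝ) - 1)) • g (x ^ (-1 : ℝ)) =
        (Set.Ici 1).indicator (fun s => Real.exp (-(z / s)) * s ^ (-(1 / 2) - 1 : ℝ)) x := by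
      intro x hx
      have hx0 : (0 : ℝ) < x := hx
      have hmem : x ^ (-1 : ℝ) ∈ Set.Ioc (0 : ℝ) 1 ↔ x ∈ Set.Ici 1 := by
        rw [Real.rpow_neg_one, Set.mem_Ioc, Set.mem_Ici, inv_le_one₀ hx0]
        simp [hx0]
      by_cases h1 : x ∈ Set.Ici 1
      · rw [Set.indicator_of_mem h1, hg, Set.indicator_of_mem (hmem.2 h1), mul_comm (Real.exp _),
          ← rpow_neg_one_comp_eq hx]
        norm_num
      · rw [Set.indicator_of_notMem h1, hg, Set.indicator_of_notMem (fun h => h1 (hmem.1 h)),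
          smul_zero]
    rw [setIntegral_congr_fun measurableSet_Ioi this, setIntegral_indicator measurableSet_Ici,
      Set.inter_eq_right.2 (Set.Ici_subset_Ioi.2 zero_lt_one), integral_Ici_eq_integral_Ioi]
  have hrad' : ∫ s in (0 : ℝ)..1, ((Real.exp (-(z / s)) * s ^ (-(1 / 2 : ℝ) - 1) : ℝ) : ℂ) = _ := hrad
  rw [hankelInt, hexp, hXY, hrad', hankelVal]
  have h2 : Complex.exp (-(Real.pi * ((1 / 2 : ℝ) : ℂ) * Complex.I)) = -Complex.I := by
    have : -(Real.pi * ((1 / 2 : ℝ) : ℂ) * Complex.I) = -(Real.pi / 2 * Complex.I) := by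
      push_cast; ring
    rw [this, Complex.exp_neg, Complex.exp_pi_div_two_mul_I, Complex.inv_I]
  have h3 : (1 : ℝ) - 1 / 2 = 1 / 2 := by norm_num
  rw [h2, h3, Real.Gamma_one_half_eq]
  have hpi : (Real.pi : ℂ) = ((√Real.pi : ℝ) : ℂ) * ((√Real.pi : ℝ) : ℂ) := by
    rw [← Complex.ofReal_mul, Real.mul_self_sqrt Real.pi_pos.le]
  have hs : ((√Real.pi : ℝ) : ℂ) ≠ 0 := by
    exact_mod_cast (Real.sqrt_pos.2 Real.pi_pos).ne'
  have h4 := mul_inv_cancel₀ hs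
  simp only [Complex.ofReal_mul, Complex.ofReal_inv]
  rw [hpi]
  linear_combination (2 * ((√Real.pi : ℝ) : ℂ) * Complex.I ^ 2 *
    ((z ^ (-(1 / 2) : ℝ) : ℝ) : ℂ)) * h4 + 2 * ((√Real.pi : ℝ) : ℂ) *
    ((z ^ (-(1 / 2) : ℝ) : ℝ) : ℂ) * Complex.I_sq

/-- Hankel's formula at integers and half-integers. -/
theorem hankelInt_eq {b₀ z : ℝ} (hb₀ : b₀ = 0 ∨ b₀ = 1 / 2) (hz : 0 < z) (k : ℤ) :
    hankelInt (b₀ + k) z = hankelVal (b₀ + k) z := by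
  have hzC : (z : ℂ) ≠ 0 := by exact_mod_cast hz.ne'
  have hbase : hankelInt b₀ z = hankelVal b₀ z := by
    rcases hb₀ with rfl | rfl
    · exact hankelInt_zero z
    · exact hankelInt_half hz
  induction k using Int.induction_on with
  | zero => simpa using hbase
  | succ k ih =>
    have e : b₀ + ((k + 1 : ℤ) : ℝ) = b₀ + ((k : ℤ) : ℝ) + 1 := by push_cast; ring
    rw [e]
    refine mul_left_cancel₀ hzC ?_
    rw [hankelInt_succ _ hz, hankelVal_succ _ hz, ih]
  | pred k ih =>
    have e : b₀ + ((-k : ℤ) : ℝ) = b₀ + ((-k - 1 : ℤ) : ℝ) + 1 := by push_cast; ring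
    rw [e] at ih
    -- Going downwards one divides by the new index. It is negative, since both starting values are
    -- below 1.
    have hne : ((b₀ + ((-k - 1 : ℤ) : ℝ) : ℝ) : ℂ) ≠ 0 := by
      have : b₀ + ((-k - 1 : ℤ) : ℝ) < 0 := by
        push_cast
        have : (0 : ℝ) ≤ k := Nat.cast_nonneg k
        rcases hb₀ with rfl | rfl <;> linarith
      exact_mod_cast this.ne
    refine mul_left_cancel₀ hne ?_
    rw [← hankelInt_succ _ hz, ← hankelVal_succ _ hz, ih]

end Hankel

/-! ### The function U on the logarithmic surface: continuity, reflection, polar part. -/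

/-- The ray part of the integral defining `riemannU`. -/
def rayInt (α : ℝ) (ζ : ℂ) : ℂ :=
  ∫ s : ℝ in (0 : ℝ)..1,
    Complex.exp (-((s : ℂ) * Complex.exp (Complex.I * (ζ.im : ℂ))) -
        ((Real.exp ζ.re / s : ℝ) : ℂ)) *
      ((s ^ (-α - 1) : ℝ) : ℂ) * Complex.exp (-(Complex.I * (α : ℂ) * (ζ.im : ℂ)))

/-- The circular part of the integral defining `riemannU`. -/
def arcInt (α : ℝ) (ζ : ℂ) : ℂ :=
  ∫ θ : ℝ in ζ.im..0,
    Complex.exp (-Complex.exp (Complex.I * (θ : ℂ)) - Complex.exp (ζ - Complex.I * (θ : ℂ))) *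
      Complex.exp (-(Complex.I * (α : ℂ) * (θ : ℂ))) * Complex.I

/-- The unbounded part of the integral defining `riemannU`. -/
def tailInt (α : ℝ) (ζ : ℂ) : ℂ :=
  ∫ t : ℝ in Set.Ioi (1 : ℝ),
    Complex.exp (-(t : ℂ) - Complex.exp ζ / (t : ℂ)) * ((t ^ (-α - 1) : ℝ) : ℂ)

theorem riemannU_eq (α : ℝ) (ζ : ℂ) :
    riemannU α ζ = ((√Real.pi : ℝ) : ℂ)⁻¹ * (rayInt α ζ + arcInt α ζ + tailInt α ζ) := rfl

theorem norm_exp_I_mul_ofReal (x : ℝ) : ‖Complex.exp (Complex.I * (x : ℂ))‖ = 1 := by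
  rw [mul_comm, Complex.norm_exp_ofReal_mul_I]

theorem exp_ray_eq (η ρ s : ℝ) : Complex.exp (-((s : ℂ) * Complex.exp (Complex.I * (η : ℂ))) -
    ((ρ / s : ℝ) : ℂ)) = Complex.exp (-((s : ℂ) * Complex.exp (Complex.I * (η : ℂ)))) *
      (Real.exp (-(ρ / s)) : ℂ) := by
  rw [sub_eq_add_neg, Complex.exp_add, Complex.ofReal_exp]; push_cast; rfl

theorem norm_exp_neg_ofReal_mul_le {s : ℝ} (hs : 0 ≤ s) (η : ℝ) :
    ‖Complex.exp (-((s : ℂ) * Complex.exp (Complex.I * (η : ℂ))))‖ ≤ Real.exp s := by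
  refine (Complex.norm_exp_le_exp_norm _).trans (Real.exp_le_exp.2 ?_)
  rw [norm_neg, norm_mul, norm_exp_I_mul_ofReal, mul_one, Complex.norm_real,
    Real.norm_of_nonneg hs]

theorem norm_exp_neg_I_mul (a b : ℝ) : ‖Complex.exp (-(Complex.I * (a : ℂ) * (b : ℂ)))‖ = 1 := by
  have : -(Complex.I * (a : ℂ) * (b : ℂ)) = ((-(a * b) : ℝ) : ℂ) * Complex.I := by push_cast; ring
  rw [this, Complex.norm_exp_ofReal_mul_I]

theorem continuous_rayInt (α : ℝ) : Continuous (rayInt α) := by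
  rw [continuous_iff_continuousAt]
  intro ζ₀
  -- A lower bound for |e^ζ| near ζ₀: the damping e^{-ρ/s} then serves all nearby ζ at once.
  set ρ := Real.exp (ζ₀.re - 1) with hρ
  have hρ0 : 0 < ρ := Real.exp_pos _
  have hev : ∀ᶠ ζ : ℂ in 𝓝 ζ₀, ζ₀.re - 1 < ζ.re :=
    Complex.continuous_re.continuousAt.eventually (lt_mem_nhds (by simp))
  refine intervalIntegral.continuousAt_of_dominated_interval
    (bound := fun s => Real.exp 1 * (Real.exp (-(ρ / s)) * s ^ (-α - 1))) ?_ ?_ ?_ ?_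
  · refine .of_forall fun ζ => Measurable.aestronglyMeasurable ?_
    fun_prop
  · filter_upwards [hev] with ζ hζ
    refine .of_forall fun s hs => ?_
    rw [Set.uIoc_of_le zero_le_one] at hs
    rw [exp_ray_eq, norm_mul, norm_mul, norm_mul, norm_exp_neg_I_mul, mul_one, Complex.norm_real,
      Complex.norm_real, Real.norm_of_nonneg (Real.exp_pos _).le,
      Real.norm_of_nonneg (Real.rpow_nonneg hs.1.le _), mul_assoc]
    have h1 := (norm_exp_neg_ofReal_mul_le hs.1.le ζ.im).trans (Real.exp_le_exp.2 hs.2)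
    have h2 : Real.exp (-(Real.exp ζ.re / s)) ≤ Real.exp (-(ρ / s)) := by
      rw [Real.exp_le_exp, neg_le_neg_iff]
      exact div_le_div_of_nonneg_right (Real.exp_le_exp.2 hζ.le) hs.1.le
    have h3 : 0 ≤ s ^ (-α - 1) := Real.rpow_nonneg hs.1.le _
    gcongr
  · rw [intervalIntegrable_iff_integrableOn_Ioc_of_le zero_le_one]
    exact (integrableOn_Ioc_exp_neg_div_mul_rpow α hρ0).const_mul _
  · refine .of_forall fun s _ => Continuous.continuousAt ?_
    have := Complex.continuous_re; have := Complex.continuous_im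
    fun_prop

theorem continuous_arcInt (α : ℝ) : Continuous (arcInt α) := by
  have h : arcInt α = fun ζ : ℂ => -∫ θ : ℝ in (0 : ℝ)..ζ.im,
      Complex.exp (-Complex.exp (Complex.I * (θ : ℂ)) - Complex.exp (ζ - Complex.I * (θ : ℂ))) *
        Complex.exp (-(Complex.I * (α : ℂ) * (θ : ℂ))) * Complex.I := by
    ext ζ; rw [arcInt, intervalIntegral.integral_symm]
  rw [h]
  refine (intervalIntegral.continuous_parametric_intervalIntegral_of_continuous ?_
    Complex.continuous_im).neg
  simp only [Function.uncurry_def]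
  fun_prop

theorem norm_tail_le (α : ℝ) (hα : 0 ≤ α) (ζ : ℂ) {t : ℝ} (ht : 1 < t) :
    ‖Complex.exp (-(t : ℂ) - Complex.exp ζ / (t : ℂ)) * ((t ^ (-α - 1) : ℝ) : ℂ)‖ ≤
      Real.exp (Real.exp ζ.re) * Real.exp (-t) := by
  have ht0 : 0 < t := by linarith
  rw [norm_mul, Complex.norm_real, Real.norm_of_nonneg (Real.rpow_nonneg ht0.le _), ← Real.exp_add]
  have h1 : t ^ (-α - 1) ≤ 1 := Real.rpow_le_one_of_one_le_of_nonpos ht.le (by linarith)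
  refine (mul_le_of_le_one_right (norm_nonneg _) h1).trans ?_
  rw [Complex.norm_exp, Real.exp_le_exp]
  have h2 : -(Complex.exp ζ / (t : ℂ)).re ≤ Real.exp ζ.re := by
    refine (neg_le_abs _).trans ((Complex.abs_re_le_norm _).trans ?_)
    rw [norm_div, Complex.norm_exp, Complex.norm_real, Real.norm_of_nonneg ht0.le]
    exact div_le_self (Real.exp_pos _).le ht.le
  simp only [Complex.sub_re, Complex.neg_re, Complex.ofReal_re]
  linarith

theorem continuous_tailInt {α : ℝ} (hα : 0 ≤ α) : Continuous (tailInt α) := by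
  rw [continuous_iff_continuousAt]
  intro ζ₀
  have hev : ∀ᶠ ζ : ℂ in 𝓝 ζ₀, ζ.re < ζ₀.re + 1 :=
    Complex.continuous_re.continuousAt.eventually (gt_mem_nhds (by simp))
  refine continuousAt_of_dominated
    (bound := fun t => Real.exp (Real.exp (ζ₀.re + 1)) * Real.exp (-t)) ?_ ?_ ?_ ?_
  · refine .of_forall fun ζ => Measurable.aestronglyMeasurable ?_
    fun_prop
  · filter_upwards [hev] with ζ hζ
    filter_upwards [ae_restrict_mem measurableSet_Ioi] with t ht
    refine (norm_tail_le α hα ζ ht).trans ?_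
    gcongr
  · exact (integrableOn_exp_neg_Ioi 1).const_mul _
  · refine .of_forall fun s => Continuous.continuousAt ?_
    fun_prop

theorem continuous_riemannU {α : ℝ} (hα : 0 ≤ α) : Continuous (riemannU α) := by
  have : riemannU α = fun ζ => ((√Real.pi : ℝ) : ℂ)⁻¹ * (rayInt α ζ + arcInt α ζ + tailInt α ζ) :=
    funext (riemannU_eq α)
  rw [this]
  have h1 := continuous_rayInt α
  have h2 := continuous_arcInt α
  have h3 := continuous_tailInt hα
  fun_prop

theorem rayInt_conj (α : ℝ) (ζ : ℂ) :
    rayInt α (starRingEnd ℂ ζ) = starRingEnd ℂ (rayInt α ζ) := by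
  rw [rayInt, rayInt, intervalIntegral.integral_of_le zero_le_one,
    intervalIntegral.integral_of_le zero_le_one, ← integral_conj]
  congr 1; ext s
  simp only [map_mul, ← Complex.exp_conj, map_sub, map_neg, Complex.conj_ofReal, Complex.conj_I,
    Complex.conj_re, Complex.conj_im]
  push_cast
  congr 3 <;> ring_nf

theorem tailInt_conj (α : ℝ) (ζ : ℂ) :
    tailInt α (starRingEnd ℂ ζ) = starRingEnd ℂ (tailInt α ζ) := by
  rw [tailInt, tailInt, ← integral_conj]
  congr 1; ext s
  simp only [map_mul, ← Complex.exp_conj, map_sub, map_neg, Complex.conj_ofReal, map_div₀]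

theorem arcInt_conj (α : ℝ) (ζ : ℂ) :
    arcInt α (starRingEnd ℂ ζ) = starRingEnd ℂ (arcInt α ζ) := by
  have h : ∀ a : ℝ, ∀ f : ℝ → ℂ, starRingEnd ℂ (∫ θ in a..0, f θ) =
      ∫ θ in a..0, starRingEnd ℂ (f θ) := by
    intro a f
    simp only [intervalIntegral, map_sub, ← integral_conj]
  rw [arcInt, arcInt, h, Complex.conj_im]
  have := intervalIntegral.integral_comp_neg (a := ζ.im) (b := 0) (fun θ : ℝ =>
    Complex.exp (-Complex.exp (Complex.I * (θ : ℂ)) - Complex.exp (starRingEnd ℂ ζ - Complex.I * (θ : ℂ))) *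
      Complex.exp (-(Complex.I * (α : ℂ) * (θ : ℂ))) * Complex.I)
  rw [neg_zero] at this
  rw [intervalIntegral.integral_symm, ← this, ← intervalIntegral.integral_neg]
  congr 1; ext θ
  simp only [map_mul, ← Complex.exp_conj, map_sub, map_neg, Complex.conj_ofReal, Complex.conj_I]
  push_cast
  simp only [mul_neg, neg_mul, neg_neg, sub_neg_eq_add]

/-- The contour for the conjugate point is the reflected contour. This symmetry will give the second
formula for G from the first. -/
theorem riemannU_conj (α : ℝ) (ζ : ℂ) :
    riemannU α (starRingEnd ℂ ζ) = starRingEnd ℂ (riemannU α ζ) := by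
  simp only [riemannU_eq, rayInt_conj, arcInt_conj, tailInt_conj, map_mul, map_add, map_inv₀,
    Complex.conj_ofReal]

theorem arcInt_bound (α : ℝ) {ζ : ℂ} (h : |ζ.im| ≤ 2 * Real.pi) :
    ‖arcInt α ζ‖ ≤ Real.exp (1 + Real.exp ζ.re) * (2 * Real.pi) := by
  refine (intervalIntegral.norm_integral_le_of_norm_le_const
    (C := Real.exp (1 + Real.exp ζ.re)) fun θ _ => ?_).trans ?_
  · rw [norm_mul, norm_mul, Complex.norm_I, norm_exp_neg_I_mul, mul_one, mul_one]
    refine (Complex.norm_exp_le_exp_norm _).trans (Real.exp_le_exp.2 ((norm_sub_le _ _).trans ?_))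
    rw [norm_neg, norm_exp_I_mul_ofReal, Complex.norm_exp]
    simp
  · refine mul_le_mul_of_nonneg_left ?_ (Real.exp_pos _).le
    rwa [zero_sub, abs_neg]

theorem tailInt_bound {α : ℝ} (hα : 0 ≤ α) (ζ : ℂ) : ‖tailInt α ζ‖ ≤ Real.exp (Real.exp ζ.re) := by
  refine (norm_integral_le_of_norm_le ((integrableOn_exp_neg_Ioi 1).const_mul
    (Real.exp (Real.exp ζ.re))) ?_).trans ?_
  · filter_upwards [ae_restrict_mem measurableSet_Ioi] with t ht using norm_tail_le α hα ζ ht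
  · rw [integral_const_mul, integral_exp_neg_Ioi]
    exact mul_le_of_le_one_right (Real.exp_pos _).le (Real.exp_le_one_iff.2 (by norm_num))

/-- The error is the integral over s > 1, where the exponential is at most 1 and ∫ s^{-b-1} ds =
1/b. -/
theorem integral_Ioc_exp_neg_div_mul_rpow_sub {b ρ : ℝ} (hb : 0 < b) (hρ : 0 < ρ) :
    |(∫ s in (0 : ℝ)..1, Real.exp (-(ρ / s)) * s ^ (-b - 1)) - ρ ^ (-b) * Real.Gamma b| ≤ b⁻¹ := by
  have hI := integrableOn_exp_neg_div_mul_rpow hb hρ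
  have hI1 := hI.mono_set (Set.Ioi_subset_Ioi zero_le_one)
  rw [← integral_exp_neg_div_mul_rpow hb hρ, ← intervalIntegral.integral_interval_add_Ioi (a := 0)
    (b := 1) hI hI1, sub_add_cancel_left, abs_neg]
  have h1 : ∫ s in Set.Ioi (1 : ℝ), s ^ (-b - 1) = b⁻¹ := by
    rw [integral_Ioi_rpow_of_lt (by linarith) one_pos]; simp
  rw [← h1, ← Real.norm_eq_abs]
  refine norm_integral_le_of_norm_le (integrableOn_Ioi_rpow_of_lt (by linarith) one_pos) ?_
  filter_upwards [ae_restrict_mem measurableSet_Ioi] with s hs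
  have hs0 : (0 : ℝ) < s := lt_trans one_pos hs
  rw [Real.norm_of_nonneg (by positivity)]
  exact mul_le_of_le_one_left (by positivity) (Real.exp_le_one_iff.2 (by
    rw [neg_nonpos]; positivity))

/-- Expand exp(-s e^{iη}) to order N. The j-th Taylor term integrates to Γ(α - j) z^{j-α} up to a
bounded error. The remainder is at most e·s^N, and s^{N-α-1} ≤ s^{-3/2} on (0, 1] because α ≤ N +
1/2, so it contributes O(|z|^{-1/2}). -/
theorem rayInt_bound {α : ℝ} {N : ℕ} (h1 : (N : ℝ) ≤ α) (h2 : α ≤ N + 1 / 2) (ζ : ℂ) :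
    ‖rayInt α ζ - ∑ j ∈ Finset.range N, ((-1) ^ j / (j.factorial : ℂ) * (Real.Gamma (α - j) : ℂ)) *
      Complex.exp (((j : ℂ) - α) * ζ)‖ ≤
      (∑ j ∈ Finset.range N, (j.factorial : ℝ)⁻¹ * (α - j)⁻¹) +
        Real.exp 1 * ((Real.exp ζ.re) ^ (-(1 / 2) : ℝ) * Real.Gamma (1 / 2)) := by
  set ρ := Real.exp ζ.re with hρ
  have hρ0 : 0 < ρ := Real.exp_pos _
  set e := Complex.exp (-(Complex.I * (α : ℂ) * (ζ.im : ℂ))) with he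
  have hen : ‖e‖ = 1 := norm_exp_neg_I_mul _ _
  set c : ℕ → ℂ := fun j => (-Complex.exp (Complex.I * (ζ.im : ℂ))) ^ j / (j.factorial : ℂ) * e
  have hcn : ∀ j, ‖c j‖ = (j.factorial : ℝ)⁻¹ := fun j => by
    simp [c, hen]
  set J : ℕ → ℝ := fun j => ∫ s in (0 : ℝ)..1, Real.exp (-(ρ / s)) * s ^ (-(α - j) - 1) with hJ
  have hsum : ∫ s in (0 : ℝ)..1, (∑ j ∈ Finset.range N, c j *
      ((Real.exp (-(ρ / s)) * s ^ (-(α - j) - 1) : ℝ) : ℂ)) = ∑ j ∈ Finset.range N, c j * (J j : ℂ) := by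
    rw [intervalIntegral.integral_finsetSum fun j _ =>
      (intervalIntegrable_exp_neg_div_mul_rpow _ hρ0).const_mul _]
    refine Finset.sum_congr rfl fun j _ => ?_
    rw [intervalIntegral.integral_const_mul, intervalIntegral.integral_ofReal]
  -- remainder of the exponential series
  have hrem : ‖rayInt α ζ - ∑ j ∈ Finset.range N, c j * (J j : ℂ)‖ ≤
      Real.exp 1 * (ρ ^ (-(1 / 2) : ℝ) * Real.Gamma (1 / 2)) := by
    have hsi : IntervalIntegrable (fun s : ℝ => ∑ j ∈ Finset.range N, c j *
        ((Real.exp (-(ρ / s)) * s ^ (-(α - j) - 1) : ℝ) : ℂ)) volume 0 1 := by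
      have := IntervalIntegrable.sum (Finset.range N) (f := fun (j : ℕ) (s : ℝ) => c j *
        ((Real.exp (-(ρ / s)) * s ^ (-(α - j) - 1) : ℝ) : ℂ)) fun j _ =>
        (intervalIntegrable_exp_neg_div_mul_rpow (α - j) hρ0).const_mul (c j)
      simpa [Finset.sum_fn] using this
    have hri : IntervalIntegrable (fun s : ℝ =>
        Complex.exp (-((s : ℂ) * Complex.exp (Complex.I * (ζ.im : ℂ))) -
          ((ρ / s : ℝ) : ℂ)) * ((s ^ (-α - 1) : ℝ) : ℂ) * e) volume 0 1 := by
      rw [intervalIntegrable_iff_integrableOn_Ioc_of_le zero_le_one]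
      refine Integrable.mono' ((integrableOn_Ioc_exp_neg_div_mul_rpow α hρ0).const_mul (Real.exp 1))
        (Measurable.aestronglyMeasurable (by fun_prop)) ?_
      filter_upwards [ae_restrict_mem measurableSet_Ioc] with s hs
      rw [exp_ray_eq, norm_mul, norm_mul, norm_mul, hen, mul_one, Complex.norm_real,
        Complex.norm_real, Real.norm_of_nonneg (Real.exp_pos _).le,
        Real.norm_of_nonneg (Real.rpow_nonneg hs.1.le _), mul_assoc]
      have h1 := (norm_exp_neg_ofReal_mul_le hs.1.le ζ.im).trans (Real.exp_le_exp.2 hs.2)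
      have h3 : 0 ≤ s ^ (-α - 1) := Real.rpow_nonneg hs.1.le _
      gcongr
    have hmaj := (integrableOn_exp_neg_div_mul_rpow (b := 1 / 2) (by norm_num) hρ0)
    rw [← hsum, rayInt, ← intervalIntegral.integral_sub hri hsi,
      ← integral_exp_neg_div_mul_rpow (by norm_num) hρ0, ← integral_const_mul]
    rw [intervalIntegral.integral_of_le zero_le_one]
    have hmaj' : IntegrableOn (fun s : ℝ => Real.exp 1 *
        (Real.exp (-(ρ / s)) * s ^ (-(1 / 2) - 1 : ℝ))) (Set.Ioi 0) := hmaj.const_mul _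
    refine (norm_integral_le_of_norm_le (hmaj'.mono_set (fun x hx => hx.1)) ?_).trans (setIntegral_mono_set (hmaj.const_mul (Real.exp 1)) ?_ ?_)
    · filter_upwards [ae_restrict_mem measurableSet_Ioc] with s hs
      have hb := Complex.norm_exp_sub_sum_le_norm_mul_exp
        (-((s : ℂ) * Complex.exp (Complex.I * (ζ.im : ℂ)))) N
      have hns : ‖(-((s : ℂ) * Complex.exp (Complex.I * (ζ.im : ℂ))))‖ = s := by
        rw [norm_neg, norm_mul, norm_exp_I_mul_ofReal, mul_one, Complex.norm_real,
          Real.norm_of_nonneg hs.1.le]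
      rw [hns] at hb
      have hterm : ∀ j : ℕ, c j * ((Real.exp (-(ρ / s)) * s ^ (-(α - j) - 1) : ℝ) : ℂ) =
          (-((s : ℂ) * Complex.exp (Complex.I * (ζ.im : ℂ)))) ^ j / (j.factorial : ℂ) *
            ((Real.exp (-(ρ / s)) * s ^ (-α - 1) : ℝ) * e) := by
        intro j
        have : s ^ (-(α - j) - 1) = s ^ j * s ^ (-α - 1) := by
          rw [← Real.rpow_natCast, ← Real.rpow_add hs.1]; congr 1; ring
        have h2 : -((s : ℂ) * Complex.exp (Complex.I * (ζ.im : ℂ))) =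
          s * -Complex.exp (Complex.I * (ζ.im : ℂ)) := by ring
        rw [this, h2, mul_pow]
        simp only [c]
        push_cast; ring
      rw [exp_ray_eq, Finset.sum_congr rfl fun j _ => hterm j, ← Finset.sum_mul]
      have : Complex.exp (-((s : ℂ) * Complex.exp (Complex.I * (ζ.im : ℂ)))) *
          (Real.exp (-(ρ / s)) : ℂ) * ((s ^ (-α - 1) : ℝ) : ℂ) * e =
          Complex.exp (-((s : ℂ) * Complex.exp (Complex.I * (ζ.im : ℂ)))) *
          ((Real.exp (-(ρ / s)) * s ^ (-α - 1) : ℝ) * e) := by push_cast; ring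
      rw [this, ← sub_mul, norm_mul, norm_mul, hen, mul_one, Complex.norm_real,
        Real.norm_of_nonneg (mul_nonneg (Real.exp_pos _).le (Real.rpow_nonneg hs.1.le _))]
      have hs0 := hs.1
      have hpow : s ^ N * s ^ (-α - 1) ≤ s ^ (-(1 / 2) - 1 : ℝ) := by
        rw [← Real.rpow_natCast, ← Real.rpow_add hs.1]
        exact Real.rpow_le_rpow_of_exponent_ge hs.1 hs.2 (by linarith)
      calc _ ≤ (s ^ N * Real.exp 1) * (Real.exp (-(ρ / s)) * s ^ (-α - 1)) := by
            refine mul_le_mul_of_nonneg_right (hb.trans ?_) (by positivity)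
            have := hs.2
            gcongr
        _ = Real.exp 1 * (Real.exp (-(ρ / s)) * (s ^ N * s ^ (-α - 1))) := by ring
        _ ≤ _ := by gcongr
    · filter_upwards [ae_restrict_mem measurableSet_Ioi] with s hs
      have : (0 : ℝ) < s := hs
      positivity
    · exact (Eventually.of_forall fun x hx => hx.1)
  have hmain : ‖(∑ j ∈ Finset.range N, c j * (J j : ℂ)) -
      ∑ j ∈ Finset.range N, ((-1) ^ j / (j.factorial : ℂ) * (Real.Gamma (α - j) : ℂ)) *
      Complex.exp (((j : ℂ) - α) * ζ)‖ ≤ ∑ j ∈ Finset.range N, (j.factorial : ℝ)⁻¹ * (α - j)⁻¹ := by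
    rw [← Finset.sum_sub_distrib]
    refine norm_sum_le_of_le _ fun j hj => ?_
    have hjN : (j : ℝ) + 1 ≤ N := by exact_mod_cast Finset.mem_range.1 hj
    have hb : 0 < α - j := by linarith
    have e1 : ((-1) ^ j / (j.factorial : ℂ) * (Real.Gamma (α - j) : ℂ)) *
        Complex.exp (((j : ℂ) - α) * ζ) = c j * ((ρ ^ (-(α - j)) * Real.Gamma (α - j) : ℝ) : ℂ) := by
      have : Complex.exp (((j : ℂ) - α) * ζ) = Complex.exp (Complex.I * (ζ.im : ℂ)) ^ j * e *
          ((ρ ^ (-(α - j)) : ℝ) : ℂ) := by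
        rw [hρ, ← Real.exp_mul, Complex.ofReal_exp, he, ← Complex.exp_nat_mul, ← Complex.exp_add,
          ← Complex.exp_add]
        congr 1
        conv_lhs => rw [← Complex.re_add_im ζ]
        push_cast; ring
      rw [this]
      simp only [c]
      rw [neg_pow (Complex.exp (Complex.I * (ζ.im : ℂ)))]
      push_cast; ring
    rw [e1, ← mul_sub, norm_mul, hcn, ← Complex.ofReal_sub, Complex.norm_real, Real.norm_eq_abs]
    exact mul_le_mul_of_nonneg_left (integral_Ioc_exp_neg_div_mul_rpow_sub hb hρ0) (by positivity)
  rw [add_comm]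
  refine (norm_sub_le_norm_sub_add_norm_sub _ (∑ j ∈ Finset.range N, c j * (J j : ℂ)) _).trans ?_
  exact add_le_add hrem hmain

/-- The coefficients of the polar part of `riemannU`. -/
def polarCoeff (α : ℝ) (j : ℕ) : ℂ :=
  ((√Real.pi : ℝ) : ℂ)⁻¹ * ((-1) ^ j / (j.factorial : ℂ) * (Real.Gamma (α - j) : ℂ))

/-- The function `riemannU` minus its polar part. -/
def regU (α : ℝ) (N : ℕ) (ζ : ℂ) : ℂ :=
  riemannU α ζ - ∑ j ∈ Finset.range N, polarCoeff α j * Complex.exp (((j : ℂ) - α) * ζ)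

theorem continuous_regU {α : ℝ} (hα : 0 ≤ α) (N : ℕ) : Continuous (regU α N) := by
  unfold regU
  have := continuous_riemannU hα
  fun_prop

/-- Arc and tail are bounded for bounded |z| and so are absorbed into |z|^{-1/2}; the ray is
`rayInt_bound`. The range |arg| ≤ 2π is what is needed for a principal logarithm shifted by iπ. -/
theorem regU_bound {α : ℝ} {N : ℕ} (h1 : (N : ℝ) ≤ α) (h2 : α ≤ N + 1 / 2) (R : ℝ) :
    ∃ C : ℝ, ∀ ζ : ℂ, |ζ.im| ≤ 2 * Real.pi → Real.exp ζ.re ≤ R →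
      ‖regU α N ζ‖ ≤ C * (Real.exp ζ.re) ^ (-(1 / 2) : ℝ) := by
  have hα : 0 ≤ α := (Nat.cast_nonneg N).trans h1
  set A : ℝ := ∑ j ∈ Finset.range N, (j.factorial : ℝ)⁻¹ * (α - j)⁻¹
  set B : ℝ := A + Real.exp (1 + R) * (2 * Real.pi) + Real.exp R
  refine ⟨(√Real.pi)⁻¹ * (|B| * R ^ (1 / 2 : ℝ) + Real.exp 1 * Real.Gamma (1 / 2)), fun ζ hi hr => ?_⟩
  have hρ : 0 < Real.exp ζ.re := Real.exp_pos _
  have e : regU α N ζ = ((√Real.pi : ℝ) : ℂ)⁻¹ * ((rayInt α ζ - ∑ j ∈ Finset.range N,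
      ((-1) ^ j / (j.factorial : ℂ) * (Real.Gamma (α - j) : ℂ)) *
      Complex.exp (((j : ℂ) - α) * ζ)) + arcInt α ζ + tailInt α ζ) := by
    rw [regU, riemannU_eq]
    simp only [polarCoeff, mul_assoc, ← Finset.mul_sum]
    ring
  rw [e, norm_mul, norm_inv, Complex.norm_real, Real.norm_of_nonneg (Real.sqrt_nonneg _), mul_assoc]
  refine mul_le_mul_of_nonneg_left ?_ (by positivity)
  have ha := (arcInt_bound α hi).trans (b := Real.exp (1 + Real.exp ζ.re) * (2 * Real.pi))
    (c := Real.exp (1 + R) * (2 * Real.pi)) (by gcongr)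
  have ht := (tailInt_bound hα ζ).trans (Real.exp_le_exp.2 hr)
  have hb := rayInt_bound h1 h2 ζ
  have h3 : 1 ≤ R ^ (1 / 2 : ℝ) * (Real.exp ζ.re) ^ (-(1 / 2) : ℝ) := by
    have := one_le_mul_abs_rpow (R := R) (w := Real.exp ζ.re) (by rwa [abs_of_pos hρ]) hρ.ne'
    rwa [abs_of_pos hρ] at this
  have h4 : B ≤ |B| * (R ^ (1 / 2 : ℝ) * (Real.exp ζ.re) ^ (-(1 / 2) : ℝ)) :=
    (le_abs_self B).trans (le_mul_of_one_le_right (abs_nonneg _) h3)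
  refine (norm_add₃_le).trans ?_
  have : A + Real.exp 1 * ((Real.exp ζ.re) ^ (-(1 / 2) : ℝ) * Real.Gamma (1 / 2)) +
      Real.exp (1 + R) * (2 * Real.pi) + Real.exp R ≤
      (|B| * R ^ (1 / 2 : ℝ) + Real.exp 1 * Real.Gamma (1 / 2)) *
        (Real.exp ζ.re) ^ (-(1 / 2) : ℝ) := by
    have : A + Real.exp 1 * ((Real.exp ζ.re) ^ (-(1 / 2) : ℝ) * Real.Gamma (1 / 2)) +
      Real.exp (1 + R) * (2 * Real.pi) + Real.exp R = B + Real.exp 1 *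
        ((Real.exp ζ.re) ^ (-(1 / 2) : ℝ) * Real.Gamma (1 / 2)) := by simp only [B]; ring
    rw [this]
    nlinarith
  linarith

/-- The jump of `U_α` around the origin. -/
theorem riemannU_sub_monodromy {b₀ : ℝ} (hb₀ : b₀ = 0 ∨ b₀ = 1 / 2) (N : ℕ) (r : ℝ) :
    riemannU (b₀ + N) (r : ℂ) - riemannU (b₀ + N) ((r : ℂ) + 2 * Complex.I * (Real.pi : ℂ)) =
      ((√Real.pi : ℝ) : ℂ)⁻¹ * (2 * Real.pi * Complex.I *
        Complex.exp (-(Real.pi * ((b₀ + N : ℝ) : ℂ) * Complex.I))) *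
        (((Real.exp r) ^ (-(b₀ + N)) * boldF (-(b₀ + N)) (Real.exp r) : ℝ) : ℂ) := by
  set α : ℝ := b₀ + N with hα
  set z := Real.exp r with hz
  have hz0 : 0 < z := Real.exp_pos r
  have hre : ((r : ℂ) + 2 * Complex.I * (Real.pi : ℂ)).re = r := by simp
  have him : ((r : ℂ) + 2 * Complex.I * (Real.pi : ℂ)).im = 2 * Real.pi := by simp
  have hexp : Complex.exp ((r : ℂ) + 2 * Complex.I * (Real.pi : ℂ)) = Complex.exp r := by
    have : (r : ℂ) + 2 * Complex.I * (Real.pi : ℂ) = r + 2 * Real.pi * Complex.I := by ring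
    rw [this, Complex.exp_add, Complex.exp_two_pi_mul_I, mul_one]
  have htail : tailInt α ((r : ℂ) + 2 * Complex.I * (Real.pi : ℂ)) = tailInt α r := by
    simp only [tailInt, hexp]
  have harc0 : arcInt α r = 0 := by simp [arcInt]
  set E := Complex.exp (-(2 * Real.pi * α * Complex.I)) with hE
  have hray0 : rayInt α r = ∫ s in (0 : ℝ)..1, Complex.exp (-s : ℂ) *
      ((Real.exp (-(z / s)) * s ^ (-α - 1) : ℝ) : ℂ) := by
    rw [rayInt]
    congr 1; ext s
    rw [exp_ray_eq]
    simp [mul_assoc, hz]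
  -- After a full turn the ray is the same set of points; only t^{-α} has picked up the factor E.
  have hray1 : rayInt α ((r : ℂ) + 2 * Complex.I * (Real.pi : ℂ)) = E * rayInt α r := by
    rw [hray0, rayInt, hre, him, ← intervalIntegral.integral_const_mul]
    congr 1; ext s
    rw [exp_ray_eq]
    have : Complex.exp (Complex.I * ((2 * Real.pi : ℝ) : ℂ)) = 1 := by
      rw [mul_comm]; push_cast; exact Complex.exp_two_pi_mul_I
    rw [this, mul_one, hE]
    have h2 : -(Complex.I * (α : ℂ) * ((2 * Real.pi : ℝ) : ℂ)) = -(2 * Real.pi * α * Complex.I) := by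
      push_cast; ring
    rw [h2, ← hz]; push_cast; ring
  have harc1 : arcInt α ((r : ℂ) + 2 * Complex.I * (Real.pi : ℂ)) =
      -(Complex.I * ∫ θ in (0 : ℝ)..2 * Real.pi, Complex.exp (-Complex.exp (Complex.I * θ)) *
        Complex.exp (-(z * Complex.exp (-(Complex.I * θ))) - Complex.I * α * θ)) := by
    rw [arcInt, him, intervalIntegral.integral_symm, ← intervalIntegral.integral_const_mul]
    congr 2; ext θ
    have : Complex.exp ((r : ℂ) + 2 * Complex.I * (Real.pi : ℂ) - Complex.I * θ) =
        z * Complex.exp (-(Complex.I * θ)) := by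
      rw [sub_eq_add_neg, Complex.exp_add, hexp, hz, Complex.ofReal_exp]
    rw [this, mul_comm _ Complex.I, ← Complex.exp_add, ← Complex.exp_add]
    congr 2; ring
  -- expansion
  have hS1 := (hasSum_intervalIntegral_exp_mul (a := 0) (b := 1) (B := 1)
    (w := fun s : ℝ => (-s : ℂ)) (by fun_prop) (fun s hs => by
      rw [Set.uIoc_of_le zero_le_one] at hs
      rw [norm_neg, Complex.norm_real, Real.norm_of_nonneg hs.1.le]; exact hs.2)
    (intervalIntegrable_exp_neg_div_mul_rpow α hz0)).mul_left (1 - E)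
  have hS2 := (hasSum_intervalIntegral_exp_mul (a := 0) (b := 2 * Real.pi) (B := 1)
    (w := fun θ : ℝ => -Complex.exp (Complex.I * θ)) (g := fun θ : ℝ =>
      Complex.exp (-(z * Complex.exp (-(Complex.I * θ))) - Complex.I * α * θ)) (by fun_prop)
    (fun θ _ => by rw [norm_neg, norm_exp_I_mul_ofReal])
    (Continuous.intervalIntegrable (by fun_prop) _ _)).mul_left Complex.I
  -- Expanding e^{-t}, the k-th term multiplies the integrand by t^k, which lowers the Hankel index
  -- to α - k and leaves E unchanged.
  have hS := (hS1.add hS2).congr_fun (g := fun k : ℕ => (-1) ^ k / (k.factorial : ℂ) *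
      hankelInt (α - k) z) fun k => by
    have hper : Complex.exp (-(2 * Real.pi * ((α - k : ℝ) : ℂ) * Complex.I)) = E := by
      have : -(2 * Real.pi * ((α - k : ℝ) : ℂ) * Complex.I) = -(2 * Real.pi * α * Complex.I) +
        (k : ℂ) * (2 * Real.pi * Complex.I) := by push_cast; ring
      rw [this, Complex.exp_add, Complex.exp_nat_mul_two_pi_mul_I, mul_one]
    have i1 : ∫ s in (0 : ℝ)..1, (-s : ℂ) ^ k / (k.factorial : ℂ) *
        ((Real.exp (-(z / s)) * s ^ (-α - 1) : ℝ) : ℂ) = (-1) ^ k / (k.factorial : ℂ) *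
        ∫ s in (0 : ℝ)..1, ((Real.exp (-(z / s)) * s ^ (-(α - k) - 1) : ℝ) : ℂ) := by
      rw [← intervalIntegral.integral_const_mul, intervalIntegral.integral_of_le zero_le_one,
        intervalIntegral.integral_of_le zero_le_one]
      refine setIntegral_congr_fun measurableSet_Ioc fun s hs => ?_
      have : s ^ (-(α - k) - 1) = s ^ k * s ^ (-α - 1) := by
        rw [← Real.rpow_natCast, ← Real.rpow_add hs.1]; congr 1; ring
      simp only [this]
      rw [neg_pow]; push_cast; ring
    have i2 : ∫ θ in (0 : ℝ)..2 * Real.pi, (-Complex.exp (Complex.I * θ)) ^ k / (k.factorial : ℂ) *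
        Complex.exp (-(z * Complex.exp (-(Complex.I * θ))) - Complex.I * α * θ) =
        (-1) ^ k / (k.factorial : ℂ) * ∫ θ in (0 : ℝ)..2 * Real.pi,
        Complex.exp (-(z * Complex.exp (-(Complex.I * θ))) - Complex.I * ((α - k : ℝ) : ℂ) * θ) := by
      rw [← intervalIntegral.integral_const_mul]
      congr 1; ext θ
      have : -(z * Complex.exp (-(Complex.I * θ))) - Complex.I * ((α - k : ℝ) : ℂ) * θ =
        (-(z * Complex.exp (-(Complex.I * θ))) - Complex.I * α * θ) + (k : ℂ) * (Complex.I * θ) := by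
        push_cast; ring
      rw [this, Complex.exp_add, Complex.exp_nat_mul, neg_pow]
      ring
    rw [i1, i2, hankelInt, hper]; ring
  have hD : riemannU α (r : ℂ) - riemannU α ((r : ℂ) + 2 * Complex.I * (Real.pi : ℂ)) =
      ((√Real.pi : ℝ) : ℂ)⁻¹ * ∑' k : ℕ, (-1) ^ k / (k.factorial : ℂ) * hankelInt (α - k) z := by
    rw [hS.tsum_eq, riemannU_eq, riemannU_eq, htail, harc0, harc1, hray1, hray0]; ring
  have hterm : ∀ k : ℕ, (-1) ^ k / (k.factorial : ℂ) * hankelInt (α - k) z =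
      (2 * Real.pi * Complex.I * Complex.exp (-(Real.pi * (α : ℂ) * Complex.I)) *
        ((z ^ (-α) : ℝ) : ℂ)) *
      ((z ^ k / (Real.Gamma (-α + 1 + k) * (k.factorial : ℝ)) : ℝ) : ℂ) := by
    intro k
    -- All indices stay in b₀ + ℤ, where Hankel's formula is known.
    have e0 : α - k = b₀ + ((N - k : ℤ) : ℝ) := by rw [hα]; push_cast; ring
    have h1 : Complex.exp (-(Real.pi * ((α - k : ℝ) : ℂ) * Complex.I)) =
        Complex.exp (-(Real.pi * α * Complex.I)) * (-1) ^ k := by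
      have : -(Real.pi * ((α - k : ℝ) : ℂ) * Complex.I) = -(Real.pi * α * Complex.I) +
        (k : ℂ) * (Real.pi * Complex.I) := by push_cast; ring
      rw [this, Complex.exp_add, Complex.exp_nat_mul, Complex.exp_pi_mul_I]
    have h2 : z ^ (-(α - k)) = z ^ (-α) * z ^ k := by
      rw [← Real.rpow_natCast, ← Real.rpow_add hz0]; congr 1; ring
    have h3 : (1 : ℝ) - (α - k) = -α + 1 + k := by ring
    have h4 : ((-1 : ℂ) ^ k) * (-1) ^ k = 1 := by rw [← mul_pow]; simp
    rw [e0, hankelInt_eq hb₀ hz0, ← e0, hankelVal, h1, h2, h3]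
    push_cast
    rw [div_eq_mul_inv, div_eq_mul_inv, mul_inv]
    linear_combination (2 * Real.pi * Complex.I * Complex.exp (-(Real.pi * α * Complex.I)) *
      ((z ^ (-α) : ℝ) : ℂ) * (z : ℂ) ^ k * ((Real.Gamma (-α + 1 + k) : ℝ) : ℂ)⁻¹ *
      (k.factorial : ℂ)⁻¹) * h4
  rw [hD, tsum_congr hterm, tsum_mul_left, ← Complex.ofReal_tsum, boldF]
  push_cast; ring

/-! ### Gaussian and spherical moments of a linear form. -/

section Moments

variable {E : Type*} [NormedAddCommGroup E] [InnerProductSpace ℝ E] [MeasurableSpace E]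
  [BorelSpace E] [FiniteDimensional ℝ E]

theorem integrable_inner_pow_mul_gaussian [Nontrivial E] (p : E) (k : ℕ) :
    Integrable (fun y : E => inner ℝ p y ^ k * Real.exp (-‖y‖ ^ 2)) := by
  have h : Integrable (fun y : E => ‖y‖ ^ k * Real.exp (-‖y‖ ^ 2)) := by
    rw [integrable_fun_norm_addHaar (volume : Measure E)
      (f := fun r : ℝ => r ^ k * Real.exp (-r ^ 2))]
    refine (integrableOn_rpow_mul_exp_neg_mul_sq (b := 1) one_pos
      (s := ((Module.finrank ℝ E - 1 + k : ℕ) : ℝ))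
      (by have : (0 : ℝ) ≤ ((Module.finrank ℝ E - 1 + k : ℕ) : ℝ) := Nat.cast_nonneg _
          linarith)).congr_fun ?_ measurableSet_Ioi
    intro r _
    simp only [Real.rpow_natCast, pow_add, smul_eq_mul, neg_mul, one_mul]
    ring
  refine (h.const_mul (‖p‖ ^ k)).mono' (by fun_prop) (.of_forall fun y => ?_)
  rw [norm_mul, Real.norm_of_nonneg (Real.exp_pos _).le, ← mul_assoc, ← mul_pow, norm_pow]
  have := norm_inner_le_norm (𝕜 := ℝ) p y
  gcongr

/-- The Gaussian moments. -/
theorem integral_inner_pow_mul_gaussian [Nontrivial E] (p : E) (k : ℕ) :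
    ∫ y : E, inner ℝ p y ^ (2 * k) * Real.exp (-‖y‖ ^ 2) =
      (‖p‖ ^ 2) ^ k * ((2 * k).factorial / (4 ^ k * k.factorial)) *
        Real.pi ^ (Module.finrank ℝ E / 2 : ℝ) := by
  induction k with
  | zero => simpa using GaussianFourier.integral_rexp_neg_mul_sq_norm (V := E) one_pos
  | succ k ih =>
    have hf : ∀ y : E, HasFDerivAt (fun y : E => inner ℝ p y ^ (2 * k + 1))
        (((2 * k + 1 : ℕ) * inner ℝ p y ^ (2 * k)) • innerSL ℝ p) y := by
      intro y
      simpa using ((innerSL ℝ p).hasFDerivAt (x := y)).pow (2 * k + 1)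
    have hg : ∀ y : E, HasFDerivAt (fun y : E => Real.exp (-‖y‖ ^ 2))
        (Real.exp (-‖y‖ ^ 2) • -((2 : ℝ) • innerSL ℝ y : E →L[ℝ] ℝ)) y := by
      intro y
      have := (hasStrictFDerivAt_norm_sq y).hasFDerivAt.neg.exp
      convert! this using 3
      ext; simp [two_smul]
    -- Integration by parts in the direction p: the Gaussian has derivative -2⟨p, y⟩e^{-|y|²}, so
    -- twice the next even moment is (2k + 1)|p|² times the present one.
    have h := integral_mul_fderiv_eq_neg_fderiv_mul_of_integrable (μ := (volume : Measure E))
      (f := fun y : E => inner ℝ p y ^ (2 * k + 1)) (g := fun y : E => Real.exp (-‖y‖ ^ 2))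
      (v := p) ?_ ?_ (integrable_inner_pow_mul_gaussian p _)
      (fun y _ => (hf y).differentiableAt) (fun y _ => (hg y).differentiableAt)
    · simp only [(hf _).fderiv, (hg _).fderiv] at h
      have e1 : ∀ y : E, inner ℝ p y ^ (2 * k + 1) * ((Real.exp (-‖y‖ ^ 2) • -((2 : ℝ) • innerSL ℝ y : E →L[ℝ] ℝ)) p) =
          -2 * (inner ℝ p y ^ (2 * (k + 1)) * Real.exp (-‖y‖ ^ 2)) := by
        intro y
        simp [real_inner_comm y p]; ring
      have e2 : ∀ y : E, ((((2 * k + 1 : ℕ) * inner ℝ p y ^ (2 * k)) • innerSL ℝ p : E →L[ℝ] ℝ) p) *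
          Real.exp (-‖y‖ ^ 2) = ((2 * k + 1) * ‖p‖ ^ 2) *
            (inner ℝ p y ^ (2 * k) * Real.exp (-‖y‖ ^ 2)) := by
        intro y
        simp; ring
      simp only [e1, e2, integral_const_mul, ih] at h
      have h3 : ∫ y : E, inner ℝ p y ^ (2 * (k + 1)) * Real.exp (-‖y‖ ^ 2) =
        1 / 2 * ((2 * k + 1) * ‖p‖ ^ 2 * ((‖p‖ ^ 2) ^ k * ((2 * k).factorial / (4 ^ k * k.factorial)) *
        Real.pi ^ (Module.finrank ℝ E / 2 : ℝ))) := by linarith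
      rw [h3]
      have : ((2 * (k + 1)).factorial : ℝ) = (2 * k + 2) * ((2 * k + 1) * (2 * k).factorial) := by
        rw [show 2 * (k + 1) = 2 * k + 1 + 1 by ring, Nat.factorial_succ, Nat.factorial_succ]
        push_cast; ring
      rw [this, Nat.factorial_succ k]
      push_cast
      field_simp
      ring
    · simp only [(hf _).fderiv]
      refine ((integrable_inner_pow_mul_gaussian p (2 * k)).const_mul
        ((2 * k + 1) * ‖p‖ ^ 2)).congr (.of_forall fun y => ?_)
      simp; ring
    · simp only [(hg _).fderiv]
      refine ((integrable_inner_pow_mul_gaussian p (2 * k + 2)).const_mul (-2)).congr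
        (.of_forall fun y => ?_)
      simp [real_inner_comm y p]; ring

theorem integral_norm_mul_inner_pow [Nontrivial E] (p : E) (k : ℕ) {f : ℝ → ℝ}
    (hf : Integrable (fun y : E => f ‖y‖ * inner ℝ p y ^ k)) :
    ∫ y : E, f ‖y‖ * inner ℝ p y ^ k =
      (∫ r in Set.Ioi (0 : ℝ), r ^ (Module.finrank ℝ E - 1 + k) * f r) *
        ∫ ω : Metric.sphere (0 : E) 1, inner ℝ p ω.1 ^ k ∂(volume : Measure E).toSphere := by
  rw [integral_polar _ hf, ← integral_const_mul]
  congr 1; ext ω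
  rw [← integral_mul_const]
  refine setIntegral_congr_fun measurableSet_Ioi fun r hr => ?_
  have hr' : (0 : ℝ) < r := hr
  simp only [norm_smul, inner_smul_right, mul_pow, smul_eq_mul, pow_add]
  rw [norm_eq_of_mem_sphere ω, mul_one, Real.norm_of_nonneg hr'.le]
  ring

/-- Apply the polar factorization to the Gaussian weight: the full moment and the radial integral
are both known, and their quotient is the spherical moment. -/
theorem integral_sphere_inner_pow [Nontrivial E] (p : E) (k : ℕ) :
    ∫ ω : Metric.sphere (0 : E) 1, inner ℝ p ω.1 ^ (2 * k) ∂(volume : Measure E).toSphere =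
      2 * ((‖p‖ ^ 2) ^ k * ((2 * k).factorial / (4 ^ k * k.factorial)) *
        Real.pi ^ (Module.finrank ℝ E / 2 : ℝ)) / Real.Gamma (Module.finrank ℝ E / 2 + k) := by
  have hn : 0 < Module.finrank ℝ E := Module.finrank_pos
  have hi : Integrable (fun y : E => Real.exp (-‖y‖ ^ 2) * inner ℝ p y ^ (2 * k)) := by
    simpa only [mul_comm] using integrable_inner_pow_mul_gaussian p (2 * k)
  have h := integral_norm_mul_inner_pow p (2 * k) (f := fun r => Real.exp (-r ^ 2)) hi
  have hr : ∫ r in Set.Ioi (0 : ℝ), r ^ (Module.finrank ℝ E - 1 + 2 * k) * Real.exp (-r ^ 2) =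
      1 / 2 * Real.Gamma (Module.finrank ℝ E / 2 + k) := by
    have h2 := integral_rpow_mul_exp_neg_rpow (p := 2)
      (q := ((Module.finrank ℝ E - 1 + 2 * k : ℕ) : ℝ)) two_pos
      (by have : (0 : ℝ) ≤ ((Module.finrank ℝ E - 1 + 2 * k : ℕ) : ℝ) := Nat.cast_nonneg _
          linarith)
    simp only [Real.rpow_natCast] at h2
    have e : (((Module.finrank ℝ E - 1 + 2 * k : ℕ) : ℝ) + 1) / 2 = Module.finrank ℝ E / 2 + k := by
      push_cast [Nat.cast_sub hn]; ring
    rw [e] at h2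
    rw [← h2]
    norm_cast
  rw [hr] at h
  have h1 : ∫ y : E, Real.exp (-‖y‖ ^ 2) * inner ℝ p y ^ (2 * k) =
      ∫ y : E, inner ℝ p y ^ (2 * k) * Real.exp (-‖y‖ ^ 2) := by simp only [mul_comm]
  rw [h1, integral_inner_pow_mul_gaussian] at h
  have hG : 0 < Real.Gamma ((Module.finrank ℝ E : ℝ) / 2 + k) := Real.Gamma_pos_of_pos (by positivity)
  rw [eq_div_iff hG.ne', h]
  ring

/-- Reflection y ↦ -y. If the integrand is not integrable the value is 0 by convention, so no
integrability is needed. -/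
theorem integral_norm_mul_inner_pow_odd (p : E) (k : ℕ) (f : ℝ → ℝ) :
    ∫ y : E, f ‖y‖ * inner ℝ p y ^ (2 * k + 1) = 0 := by
  have h := integral_neg_eq_self (fun y : E => f ‖y‖ * inner ℝ p y ^ (2 * k + 1)) volume
  simp only [norm_neg, inner_neg_right, Odd.neg_pow (⟨k, rfl⟩ : Odd (2 * k + 1)), mul_neg,
    integral_neg] at h
  linarith

end Moments

/-! ### Beta integrals, normalized powers of w_- and the cone kernel. -/

theorem integral_beta_radial {a b t : ℝ} (ha : 0 < a) (hb : 0 < b) (ht : 0 < t) :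
    ∫ r in Set.Ioi (0 : ℝ), r ^ (2 * a - 1) * (if r < t then (t ^ 2 - r ^ 2) ^ (b - 1) else 0) =
      1 / 2 * t ^ (2 * (a + b - 1)) * (Real.Gamma a * Real.Gamma b / Real.Gamma (a + b)) := by
  have h := integral_comp_rpow_Ioi_of_pos (p := 2) two_pos
    (g := fun x : ℝ => 1 / 2 * (x ^ (a - 1) * (if x < t ^ 2 then (t ^ 2 - x) ^ (b - 1) else 0)))
  have e1 : ∫ r in Set.Ioi (0 : ℝ), r ^ (2 * a - 1) *
      (if r < t then (t ^ 2 - r ^ 2) ^ (b - 1) else 0) =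
      ∫ x in Set.Ioi (0 : ℝ), (2 * x ^ ((2 : ℝ) - 1)) • (1 / 2 * ((x ^ (2 : ℝ)) ^ (a - 1) *
        (if x ^ (2 : ℝ) < t ^ 2 then (t ^ 2 - x ^ (2 : ℝ)) ^ (b - 1) else 0))) := by
    refine setIntegral_congr_fun measurableSet_Ioi fun r hr => ?_
    have hr' : (0 : ℝ) < r := hr
    have hiff : r ^ (2 : ℝ) < t ^ 2 ↔ r < t := by
      rw [Real.rpow_two, sq_lt_sq₀ hr'.le ht.le]
    have : r ^ (2 * a - 1) = r ^ ((2 : ℝ) - 1) * (r ^ (2 : ℝ)) ^ (a - 1) := by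
      rw [← Real.rpow_mul hr'.le, ← Real.rpow_add hr']; congr 1; ring
    simp only [hiff, this, smul_eq_mul]
    simp only [Real.rpow_two]
    ring
  rw [e1, h, integral_const_mul, mul_assoc]
  congr 1
  have e2 : ∫ x in Set.Ioi (0 : ℝ), x ^ (a - 1) *
      (if x < t ^ 2 then (t ^ 2 - x) ^ (b - 1) else 0) =
      ∫ x in (0 : ℝ)..t ^ 2, x ^ (a - 1) * (t ^ 2 - x) ^ (b - 1) := by
    rw [intervalIntegral.integral_of_le (by positivity), integral_Ioc_eq_integral_Ioo,
      ← integral_indicator measurableSet_Ioi, ← integral_indicator measurableSet_Ioo]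
    congr 1; ext x
    simp only [Set.indicator, Set.mem_Ioi, Set.mem_Ioo]
    split_ifs <;> simp_all
  rw [e2]
  have h3 := Complex.betaIntegral_scaled (a : ℂ) (b : ℂ) (a := t ^ 2) (by positivity)
  rw [Complex.betaIntegral_eq_Gamma_mul_div _ _ (by simpa) (by simpa)] at h3
  have e3 : ∫ x in (0 : ℝ)..t ^ 2, (x : ℂ) ^ ((a : ℂ) - 1) * (((t ^ 2 : ℝ) : ℂ) - x) ^ ((b : ℂ) - 1) =
      ((∫ x in (0 : ℝ)..t ^ 2, x ^ (a - 1) * (t ^ 2 - x) ^ (b - 1) : ℝ) : ℂ) := by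
    rw [← intervalIntegral.integral_ofReal]
    refine intervalIntegral.integral_congr fun x hx => ?_
    rw [Set.uIcc_of_le (by positivity)] at hx
    simp only [Complex.ofReal_mul, Complex.ofReal_cpow hx.1,
      Complex.ofReal_cpow (sub_nonneg.2 hx.2)]
    push_cast; rfl
  rw [e3] at h3
  have e4 : ((t ^ 2 : ℝ) : ℂ) ^ ((a : ℂ) + b - 1) = ((t ^ (2 * (a + b - 1)) : ℝ) : ℂ) := by
    rw [Real.rpow_mul ht.le, Real.rpow_two, Complex.ofReal_cpow (by positivity)]
    push_cast; rfl
  rw [e4, ← Complex.ofReal_add, Complex.Gamma_ofReal, Complex.Gamma_ofReal, Complex.Gamma_ofReal] at h3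
  exact_mod_cast h3

/-- The function `w_-^l / Γ(l + 1)`. -/
def primPow (l w : ℝ) : ℝ := if w < 0 then (-w) ^ l / Real.Gamma (l + 1) else 0

/-- The function `θ(-w) (-w/4)^{-a} 𝐅_{-a}(- c w / 4)`. -/
def coneKernel (a : ℝ) (c : ℂ) (w : ℝ) : ℂ :=
  ∑' j : ℕ, c ^ j / (j.factorial : ℂ) * (primPow (j - a) (w / 4) : ℂ)

theorem primPow_of_nonneg (l : ℝ) {w : ℝ} (hw : 0 ≤ w) : primPow l w = 0 := if_neg hw.not_gt

theorem measurable_primPow (l : ℝ) : Measurable (primPow l) :=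
  Measurable.ite measurableSet_Iio (by fun_prop) measurable_const

/-- A crude lower bound, uniform in j, with which the kernel series is dominated by an exponential
series. For a = 1/2 the values are √π, then √π/2, and from there on each factor of the functional
equation is at least 1. -/
theorem half_le_Gamma {a : ℝ} (ha : a = 0 ∨ a = 1 / 2) (j : ℕ) :
    1 / 2 ≤ Real.Gamma (j - a + 1) := by
  rcases ha with rfl | rfl
  · rw [sub_zero, Real.Gamma_nat_eq_factorial]
    have : (1 : ℝ) ≤ j.factorial := by exact_mod_cast j.factorial_pos
    linarith
  · have h0 : Real.Gamma ((0 : ℕ) - 1 / 2 + 1) = √Real.pi := by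
      rw [← Real.Gamma_one_half_eq]; norm_num
    have hpi : 1 ≤ √Real.pi := by rw [Real.one_le_sqrt]; linarith [Real.pi_gt_three]
    have h1 : ∀ j : ℕ, 1 / 2 ≤ Real.Gamma ((j + 1 : ℕ) - 1 / 2 + 1) := by
      intro j
      induction j with
      | zero =>
        rw [Real.Gamma_add_one (by norm_num)]
        have : ((0 + 1 : ℕ) : ℝ) - 1 / 2 = (0 : ℕ) - 1 / 2 + 1 := by push_cast; ring
        rw [this, h0]; push_cast; nlinarith
      | succ j ih =>
        have h : (0 : ℝ) ≤ j := Nat.cast_nonneg _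
        rw [Real.Gamma_add_one (by push_cast; linarith)]
        have : ((j + 1 + 1 : ℕ) : ℝ) - 1 / 2 = (j + 1 : ℕ) - 1 / 2 + 1 := by push_cast; ring
        rw [this]
        refine ih.trans (le_mul_of_one_le_left (by linarith) (by push_cast; linarith))
    rcases j with _ | j
    · rw [h0]; linarith
    · exact h1 j

theorem Gamma_pos_aux {a : ℝ} (ha : a = 0 ∨ a = 1 / 2) (j : ℕ) : 0 < Real.Gamma (j - a + 1) :=
  lt_of_lt_of_le (by norm_num) (half_le_Gamma ha j)

/-- Every term is compared with the leading one, so that all estimates on the series reduce to the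
single power (-w)^{-a}. -/
theorem abs_primPow_le {a : ℝ} (ha : a = 0 ∨ a = 1 / 2) (j : ℕ) (w : ℝ) :
    |primPow (j - a) w| ≤ |w| ^ j * |primPow (-a) w| * (2 * Real.Gamma (1 - a)) := by
  rcases le_or_gt 0 w with hw | hw
  · simp [primPow_of_nonneg _ hw]
  · have hw' : 0 < -w := by linarith
    have hG := half_le_Gamma ha j
    have hG0 := Gamma_pos_aux ha 0
    have e : -a + 1 = 1 - a := by ring
    have hG0' : 0 < Real.Gamma (1 - a) := by convert! hG0 using 2; simp; ring
    rw [primPow, primPow, if_pos hw, if_pos hw, abs_of_neg hw, sub_eq_add_neg, Real.rpow_add hw',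
      Real.rpow_natCast, e, abs_of_nonneg, abs_of_nonneg (by positivity), div_eq_mul_inv]
    · rw [sub_eq_add_neg] at hG
      have hi : (Real.Gamma (j + -a + 1))⁻¹ ≤ 2 := by
        rw [inv_le_comm₀ (by linarith) two_pos]; linarith
      calc _ ≤ (-w) ^ j * (-w) ^ (-a) * 2 := by gcongr
        _ = _ := by field_simp
    · rw [sub_eq_add_neg] at hG
      have : 0 < Real.Gamma (j + -a + 1) := by linarith
      positivity

theorem coneKernel_term_le {a : ℝ} (ha : a = 0 ∨ a = 1 / 2) (c : ℂ) (j : ℕ) (w : ℝ) :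
    ‖c ^ j / (j.factorial : ℂ) * (primPow (j - a) (w / 4) : ℂ)‖ ≤
      (‖c‖ * |w / 4|) ^ j / j.factorial * (|primPow (-a) (w / 4)| * (2 * Real.Gamma (1 - a))) := by
  rw [norm_mul, norm_div, norm_pow, Complex.norm_natCast, Complex.norm_real, Real.norm_eq_abs,
    mul_pow]
  calc _ ≤ ‖c‖ ^ j / j.factorial * (|w / 4| ^ j * |primPow (-a) (w / 4)| *
        (2 * Real.Gamma (1 - a))) := by gcongr; exact abs_primPow_le ha j _
    _ = _ := by ring

theorem summable_norm_coneKernel {a : ℝ} (ha : a = 0 ∨ a = 1 / 2) (c : ℂ) (w : ℝ) :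
    Summable (fun j : ℕ => ‖c ^ j / (j.factorial : ℂ) * (primPow (j - a) (w / 4) : ℂ)‖) :=
  .of_nonneg_of_le (fun _ => norm_nonneg _) (fun j => coneKernel_term_le ha c j w)
    ((Real.summable_pow_div_factorial _).mul_right _)

theorem hasSum_coneKernel {a : ℝ} (ha : a = 0 ∨ a = 1 / 2) (c : ℂ) (w : ℝ) :
    HasSum (fun j : ℕ => c ^ j / (j.factorial : ℂ) * (primPow (j - a) (w / 4) : ℂ))
      (coneKernel a c w) := (summable_norm_coneKernel ha c w).of_norm.hasSum

theorem coneKernel_of_nonneg (a : ℝ) (c : ℂ) {w : ℝ} (hw : 0 ≤ w) : coneKernel a c w = 0 := by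
  have : ∀ j : ℕ, primPow (j - a) (w / 4) = 0 := fun j => primPow_of_nonneg _ (by positivity)
  simp [coneKernel, this]

theorem norm_coneKernel_le {a : ℝ} (ha : a = 0 ∨ a = 1 / 2) (c : ℂ) (w : ℝ) :
    ‖coneKernel a c w‖ ≤
      Real.exp (‖c‖ * |w / 4|) * (|primPow (-a) (w / 4)| * (2 * Real.Gamma (1 - a))) := by
  have h := (NormedSpace.expSeries_div_hasSum_exp (‖c‖ * |w / 4|))
  rw [← Real.exp_eq_exp_ℝ] at h
  exact tsum_of_norm_bounded (h.mul_right _) fun j => coneKernel_term_le ha c j w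

theorem measurable_coneKernel {a : ℝ} (ha : a = 0 ∨ a = 1 / 2) (c : ℂ) :
    Measurable (coneKernel a c) := by
  refine measurable_of_tendsto_metrizable (f := fun n w => ∑ j ∈ Finset.range n,
    c ^ j / (j.factorial : ℂ) * (primPow (j - a) (w / 4) : ℂ)) (fun n => ?_)
    (tendsto_pi_nhds.2 fun w => (hasSum_coneKernel ha c w).tendsto_sum_nat)
  have := fun j : ℕ => measurable_primPow (j - a)
  fun_prop

/-- The place where a ≤ 1/2 is used: the leading power is no worse than the standard majorant. -/
theorem abs_primPow_neg_le {a : ℝ} (ha : a = 0 ∨ a = 1 / 2) (R : ℝ) : ∃ C : ℝ, 0 ≤ C ∧ ∀ w : ℝ,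
    |w| ≤ R → w ≠ 0 → |primPow (-a) (w / 4)| ≤ C * |w| ^ (-(1 / 2) : ℝ) := by
  rcases ha with rfl | rfl
  · refine ⟨|R| ^ (1 / 2 : ℝ), by positivity, fun w hw h0 => ?_⟩
    refine le_trans ?_ (one_le_mul_abs_rpow (hw.trans (le_abs_self R)) h0)
    rw [primPow]; split_ifs <;> simp
  · refine ⟨4 ^ (1 / 2 : ℝ), by positivity, fun w hw h0 => ?_⟩
    rcases le_or_gt 0 w with hw' | hw'
    · rw [primPow_of_nonneg _ (by positivity)]; simp; positivity
    · have hG : Real.Gamma (-(1 / 2) + 1) = √Real.pi := by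
        rw [← Real.Gamma_one_half_eq]; norm_num
      have hpi : 1 ≤ √Real.pi := by rw [Real.one_le_sqrt]; linarith [Real.pi_gt_three]
      have e : -(w / 4) = |w| / 4 := by rw [abs_of_neg hw']; ring
      rw [primPow, if_pos (by linarith), hG, e, abs_of_nonneg (by positivity)]
      refine (div_le_self (by positivity) hpi).trans (le_of_eq ?_)
      rw [Real.div_rpow (abs_nonneg _) (by norm_num), Real.rpow_neg (by norm_num : (0 : ℝ) ≤ 4), div_inv_eq_mul,
        mul_comm]

theorem admissible_coneKernel {a : ℝ} (ha : a = 0 ∨ a = 1 / 2) (c : ℂ) :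
    Admissible (coneKernel a c) := by
  refine ⟨measurable_coneKernel ha c, fun R => ?_⟩
  obtain ⟨C, hC0, hC⟩ := abs_primPow_neg_le ha R
  have hG : 0 < Real.Gamma (1 - a) := Real.Gamma_pos_of_pos (by rcases ha with rfl | rfl <;> norm_num)
  refine ⟨Real.exp (‖c‖ * (R / 4)) * (C * (2 * Real.Gamma (1 - a))), fun w hw h0 => ?_⟩
  refine (norm_coneKernel_le ha c w).trans ?_
  have h1 : |w / 4| ≤ R / 4 := by rw [abs_div, abs_of_pos (by norm_num : (0 : ℝ) < 4)]; gcongr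
  calc _ ≤ Real.exp (‖c‖ * (R / 4)) * ((C * |w| ^ (-(1 / 2) : ℝ)) * (2 * Real.Gamma (1 - a))) := by
        gcongr; exact hC w hw h0
    _ = _ := by ring

/-- The half-integer case of the duplication formula. It converts the Gamma factor of the Beta
integral into the (2n + 1)! of the sine series. -/
theorem Gamma_nat_add_three_halves (m : ℕ) :
    Real.Gamma (m + 3 / 2) = √Real.pi * (2 * m + 1).factorial / (2 * 4 ^ m * m.factorial) := by
  induction m with
  | zero =>
    rw [show ((0 : ℕ) : ℝ) + 3 / 2 = 1 / 2 + 1 by norm_num, Real.Gamma_add_one (by norm_num),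
      Real.Gamma_one_half_eq]
    norm_num; ring
  | succ m ih =>
    rw [show ((m + 1 : ℕ) : ℝ) + 3 / 2 = (m + 3 / 2) + 1 by push_cast; ring,
      Real.Gamma_add_one (by positivity), ih, show 2 * (m + 1) + 1 = 2 * m + 1 + 1 + 1 by ring,
      Nat.factorial_succ (2 * m + 1 + 1), Nat.factorial_succ (2 * m + 1), Nat.factorial_succ m]
    push_cast
    field_simp
    ring

/-! ### The spatial Fourier transform of the kernel at fixed time. -/

section PlaneWave

variable {E : Type*} [NormedAddCommGroup E] [InnerProductSpace ℝ E] [MeasurableSpace E]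
  [BorelSpace E] [FiniteDimensional ℝ E]

/-- The factor 1/Γ(j - a + 1) in the normalized power cancels one Gamma factor of the Beta integral.
What remains depends on j and k almost only through j + k, which makes the later resummation
possible. -/
theorem radial_primPow {a t : ℝ} (ha : a = 0 ∨ a = 1 / 2) (ht : 0 < t) (j k : ℕ) (q : ℕ)
    (hq : (q : ℝ) = 2 * a + 2 * k) :
    ∫ r in Set.Ioi (0 : ℝ), r ^ q * primPow (j - a) ((r ^ 2 - t ^ 2) / 4) =
      4 ^ a / (4 ^ j) * (1 / 2 * t ^ (2 * (j + k) + 1) *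
        (Real.Gamma (a + 1 / 2 + k) / Real.Gamma ((j + k : ℕ) + 3 / 2))) := by
  have ha' : a < 1 ∧ 0 ≤ a := by rcases ha with rfl | rfl <;> norm_num
  have hk : (0 : ℝ) ≤ k := Nat.cast_nonneg _
  have hj : (0 : ℝ) ≤ j := Nat.cast_nonneg _
  have h := integral_beta_radial (a := a + 1 / 2 + k) (b := j - a + 1) (by linarith)
    (by linarith) ht
  have hG := Gamma_pos_aux ha j
  have e1 : ∫ r in Set.Ioi (0 : ℝ), r ^ q * primPow (j - a) ((r ^ 2 - t ^ 2) / 4) =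
      4 ^ a / 4 ^ j / Real.Gamma (j - a + 1) * ∫ r in Set.Ioi (0 : ℝ), r ^ (2 * (a + 1 / 2 + k) - 1) *
        (if r < t then (t ^ 2 - r ^ 2) ^ (j - a + 1 - 1) else 0) := by
    rw [← integral_const_mul]
    refine setIntegral_congr_fun measurableSet_Ioi fun r hr => ?_
    have hr' : (0 : ℝ) < r := hr
    have hiff : (r ^ 2 - t ^ 2) / 4 < 0 ↔ r < t := by
      rw [← sq_lt_sq₀ hr'.le ht.le]; constructor <;> intro h <;> linarith
    have e2 : 2 * (a + 1 / 2 + k) - 1 = q := by rw [hq]; ring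
    simp only [primPow, hiff, e2, Real.rpow_natCast, add_sub_cancel_right]
    split_ifs with hlt
    · have : -((r ^ 2 - t ^ 2) / 4) = (t ^ 2 - r ^ 2) / 4 := by ring
      have hpos : 0 ≤ t ^ 2 - r ^ 2 := by nlinarith
      rw [this, Real.div_rpow hpos (by norm_num), Real.rpow_sub (by norm_num : (0 : ℝ) < 4),
        Real.rpow_natCast]
      field_simp
    · simp
  have e3 : a + 1 / 2 + k + (j - a + 1) = (j + k : ℕ) + 3 / 2 := by push_cast; ring
  have e4 : 2 * (a + 1 / 2 + k + (j - a + 1) - 1) = (2 * (j + k) + 1 : ℕ) := by push_cast; ring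
  rw [e1, h, e4, e3, Real.rpow_natCast]
  field_simp

theorem integrable_primPow_norm [Nontrivial E] {a t : ℝ} (ha : a = 0 ∨ a = 1 / 2) (ht : 0 < t)
    (N : ℕ) (hn : (Module.finrank ℝ E : ℝ) = 2 * N + 1 + 2 * a) :
    Integrable (fun y : E => |primPow (-a) ((‖y‖ ^ 2 - t ^ 2) / 4)| * (‖y‖ ^ (2 * N))⁻¹) := by
  have hn1 : 0 < Module.finrank ℝ E := Module.finrank_pos
  rw [integrable_fun_norm_addHaar (volume : Measure E)
    (f := fun r => |primPow (-a) ((r ^ 2 - t ^ 2) / 4)| * (r ^ (2 * N))⁻¹)]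
  have hn2 : 2 * N ≤ Module.finrank ℝ E - 1 := by
    have : (2 * N + 1 : ℝ) ≤ Module.finrank ℝ E := by rw [hn]; rcases ha with rfl | rfl <;> norm_num
    have : 2 * N + 1 ≤ Module.finrank ℝ E := by exact_mod_cast this
    omega
  have h := radial_primPow ha ht 0 0 (Module.finrank ℝ E - 1 - 2 * N)
    (by rw [Nat.cast_sub hn2, Nat.cast_sub hn1, hn]; push_cast; ring)
  have hpos : 0 < Real.Gamma (a + 1 / 2 + (0 : ℕ)) :=
    Real.Gamma_pos_of_pos (by rcases ha with rfl | rfl <;> norm_num)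
  have hpos' : 0 < Real.Gamma ((0 + 0 : ℕ) + 3 / 2) := Real.Gamma_pos_of_pos (by norm_num)
  -- The integral has just been computed and is nonzero, whereas the integral of a non-integrable
  -- function is 0 by convention; this gives integrability without further estimates.
  have hI := (Integrable.of_integral_ne_zero (by rw [h]; positivity)).abs
  refine IntegrableOn.congr_fun (f := fun r : ℝ => |r ^ (Module.finrank ℝ E - 1 - 2 * N) *
    primPow ((0 : ℕ) - a) ((r ^ 2 - t ^ 2) / 4)|) hI (fun r hr => ?_) measurableSet_Ioi
  have hr' : (0 : ℝ) < r := hr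
  have : r ^ (Module.finrank ℝ E - 1) = r ^ (Module.finrank ℝ E - 1 - 2 * N) * r ^ (2 * N) := by
    rw [← pow_add, Nat.sub_add_cancel hn2]
  simp only [this, smul_eq_mul, abs_mul, abs_of_pos (pow_pos hr' _), Nat.cast_zero, zero_sub]
  field_simp

/-- A double expansion, in j for the kernel and in k for f. Odd k vanish by symmetry. For even k the
spherical moment and the radial Beta integral are explicit, and the prescribed `lam` cancels their
Gamma quotient. What remains is a binomial coefficient divided by (2(j + k) + 1)!, so that the sum
over j + k = n is (c - |p|²)^n by the binomial theorem. -/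
theorem hasSum_integral_planeWave [Nontrivial E] {a t : ℝ} (ha : a = 0 ∨ a = 1 / 2) (ht : 0 < t)
    (N : ℕ) (hn : (Module.finrank ℝ E : ℝ) = 2 * N + 1 + 2 * a) (c : ℂ) (p : E) {lam : ℕ → ℝ}
    {f : ℝ → ℂ}
    (hf : ∀ ξ : ℝ, HasSum (fun k : ℕ => (lam k : ℂ) * (-(Complex.I * ξ)) ^ k / k.factorial) (f ξ))
    (hlam : ∀ k : ℕ, lam (2 * k) =
      Real.Gamma (Module.finrank ℝ E / 2 + k) / Real.Gamma (a + 1 / 2 + k)) :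
    HasSum (fun m : ℕ => (2 * 4 ^ a * Real.pi ^ (N + a) : ℝ) *
        ((c - (‖p‖ : ℂ) ^ 2) ^ m * (t : ℂ) ^ (2 * m + 1) / ((2 * m + 1).factorial : ℂ)))
      (∫ y : E, coneKernel a c (‖y‖ ^ 2 - t ^ 2) * (((‖y‖ ^ (2 * N))⁻¹ : ℝ) : ℂ) *
        f (inner ℝ p y)) := by
  have hn1 : 0 < Module.finrank ℝ E := Module.finrank_pos
  have hn2 : 2 * N ≤ Module.finrank ℝ E - 1 := by
    have : (2 * N + 1 : ℝ) ≤ Module.finrank ℝ E := by rw [hn]; rcases ha with rfl | rfl <;> norm_num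
    have : 2 * N + 1 ≤ Module.finrank ℝ E := by exact_mod_cast this
    omega
  have hGa : 0 < Real.Gamma (1 - a) :=
    Real.Gamma_pos_of_pos (by rcases ha with rfl | rfl <;> norm_num)
  set A : ℕ → ℂ := fun j => c ^ j / (j.factorial : ℂ)
  set B : ℕ → ℂ := fun k => (lam k : ℂ) * (-Complex.I) ^ k / (k.factorial : ℂ)
  set H : ℕ → ℕ → E → ℝ := fun j k y =>
    (primPow (j - a) ((‖y‖ ^ 2 - t ^ 2) / 4) * (‖y‖ ^ (2 * N))⁻¹) * inner ℝ p y ^ k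
  set g : E → ℝ := fun y => |primPow (-a) ((‖y‖ ^ 2 - t ^ 2) / 4)| * (‖y‖ ^ (2 * N))⁻¹
  have hg := integrable_primPow_norm (E := E) ha ht N hn
  have hHm : ∀ j k, Measurable (H j k) := fun j k => by
    have := measurable_primPow (j - a)
    have h2 : Measurable fun y : E => inner ℝ p y := by fun_prop
    simp only [H]
    fun_prop
  have hHle : ∀ j k y, ‖H j k y‖ ≤
      (t ^ 2 / 4) ^ j * (‖p‖ * t) ^ k * (2 * Real.Gamma (1 - a)) * g y := by
    intro j k y
    simp only [H, g]
    rcases lt_or_ge ((‖y‖ ^ 2 - t ^ 2) / 4) 0 with hlt | hge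
    · have hy : ‖y‖ ≤ t := by
        by_contra hcon
        push Not at hcon
        nlinarith [norm_nonneg y]
      rw [norm_mul, norm_mul, Real.norm_of_nonneg (by positivity : 0 ≤ (‖y‖ ^ (2 * N))⁻¹), norm_pow,
        Real.norm_eq_abs (primPow _ _)]
      have h1 := abs_primPow_le ha j ((‖y‖ ^ 2 - t ^ 2) / 4)
      have h2 : |(‖y‖ ^ 2 - t ^ 2) / 4| ≤ t ^ 2 / 4 := by
        rw [abs_of_neg hlt]; nlinarith [sq_nonneg ‖y‖]
      have h3 : ‖(inner ℝ p y : ℝ)‖ ≤ ‖p‖ * t := (norm_inner_le_norm _ _).trans (by gcongr)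
      calc _ ≤ ((t ^ 2 / 4) ^ j * |primPow (-a) ((‖y‖ ^ 2 - t ^ 2) / 4)| * (2 * Real.Gamma (1 - a))) *
            (‖y‖ ^ (2 * N))⁻¹ * (‖p‖ * t) ^ k := by
              gcongr
              exact h1.trans (by gcongr)
        _ = _ := by ring
    · rw [primPow_of_nonneg _ hge, primPow_of_nonneg _ hge]; simp
  have hHi : ∀ j k, Integrable (H j k) := fun j k =>
    (hg.const_mul _).mono' (hHm j k).aestronglyMeasurable (.of_forall (hHle j k))
  set F : ℕ × ℕ → E → ℂ := fun i y => A i.1 * B i.2 * (H i.1 i.2 y : ℂ) with hF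
  have hBs : ∀ x : ℝ, Summable fun k => ‖B k‖ * |x| ^ k := fun x => by
    refine (hf x).summable.norm.congr fun k => ?_
    simp [B, mul_right_comm, div_eq_mul_inv]
  have hAs : Summable fun j => ‖A j‖ * (t ^ 2 / 4) ^ j := by
    refine (Real.summable_pow_div_factorial (‖c‖ * (t ^ 2 / 4))).congr fun j => ?_
    simp only [A, norm_div, norm_pow, Complex.norm_natCast, mul_pow]; ring
  have hsum : Summable fun i : ℕ × ℕ => ∫ y, ‖F i y‖ := by
    have hp := (hAs.mul_of_nonneg (hBs (‖p‖ * t)) (fun _ => by positivity)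
      (fun _ => by positivity)).mul_right (2 * Real.Gamma (1 - a) * ∫ y, g y)
    refine .of_nonneg_of_le (fun _ => integral_nonneg fun _ => norm_nonneg _) (fun i => ?_) hp
    have : ∀ y, ‖F i y‖ ≤ ‖A i.1‖ * ‖B i.2‖ *
        ((t ^ 2 / 4) ^ i.1 * (‖p‖ * t) ^ i.2 * (2 * Real.Gamma (1 - a)) * g y) := fun y => by
      rw [hF, norm_mul, norm_mul, Complex.norm_real]
      exact mul_le_mul_of_nonneg_left (hHle _ _ y) (by positivity)
    refine (integral_mono_of_nonneg (.of_forall fun _ => norm_nonneg _)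
      ((hg.const_mul _).const_mul _) (.of_forall this)).trans (le_of_eq ?_)
    rw [integral_const_mul, integral_const_mul, abs_of_nonneg (by positivity : 0 ≤ ‖p‖ * t)]
    ring
  have hFi : ∀ i, Integrable (F i) := fun i => (hHi i.1 i.2).ofReal.const_mul _
  have key := hasSum_integral_of_summable_integral_norm hFi hsum
  have hpt : ∀ y, ∑' i, F i y = coneKernel a c (‖y‖ ^ 2 - t ^ 2) *
      (((‖y‖ ^ (2 * N))⁻¹ : ℝ) : ℂ) * f (inner ℝ p y) := by
    intro y
    have h1 := summable_norm_coneKernel ha c (‖y‖ ^ 2 - t ^ 2)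
    have h2 := (hf (inner ℝ p y)).summable.norm
    rw [← (hf (inner ℝ p y)).tsum_eq, coneKernel, mul_right_comm,
      tsum_mul_tsum_of_summable_norm h1 h2, ← tsum_mul_right]
    refine tsum_congr fun i => ?_
    have : (-(Complex.I * ((inner ℝ p y : ℝ) : ℂ))) ^ i.2 =
      (-Complex.I) ^ i.2 * ((inner ℝ p y : ℝ) : ℂ) ^ i.2 := by rw [← mul_pow]; ring
    rw [this]
    simp only [F, A, B, H]
    push_cast
    ring
  simp only [hpt] at key
  -- odd terms vanish
  have hval : ∀ j k : ℕ, ∫ y, F (j, 2 * k) y = (2 * 4 ^ a * Real.pi ^ (N + a) : ℝ) *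
      (((j + k).choose j : ℂ) * c ^ j * (-(‖p‖ : ℂ) ^ 2) ^ k * (t : ℂ) ^ (2 * (j + k) + 1) /
        ((2 * (j + k) + 1).factorial : ℂ)) := by
    intro j k
    have h1 : ∫ y, F (j, 2 * k) y = A j * B (2 * k) * ((∫ y, H j (2 * k) y : ℝ) : ℂ) := by
      simp only [F]; rw [integral_const_mul, integral_complex_ofReal]
    have h2 := integral_norm_mul_inner_pow p (2 * k)
      (f := fun r => primPow (j - a) ((r ^ 2 - t ^ 2) / 4) * (r ^ (2 * N))⁻¹) (hHi j (2 * k))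
    have h3 : ∫ r in Set.Ioi (0 : ℝ), r ^ (Module.finrank ℝ E - 1 + 2 * k) *
        (primPow (j - a) ((r ^ 2 - t ^ 2) / 4) * (r ^ (2 * N))⁻¹) =
        ∫ r in Set.Ioi (0 : ℝ), r ^ (Module.finrank ℝ E - 1 - 2 * N + 2 * k) *
          primPow (j - a) ((r ^ 2 - t ^ 2) / 4) := by
      refine setIntegral_congr_fun measurableSet_Ioi fun r hr => ?_
      have hr' : (0 : ℝ) < r := hr
      have : r ^ (Module.finrank ℝ E - 1 + 2 * k) =
          r ^ (Module.finrank ℝ E - 1 - 2 * N + 2 * k) * r ^ (2 * N) := by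
        rw [← pow_add]; congr 1; omega
      simp only [this]
      field_simp
    have hc1 : ((Module.finrank ℝ E - 1 - 2 * N + 2 * k : ℕ) : ℝ) = 2 * a + 2 * k := by
      push_cast [Nat.cast_sub hn2, Nat.cast_sub hn1]; rw [hn]; ring
    rw [h3, radial_primPow ha ht j k _ hc1, integral_sphere_inner_pow] at h2
    have hH : ∫ y, H j (2 * k) y = _ := h2
    have hG1 : 0 < Real.Gamma (Module.finrank ℝ E / 2 + k) := Real.Gamma_pos_of_pos (by positivity)
    have hG2 : 0 < Real.Gamma (a + 1 / 2 + k) :=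
      Real.Gamma_pos_of_pos (by rcases ha with rfl | rfl <;> positivity)
    have hpi : Real.pi ^ (Module.finrank ℝ E / 2 : ℝ) = Real.pi ^ (N + a) * √Real.pi := by
      rw [Real.sqrt_eq_rpow, ← Real.rpow_add Real.pi_pos, hn]; congr 1; ring
    have hI : (-Complex.I) ^ (2 * k) = (-1) ^ k := by rw [pow_mul]; simp
    have hch : ((j + k).choose j : ℂ) =
        ((j + k).factorial : ℂ) / ((j.factorial : ℂ) * (k.factorial : ℂ)) := by
      rw [eq_div_iff (mul_ne_zero (by exact_mod_cast j.factorial_ne_zero)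
        (by exact_mod_cast k.factorial_ne_zero))]
      have := Nat.add_choose_mul_factorial_mul_factorial j k
      rw [← Nat.choose_symm_add] at this
      rw [← mul_assoc]; exact_mod_cast this
    -- All Gamma functions cancel here: Γ(n/2 + k) of the sphere, n being the dimension of the
    -- space, and Γ(a + 1/2 + k) of the radial part against `lam`, while Γ(j + k + 3/2) becomes a
    -- factorial.
    have hreal : lam (2 * k) / ((2 * k).factorial : ℝ) * (∫ y, H j (2 * k) y) =
        2 * 4 ^ a * Real.pi ^ (N + a) * ((j + k).factorial / (k.factorial : ℝ) * (‖p‖ ^ 2) ^ k *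
          t ^ (2 * (j + k) + 1) / (2 * (j + k) + 1).factorial) := by
      rw [hH, hlam, Gamma_nat_add_three_halves, hpi]
      have hs : 0 < √Real.pi := Real.sqrt_pos.2 Real.pi_pos
      rw [pow_add (4 : ℝ) j k]
      generalize Real.Gamma (Module.finrank ℝ E / 2 + k) = G1 at hG1 ⊢
      generalize Real.Gamma (a + 1 / 2 + k) = G2 at hG2 ⊢
      field_simp
    have h5 := congrArg (fun x : ℝ => (x : ℂ)) hreal
    push_cast at h5 ⊢
    rw [h1]
    simp only [A, B]
    rw [hI, hch, neg_pow ((‖p‖ : ℂ) ^ 2)]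
    linear_combination (c ^ j / (j.factorial : ℂ) * (-1) ^ k) * h5
  have hodd : ∀ j k : ℕ, ∫ y, F (j, 2 * k + 1) y = 0 := by
    intro j k
    have h1 : ∫ y, F (j, 2 * k + 1) y = A j * B (2 * k + 1) * ((∫ y, H j (2 * k + 1) y : ℝ) : ℂ) := by
      simp only [F]; rw [integral_const_mul, integral_complex_ofReal]
    rw [h1]
    simp only [H]
    rw [integral_norm_mul_inner_pow_odd p k
      (fun r => primPow (j - a) ((r ^ 2 - t ^ 2) / 4) * (r ^ (2 * N))⁻¹)]
    simp
  have hinj : Function.Injective (fun i : ℕ × ℕ => (i.1, 2 * i.2)) := by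
    rintro ⟨a, b⟩ ⟨c, d⟩ h
    simp only [Prod.mk.injEq] at h ⊢
    omega
  -- Only the pairs (j, 2l) contribute; they are then regrouped along antidiagonals.
  rw [← hinj.hasSum_iff] at key
  · have key2 := (Finset.HasAntidiagonal.sigmaAntidiagonalEquivProd.hasSum_iff.2 key).sigma
      (fun m => hasSum_fintype _)
    refine key2.congr_fun fun m => ?_
    simp only [Function.comp_apply, Finset.HasAntidiagonal.sigmaAntidiagonalEquivProd_apply]
    rw [Finset.sum_coe_sort (Finset.HasAntidiagonal.antidiagonal m)
      (fun i : ℕ × ℕ => ∫ y, F (i.1, 2 * i.2) y)]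
    rw [sub_eq_add_neg, (Commute.all c (-(‖p‖ : ℂ) ^ 2)).add_pow', Finset.sum_mul, Finset.sum_div,
      Finset.mul_sum]
    refine Finset.sum_congr rfl fun i hi => ?_
    rw [Finset.HasAntidiagonal.mem_antidiagonal] at hi
    rw [hval, hi, nsmul_eq_mul]
    ring
  · rintro ⟨j, k⟩ hjk
    rcases Nat.even_or_odd' k with ⟨l, rfl | rfl⟩
    · exact absurd ⟨(j, l), rfl⟩ hjk
    · exact hodd j l

end PlaneWave

/-! ### The Fourier transform with respect to the Minkowski product. -/

/-- Minkowski space with its Euclidean inner product. -/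
abbrev EuclMink (d : ℕ) : Type := WithLp 2 (ℝ × EuclideanSpace ℝ (Fin (d - 1)))

/-- The linear change of variables relating the Minkowski product to the Euclidean one. -/
def freq {d : ℕ} (p : Mink d) : EuclMink d := (2 * Real.pi)⁻¹ • WithLp.toLp 2 (p.1, -p.2)

theorem continuous_freq {d : ℕ} : Continuous (freq (d := d)) := by
  unfold freq
  have : Continuous (WithLp.toLp 2 : ℝ × EuclideanSpace ℝ (Fin (d - 1)) → EuclMink d) :=
    (WithLp.prodContinuousLinearEquiv 2 ℝ ℝ (EuclideanSpace ℝ (Fin (d - 1)))).symm.continuous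
  fun_prop

theorem minkProd_eq {d : ℕ} (p x : Mink d) : minkProd p x = -(p.1 * x.1) + inner ℝ p.2 x.2 := by
  simp [minkProd, PiLp.inner_apply, mul_comm]

theorem inner_freq {d : ℕ} (p x : Mink d) :
    inner ℝ (WithLp.toLp 2 x : EuclMink d) (freq p) = -((2 * Real.pi)⁻¹ * minkProd p x) := by
  rw [freq, inner_smul_right, WithLp.prod_inner_apply, minkProd_eq]
  simp [real_inner_comm p.2 x.2]
  ring

theorem measurePreserving_toLp_neg (d : ℕ) : MeasurePreserving
    (fun p : Mink d => (WithLp.toLp 2 (p.1, -p.2) : EuclMink d)) := by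
  have h := (MeasurePreserving.id (volume : Measure ℝ)).prod
    (Measure.measurePreserving_neg (volume : Measure (EuclideanSpace ℝ (Fin (d - 1)))))
  exact (WithLp.volume_preserving_toLp ℝ (EuclideanSpace ℝ (Fin (d - 1)))).comp h

theorem measurableEmbedding_toLp_neg (d : ℕ) : MeasurableEmbedding
    (fun p : Mink d => (WithLp.toLp 2 (p.1, -p.2) : EuclMink d)) :=
  (((Homeomorph.refl ℝ).prodCongr (Homeomorph.neg (EuclideanSpace ℝ (Fin (d - 1))))).trans
    (WithLp.prodContinuousLinearEquiv 2 ℝ ℝ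
      (EuclideanSpace ℝ (Fin (d - 1)))).symm.toHomeomorph).measurableEmbedding

theorem finrank_euclMink {d : ℕ} (hd : 2 ≤ d) : Module.finrank ℝ (EuclMink d) = d := by
  rw [(WithLp.prodContinuousLinearEquiv 2 ℝ ℝ
    (EuclideanSpace ℝ (Fin (d - 1)))).toLinearEquiv.finrank_eq]
  simp; omega

/-- A reflection in space preserves the volume, and the dilation by 1/(2π) accounts for the factor
(2π)^d of the convention used for propagators. -/
theorem integral_comp_freq {d : ℕ} (hd : 2 ≤ d) {F : Type*} [NormedAddCommGroup F]
    [NormedSpace ℝ F] (g : EuclMink d → F) :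
    ∫ p : Mink d, g (freq p) = (2 * Real.pi) ^ d • ∫ w, g w := by
  have h1 := (measurePreserving_toLp_neg d).integral_comp (measurableEmbedding_toLp_neg d)
    (fun w => g ((2 * Real.pi)⁻¹ • w))
  have h2 := Measure.integral_comp_inv_smul (volume : Measure (EuclMink d)) g (2 * Real.pi)
  rw [finrank_euclMink hd, abs_of_nonneg (by positivity)] at h2
  rw [← h2, ← h1]
  rfl

theorem integrable_comp_freq {d : ℕ} {F : Type*} [NormedAddCommGroup F]
    {g : EuclMink d → F} (hg : Integrable g) : Integrable (fun p : Mink d => g (freq p)) := by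
  have h2 := (integrable_comp_smul_iff (volume : Measure (EuclMink d)) g
    (R := (2 * Real.pi)⁻¹) (by positivity)).2 hg
  exact ((measurePreserving_toLp_neg d).integrable_comp_emb (measurableEmbedding_toLp_neg d)).2 h2

theorem norm_le_norm_freq {d : ℕ} (p : Mink d) : ‖p‖ ≤ 2 * Real.pi * ‖freq p‖ := by
  rw [freq, norm_smul, ← mul_assoc, Real.norm_of_nonneg (by positivity),
    mul_inv_cancel₀ (by positivity), one_mul]
  have h := WithLp.prod_norm_sq_eq_of_L2 (WithLp.toLp 2 (p.1, -p.2) : EuclMink d)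
  refine max_le ?_ ?_
  · refine (sq_le_sq₀ (norm_nonneg _) (norm_nonneg _)).1 ?_
    rw [h]
    exact le_add_of_nonneg_right (sq_nonneg _)
  · refine (sq_le_sq₀ (norm_nonneg _) (norm_nonneg _)).1 ?_
    rw [h, WithLp.toLp_snd, norm_neg]
    exact le_add_of_nonneg_left (sq_nonneg _)

/-- A test function as a Schwartz function. -/
def testSchwartz {d : ℕ} (φ : MinkTest d) : SchwartzMap (EuclMink d) ℂ :=
  HasCompactSupport.toSchwartzMap (f := fun w : EuclMink d => (φ w.ofLp : ℂ))
    (by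
      have h := φ.hasCompactSupport.comp_homeomorph
        (WithLp.prodContinuousLinearEquiv 2 ℝ ℝ (EuclideanSpace ℝ (Fin (d - 1)))).toHomeomorph
      exact h.comp_left (g := ((↑) : ℝ → ℂ)) rfl)
    (Complex.ofRealCLM.contDiff.comp (φ.contDiff.comp
      (WithLp.prodContinuousLinearEquiv 2 ℝ ℝ (EuclideanSpace ℝ (Fin (d - 1)))).contDiff))

theorem testSchwartz_apply {d : ℕ} (φ : MinkTest d) (w : EuclMink d) :
    testSchwartz φ w = (φ w.ofLp : ℂ) := rfl

/-- The Fourier transform with respect to the Minkowski product. -/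
def minkFourier {d : ℕ} (φ : MinkTest d) (p : Mink d) : ℂ :=
  ∫ x : Mink d, Complex.exp (Complex.I * (minkProd p x : ℂ)) * (φ x : ℂ)

theorem minkFourier_eq {d : ℕ} (φ : MinkTest d) (p : Mink d) :
    minkFourier φ p = 𝓕 (testSchwartz φ) (freq p) := by
  rw [SchwartzMap.fourier_coe, Real.fourier_eq', minkFourier,
    ← (WithLp.volume_preserving_toLp ℝ (EuclideanSpace ℝ (Fin (d - 1)))).integral_comp
    (WithLp.prodContinuousLinearEquiv 2 ℝ ℝ
      (EuclideanSpace ℝ (Fin (d - 1)))).symm.toHomeomorph.measurableEmbedding]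
  congr 1; ext x
  rw [inner_freq, testSchwartz_apply, smul_eq_mul]
  congr 2
  have : (Real.pi : ℂ) ≠ 0 := by exact_mod_cast Real.pi_ne_zero
  push_cast
  field_simp

theorem continuous_minkFourier {d : ℕ} (φ : MinkTest d) : Continuous (minkFourier φ) := by
  have : minkFourier φ = fun p => 𝓕 (testSchwartz φ) (freq p) := funext (minkFourier_eq φ)
  rw [this]
  exact (𝓕 (testSchwartz φ)).continuous.comp continuous_freq

theorem integrable_pow_mul_minkFourier {d : ℕ} (φ : MinkTest d) (k : ℕ) :
    Integrable (fun p => ‖p‖ ^ k * ‖minkFourier φ p‖) := by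
  have h := (integrable_comp_freq
    ((𝓕 (testSchwartz φ)).integrable_pow_mul volume k)).const_mul ((2 * Real.pi) ^ k)
  refine h.mono' ((continuous_norm.pow k).mul
    (continuous_minkFourier φ).norm).aestronglyMeasurable (.of_forall fun p => ?_)
  rw [minkFourier_eq, Real.norm_of_nonneg (by positivity), ← mul_assoc, ← mul_pow]
  have := norm_le_norm_freq p
  gcongr

theorem integrable_minkFourier {d : ℕ} (φ : MinkTest d) : Integrable (minkFourier φ) := by
  have := integrable_pow_mul_minkFourier φ 0
  simp only [pow_zero, one_mul] at this
  exact (integrable_norm_iff (continuous_minkFourier φ).aestronglyMeasurable).1 this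

/-- The rapid decay of the transform in the form needed to dominate polynomial factors in ⟨p⃗, x⃗⟩,
as produced by the Euler operators. -/
theorem integrable_one_add_pow_mul_minkFourier {d : ℕ} (φ : MinkTest d) (k : ℕ) (R : ℝ) :
    Integrable (fun p => (1 + ‖p‖ * R) ^ k * ‖minkFourier φ p‖) := by
  have h : Integrable (fun p => ∑ i ∈ Finset.range (k + 1),
      ((k.choose i : ℝ) * R ^ i) * (‖p‖ ^ i * ‖minkFourier φ p‖)) :=
    integrable_finsetSum _ fun i _ => (integrable_pow_mul_minkFourier φ i).const_mul _
  refine h.congr (.of_forall fun p => ?_)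
  simp only
  rw [add_comm (1 : ℝ), add_pow, Finset.sum_mul]
  refine Finset.sum_congr rfl fun i _ => ?_
  rw [mul_pow]; ring

theorem minkFourier_inversion {d : ℕ} (hd : 2 ≤ d) (φ : MinkTest d) (x : Mink d) :
    (φ x : ℂ) = ((2 * (Real.pi : ℂ)) ^ d)⁻¹ *
      ∫ p : Mink d, minkFourier φ p * Complex.exp (-(Complex.I * (minkProd p x : ℂ))) := by
  have h := congrFun ((testSchwartz φ).continuous.fourierInv_fourier_eq (testSchwartz φ).integrable
    (by rw [← SchwartzMap.fourier_coe]; exact (𝓕 (testSchwartz φ)).integrable)) (WithLp.toLp 2 x)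
  rw [testSchwartz_apply, Real.fourierInv_eq'] at h
  have h2 := integral_comp_freq hd (fun w : EuclMink d => Complex.exp
    (((2 * Real.pi * inner ℝ w (WithLp.toLp 2 x : EuclMink d) : ℝ) : ℂ) * Complex.I) •
      𝓕 (⇑(testSchwartz φ)) w)
  rw [h, ← SchwartzMap.fourier_coe] at h2
  have e : ∀ p : Mink d, Complex.exp
      (((2 * Real.pi * inner ℝ (freq p) (WithLp.toLp 2 x : EuclMink d) : ℝ) : ℂ) * Complex.I) •
      𝓕 (testSchwartz φ) (freq p) =
      minkFourier φ p * Complex.exp (-(Complex.I * (minkProd p x : ℂ))) := by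
    intro p
    rw [real_inner_comm, inner_freq, minkFourier_eq, smul_eq_mul, mul_comm]
    congr 2
    have : (Real.pi : ℂ) ≠ 0 := by exact_mod_cast Real.pi_ne_zero
    push_cast
    field_simp
  simp only [e] at h2
  rw [h2]
  have hne : ((2 * (Real.pi : ℂ)) ^ d) ≠ 0 :=
    pow_ne_zero _ (mul_ne_zero two_ne_zero (by exact_mod_cast Real.pi_ne_zero))
  rw [Complex.real_smul]
  push_cast
  rw [inv_mul_cancel_left₀ hne]

/-! ### Action of the Euler operators on plane waves. -/

/-- The function `ξ ↦ q(ξ) e^{-iξ}`. -/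
def polyExp (q : Polynomial ℂ) (ξ : ℝ) : ℂ := q.eval (ξ : ℂ) * Complex.exp (-(Complex.I * ξ))

theorem continuous_polyExp (q : Polynomial ℂ) : Continuous (polyExp q) := by
  unfold polyExp
  have := q.continuous
  fun_prop

theorem hasDerivAt_polyExp (q : Polynomial ℂ) (ξ : ℝ) : HasDerivAt (polyExp q)
    (polyExp (q.derivative - Polynomial.C Complex.I * q) ξ) ξ := by
  have h1 : HasDerivAt (fun z : ℂ => q.eval z * Complex.exp (-(Complex.I * z)))
      (q.derivative.eval (ξ : ℂ) * Complex.exp (-(Complex.I * ξ)) +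
        q.eval (ξ : ℂ) * (Complex.exp (-(Complex.I * ξ)) * (-(Complex.I * 1)))) (ξ : ℂ) :=
    (q.hasDerivAt _).mul ((((hasDerivAt_id _).const_mul Complex.I).neg).cexp)
  convert! h1.comp_ofReal using 1
  simp [polyExp]; ring

theorem norm_polyExp_le (q : Polynomial ℂ) : ∃ C : ℝ, 0 ≤ C ∧ ∃ k : ℕ, ∀ ξ : ℝ,
    ‖polyExp q ξ‖ ≤ C * (1 + |ξ|) ^ k := by
  refine ⟨∑ i ∈ Finset.range (q.natDegree + 1), ‖q.coeff i‖,
    Finset.sum_nonneg fun _ _ => norm_nonneg _, q.natDegree, fun ξ => ?_⟩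
  have h1 : ‖Complex.exp (-(Complex.I * ξ))‖ = 1 := by
    rw [← mul_neg, ← Complex.ofReal_neg, norm_exp_I_mul_ofReal]
  rw [polyExp, norm_mul, h1, mul_one, Polynomial.eval_eq_sum_range, Finset.sum_mul]
  refine norm_sum_le_of_le _ fun i hi => ?_
  rw [norm_mul, norm_pow, Complex.norm_real, Real.norm_eq_abs]
  refine mul_le_mul_of_nonneg_left ?_ (norm_nonneg _)
  have h0 := abs_nonneg ξ
  calc |ξ| ^ i ≤ (1 + |ξ|) ^ i := by gcongr; linarith
    _ ≤ _ := pow_le_pow_right₀ (by linarith) (by simpa [Nat.lt_succ_iff] using hi)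

/-- The Taylor coefficients of `polyExp`, up to the factor `(-i)^k / k!`. -/
def polyExpCoeff (k : ℕ) : Polynomial ℂ →ₗ[ℂ] ℂ :=
  Polynomial.lsum fun l => (Complex.I ^ l * (k.descFactorial l : ℂ)) • LinearMap.id

theorem polyExpCoeff_monomial (k l : ℕ) (c : ℂ) :
    polyExpCoeff k (Polynomial.monomial l c) = Complex.I ^ l * (k.descFactorial l : ℂ) * c := by
  simp [polyExpCoeff, Polynomial.lsum_apply, Polynomial.sum_monomial_index]

/-- The polynomial on the left is the one belonging to ξ d/dξ applied to q(ξ)e^{-iξ}, and ξ d/dξ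
multiplies the k-th Taylor coefficient by k. -/
theorem polyExpCoeff_euler (k : ℕ) (q : Polynomial ℂ) :
    polyExpCoeff k (Polynomial.X * (q.derivative - Polynomial.C Complex.I * q)) =
      k * polyExpCoeff k q := by
  induction q using Polynomial.induction_on' with
  | add p q hp hq =>
    rw [Polynomial.derivative_add, (polyExpCoeff k).map_add p q, mul_add (k : ℂ), ← hp, ← hq,
      ← (polyExpCoeff k).map_add]
    congr 1; ring
  | monomial l c =>
    have e : Polynomial.X * ((Polynomial.monomial l c).derivative -
        Polynomial.C Complex.I * Polynomial.monomial l c) =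
        Polynomial.monomial l (c * l) - Polynomial.monomial (l + 1) (Complex.I * c) := by
      rw [mul_sub, Polynomial.derivative_monomial, Polynomial.C_mul_monomial,
        Polynomial.X_mul_monomial, Polynomial.X_mul_monomial]
      rcases l with _ | l
      · simp
      · simp
    rw [e, map_sub, polyExpCoeff_monomial, polyExpCoeff_monomial, polyExpCoeff_monomial,
      Nat.descFactorial_succ, pow_succ]
    rcases le_or_gt l k with h | h
    · push_cast [Nat.cast_sub h]
      linear_combination (-(Complex.I ^ l * (k - l) * (k.descFactorial l : ℂ) * c)) * Complex.I_mul_I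
    · simp [Nat.descFactorial_eq_zero_iff_lt.2 h]

theorem hasSum_polyExp (q : Polynomial ℂ) (ξ : ℝ) :
    HasSum (fun k : ℕ => polyExpCoeff k q * (-(Complex.I * ξ)) ^ k / k.factorial)
      (polyExp q ξ) := by
  induction q using Polynomial.induction_on' with
  | add p q hp hq =>
    have := hp.add hq
    simpa only [map_add, add_mul, add_div, polyExp, Polynomial.eval_add] using this
  | monomial l c =>
    have h := (NormedSpace.expSeries_div_hasSum_exp (-(Complex.I * ξ))).mul_left (c * (ξ : ℂ) ^ l)
    rw [← Complex.exp_eq_exp_ℂ] at h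
    have e : polyExp (Polynomial.monomial l c) ξ =
        c * (ξ : ℂ) ^ l * Complex.exp (-(Complex.I * ξ)) := by simp [polyExp]
    rw [e, ← (add_left_injective l).hasSum_iff]
    · refine h.congr_fun fun k => ?_
      simp only [Function.comp_apply]
      rw [polyExpCoeff_monomial]
      have h1 : ((k + l).factorial : ℂ) = k.factorial * ((k + l).descFactorial l : ℂ) := by
        have := Nat.factorial_mul_descFactorial (Nat.le_add_left l k)
        rw [Nat.add_sub_cancel] at this
        exact_mod_cast this.symm
      have h2 : ((k + l).descFactorial l : ℂ) ≠ 0 := by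
        intro h0; rw [h0, mul_zero] at h1
        exact (Nat.cast_ne_zero.2 (k + l).factorial_ne_zero) h1
      have h3 : (-(Complex.I * (ξ : ℂ))) ^ l * Complex.I ^ l = (ξ : ℂ) ^ l := by
        rw [← mul_pow]; congr 1
        linear_combination (-(ξ : ℂ)) * Complex.I_mul_I
      have h4 : (k.factorial : ℂ) ≠ 0 := by exact_mod_cast k.factorial_ne_zero
      rw [h1, pow_add, ← h3]
      field_simp
    · intro k hk
      have : k < l := by
        by_contra hcon
        exact hk ⟨k - l, by simp only; omega⟩
      rw [polyExpCoeff_monomial, Nat.descFactorial_eq_zero_iff_lt.2 this]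
      simp

/-- The polynomials `q` such that the iterated Euler operators map `e^{-ip·y}` to
`q(p·y) e^{-ip·y}`. -/
def eulerPoly (d : ℕ) : ℕ → Polynomial ℂ
  | 0 => 1
  | k + 1 => Polynomial.C (1 / 2) * (Polynomial.C (((d : ℝ) - 3 - 2 * k : ℝ) : ℂ) * eulerPoly d k +
      Polynomial.X * ((eulerPoly d k).derivative - Polynomial.C Complex.I * eulerPoly d k))

/-- Each factor of D_N acts diagonally on powers of ξ, with eigenvalue (d - 3 - 2i + k)/2 on ξ^k. -/
theorem polyExpCoeff_eulerPoly (d N k : ℕ) : polyExpCoeff k (eulerPoly d N) =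
    ((∏ i ∈ Finset.range N, (((d : ℝ) - 3 - 2 * i + k) / 2) : ℝ) : ℂ) := by
  induction N with
  | zero =>
    have : (1 : Polynomial ℂ) = Polynomial.monomial 0 1 := rfl
    rw [eulerPoly, this, polyExpCoeff_monomial]; simp
  | succ N ih =>
    rw [eulerPoly, Finset.prod_range_succ, ← Polynomial.smul_eq_C_mul, ← Polynomial.smul_eq_C_mul,
      map_smul, map_add, map_smul, polyExpCoeff_euler, ih]
    push_cast
    simp only [smul_eq_mul]
    ring

theorem prod_sub_mul_Gamma {x : ℝ} (N : ℕ) (h : 0 < x - N) :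
    (∏ i ∈ Finset.range N, (x - 1 - i)) * Real.Gamma (x - N) = Real.Gamma x := by
  induction N with
  | zero => simp
  | succ N ih =>
    push_cast at h
    rw [← ih (by linarith), Finset.prod_range_succ, mul_assoc]
    have := Real.Gamma_add_one (s := x - (N + 1 : ℕ)) (by push_cast; linarith)
    rw [show x - N = x - (N + 1 : ℕ) + 1 by push_cast; ring, this]
    push_cast; ring

/-- The product of eigenvalues telescopes into a quotient of Gamma values, exactly the weight that
`hasSum_integral_planeWave` asks for. This is the reason why the integrations by parts and the
choice of kernel fit together. -/
theorem eulerCoeff_even {d N : ℕ} {a : ℝ} (ha : a = 0 ∨ a = 1 / 2)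
    (hn : (d : ℝ) = 2 * N + 2 + 2 * a) (k : ℕ) :
    ∏ i ∈ Finset.range N, (((d : ℝ) - 3 - 2 * i + (2 * k : ℕ)) / 2) =
      Real.Gamma (((d : ℝ) - 1) / 2 + k) / Real.Gamma (a + 1 / 2 + k) := by
  have e : a + 1 / 2 + k = (((d : ℝ) - 1) / 2 + k) - N := by rw [hn]; ring
  have hpos : 0 < a + 1 / 2 + k := by rcases ha with rfl | rfl <;> positivity
  rw [eq_div_iff (Real.Gamma_pos_of_pos hpos).ne', 
    ← prod_sub_mul_Gamma (x := ((d : ℝ) - 1) / 2 + k) N (by rwa [← e]), ← e]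
  congr 1
  refine Finset.prod_congr rfl fun i _ => ?_
  push_cast; ring

/-- The spatial Euler operator is the derivative at s = 1 of the dilation x⃗ ↦ s x⃗. Differentiating
the inversion formula under the integral sign therefore turns D_N into a polynomial factor on each
plane wave. -/
theorem eulerIter_eq_integral {d : ℕ} (hd : 2 ≤ d) (φ : MinkTest d) (N : ℕ) (x : Mink d) :
    (eulerIter d N φ x : ℂ) = ((2 * (Real.pi : ℂ)) ^ d)⁻¹ *
      ∫ p : Mink d, minkFourier φ p * Complex.exp (Complex.I * ((p.1 * x.1 : ℝ) : ℂ)) *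
        polyExp (eulerPoly d N) (inner ℝ p.2 x.2) := by
  induction N generalizing x with
  | zero =>
    rw [eulerIter, ContinuousLinearMap.id_apply, minkFourier_inversion hd φ x]
    congr 2; ext p
    rw [eulerPoly, polyExp, Polynomial.eval_one, one_mul, mul_assoc, ← Complex.exp_add, minkProd_eq]
    congr 2; push_cast; ring
  | succ N ih =>
    set q := eulerPoly d N with hq
    set q' := q.derivative - Polynomial.C Complex.I * q with hq'
    set c : ℂ := ((2 * (Real.pi : ℂ)) ^ d)⁻¹
    set g : Polynomial ℂ → ℝ → Mink d → ℂ := fun r s p =>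
      minkFourier φ p * Complex.exp (Complex.I * ((p.1 * x.1 : ℝ) : ℂ)) *
        polyExp r (s * inner ℝ p.2 x.2) with hg
    have hgc : ∀ r s, Continuous (g r s) := fun r s => by
      have h1 := continuous_minkFourier φ
      have h2 := continuous_polyExp r
      simp only [hg]; fun_prop
    have hin : ∀ p : Mink d, |(inner ℝ p.2 x.2 : ℝ)| ≤ ‖p‖ * ‖x‖ := fun p =>
      (abs_real_inner_le_norm _ _).trans (mul_le_mul (norm_snd_le p) (norm_snd_le x)
        (norm_nonneg _) (norm_nonneg _))
    -- One majorant for all |s - 1| < 1 that controls the integrand as well as the integrand times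
    -- ⟨p⃗, x⃗⟩; the spare power k + 1 pays for that extra factor.
    have hgb : ∀ r : Polynomial ℂ, ∃ b : Mink d → ℝ, Integrable b ∧
        ∀ s ∈ Metric.ball (1 : ℝ) 1, ∀ p, ‖g r s p‖ ≤ b p ∧
          ‖g r s p * (inner ℝ p.2 x.2 : ℝ)‖ ≤ b p := by
      intro r
      obtain ⟨C, hC0, k, hC⟩ := norm_polyExp_le r
      refine ⟨fun p => C * ((1 + ‖p‖ * (2 * ‖x‖)) ^ (k + 1) * ‖minkFourier φ p‖),
        (integrable_one_add_pow_mul_minkFourier φ _ _).const_mul _, fun s hs p => ?_⟩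
      have hs' : |s| ≤ 2 := by
        rw [Metric.mem_ball, Real.dist_eq] at hs
        have h1 := abs_sub_abs_le_abs_sub s 1
        rw [abs_one] at h1; linarith
      have h0 : 0 ≤ ‖p‖ * ‖x‖ := by positivity
      have h1 : |s * inner ℝ p.2 x.2| ≤ ‖p‖ * (2 * ‖x‖) := by
        rw [abs_mul]
        calc _ ≤ 2 * (‖p‖ * ‖x‖) := mul_le_mul hs' (hin p) (abs_nonneg _) zero_le_two
          _ = _ := by ring
      have h2 : ‖polyExp r (s * inner ℝ p.2 x.2)‖ ≤ C * (1 + ‖p‖ * (2 * ‖x‖)) ^ k :=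
        (hC _).trans (by gcongr)
      have h3 : ‖g r s p‖ ≤ ‖minkFourier φ p‖ * (C * (1 + ‖p‖ * (2 * ‖x‖)) ^ k) := by
        simp only [hg]
        rw [norm_mul, norm_mul, norm_exp_I_mul_ofReal, mul_one]
        gcongr
      have h4 : 1 ≤ 1 + ‖p‖ * (2 * ‖x‖) := by
        have : 0 ≤ ‖p‖ * (2 * ‖x‖) := by positivity
        linarith
      have h5 : ∀ u : ℝ, 0 ≤ u → u ≤ 1 + ‖p‖ * (2 * ‖x‖) → ‖g r s p‖ * u ≤
          C * ((1 + ‖p‖ * (2 * ‖x‖)) ^ (k + 1) * ‖minkFourier φ p‖) := by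
        intro u hu0 hu
        calc _ ≤ ‖minkFourier φ p‖ * (C * (1 + ‖p‖ * (2 * ‖x‖)) ^ k) * (1 + ‖p‖ * (2 * ‖x‖)) := by
              gcongr
          _ = _ := by ring
      refine ⟨by simpa using h5 1 zero_le_one h4, ?_⟩
      rw [norm_mul, Complex.norm_real, Real.norm_eq_abs]
      exact h5 _ (abs_nonneg _) ((hin p).trans (by linarith))
    have h1mem : (1 : ℝ) ∈ Metric.ball (1 : ℝ) 1 := by simp
    have hgi : ∀ r, Integrable (g r 1) := fun r => by
      obtain ⟨b, hb, hbd⟩ := hgb r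
      exact hb.mono' (hgc r 1).aestronglyMeasurable (.of_forall fun p => (hbd 1 h1mem p).1)
    have hgi' : ∀ r, Integrable (fun p => g r 1 p * (inner ℝ p.2 x.2 : ℝ)) := fun r => by
      obtain ⟨b, hb, hbd⟩ := hgb r
      have := hgc r 1
      exact hb.mono' (Continuous.aestronglyMeasurable (by fun_prop))
        (.of_forall fun p => (hbd 1 h1mem p).2)
    -- derivative along the spatial dilation
    have hd1 : HasDerivAt (fun s : ℝ => ∫ p, g q s p)
        (∫ p, g q' 1 p * (inner ℝ p.2 x.2 : ℝ)) 1 := by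
      obtain ⟨b, hb, hbd⟩ := hgb q'
      refine (hasDerivAt_integral_of_dominated_loc_of_deriv_le (F := g q) (bound := b)
        (F' := fun s p => g q' s p * (inner ℝ p.2 x.2 : ℝ))
        (Metric.ball_mem_nhds (1 : ℝ) one_pos) (.of_forall fun s => (hgc q s).aestronglyMeasurable)
        (hgi q) (hgi' q').aestronglyMeasurable (.of_forall fun p s hs => (hbd s hs p).2) hb
        (.of_forall fun p s _ => ?_)).2
      have := ((hasDerivAt_polyExp q (s * inner ℝ p.2 x.2)).scomp s
        ((hasDerivAt_id s).mul_const (inner ℝ p.2 x.2))).const_mul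
          (minkFourier φ p * Complex.exp (Complex.I * ((p.1 * x.1 : ℝ) : ℂ)))
      convert! this using 1
      simp only [hg, one_mul, Complex.real_smul]; ring
    have hd2 : HasDerivAt (fun s : ℝ => (eulerIter d N φ (x.1, s • x.2) : ℂ))
        ((fderiv ℝ (eulerIter d N φ) x (0, x.2) : ℝ) : ℂ) 1 := by
      have h1 : HasDerivAt (fun s : ℝ => ((x.1, s • x.2) : Mink d)) (0, x.2) 1 := by
        refine (hasDerivAt_const _ _).prodMk ?_
        simpa using (hasDerivAt_id (1 : ℝ)).smul_const x.2
      have h2 : HasFDerivAt (eulerIter d N φ) (fderiv ℝ (eulerIter d N φ) x) (x.1, (1 : ℝ) • x.2) := by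
        rw [one_smul]
        exact ((eulerIter d N φ).contDiff.differentiable (by simp) x).hasFDerivAt
      exact (h2.comp_hasDerivAt (1 : ℝ) h1).ofReal_comp
    have heq : (fun s : ℝ => (eulerIter d N φ (x.1, s • x.2) : ℂ)) =
        fun s : ℝ => c * ∫ p, g q s p := by
      ext s
      rw [ih (x.1, s • x.2)]
      simp only [hg, inner_smul_right]
    rw [heq] at hd2
    have hder := hd2.unique (hd1.const_mul c)
    have hx : (eulerIter d N φ x : ℂ) = c * ∫ p, g q 1 p := by
      have := congrFun heq 1
      simpa using this
    have e1 : (eulerIter d (N + 1) φ x : ℂ) = 1 / 2 * (((((d : ℝ) - 3 - 2 * N : ℝ) : ℂ)) *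
        (eulerIter d N φ x : ℂ) + ((fderiv ℝ (eulerIter d N φ) x (0, x.2) : ℝ) : ℂ)) := by
      rw [eulerIter, ContinuousLinearMap.comp_apply, eulerStep_apply]
      push_cast; ring
    rw [e1, hx, hder]
    have e2 : ∀ p : Mink d, minkFourier φ p * Complex.exp (Complex.I * ((p.1 * x.1 : ℝ) : ℂ)) *
        polyExp (eulerPoly d (N + 1)) (inner ℝ p.2 x.2) =
        1 / 2 * ((((d : ℝ) - 3 - 2 * N : ℝ) : ℂ) * g q 1 p +
          g q' 1 p * (inner ℝ p.2 x.2 : ℝ)) := by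
      intro p
      simp only [hg, one_mul]
      rw [eulerPoly, ← hq, ← hq']
      simp only [polyExp, Polynomial.eval_mul, Polynomial.eval_add, Polynomial.eval_C,
        Polynomial.eval_X]
      ring
    simp only [e2]
    rw [integral_const_mul, integral_add ((hgi q).const_mul _) (hgi' q'), integral_const_mul]
    ring

/-! ### Resolvents: the sine kernel and comparison of two regularizations. -/

/-- The energy `ω = (M² + p⃗²)^{1/2}`. -/
def energy {d : ℕ} (M : ℝ) (p : Mink d) : ℝ := √(M ^ 2 + ‖p.2‖ ^ 2)

theorem energy_sq {d : ℕ} (M : ℝ) (p : Mink d) : energy M p ^ 2 = M ^ 2 + ‖p.2‖ ^ 2 :=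
  Real.sq_sqrt (by positivity)

theorem le_energy {d : ℕ} {M : ℝ} (p : Mink d) : M ≤ energy M p :=
  Real.le_sqrt_of_sq_le (le_add_of_nonneg_right (sq_nonneg _))

theorem energy_pos {d : ℕ} {M : ℝ} (hM : 0 < M) (p : Mink d) : 0 < energy M p :=
  hM.trans_le (le_energy p)

theorem continuous_energy {d : ℕ} (M : ℝ) : Continuous (energy (d := d) M) := by
  unfold energy; fun_prop

/-- The Fourier transform of the propagator, cut off at time `R`. -/
def cutoffSymbol {d : ℕ} (σ M R η : ℝ) (p : Mink d) : ℂ :=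
  ∫ t in Set.Ioc (0 : ℝ) R, Complex.exp (-((η - Complex.I * ((σ * p.1 : ℝ) : ℂ)) * t)) *
    ((Real.sin (energy M p * t) / energy M p : ℝ) : ℂ)

theorem norm_exp_neg_sub_I_mul (η q t : ℝ) :
    ‖Complex.exp (-((η - Complex.I * (q : ℂ)) * t))‖ = Real.exp (-(η * t)) := by
  rw [Complex.norm_exp]; simp

theorem norm_sin_div_le {ω : ℝ} (hω : 0 < ω) (t : ℝ) :
    ‖((Real.sin (ω * t) / ω : ℝ) : ℂ)‖ ≤ ω⁻¹ := by
  rw [Complex.norm_real, norm_div, Real.norm_of_nonneg hω.le, Real.norm_eq_abs, div_eq_mul_inv]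
  exact mul_le_of_le_one_left (by positivity) (Real.abs_sin_le_one _)

theorem integral_exp_mul_sin {η q ω : ℝ} (hη : 0 < η) (hω : 0 < ω) :
    ∫ t in Set.Ioi (0 : ℝ), Complex.exp (-((η - Complex.I * (q : ℂ)) * t)) *
      ((Real.sin (ω * t) / ω : ℝ) : ℂ) = 1 / ((ω : ℂ) ^ 2 + (η - Complex.I * q) ^ 2) := by
  set s : ℂ := η - Complex.I * q with hs
  have hω' : (ω : ℂ) ≠ 0 := by exact_mod_cast hω.ne'
  have e : ∀ t : ℝ, Complex.exp (-(s * t)) * ((Real.sin (ω * t) / ω : ℝ) : ℂ) =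
      (Complex.exp ((-s + -ω * Complex.I) * t) - Complex.exp ((-s + ω * Complex.I) * t)) *
        (Complex.I / (2 * ω)) := by
    intro t
    push_cast
    rw [Complex.sin, add_mul, add_mul, Complex.exp_add, Complex.exp_add]
    have e1 : -((ω : ℂ) * t) * Complex.I = -ω * Complex.I * t := by ring
    have e2 : ((ω : ℂ) * t) * Complex.I = ω * Complex.I * t := by ring
    rw [e1, e2, neg_mul s]
    field_simp
  have hre1 : (-s + -ω * Complex.I).re < 0 := by simp [hs, hη]
  have hre2 : (-s + ω * Complex.I).re < 0 := by simp [hs, hη]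
  simp only [e]
  rw [integral_mul_const, integral_sub (integrableOn_exp_mul_complex_Ioi hre1 0)
    (integrableOn_exp_mul_complex_Ioi hre2 0), integral_exp_mul_complex_Ioi hre1,
    integral_exp_mul_complex_Ioi hre2]
  have h1 : -s + -ω * Complex.I ≠ 0 := fun h => by rw [h] at hre1; simp at hre1
  have h2 : -s + ω * Complex.I ≠ 0 := fun h => by rw [h] at hre2; simp at hre2
  have h3 : (ω : ℂ) ^ 2 + s ^ 2 = (-s + -ω * Complex.I) * (-s + ω * Complex.I) := by
    linear_combination (ω : ℂ) ^ 2 * Complex.I_sq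
  rw [h3]
  simp only [Complex.ofReal_zero, mul_zero, Complex.exp_zero]
  have h4 : -s + -ω * Complex.I = (-s + ω * Complex.I) - 2 * ω * Complex.I := by ring
  generalize -s + ω * Complex.I = v at *
  generalize -s + -ω * Complex.I = u at *
  field_simp
  linear_combination Complex.I * h4 + (-2 * (ω : ℂ)) * Complex.I_sq

section Comparison

variable {M ω q ε : ℝ}

/-- On the mass shell |q| = ω the two quantities coincide; elsewhere their difference is controlled
by the distance from the shell. -/
theorem abs_sub_sign_le (hω : 0 < ω) : |q / ω - Real.sign q| ≤ |ω ^ 2 - q ^ 2| / ω ^ 2 ∨ q = 0 := by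
  rcases lt_trichotomy q 0 with hq | hq | hq
  · left
    rw [Real.sign_of_neg hq, le_div_iff₀ (by positivity)]
    have e : |q / ω - -1| * ω ^ 2 = |q + ω| * ω := by
      rw [show q / ω - -1 = (q + ω) / ω by field_simp; ring, abs_div, abs_of_pos hω]; field_simp
    have e2 : |ω ^ 2 - q ^ 2| = |q + ω| * (ω - q) := by
      rw [show ω ^ 2 - q ^ 2 = (q + ω) * (ω - q) by ring, abs_mul, abs_of_pos (by linarith : 0 < ω - q)]
    rw [e, e2]
    exact mul_le_mul_of_nonneg_left (by linarith) (abs_nonneg _)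
  · exact .inr hq
  · left
    rw [Real.sign_of_pos hq, le_div_iff₀ (by positivity)]
    have e : |q / ω - 1| * ω ^ 2 = |q - ω| * ω := by
      rw [show q / ω - 1 = (q - ω) / ω by field_simp, abs_div, abs_of_pos hω]; field_simp
    have e2 : |ω ^ 2 - q ^ 2| = |q - ω| * (ω + q) := by
      rw [show ω ^ 2 - q ^ 2 = -((q - ω) * (ω + q)) by ring, abs_neg, abs_mul,
        abs_of_pos (by linarith : 0 < ω + q)]
    rw [e, e2]
    exact mul_le_mul_of_nonneg_left (by linarith) (abs_nonneg _)

/-- Put D = ω² - q² and η = ε/(2ω). The second denominator is D + η² - iεq/ω, which agrees with D -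
iε sgn q on the mass shell to first order in ε. The numerator of the difference is at most η² +
ε|D|/ω², while the denominators are bounded below by |D| and by ε, respectively εω⁻¹ω/2. The
quotient is thus bounded independently of ε and q, although each resolvent separately is not. -/
theorem norm_resolvent_sub_le (hM : 0 < M) (hω : M ≤ ω) (hq : q ≠ 0) (hε : 0 < ε) :
    ‖1 / (((ω ^ 2 - q ^ 2 : ℝ) : ℂ) - Complex.I * ε * (Real.sign q : ℂ)) -
      1 / ((ω : ℂ) ^ 2 + (((ε / (2 * ω) : ℝ) : ℂ) - Complex.I * q) ^ 2)‖ ≤ 3 / (2 * M ^ 2) := by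
  have hω0 : 0 < ω := hM.trans_le hω
  set η : ℝ := ε / (2 * ω) with hη
  have hη0 : 0 < η := by positivity
  set D : ℝ := ω ^ 2 - q ^ 2 with hD
  set A : ℂ := (D : ℂ) - Complex.I * ε * (Real.sign q : ℂ) with hA
  set B : ℂ := (ω : ℂ) ^ 2 + ((η : ℂ) - Complex.I * q) ^ 2 with hB
  have hs : |Real.sign q| = 1 := by
    rcases hq.lt_or_gt with h | h
    · simp [Real.sign_of_neg h]
    · simp [Real.sign_of_pos h]
  have hAre : A.re = D := by simp [hA]
  have hAim : A.im = -(ε * Real.sign q) := by simp [hA]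
  have hBre : B.re = D + η ^ 2 := by simp [hB, hD, sq]; ring
  have hBim : B.im = -(2 * η * q) := by simp [hB, sq]; ring
  have hA1 : |D| ≤ ‖A‖ := hAre ▸ Complex.abs_re_le_norm A
  have hA2 : ε ≤ ‖A‖ := by
    have := Complex.abs_im_le_norm A
    rwa [hAim, abs_neg, abs_mul, hs, mul_one, abs_of_pos hε] at this
  have hBsq : ‖B‖ ^ 2 = ((ω - q) ^ 2 + η ^ 2) * ((ω + q) ^ 2 + η ^ 2) := by
    rw [← Complex.normSq_eq_norm_sq, Complex.normSq_apply, hBre, hBim, hD]; ring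
  have hB1 : |D| ≤ ‖B‖ := by
    refine abs_le_of_sq_le_sq ?_ (norm_nonneg _)
    · rw [hBsq, hD]; nlinarith [sq_nonneg (η * (ω - q)), sq_nonneg (η * (ω + q)), sq_nonneg (η ^ 2)]
  have hB2 : η * ω ≤ ‖B‖ := by
    refine (sq_le_sq₀ (by positivity) (norm_nonneg _)).1 ?_
    rw [hBsq]
    rcases le_total 0 q with h | h
    · have h1 : ω ^ 2 ≤ (ω + q) ^ 2 := by nlinarith
      nlinarith [sq_nonneg (ω - q), sq_nonneg η, mul_nonneg (sq_nonneg (ω - q)) (sq_nonneg (ω + q)),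
        mul_nonneg (sq_nonneg η) (sub_nonneg.2 h1), sq_nonneg (η * (ω - q)), sq_nonneg (η ^ 2)]
    · have h1 : ω ^ 2 ≤ (ω - q) ^ 2 := by nlinarith
      nlinarith [sq_nonneg (ω + q), sq_nonneg η, mul_nonneg (sq_nonneg (ω - q)) (sq_nonneg (ω + q)),
        mul_nonneg (sq_nonneg η) (sub_nonneg.2 h1), sq_nonneg (η * (ω + q)), sq_nonneg (η ^ 2)]
  have hApos : 0 < ‖A‖ := hε.trans_le hA2
  have hBpos : 0 < ‖B‖ := (mul_pos hη0 hω0).trans_le hB2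
  have hAB : B - A = ((η ^ 2 : ℝ) : ℂ) + ((-(ε * (q / ω - Real.sign q)) : ℝ) : ℂ) * Complex.I := by
    apply Complex.ext
    · rw [Complex.sub_re, hAre, hBre, Complex.add_re, Complex.re_ofReal_mul, Complex.ofReal_re,
        Complex.I_re]
      ring
    · rw [Complex.sub_im, hAim, hBim, Complex.add_im, Complex.im_ofReal_mul, Complex.ofReal_im,
        Complex.I_im, hη]
      field_simp; ring
  have hdiff : ‖B - A‖ ≤ η ^ 2 + ε * (|D| / ω ^ 2) := by
    rw [hAB]
    refine (norm_add_le _ _).trans ?_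
    rw [norm_mul, Complex.norm_I, mul_one, Complex.norm_real, Complex.norm_real,
      Real.norm_of_nonneg (sq_nonneg η), norm_neg, norm_mul, Real.norm_of_nonneg hε.le,
      Real.norm_eq_abs]
    gcongr
    exact (abs_sub_sign_le hω0).resolve_right hq
  have hAne : A ≠ 0 := norm_pos_iff.1 hApos
  have hBne : B ≠ 0 := norm_pos_iff.1 hBpos
  have e : 1 / A - 1 / B = (B - A) / (A * B) := by field_simp
  rw [e, norm_div, norm_mul, div_le_iff₀ (by positivity)]
  refine hdiff.trans ?_
  have h1 : η ^ 2 ≤ 1 / (2 * ω ^ 2) * (‖A‖ * ‖B‖) := by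
    calc η ^ 2 = 1 / (2 * ω ^ 2) * (ε * (η * ω)) := by rw [hη]; field_simp
      _ ≤ _ := by gcongr
  have h2 : ε * (|D| / ω ^ 2) ≤ 1 / ω ^ 2 * (‖A‖ * ‖B‖) := by
    calc ε * (|D| / ω ^ 2) = 1 / ω ^ 2 * (ε * |D|) := by ring
      _ ≤ _ := by gcongr
  calc _ ≤ 3 / (2 * ω ^ 2) * (‖A‖ * ‖B‖) := by
        refine (add_le_add h1 h2).trans (le_of_eq ?_)
        field_simp; ring
    _ ≤ _ := by gcongr

end Comparison

/-! ### Finite time horizon on the Fourier side. -/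

section Vanishing

variable {d : ℕ}

/-- At fixed spatial momentum, integration over the energy is Fourier inversion in time of the
partial transform A(t) = ∫ e^{ip'·y} φ(t, y) dy, evaluated at a time τ where φ vanishes. -/
theorem integral_minkFourier_fiber (φ : MinkTest d) {R : ℝ} (hR : ∀ x : Mink d, R ≤ |x.1| → φ x = 0)
    {τ : ℝ} (hτ : R ≤ |τ|) (p' : EuclideanSpace ℝ (Fin (d - 1)))
    (hi : Integrable fun s : ℝ => minkFourier φ (s, p')) :
    ∫ s : ℝ, minkFourier φ (s, p') * Complex.exp (Complex.I * ((s * τ : ℝ) : ℂ)) = 0 := by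
  set A : ℝ → ℂ := fun t => ∫ y : EuclideanSpace ℝ (Fin (d - 1)),
    Complex.exp (Complex.I * ((inner ℝ p' y : ℝ) : ℂ)) * (φ (t, y) : ℂ)
  have hφi : Integrable (fun x : Mink d => (φ x : ℂ)) :=
    (φ.continuous.integrable_of_hasCompactSupport φ.hasCompactSupport).ofReal
  have hiP : ∀ s : ℝ, Integrable (fun x : Mink d =>
      Complex.exp (Complex.I * (minkProd (s, p') x : ℂ)) * (φ x : ℂ)) (volume.prod volume) := by
    intro s
    rw [← Measure.volume_eq_prod]
    have hc : Continuous fun x : Mink d => minkProd (s, p') x := by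
      simp only [minkProd_eq]; fun_prop
    refine hφi.bdd_mul (c := 1) (Continuous.aestronglyMeasurable (by fun_prop))
      (.of_forall fun x => ?_)
    rw [norm_exp_I_mul_ofReal]
  have hA1 : ∀ s : ℝ, minkFourier φ (s, p') = ∫ t, Complex.exp (-(Complex.I * ((s * t : ℝ) : ℂ))) * A t := by
    intro s
    rw [minkFourier, Measure.volume_eq_prod, integral_prod _ (hiP s)]
    congr 1; ext t
    rw [← integral_const_mul]
    congr 1; ext y
    rw [← mul_assoc, ← Complex.exp_add, minkProd_eq]
    congr 2
    push_cast; ring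
  obtain ⟨B, hB⟩ := φ.continuous.bounded_above_of_compact_support φ.hasCompactSupport
  obtain ⟨r, hr⟩ := φ.hasCompactSupport.isBounded.subset_closedBall 0
  have hvan : ∀ t y, r < ‖y‖ → φ (t, y) = 0 := by
    intro t y hy
    by_contra hne
    have := hr (subset_tsupport _ hne)
    rw [mem_closedBall_zero_iff] at this
    exact absurd ((norm_snd_le ((t, y) : Mink d)).trans this) (not_le.2 hy)
  have hAc : Continuous A := by
    refine continuous_of_dominated (bound := (Metric.closedBall (0 : EuclideanSpace ℝ (Fin (d - 1))) r).indicator fun _ => B)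
      (fun t => ?_) (fun t => .of_forall fun y => ?_) ?_ (.of_forall fun y => ?_)
    · have := φ.continuous
      exact Continuous.aestronglyMeasurable (by fun_prop)
    · rw [norm_mul, norm_exp_I_mul_ofReal, one_mul, Complex.norm_real]
      by_cases hy : y ∈ Metric.closedBall (0 : EuclideanSpace ℝ (Fin (d - 1))) r
      · rw [Set.indicator_of_mem hy]; exact hB _
      · rw [Set.indicator_of_notMem hy, hvan t y (by simpa using hy)]; simp
    · exact (integrable_indicator_iff measurableSet_closedBall).2
        (integrableOn_const (isCompact_closedBall _ _).measure_lt_top.ne)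
    · have := φ.continuous
      fun_prop
  have hAi : Integrable A := by
    have h := (hiP 0).integral_prod_left
    refine h.congr (.of_forall fun t => ?_)
    simp only [A]
    congr 1; ext y
    rw [minkProd_eq]; simp
  have hF : ∀ v : ℝ, 𝓕 A v = minkFourier φ (2 * Real.pi * v, p') := by
    intro v
    rw [Real.fourier_eq', hA1]
    congr 1; ext t
    rw [smul_eq_mul]
    congr 2
    simp only [RCLike.inner_apply, conj_trivial]
    push_cast; ring
  have hFi : Integrable (𝓕 A) := by
    have := (integrable_comp_mul_left_iff (fun s : ℝ => minkFourier φ (s, p'))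
      (R := 2 * Real.pi) (by positivity)).2 hi
    exact this.congr (.of_forall fun v => (hF v).symm)
  have hinv := congrFun (hAc.fourierInv_fourier_eq hAi hFi) τ
  have hA0 : A τ = 0 := by
    simp only [A]
    rw [integral_eq_zero_of_ae (.of_forall fun y => ?_)]
    rw [hR (τ, y) hτ]; simp
  rw [hA0, Real.fourierInv_eq'] at hinv
  have hsub := Measure.integral_comp_mul_left (fun s : ℝ => minkFourier φ (s, p') *
    Complex.exp (Complex.I * ((s * τ : ℝ) : ℂ))) (2 * Real.pi)
  have e : ∀ v : ℝ, Complex.exp (((2 * Real.pi * inner ℝ v τ : ℝ) : ℂ) * Complex.I) • 𝓕 A v =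
      minkFourier φ (2 * Real.pi * v, p') *
        Complex.exp (Complex.I * ((2 * Real.pi * v * τ : ℝ) : ℂ)) := by
    intro v
    rw [hF, smul_eq_mul, mul_comm]
    congr 2
    simp only [RCLike.inner_apply, conj_trivial]
    push_cast; ring
  simp only [e] at hinv
  rw [hinv] at hsub
  have hne : |(2 * Real.pi)⁻¹| ≠ 0 := by positivity
  exact (smul_eq_zero.1 hsub.symm).resolve_left hne

/-- A multiplier depending on the spatial momentum alone does not enlarge the support in time;
Fubini reduces the claim to the fibres. -/
theorem integral_minkFourier_mul_eq_zero (φ : MinkTest d) {R : ℝ}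
    (hR : ∀ x : Mink d, R ≤ |x.1| → φ x = 0) {τ : ℝ} (hτ : R ≤ |τ|)
    {g : EuclideanSpace ℝ (Fin (d - 1)) → ℂ} (hgm : Measurable g) {C : ℝ} (hgC : ∀ y, ‖g y‖ ≤ C) :
    ∫ p : Mink d, minkFourier φ p * Complex.exp (Complex.I * ((p.1 * τ : ℝ) : ℂ)) * g p.2 = 0 := by
  have hi := integrable_minkFourier φ
  have h1 : Integrable (fun p : Mink d =>
      minkFourier φ p * Complex.exp (Complex.I * ((p.1 * τ : ℝ) : ℂ)) * g p.2) := by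
    have : Integrable (fun p : Mink d =>
        Complex.exp (Complex.I * ((p.1 * τ : ℝ) : ℂ)) * g p.2 * minkFourier φ p) := by
      refine hi.bdd_mul (c := C) (Measurable.aestronglyMeasurable (by fun_prop))
        (.of_forall fun p => ?_)
      rw [norm_mul, norm_exp_I_mul_ofReal, one_mul]; exact hgC _
    refine this.congr (.of_forall fun p => ?_)
    simp only; ring
  rw [Measure.volume_eq_prod] at h1 hi ⊢
  rw [integral_prod_symm _ h1]
  refine integral_eq_zero_of_ae ?_
  filter_upwards [hi.prod_left_ae] with p' hp'
  rw [integral_mul_const, integral_minkFourier_fiber φ hR hτ p' hp', zero_mul, Pi.zero_apply]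

end Vanishing

/-! ### The cone distribution in momentum space. -/

/-- The normalized kernel of the propagators. -/
def propKernel (N : ℕ) (a : ℝ) (c : ℂ) (w : ℝ) : ℂ :=
  (((2 * 4 ^ a * Real.pi ^ (N + a))⁻¹ : ℝ) : ℂ) * coneKernel a c w

theorem admissible_propKernel (N : ℕ) {a : ℝ} (ha : a = 0 ∨ a = 1 / 2) (c : ℂ) :
    Admissible (propKernel N a c) := (admissible_coneKernel ha c).const_mul _

theorem propKernel_of_nonneg (N : ℕ) (a : ℝ) (c : ℂ) {w : ℝ} (hw : 0 ≤ w) :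
    propKernel N a c w = 0 := by rw [propKernel, coneKernel_of_nonneg a c hw, mul_zero]

/-- For c = -M² one has c - |p⃗|² = -ω², and the plane-wave series becomes the sine series. -/
theorem integral_propKernel_planeWave {d N : ℕ} (hd : 2 ≤ d) {a : ℝ} (ha : a = 0 ∨ a = 1 / 2)
    (hn : (d : ℝ) = 2 * N + 2 + 2 * a) {M : ℝ} (hM : 0 < M) (p : Mink d) {t : ℝ} (ht : 0 < t) :
    ∫ y : EuclideanSpace ℝ (Fin (d - 1)), propKernel N a (-(M : ℂ) ^ 2) (‖y‖ ^ 2 - t ^ 2) *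
      (((‖y‖ ^ (2 * N))⁻¹ : ℝ) : ℂ) * polyExp (eulerPoly d N) (inner ℝ p.2 y) =
      ((Real.sin (energy M p * t) / energy M p : ℝ) : ℂ) := by
  have := nontrivial_space (d := d) (N := 0) (by omega)
  have hfin : (Module.finrank ℝ (EuclideanSpace ℝ (Fin (d - 1))) : ℝ) = d - 1 := by
    rw [finrank_euclideanSpace_fin, Nat.cast_sub (by omega)]; simp
  have h := hasSum_integral_planeWave ha ht N (by rw [hfin, hn]; ring) (-(M : ℂ) ^ 2) p.2
    (lam := fun k => ∏ i ∈ Finset.range N, (((d : ℝ) - 3 - 2 * i + k) / 2))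
    (f := polyExp (eulerPoly d N))
    (fun ξ => by simpa only [polyExpCoeff_eulerPoly] using hasSum_polyExp (eulerPoly d N) ξ)
    (fun k => by rw [hfin]; exact eulerCoeff_even ha hn k)
  have hω := energy_pos hM p
  have hω' : (energy M p : ℂ) ≠ 0 := by exact_mod_cast hω.ne'
  have hC : (((2 * 4 ^ a * Real.pi ^ (N + a)) : ℝ) : ℂ) ≠ 0 := by
    have : (0 : ℝ) < 2 * 4 ^ a * Real.pi ^ (N + a) := by positivity
    exact_mod_cast this.ne'
  have h2 := ((Complex.hasSum_sin ((energy M p * t : ℝ) : ℂ)).mul_right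
    (energy M p : ℂ)⁻¹).mul_left (((2 * 4 ^ a * Real.pi ^ (N + a)) : ℝ) : ℂ)
  have h3 := h.unique (h2.congr_fun fun m => by
    have hs : -(M : ℂ) ^ 2 - (‖p.2‖ : ℂ) ^ 2 = -(energy M p : ℂ) ^ 2 := by
      have : ((energy M p ^ 2 : ℝ) : ℂ) = ((M ^ 2 + ‖p.2‖ ^ 2 : ℝ) : ℂ) := by rw [energy_sq]
      push_cast at this
      rw [this]; ring
    rw [hs, neg_pow]
    push_cast
    rw [← pow_mul, mul_pow, pow_succ (energy M p : ℂ)]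
    field_simp)
  have e : ∀ y : EuclideanSpace ℝ (Fin (d - 1)), propKernel N a (-(M : ℂ) ^ 2) (‖y‖ ^ 2 - t ^ 2) *
      (((‖y‖ ^ (2 * N))⁻¹ : ℝ) : ℂ) * polyExp (eulerPoly d N) (inner ℝ p.2 y) =
      (((2 * 4 ^ a * Real.pi ^ (N + a))⁻¹ : ℝ) : ℂ) * (coneKernel a (-(M : ℂ) ^ 2)
        (‖y‖ ^ 2 - t ^ 2) * (((‖y‖ ^ (2 * N))⁻¹ : ℝ) : ℂ) *
          polyExp (eulerPoly d N) (inner ℝ p.2 y)) := fun y => by rw [propKernel]; ring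
  simp only [e]
  rw [integral_const_mul, h3, Complex.ofReal_inv, inv_mul_cancel_left₀ hC]
  push_cast
  rw [div_eq_mul_inv]

theorem abs_eq_of_sign {σ : ℝ} (hσ : σ = 1 ∨ σ = -1) (t : ℝ) : |σ * t| = |t| := by
  rcases hσ with rfl | rfl <;> simp

theorem integral_comp_sign_mul {σ : ℝ} (hσ : σ = 1 ∨ σ = -1) (f : ℝ → ℂ) :
    ∫ t, f (σ * t) = ∫ t, f t := by
  rcases hσ with rfl | rfl
  · simp
  · simpa using integral_neg_eq_self f volume

/-- Insert the Fourier representation of D_N φ, exchange the integrals and do the spatial one by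
`integral_propKernel_planeWave`. The cutoff at time R changes nothing because D_N φ vanishes beyond
it, and it is what makes Fubini applicable. -/
theorem coneDist_propKernel_eq {d N : ℕ} (hd : 2 ≤ d) {a : ℝ} (ha : a = 0 ∨ a = 1 / 2)
    (hn : (d : ℝ) = 2 * N + 2 + 2 * a) (hN : 2 * N + 1 ≤ d - 1) {σ : ℝ} (hσ : σ = 1 ∨ σ = -1)
    {M : ℝ} (hM : 0 < M) (φ : MinkTest d) {R : ℝ}
    (hR : ∀ x : Mink d, R ≤ |x.1| → eulerIter d N φ x = 0) :
    coneDist d σ N (propKernel N a (-(M : ℂ) ^ 2)) φ =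
      ((2 * (Real.pi : ℂ)) ^ d)⁻¹ * ∫ p, minkFourier φ p * cutoffSymbol σ M R 0 p := by
  have hσ2 : σ * σ = 1 := by rcases hσ with rfl | rfl <;> norm_num
  set K := propKernel N a (-(M : ℂ) ^ 2) with hK
  have hKa : Admissible K := admissible_propKernel N ha _
  set ind : ℝ → ℂ := fun s => if 0 < s ∧ s ≤ R then 1 else 0 with hind
  have hindm : Measurable ind :=
    Measurable.ite (measurableSet_Ioc (a := (0 : ℝ)) (b := R)) measurable_const measurable_const
  set W : Mink d → ℂ := fun x => ind (σ * x.1) * (K (minkSq x) * (((‖x.2‖ ^ (2 * N))⁻¹ : ℝ) : ℂ))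
    with hW
  have hWm : Measurable W := by
    have h1 := hKa.measurable
    have h2 := (continuous_minkSq (d := d)).measurable
    simp only [hW]; fun_prop
  -- Inside the cone |x⃗| ≤ |x⁰|, so the cutoff in time confines the weight to a ball.
  have hWball : ∀ x, W x ≠ 0 → ‖x‖ ≤ R := by
    intro x hx
    simp only [hW, hind] at hx
    have h1 : 0 < σ * x.1 ∧ σ * x.1 ≤ R := by
      by_contra hcon
      rw [if_neg hcon, zero_mul] at hx
      exact hx rfl
    have h2 : minkSq x < 0 := by
      by_contra hcon
      rw [hK, propKernel_of_nonneg N a _ (not_lt.1 hcon)] at hx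
      simp at hx
    have h3 : |x.1| = σ * x.1 := by rw [← abs_eq_of_sign hσ, abs_of_pos h1.1]
    have h4 : ‖x.2‖ ≤ |x.1| := by
      rw [minkSq_eq, sub_neg, ← sq_abs x.1] at h2
      exact ((sq_lt_sq₀ (norm_nonneg _) (abs_nonneg _)).1 h2).le
    exact max_le (by rw [Real.norm_eq_abs, h3]; exact h1.2) (h4.trans (h3.trans_le h1.2))
  have hWi : Integrable W := by
    have h := ((locallyIntegrable_coneWeight hN σ hKa).integrableOn_isCompact
      (isCompact_closedBall (0 : Mink d) R)).norm
    have h2 := (integrable_indicator_iff measurableSet_closedBall).2 h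
    refine h2.mono' hWm.aestronglyMeasurable (.of_forall fun x => ?_)
    by_cases hx : W x = 0
    · rw [hx, norm_zero]; exact Set.indicator_nonneg (fun _ _ => norm_nonneg _) _
    · rw [Set.indicator_of_mem (by simpa using hWball x hx)]
      simp only [hW, hind, coneWeight, heaviside]
      split_ifs with h1 h2 h2
      · simp
      · exact absurd h1.1 h2
      · rw [zero_mul, norm_zero]; exact norm_nonneg _
      · simp
  have hstep : coneDist d σ N K φ = ∫ x, W x * (eulerIter d N φ x : ℂ) := by
    rw [coneDist_apply hN σ hKa]
    congr 1; ext x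
    by_cases hx : R ≤ |x.1|
    · rw [hR x hx]; simp
    · have : σ * x.1 ≤ R := ((le_abs_self _).trans_eq (abs_eq_of_sign hσ _)).trans (not_le.1 hx).le
      simp only [hW, hind, coneWeight, heaviside, this, and_true]
      split_ifs <;> simp
  set q := eulerPoly d N with hq
  set G : Mink d → Mink d → ℂ := fun x p => W x * (minkFourier φ p *
    Complex.exp (Complex.I * ((p.1 * x.1 : ℝ) : ℂ)) * polyExp q (inner ℝ p.2 x.2)) with hG
  have hGi : Integrable (Function.uncurry G) (volume.prod volume) := by
    obtain ⟨C, hC0, k, hC⟩ := norm_polyExp_le q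
    refine (hWi.norm.mul_prod ((integrable_one_add_pow_mul_minkFourier φ k R).const_mul C)).mono'
      ?_ (.of_forall fun z => ?_)
    · have h1 := (continuous_minkFourier φ).measurable
      have h2 := (continuous_polyExp q).measurable
      refine Measurable.aestronglyMeasurable ?_
      simp only [hG, Function.uncurry_def]
      fun_prop
    · obtain ⟨x, p⟩ := z
      simp only [Function.uncurry_apply_pair, hG]
      by_cases hx : W x = 0
      · simp [hx]
      · rw [norm_mul (W x), norm_mul _ (polyExp q _), norm_mul (minkFourier φ p),
          norm_exp_I_mul_ofReal, mul_one]
        refine mul_le_mul_of_nonneg_left ?_ (norm_nonneg _)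
        have h1 : |(inner ℝ p.2 x.2 : ℝ)| ≤ ‖p‖ * R :=
          (abs_real_inner_le_norm _ _).trans (mul_le_mul (norm_snd_le p)
            ((norm_snd_le x).trans (hWball x hx)) (norm_nonneg _) (norm_nonneg _))
        calc _ ≤ ‖minkFourier φ p‖ * (C * (1 + ‖p‖ * R) ^ k) := by
              refine mul_le_mul_of_nonneg_left ((hC _).trans ?_) (norm_nonneg _)
              gcongr
          _ = _ := by ring
  rw [hstep]
  simp only [eulerIter_eq_integral hd φ N]
  have e1 : ∀ x : Mink d, W x * (((2 * (Real.pi : ℂ)) ^ d)⁻¹ * ∫ p : Mink d, minkFourier φ p *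
      Complex.exp (Complex.I * ((p.1 * x.1 : ℝ) : ℂ)) * polyExp (eulerPoly d N) (inner ℝ p.2 x.2)) =
      ((2 * (Real.pi : ℂ)) ^ d)⁻¹ * ∫ p, G x p := by
    intro x
    simp only [hG]
    rw [integral_const_mul]; ring
  simp only [e1]
  rw [integral_const_mul, integral_integral_swap hGi]
  congr 1
  refine integral_congr_ae ?_
  filter_upwards [hGi.prod_left_ae] with p hp
  have hp' : Integrable (fun x => G x p) (volume.prod volume) := hp
  have e2 : ∫ x, G x p = ∫ t : ℝ, ∫ y : EuclideanSpace ℝ (Fin (d - 1)), G (t, y) p := by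
    rw [Measure.volume_eq_prod]; exact integral_prod _ hp'
  set H : ℝ → ℂ := fun s => ind s * (minkFourier φ p *
    (Complex.exp (Complex.I * ((σ * p.1 * s : ℝ) : ℂ)) *
      ((Real.sin (energy M p * s) / energy M p : ℝ) : ℂ))) with hH
  have e3 : ∀ t : ℝ, ∫ y : EuclideanSpace ℝ (Fin (d - 1)), G (t, y) p = H (σ * t) := by
    intro t
    simp only [hG, hW, hH]
    by_cases ht : 0 < σ * t
    · have h1 := integral_propKernel_planeWave hd ha hn hM p ht
      rw [← h1, ← integral_const_mul, ← integral_const_mul, ← integral_const_mul]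
      congr 1; ext y
      have h2 : minkSq ((t, y) : Mink d) = ‖y‖ ^ 2 - (σ * t) ^ 2 := by
        rw [minkSq_eq]
        have : (σ * t) ^ 2 = σ * σ * t ^ 2 := by ring
        rw [this, hσ2, one_mul]
      have h3 : σ * p.1 * (σ * t) = p.1 * t := by
        have : σ * p.1 * (σ * t) = σ * σ * (p.1 * t) := by ring
        rw [this, hσ2, one_mul]
      rw [h2, h3]
      ring
    · have h0 : ind (σ * t) = 0 := if_neg fun h => ht h.1
      simp only [h0, zero_mul, integral_zero]
  rw [e2]
  simp only [e3]
  rw [integral_comp_sign_mul hσ, cutoffSymbol, ← integral_const_mul,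
    ← integral_indicator measurableSet_Ioc]
  congr 1; ext s
  simp only [hH, hind, Set.indicator, Set.mem_Ioc]
  split_ifs with hs
  · rw [one_mul]
    congr 3
    push_cast; ring
  · rw [zero_mul]

theorem exists_time_bound {d : ℕ} (φ : MinkTest d) :
    ∃ R : ℝ, 0 < R ∧ ∀ x : Mink d, R ≤ |x.1| → φ x = 0 := by
  obtain ⟨r, hr⟩ := φ.hasCompactSupport.isBounded.subset_ball 0
  refine ⟨max r 1, by positivity, fun x hx => ?_⟩
  by_contra hne
  have := hr (subset_tsupport _ hne)
  rw [mem_ball_zero_iff] at this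
  exact absurd ((norm_fst_le x).trans_lt this) (not_lt.2 ((le_max_left _ _).trans hx))

/-! ### The limit ε ↘ 0: identification of the massive propagators. -/

section Limit

variable {d : ℕ} {σ M R : ℝ}

theorem measurable_cutoffSymbol (σ M R : ℝ) {g : Mink d → ℝ} (hg : Measurable g) :
    Measurable fun p => cutoffSymbol σ M R (g p) p := by
  have h2 := (continuous_energy (d := d) M).measurable
  refine (StronglyMeasurable.integral_prod_right' (f := fun z : Mink d × ℝ =>
    Complex.exp (-(((g z.1 : ℝ) - Complex.I * ((σ * z.1.1 : ℝ) : ℂ)) * z.2)) *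
    ((Real.sin (energy M z.1 * z.2) / energy M z.1 : ℝ) : ℂ)) ?_).measurable
  exact Measurable.stronglyMeasurable (by fun_prop)

theorem norm_cutoffSymbol_le (hM : 0 < M) (hR : 0 < R) {η : ℝ} (hη : 0 ≤ η) (p : Mink d) :
    ‖cutoffSymbol σ M R η p‖ ≤ M⁻¹ * R := by
  have h := norm_setIntegral_le_of_norm_le_const (μ := volume) (s := Set.Ioc (0 : ℝ) R) (C := M⁻¹)
    (f := fun t : ℝ => Complex.exp (-((η - Complex.I * ((σ * p.1 : ℝ) : ℂ)) * t)) *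
    ((Real.sin (energy M p * t) / energy M p : ℝ) : ℂ)) measure_Ioc_lt_top fun t ht => ?_
  · simpa [hR.le, cutoffSymbol] using h
  · rw [norm_mul, norm_exp_neg_sub_I_mul]
    refine (mul_le_of_le_one_left (norm_nonneg _) (Real.exp_le_one_iff.2 ?_)).trans
      ((norm_sin_div_le (energy_pos hM p) t).trans (inv_anti₀ hM (le_energy p)))
    have := mul_nonneg hη ht.1.le
    linarith

theorem continuous_cutoffSymbol (hR : 0 < R) (p : Mink d) :
    Continuous fun η : ℝ => cutoffSymbol σ M R η p := by
  have : (fun η : ℝ => cutoffSymbol σ M R η p) = fun η : ℝ => ∫ t in (0 : ℝ)..R,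
      Complex.exp (-((η - Complex.I * ((σ * p.1 : ℝ) : ℂ)) * t)) *
        ((Real.sin (energy M p * t) / energy M p : ℝ) : ℂ) := by
    ext η; rw [intervalIntegral.integral_of_le hR.le]; rfl
  rw [this]
  refine intervalIntegral.continuous_parametric_intervalIntegral_of_continuous' ?_ _ _
  simp only [Function.uncurry_def]
  fun_prop

/-- The regularized symbol. -/
def dampedSymbol (σ M ε : ℝ) (p : Mink d) : ℂ :=
  1 / ((energy M p : ℂ) ^ 2 +
    (((ε / (2 * energy M p) : ℝ) : ℂ) - Complex.I * ((σ * p.1 : ℝ) : ℂ)) ^ 2)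

theorem integrableOn_exp_neg_mul {η : ℝ} (hη : 0 < η) (R : ℝ) :
    IntegrableOn (fun t => Real.exp (-(η * t))) (Set.Ioi R) := by
  simpa only [neg_mul] using exp_neg_integrableOn_Ioi R hη

theorem integral_exp_neg_mul_le {η : ℝ} (hη : 0 < η) (hR : 0 ≤ R) :
    ∫ t in Set.Ioi R, Real.exp (-(η * t)) ≤ η⁻¹ := by
  have h := integral_exp_mul_Ioi (a := -η) (by linarith) R
  simp only [neg_mul] at h
  rw [h, neg_div_neg_eq, div_eq_mul_inv]
  exact mul_le_of_le_one_left (by positivity) (Real.exp_le_one_iff.2 (by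
    have := mul_nonneg hη.le hR; linarith))

/-- The Laplace integral is at most ω⁻¹η⁻¹, and with η = ε/(2ω) the energy drops out. -/
theorem norm_dampedSymbol_le (hM : 0 < M) {ε : ℝ} (hε : 0 < ε) (p : Mink d) :
    ‖dampedSymbol σ M ε p‖ ≤ 2 / ε := by
  have hω := energy_pos hM p
  have hη : 0 < ε / (2 * energy M p) := by positivity
  rw [dampedSymbol, ← integral_exp_mul_sin hη hω]
  refine (norm_integral_le_of_norm_le ((integrableOn_exp_neg_mul hη 0).const_mul (energy M p)⁻¹)
    (.of_forall fun t => ?_)).trans ?_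
  · rw [norm_mul, norm_exp_neg_sub_I_mul, mul_comm]
    exact mul_le_mul_of_nonneg_right (norm_sin_div_le hω t) (Real.exp_pos _).le
  · rw [integral_const_mul]
    calc _ ≤ (energy M p)⁻¹ * (ε / (2 * energy M p))⁻¹ := by
          gcongr; exact integral_exp_neg_mul_le hη le_rfl
      _ = _ := by field_simp

theorem measurable_dampedSymbol (σ M ε : ℝ) : Measurable (dampedSymbol (d := d) σ M ε) := by
  unfold dampedSymbol
  have h2 := (continuous_energy (d := d) M).measurable
  fun_prop

/-- The part t > R of the Laplace integral contributes nothing: the damping depends on p only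
through the spatial momentum, so for each such t the momentum integral vanishes by
`integral_minkFourier_mul_eq_zero`. A cutoff independent of ε is thus exact, and the limit ε → 0 is
taken on a bounded time interval. -/
theorem integral_minkFourier_mul_dampedSymbol (hσ : σ = 1 ∨ σ = -1) (hM : 0 < M) (hR0 : 0 < R)
    (φ : MinkTest d) (hR : ∀ x : Mink d, R ≤ |x.1| → φ x = 0) {ε : ℝ} (hε : 0 < ε) :
    ∫ p, minkFourier φ p * dampedSymbol σ M ε p =
      ∫ p, minkFourier φ p * cutoffSymbol σ M R (ε / (2 * energy M p)) p := by
  have hΦ := integrable_minkFourier φ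
  have hωm := (continuous_energy (d := d) M).measurable
  set η : Mink d → ℝ := fun p => ε / (2 * energy M p) with hη
  have hηm : Measurable η := by fun_prop
  have hη0 : ∀ p, 0 < η p := fun p => by have := energy_pos hM p; positivity
  set k : Mink d → ℝ → ℂ := fun p t => Complex.exp (-((η p - Complex.I * ((σ * p.1 : ℝ) : ℂ)) * t)) *
    ((Real.sin (energy M p * t) / energy M p : ℝ) : ℂ) with hk
  have hkn : ∀ p t, ‖k p t‖ ≤ (energy M p)⁻¹ * Real.exp (-(η p * t)) := fun p t => by
    simp only [hk]
    rw [norm_mul, norm_exp_neg_sub_I_mul, mul_comm]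
    exact mul_le_mul_of_nonneg_right (norm_sin_div_le (energy_pos hM p) t) (Real.exp_pos _).le
  have hki : ∀ p r, IntegrableOn (k p) (Set.Ioi r) := fun p r =>
    ((integrableOn_exp_neg_mul (hη0 p) r).const_mul _).mono'
      (Measurable.aestronglyMeasurable (by fun_prop)) (.of_forall (hkn p))
  have hsplit : ∀ p, dampedSymbol σ M ε p = cutoffSymbol σ M R (η p) p +
      ∫ t in Set.Ioi R, k p t := by
    intro p
    rw [dampedSymbol, ← integral_exp_mul_sin (hη0 p) (energy_pos hM p), cutoffSymbol,
      ← setIntegral_union (Set.Ioc_disjoint_Ioi le_rfl) measurableSet_Ioi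
      ((hki p 0).mono_set Set.Ioc_subset_Ioi_self) (hki p R), Set.Ioc_union_Ioi_eq_Ioi hR0.le]
  have hprod : Integrable (Function.uncurry fun p t => minkFourier φ p * k p t)
      (volume.prod (volume.restrict (Set.Ioi R))) := by
    have hm : Measurable (Function.uncurry fun p t => minkFourier φ p * k p t) := by
      have h1 := (continuous_minkFourier φ).measurable
      simp only [hk, Function.uncurry_def]
      fun_prop
    rw [integrable_prod_iff hm.aestronglyMeasurable]
    refine ⟨.of_forall fun p => Integrable.const_mul (hki p R) (minkFourier φ p), ?_⟩
    refine (hΦ.norm.const_mul (2 / ε)).mono'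
      hm.norm.stronglyMeasurable.integral_prod_right'.aestronglyMeasurable (.of_forall fun p => ?_)
    rw [Real.norm_of_nonneg (integral_nonneg fun _ => norm_nonneg _)]
    simp only [Function.uncurry_apply_pair, norm_mul]
    rw [integral_const_mul, mul_comm]
    refine mul_le_mul_of_nonneg_right ?_ (norm_nonneg _)
    refine (integral_mono_of_nonneg (.of_forall fun _ => norm_nonneg _)
      ((integrableOn_exp_neg_mul (hη0 p) R).const_mul _) (.of_forall (hkn p))).trans ?_
    rw [integral_const_mul]
    have := energy_pos hM p
    calc _ ≤ (energy M p)⁻¹ * (η p)⁻¹ := by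
          gcongr; exact integral_exp_neg_mul_le (hη0 p) hR0.le
      _ = _ := by simp only [hη]; field_simp
  have hzero : ∫ p, minkFourier φ p * ∫ t in Set.Ioi R, k p t = 0 := by
    simp only [← integral_const_mul]
    rw [integral_integral_swap hprod]
    refine setIntegral_eq_zero_of_forall_eq_zero fun t ht => ?_
    have ht' : R < t := ht
    have h := integral_minkFourier_mul_eq_zero φ hR (τ := σ * t)
      (by rw [abs_eq_of_sign hσ]; exact ht'.le.trans (le_abs_self t))
      (g := fun y => ((Real.exp (-(η (0, y) * t)) * (Real.sin (energy M ((0, y) : Mink d) * t) /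
        energy M ((0, y) : Mink d)) : ℝ) : ℂ)) (by fun_prop) (C := M⁻¹) (fun y => by
          rw [Complex.ofReal_mul, norm_mul, Complex.norm_real, Real.norm_of_nonneg (Real.exp_pos _).le]
          refine (mul_le_of_le_one_left (norm_nonneg _) (Real.exp_le_one_iff.2 ?_)).trans
            ((norm_sin_div_le (energy_pos hM _) t).trans (inv_anti₀ hM (le_energy _)))
          have := mul_pos (hη0 (0, y)) (hR0.trans ht')
          linarith)
    rw [← h]
    congr 1; ext p
    have e1 : energy M ((0, p.2) : Mink d) = energy M p := rfl
    have e2 : η ((0, p.2) : Mink d) = η p := rfl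
    simp only [hk, e1, e2]
    have e3 : -((η p - Complex.I * ((σ * p.1 : ℝ) : ℂ)) * t) =
      Complex.I * ((p.1 * (σ * t) : ℝ) : ℂ) + ((-(η p * t) : ℝ) : ℂ) := by push_cast; ring
    rw [e3, Complex.exp_add]
    push_cast; ring
  have hi1 : Integrable fun p => minkFourier φ p * cutoffSymbol σ M R (η p) p := by
    refine (hΦ.bdd_mul (c := M⁻¹ * R) (measurable_cutoffSymbol σ M R hηm).aestronglyMeasurable
      (.of_forall fun p => norm_cutoffSymbol_le hM hR0 (hη0 p).le p)).congr (.of_forall fun p => ?_)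
    exact mul_comm _ _
  have hi2 : Integrable fun p => minkFourier φ p * ∫ t in Set.Ioi R, k p t := by
    refine hprod.integral_prod_left.congr (.of_forall fun p => ?_)
    simp only [Function.uncurry_apply_pair]
    rw [integral_const_mul]
  simp only [hsplit, mul_add]
  rw [integral_add hi1 hi2, hzero, add_zero]

/-- The prescribed integrand minus the damped one tends to 0 under a uniform bound; the damped one
equals the cut-off one with η = ε/(2ω), which converges to the cut-off symbol at η = 0; and that is
the cone distribution. -/
theorem isMassivePropagator_coneDist {N : ℕ} (hd : 2 ≤ d) {a : ℝ} (ha : a = 0 ∨ a = 1 / 2)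
    (hn : (d : ℝ) = 2 * N + 2 + 2 * a) (hN : 2 * N + 1 ≤ d - 1) (hσ : σ = 1 ∨ σ = -1)
    (hM : 0 < M) : IsMassivePropagator σ M (coneDist d σ N (propKernel N a (-(M : ℂ) ^ 2))) := by
  intro φ
  obtain ⟨R₁, hR₁0, hR₁⟩ := exists_time_bound φ
  obtain ⟨R₂, -, hR₂⟩ := exists_time_bound (eulerIter d N φ)
  -- The horizon must serve φ, for dropping the late times, and D_N φ, for the representation of the
  -- cone distribution.
  set R := max R₁ R₂ with hRdef
  have hR0 : 0 < R := lt_max_of_lt_left hR₁0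
  have hR : ∀ x : Mink d, R ≤ |x.1| → φ x = 0 := fun x hx => hR₁ x ((le_max_left _ _).trans hx)
  have hR' : ∀ x : Mink d, R ≤ |x.1| → eulerIter d N φ x = 0 :=
    fun x hx => hR₂ x ((le_max_right _ _).trans hx)
  rw [coneDist_propKernel_eq hd ha hn hN hσ hM φ hR']
  refine Tendsto.const_mul _ ?_
  have hΦ := integrable_minkFourier φ
  have hΦm := (continuous_minkFourier φ).measurable
  have hωm := (continuous_energy (d := d) M).measurable
  set F : ℝ → Mink d → ℂ := fun ε p => 1 / ((M : ℂ) ^ 2 + (minkSq p : ℂ) -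
    Complex.I * (σ : ℂ) * (ε : ℂ) * (Real.sign p.1 : ℂ)) with hF
  have hsign : Measurable Real.sign := by
    have : Real.sign = fun r : ℝ => if r < 0 then -1 else if 0 < r then (1 : ℝ) else 0 := rfl
    rw [this]
    exact Measurable.ite measurableSet_Iio measurable_const
      (Measurable.ite measurableSet_Ioi measurable_const measurable_const)
  have hFm : ∀ ε, Measurable (F ε) := fun ε => by
    have h2 := (continuous_minkSq (d := d)).measurable
    simp only [hF]; fun_prop
  have hFe : ∀ ε (p : Mink d), F ε p = 1 / (((energy M p ^ 2 - (σ * p.1) ^ 2 : ℝ) : ℂ) -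
      Complex.I * ε * (Real.sign (σ * p.1) : ℂ)) := by
    intro ε p
    have h1 : energy M p ^ 2 - (σ * p.1) ^ 2 = M ^ 2 + minkSq p := by
      rw [energy_sq, minkSq_eq]; rcases hσ with rfl | rfl <;> ring
    have h2 : Real.sign (σ * p.1) = σ * Real.sign p.1 := by
      rcases hσ with rfl | rfl
      · simp
      · simp [Real.sign_neg]
    simp only [hF]
    rw [h1, h2]; push_cast; congr 2; ring
  have hne : ∀ᵐ p : Mink d, p.1 ≠ 0 := by
    have : ∀ᵐ t : ℝ, t ≠ 0 := Measure.ae_ne volume 0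
    rw [Measure.volume_eq_prod]
    exact Measure.quasiMeasurePreserving_fst.ae this
  have hDne := ae_minkSq_ne hd (-M ^ 2)
  have hq : ∀ p : Mink d, p.1 ≠ 0 → σ * p.1 ≠ 0 := fun p hp =>
    mul_ne_zero (by rcases hσ with rfl | rfl <;> norm_num) hp
  have hcmp : ∀ ε > 0, ∀ᵐ p : Mink d, ‖minkFourier φ p * (F ε p - dampedSymbol σ M ε p)‖ ≤
      ‖minkFourier φ p‖ * (3 / (2 * M ^ 2)) := by
    intro ε hε
    filter_upwards [hne] with p hp
    rw [norm_mul, hFe, dampedSymbol]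
    exact mul_le_mul_of_nonneg_left (norm_resolvent_sub_le hM (le_energy p) (hq p hp) hε)
      (norm_nonneg _)
  have hdm := fun ε => measurable_dampedSymbol (d := d) σ M ε
  have lim1 : Tendsto (fun ε => ∫ p, minkFourier φ p * (F ε p - dampedSymbol σ M ε p))
      (𝓝[>] 0) (𝓝 (∫ p : Mink d, (0 : ℂ))) := by
    refine tendsto_integral_filter_of_dominated_convergence
      (fun p => ‖minkFourier φ p‖ * (3 / (2 * M ^ 2)))
      (.of_forall fun ε => (hΦm.mul ((hFm ε).sub (hdm ε))).aestronglyMeasurable) ?_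
      (hΦ.norm.mul_const _) ?_
    · filter_upwards [self_mem_nhdsWithin] with ε hε using hcmp ε hε
    · filter_upwards [hDne] with p hD
      have hω := energy_pos hM p
      have hD' : ((energy M p ^ 2 - (σ * p.1) ^ 2 : ℝ) : ℂ) ≠ 0 := by
        have h1 : energy M p ^ 2 - (σ * p.1) ^ 2 = M ^ 2 + minkSq p := by
          rw [energy_sq, minkSq_eq]; rcases hσ with rfl | rfl <;> ring
        rw [h1]
        exact_mod_cast fun h => hD (by linarith)
      have c1 : ContinuousAt (fun ε : ℝ => 1 / (((energy M p ^ 2 - (σ * p.1) ^ 2 : ℝ) : ℂ) -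
          Complex.I * ε * (Real.sign (σ * p.1) : ℂ))) 0 := by
        refine ContinuousAt.div continuousAt_const (Continuous.continuousAt (by fun_prop)) ?_
        simpa using hD'
      have c2 : ContinuousAt (fun ε : ℝ => dampedSymbol σ M ε p) 0 := by
        refine ContinuousAt.div continuousAt_const (Continuous.continuousAt (by fun_prop)) ?_
        convert! hD' using 1
        push_cast
        linear_combination (((σ : ℂ) * p.1) ^ 2) * Complex.I_sq
      have h := (c1.sub c2).tendsto
      have e0 : (1 / (((energy M p ^ 2 - (σ * p.1) ^ 2 : ℝ) : ℂ) -
          Complex.I * ((0 : ℝ) : ℂ) * (Real.sign (σ * p.1) : ℂ))) - dampedSymbol σ M 0 p = 0 := by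
        rw [sub_eq_zero, dampedSymbol]
        congr 1
        push_cast
        linear_combination (-((σ : ℂ) * p.1) ^ 2) * Complex.I_sq
      rw [Pi.sub_apply, e0] at h
      simp only [hFe]
      simpa using (h.const_mul (minkFourier φ p)).mono_left nhdsWithin_le_nhds
  have lim2 : Tendsto (fun ε => ∫ p, minkFourier φ p * cutoffSymbol σ M R (ε / (2 * energy M p)) p)
      (𝓝[>] 0) (𝓝 (∫ p, minkFourier φ p * cutoffSymbol σ M R 0 p)) := by
    refine tendsto_integral_filter_of_dominated_convergence
      (fun p => ‖minkFourier φ p‖ * (M⁻¹ * R))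
      (.of_forall fun ε => (hΦm.mul (measurable_cutoffSymbol σ M R
        (by fun_prop))).aestronglyMeasurable) ?_ (hΦ.norm.mul_const _) ?_
    · filter_upwards [self_mem_nhdsWithin] with ε hε
      have hε' : 0 < ε := hε
      refine .of_forall fun p => ?_
      rw [norm_mul]
      have := energy_pos hM p
      exact mul_le_mul_of_nonneg_left (norm_cutoffSymbol_le hM hR0 (by positivity) p) (norm_nonneg _)
    · refine .of_forall fun p => Tendsto.const_mul _ (Tendsto.mono_left ?_ nhdsWithin_le_nhds)
      have h1 : Continuous fun ε : ℝ => cutoffSymbol σ M R (ε / (2 * energy M p)) p :=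
        (continuous_cutoffSymbol hR0 p).comp (by fun_prop)
      simpa using h1.tendsto 0
  have hsum := lim1.add lim2
  rw [integral_zero, zero_add] at hsum
  refine hsum.congr' ?_
  filter_upwards [self_mem_nhdsWithin] with ε hε
  have hε' : 0 < ε := hε
  rw [← integral_minkFourier_mul_dampedSymbol hσ hM hR0 φ hR hε', ← integral_add]
  · congr 1; ext p
    simp only [hF]
    rw [← mul_add, sub_add_cancel, mul_one_div]
    rfl
  · exact (hΦ.norm.mul_const _).mono' (hΦm.mul ((hFm ε).sub (hdm ε))).aestronglyMeasurable
      (hcmp ε hε')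
  · refine (hΦ.norm.mul_const (2 / ε)).mono' (hΦm.mul (hdm ε)).aestronglyMeasurable
      (.of_forall fun p => ?_)
    rw [norm_mul]
    exact mul_le_mul_of_nonneg_left (norm_dampedSymbol_le hM hε' p) (norm_nonneg _)

end Limit

/-! ### The Green equation and its continuation in the mass. -/

instance isAddHaarMeasure_mink (d : ℕ) : (volume : Measure (Mink d)).IsAddHaarMeasure := by
  rw [Measure.volume_eq_prod]; infer_instance

/-- The d'Alembertian on test functions. -/
def boxTest {d : ℕ} (φ : MinkTest d) : MinkTest d :=
  -(∂_{((1, 0) : Mink d)} (∂_{((1, 0) : Mink d)} φ)) +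
    ∑ i : Fin (d - 1), ∂_{((0, EuclideanSpace.single i 1) : Mink d)}
      (∂_{((0, EuclideanSpace.single i 1) : Mink d)} φ)

theorem dAlembert_apply {d : ℕ} (T : MinkDist d) (φ : MinkTest d) :
    dAlembert T φ = T (boxTest φ) := by
  have h : ∀ v : Mink d, (∂_{v} (∂_{v} T)) φ = T (∂_{v} (∂_{v} φ)) := fun v => by
    rw [Distribution.lineDerivOp_apply_apply, Distribution.lineDerivOp_apply_apply,
      LineDeriv.lineDerivOp_neg,
      neg_neg]
  have h2 : dAlembert T φ = -((∂_{((1, 0) : Mink d)} (∂_{((1, 0) : Mink d)} T)) φ) +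
    ∑ i : Fin (d - 1), (∂_{((0, EuclideanSpace.single i 1) : Mink d)}
      (∂_{((0, EuclideanSpace.single i 1) : Mink d)} T)) φ := by
    let ev : MinkDist d →+ ℂ := ⟨⟨fun T => T φ, rfl⟩, fun _ _ => rfl⟩
    exact congrArg (_ + ·) (map_sum ev _ _)
  rw [h2, boxTest, map_add, map_neg, map_sum, h]
  simp only [h]

/-- The two sign changes of each second derivative cancel, so □ passes to the test function
unchanged. -/
theorem isGreenFunction_iff {d : ℕ} {c : ℝ} {G : MinkDist d} :
    IsGreenFunction c G ↔ ∀ φ : MinkTest d, c * G φ - G (boxTest φ) = φ 0 := by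
  rw [IsGreenFunction, DFunLike.ext_iff]
  refine forall_congr' fun φ => ?_
  rw [Distribution.mapCLM_apply, Distribution.delta_apply, ← dAlembert_apply]
  rfl

theorem lineDerivOp_test_apply {d : ℕ} (φ : MinkTest d) (v x : Mink d) :
    (∂_{v} φ) x = fderiv ℝ φ x v := by
  rw [TestFunction.lineDerivOp_eq_lineDerivCLM ℝ,
    TestFunction.lineDerivCLM_apply_of_le (by simp)]
  exact ((φ.contDiff.differentiable (by simp)) x).lineDeriv_eq_fderiv

theorem integrable_exp_mul_test {d : ℕ} (ψ : MinkTest d) (p : Mink d) : Integrable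
    (fun x : Mink d => Complex.exp (Complex.I * (minkProd p x : ℂ)) * (ψ x : ℂ)) := by
  have hec : Continuous fun x : Mink d => Complex.exp (Complex.I * (minkProd p x : ℂ)) := by
    simp only [minkProd_eq]; fun_prop
  have h1 : Continuous fun x : Mink d =>
    Complex.exp (Complex.I * (minkProd p x : ℂ)) * (ψ x : ℂ) :=
      hec.mul (Complex.continuous_ofReal.comp ψ.continuous)
  refine h1.integrable_of_hasCompactSupport ?_
  exact (ψ.hasCompactSupport.comp_left (g := ((↑) : ℝ → ℂ)) rfl).mul_left

/-- The Fourier transform at a fixed frequency as a linear functional. -/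
def minkFourierLM {d : ℕ} (p : Mink d) : MinkTest d →ₗ[ℝ] ℂ where
  toFun φ := minkFourier φ p
  map_add' φ ψ := by
    rw [minkFourier, minkFourier, minkFourier,
      ← integral_add (integrable_exp_mul_test φ p) (integrable_exp_mul_test ψ p)]
    simp [mul_add]
  map_smul' c φ := by
    rw [minkFourier, minkFourier, RingHom.id_apply, Complex.real_smul, ← integral_const_mul]
    congr 1; ext x
    have : (c • φ) x = c * φ x := rfl
    rw [this]
    push_cast; ring

theorem minkFourierLM_apply {d : ℕ} (p : Mink d) (φ : MinkTest d) :
    minkFourierLM p φ = minkFourier φ p := rfl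

theorem minkFourier_lineDerivOp {d : ℕ} (φ : MinkTest d) (v p : Mink d) :
    minkFourier (∂_{v} φ) p = -(Complex.I * (minkProd p v : ℂ)) * minkFourier φ p := by
  have hd : ∀ x : Mink d, HasFDerivAt (fun x : Mink d => (φ x : ℂ))
      (Complex.ofRealCLM ∘L fderiv ℝ φ x) x := fun x =>
    Complex.ofRealCLM.hasFDerivAt.comp x ((φ.contDiff.differentiable (by simp)) x).hasFDerivAt
  let L : Mink d →L[ℝ] ℝ := -(p.1 • ContinuousLinearMap.fst ℝ ℝ (EuclideanSpace ℝ (Fin (d - 1)))) +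
    (innerSL ℝ p.2) ∘L ContinuousLinearMap.snd ℝ ℝ (EuclideanSpace ℝ (Fin (d - 1)))
  have hL : ∀ x, L x = minkProd p x := fun x => by
    rw [minkProd_eq]; simp [L]
  have he : ∀ x : Mink d, HasFDerivAt (fun x : Mink d => Complex.exp (Complex.I * (minkProd p x : ℂ)))
      (Complex.exp (Complex.I * (minkProd p x : ℂ)) • (Complex.I • (Complex.ofRealCLM ∘L L))) x :=
    fun x => by
      simp only [← hL]
      exact ((Complex.ofRealCLM ∘L L).hasFDerivAt.const_mul Complex.I).cexp
  have hi := fun ψ : MinkTest d => integrable_exp_mul_test ψ p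
  have key := integral_bilinear_hasFDerivAt_right_eq_neg_left_of_integrable
    (μ := (volume : Measure (Mink d))) (v := v) (B := ContinuousLinearMap.mul ℝ ℂ)
    (f := fun x : Mink d => Complex.exp (Complex.I * (minkProd p x : ℂ)))
    (g := fun x : Mink d => (φ x : ℂ)) (f' := fun x => 
      Complex.exp (Complex.I * (minkProd p x : ℂ)) • (Complex.I • (Complex.ofRealCLM ∘L L)))
    (g' := fun x => Complex.ofRealCLM ∘L fderiv ℝ φ x)
    (by
      refine ((hi φ).const_mul (Complex.I * minkProd p v)).congr (.of_forall fun x => ?_)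
      simp [hL]; ring)
    (by
      refine (hi (∂_{v} φ)).congr (.of_forall fun x => ?_)
      simp [lineDerivOp_test_apply])
    (hi φ) (fun x _ => he x) (fun x _ => hd x)
  rw [minkFourier, minkFourier, ← integral_const_mul]
  simp only [ContinuousLinearMap.mul_apply'] at key
  simp only [lineDerivOp_test_apply]
  refine key.trans ?_
  rw [← integral_neg]
  refine integral_congr_ae (.of_forall fun x => ?_)
  simp [hL]; ring

theorem minkFourier_boxTest {d : ℕ} (φ : MinkTest d) (p : Mink d) :
    minkFourier (boxTest φ) p = -(minkSq p : ℂ) * minkFourier φ p := by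
  rw [← minkFourierLM_apply, boxTest, map_add, map_neg, map_sum]
  simp only [minkFourierLM_apply, minkFourier_lineDerivOp]
  have h1 : minkProd p (1, 0) = -p.1 := by simp [minkProd]
  have h2 : ∀ i, minkProd p (0, EuclideanSpace.single i 1) = p.2 i := fun i => by
    simp [minkProd]
  have h3 : (minkSq p : ℂ) = -((p.1 : ℂ) * p.1) + ∑ i, (p.2 i : ℂ) * p.2 i := by
    rw [minkSq, minkProd]; push_cast; rfl
  simp only [h1, h2]
  have h4 : ∀ i, -(Complex.I * (p.2 i : ℂ)) * (-(Complex.I * (p.2 i : ℂ)) * minkFourier φ p) =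
      -((p.2 i : ℂ) * p.2 i) * minkFourier φ p := fun i => by
    linear_combination ((p.2 i : ℂ) * p.2 i * minkFourier φ p) * Complex.I_mul_I
  simp only [h4]
  rw [← Finset.sum_mul, Finset.sum_neg_distrib, h3]
  push_cast
  linear_combination -(p.1 : ℂ) * p.1 * minkFourier φ p * Complex.I_mul_I

/-- The parameter c enters the kernel only through c^j/j!. On the support of D_N φ one has |x²|/4 ≤
R²/4, so the j-th coefficient grows at most geometrically and the series is entire in c. -/
theorem hasSum_coneDist_propKernel {d N : ℕ} (h : 2 * N + 1 ≤ d - 1) (σ : ℝ) {a : ℝ}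
    (ha : a = 0 ∨ a = 1 / 2) (φ : MinkTest d) : ∃ b : ℕ → ℂ, ∃ A B : ℝ, (∀ j, ‖b j‖ ≤ B * A ^ j) ∧
      ∀ c : ℂ, HasSum (fun j => c ^ j / j.factorial * b j) (coneDist d σ N (propKernel N a c) φ) := by
  obtain ⟨R, hR0, hR⟩ : ∃ R : ℝ, 0 < R ∧ tsupport (eulerIter d N φ) ⊆ Metric.ball 0 R := by
    obtain ⟨R, hR⟩ := (eulerIter d N φ).hasCompactSupport.isBounded.subset_ball 0
    exact ⟨max R 1, by positivity, hR.trans (Metric.ball_subset_ball (le_max_left _ _))⟩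
  set κ : ℂ := (((2 * 4 ^ a * Real.pi ^ (N + a))⁻¹ : ℝ) : ℂ) with hκ
  set f : ℕ → Mink d → ℂ := fun j x => κ * (coneWeight σ N (fun w => (primPow (j - a) (w / 4) : ℂ)) x *
    (eulerIter d N φ x : ℂ)) with hf
  have hG : 0 < Real.Gamma (1 - a) :=
    Real.Gamma_pos_of_pos (by rcases ha with rfl | rfl <;> norm_num)
  have hadm : Admissible (fun w => (primPow (-a) (w / 4) : ℂ)) := by
    have := measurable_primPow (-a)
    refine ⟨by fun_prop, fun R => ?_⟩
    obtain ⟨C, -, hC⟩ := abs_primPow_neg_le ha R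
    exact ⟨C, fun w hw h0 => by simpa using hC w hw h0⟩
  set g : Mink d → ℝ := fun x => ‖f 0 x‖ * (2 * Real.Gamma (1 - a)) with hg
  have hf0 : Integrable (f 0) := by
    refine ((integrable_coneWeight_mul h σ hadm (eulerIter d N φ)).const_mul κ).congr
      (.of_forall fun x => ?_)
    simp [hf]
  have hgi : Integrable g := hf0.norm.mul_const _
  have hbd : ∀ j x, ‖f j x‖ ≤ (R ^ 2 / 4) ^ j * g x := fun j x => by
    by_cases hx : x ∈ Metric.ball (0 : Mink d) R
    · have h1 := abs_primPow_le ha j (minkSq x / 4)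
      have h2 : |minkSq x / 4| ≤ R ^ 2 / 4 := by
        rw [abs_div, abs_of_pos (by norm_num : (0 : ℝ) < 4)]
        have := abs_minkSq_le (x := x) (le_of_lt (by simpa using hx))
        gcongr
      simp only [hg, hf, coneWeight, norm_mul, Complex.norm_real, Real.norm_eq_abs,
        Nat.cast_zero, zero_sub]
      have h3 : |primPow (j - a) (minkSq x / 4)| ≤
          (R ^ 2 / 4) ^ j * |primPow (-a) (minkSq x / 4)| * (2 * Real.Gamma (1 - a)) :=
        h1.trans (by gcongr)
      calc _ ≤ ‖κ‖ * (|heaviside (σ * x.1)| *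
            ((R ^ 2 / 4) ^ j * |primPow (-a) (minkSq x / 4)| * (2 * Real.Gamma (1 - a))) *
            |(‖x.2‖ ^ (2 * N))⁻¹| * |eulerIter d N φ x|) := by gcongr
        _ = _ := by ring
    · have : eulerIter d N φ x = 0 := image_eq_zero_of_notMem_tsupport fun hx' => hx (hR hx')
      simp [hf, hg, this]
  have hfi : ∀ j, Integrable (f j) := fun j => by
    refine (hgi.const_mul ((R ^ 2 / 4) ^ j)).mono' ?_ (.of_forall (hbd j))
    have hm := measurable_primPow (j - a)
    exact (((measurable_coneWeight σ N (K := fun w => (primPow (j - a) (w / 4) : ℂ))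
      (by fun_prop)).mul (Complex.measurable_ofReal.comp
        (eulerIter d N φ).continuous.measurable)).const_mul κ).aestronglyMeasurable
  have hb1 : ∀ j, ∫ x, ‖f j x‖ ≤ (∫ x, g x) * (R ^ 2 / 4) ^ j := fun j => by
    rw [mul_comm, ← integral_const_mul]
    exact integral_mono (hfi j).norm (hgi.const_mul _) (hbd j)
  refine ⟨fun j => ∫ x, f j x, R ^ 2 / 4, ∫ x, g x,
    fun j => (norm_integral_le_integral_norm _).trans (hb1 j), fun c => ?_⟩
  rw [coneDist_apply h σ (admissible_propKernel N ha c)]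
  have key := hasSum_integral_of_summable_integral_norm (μ := (volume : Measure (Mink d)))
    (F := fun (j : ℕ) x => c ^ j / j.factorial * f j x) (fun j => (hfi j).const_mul _) (by
      refine .of_nonneg_of_le (fun j => integral_nonneg fun x => norm_nonneg _) (fun j => ?_)
        ((Real.summable_pow_div_factorial (‖c‖ * (R ^ 2 / 4))).mul_right (∫ x, g x))
      simp only [norm_mul, norm_div, norm_pow, Complex.norm_natCast]
      rw [integral_const_mul]
      calc _ ≤ ‖c‖ ^ j / j.factorial * ((∫ x, g x) * (R ^ 2 / 4) ^ j) := by
            gcongr; exact hb1 j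
        _ = _ := by ring)
  simp only [integral_const_mul] at key
  refine (integral_congr_ae (.of_forall fun x => HasSum.tsum_eq ?_)).subst (motive := HasSum _) key
  have := ((((hasSum_coneKernel ha c (minkSq x)).mul_left κ).mul_left
    (heaviside (σ * x.1) : ℂ)).mul_right (((‖x.2‖ ^ (2 * N))⁻¹ : ℝ) : ℂ)).mul_right
    (eulerIter d N φ x : ℂ)
  refine this.congr_fun fun j => ?_
  simp only [hf, coneWeight]; ring

theorem differentiable_coneDist_propKernel {d N : ℕ} (h : 2 * N + 1 ≤ d - 1) (σ : ℝ) {a : ℝ}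
    (ha : a = 0 ∨ a = 1 / 2) (φ : MinkTest d) :
    Differentiable ℂ (fun c => coneDist d σ N (propKernel N a c) φ) := by
  obtain ⟨b, A, B, hb, hs⟩ := hasSum_coneDist_propKernel h σ ha φ
  intro c₀
  have h1 : DifferentiableOn ℂ (fun c : ℂ => ∑' j : ℕ, c ^ j / j.factorial * b j)
      (Metric.ball 0 (‖c₀‖ + 1)) := by
    refine Complex.differentiableOn_tsum_of_summable_norm
      (u := fun j => ((‖c₀‖ + 1) * A) ^ j / j.factorial * B)
      ((Real.summable_pow_div_factorial _).mul_right B) (fun j => by fun_prop) Metric.isOpen_ball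
      fun j c hc => ?_
    rw [norm_mul, norm_div, norm_pow, Complex.norm_natCast, mul_pow]
    have hc' : ‖c‖ ≤ ‖c₀‖ + 1 := le_of_lt (by simpa using hc)
    calc _ ≤ (‖c₀‖ + 1) ^ j / j.factorial * (B * A ^ j) := by
          gcongr
          exact hb j
      _ = _ := by ring
  have h2 : (fun c => coneDist d σ N (propKernel N a c) φ) =
      fun c : ℂ => ∑' j : ℕ, c ^ j / j.factorial * b j := funext fun c => (hs c).tsum_eq.symm
  rw [h2]
  exact h1.differentiableAt (Metric.isOpen_ball.mem_nhds (by simp))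

/-- The transform of (M² - □)φ is (M² + p²) times that of φ. Dividing it by the regularized
denominator gives a factor of modulus at most 1, since the real part of that denominator is M² + p²;
in the limit the factor is 1 and Fourier inversion at the origin remains. -/
theorem IsMassivePropagator.green {d : ℕ} (hd : 2 ≤ d) {σ M : ℝ} {T : MinkDist d} (hT : IsMassivePropagator σ M T) (φ : MinkTest d) :
    (M : ℂ) ^ 2 * T φ - T (boxTest φ) = φ 0 := by
  have e : (M : ℂ) ^ 2 * T φ - T (boxTest φ) = T (M ^ 2 • φ - boxTest φ) := by
    rw [map_sub, map_smul, Complex.real_smul]; push_cast; rfl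
  rw [e]
  refine tendsto_nhds_unique (hT (M ^ 2 • φ - boxTest φ)) ?_
  have hF : ∀ p, (∫ x : Mink d, Complex.exp (Complex.I * (minkProd p x : ℂ)) *
      ((M ^ 2 • φ - boxTest φ : MinkTest d) x : ℂ)) =
      ((M : ℂ) ^ 2 + minkSq p) * minkFourier φ p := fun p => by
    have : minkFourier (M ^ 2 • φ - boxTest φ) p = _ :=
      map_sub (minkFourierLM p) (M ^ 2 • φ) (boxTest φ)
    rw [map_smul, minkFourierLM_apply, minkFourierLM_apply, minkFourier_boxTest] at this
    refine this.trans ?_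
    rw [Complex.real_smul]; push_cast; ring
  simp only [hF]
  have hinv := minkFourier_inversion hd φ 0
  rw [hinv]
  refine Tendsto.const_mul _ ?_
  have hne := ae_minkSq_ne hd (-M ^ 2)
  have him : ∀ (ε : ℝ) (p : Mink d), ((M : ℂ) ^ 2 + minkSq p - Complex.I * σ * ε * Real.sign p.1) =
      ((M ^ 2 + minkSq p : ℝ) : ℂ) + ((-(σ * ε * Real.sign p.1) : ℝ) : ℂ) * Complex.I := fun ε p => by
    push_cast; ring
  refine tendsto_integral_filter_of_dominated_convergence (fun p => ‖minkFourier φ p‖) ?_ ?_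
    (integrable_minkFourier φ).norm ?_
  · refine .of_forall fun ε => Measurable.aestronglyMeasurable ?_
    have h1 := (continuous_minkSq (d := d)).measurable
    have h2 := (continuous_minkFourier φ).measurable
    have h3 : Measurable Real.sign :=
      Measurable.ite measurableSet_Iio measurable_const
        (Measurable.ite measurableSet_Ioi measurable_const measurable_const)
    fun_prop
  · filter_upwards with ε
    filter_upwards [hne] with p hp
    have h0 : M ^ 2 + minkSq p ≠ 0 := fun h => hp (by linarith)
    rw [him, mul_comm, mul_div_assoc, norm_mul]
    refine mul_le_of_le_one_right (norm_nonneg _) ?_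
    rw [norm_div]
    refine div_le_one_of_le₀ ?_ (norm_nonneg _)
    have h1 := Complex.abs_re_le_norm (((M ^ 2 + minkSq p : ℝ) : ℂ) +
      ((-(σ * ε * Real.sign p.1) : ℝ) : ℂ) * Complex.I)
    have h3 : (((M ^ 2 + minkSq p : ℝ) : ℂ) +
      ((-(σ * ε * Real.sign p.1) : ℝ) : ℂ) * Complex.I).re = M ^ 2 + minkSq p := by
      simp [-Complex.ofReal_add, -Complex.ofReal_neg, -Complex.ofReal_mul]
    rw [h3] at h1
    have h2 : ((M : ℂ) ^ 2 + (minkSq p : ℂ)) = ((M ^ 2 + minkSq p : ℝ) : ℂ) := by push_cast; rfl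
    rw [h2, Complex.norm_real, Real.norm_eq_abs]
    exact h1
  · filter_upwards [hne] with p hp
    have h0 : (M : ℂ) ^ 2 + (minkSq p : ℂ) ≠ 0 := fun h => hp (by
      have : M ^ 2 + minkSq p = 0 := by exact_mod_cast h
      linarith)
    have h1 : Tendsto (fun ε : ℝ => (M : ℂ) ^ 2 + minkSq p - Complex.I * σ * ε * Real.sign p.1)
        (𝓝[>] 0) (𝓝 ((M : ℂ) ^ 2 + minkSq p)) := by
      have hc : Continuous fun ε : ℝ =>
        (M : ℂ) ^ 2 + minkSq p - Complex.I * σ * ε * Real.sign p.1 := by fun_prop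
      simpa using (hc.tendsto 0).mono_left nhdsWithin_le_nhds
    have h2 := (tendsto_const_nhds (x := ((M : ℂ) ^ 2 + minkSq p) * minkFourier φ p)).div h1 h0
    rw [mul_div_cancel_left₀ _ h0] at h2
    have h3 : minkProd p (0 : Mink d) = 0 := by simp [minkProd]
    rw [h3]
    simpa only [Complex.ofReal_zero, mul_zero, neg_zero, Complex.exp_zero, mul_one] using! h2

/-- The weak equation is an identity between entire functions of z, with z = -c. It holds for z =
-M² with M > 0, hence everywhere by the identity theorem, in particular for the tachyonic value z =
m². -/
theorem isGreenFunction_coneDist {d N : ℕ} (hd : 2 ≤ d) {a : ℝ}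
    (ha : a = 0 ∨ a = 1 / 2) (hn : (d : ℝ) = 2 * N + 2 + 2 * a) (hN : 2 * N + 1 ≤ d - 1)
    {σ : ℝ} (hσ : σ = 1 ∨ σ = -1) (c : ℝ) :
    IsGreenFunction c (coneDist d σ N (propKernel N a (-(c : ℂ)))) := by
  rw [isGreenFunction_iff]
  intro φ
  set F : ℂ → ℂ := fun z => -z * coneDist d σ N (propKernel N a z) φ -
    coneDist d σ N (propKernel N a z) (boxTest φ) with hF
  have hFd : Differentiable ℂ F :=
    (differentiable_id.neg.mul (differentiable_coneDist_propKernel hN σ ha φ)).sub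
      (differentiable_coneDist_propKernel hN σ ha (boxTest φ))
  have hpos : ∀ M : ℝ, 0 < M → F (-(M : ℂ) ^ 2) = φ 0 := fun M hM => by
    rw [← IsMassivePropagator.green hd (isMassivePropagator_coneDist hd ha hn hN hσ hM) φ]
    simp [hF]
  have := AnalyticOnNhd.eq_of_frequently_eq (z₀ := (-1 : ℂ)) (f := F) (g := fun _ => (φ 0 : ℂ))
    (fun z _ => hFd.analyticAt z) (fun z _ => analyticAt_const) ?_
  · simpa [hF] using congrFun this (-(c : ℂ))
  -- The points -M² with M ↘ 1 accumulate at -1 without being equal to it.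
  · have ht : Tendsto (fun M : ℝ => -(M : ℂ) ^ 2) (𝓝[>] 1) (𝓝[≠] (-1)) := by
      refine tendsto_nhdsWithin_iff.2 ⟨?_, ?_⟩
      · have : Continuous fun M : ℝ => -(M : ℂ) ^ 2 := by fun_prop
        simpa using (this.tendsto 1).mono_left nhdsWithin_le_nhds
      · filter_upwards [self_mem_nhdsWithin] with M hM
        have h1 : (1 : ℝ) < M := hM
        rw [Set.mem_compl_singleton_iff]
        intro h
        have : M ^ 2 = 1 := by exact_mod_cast neg_injective h
        nlinarith
    refine ht.frequently (Eventually.frequently ?_)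
    filter_upwards [self_mem_nhdsWithin] with M hM
    exact hpos M (lt_trans one_pos hM)

/-! ### Support in the cone. -/

theorem tsupport_eulerIter_subset {d : ℕ} (φ : MinkTest d) (N : ℕ) :
    tsupport (eulerIter d N φ) ⊆ tsupport φ := by
  induction N with
  | zero => rfl
  | succ k ih =>
    refine Set.Subset.trans (closure_minimal (fun x hx => ?_) (isClosed_tsupport _)) ih
    by_contra h
    refine hx ?_
    have h1 : fderiv ℝ (eulerIter d k φ) x = 0 :=
      image_eq_zero_of_notMem_tsupport fun h' => h (tsupport_fderiv_subset ℝ h')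
    have : eulerIter d (k + 1) φ x = eulerStep d ((d : ℝ) - 3 - 2 * k) (eulerIter d k φ) x := rfl
    rw [this, eulerStep_apply, h1, image_eq_zero_of_notMem_tsupport h]
    simp

theorem isClosed_causalCone (d : ℕ) (σ : ℝ) : IsClosed (causalCone d σ) :=
  (isClosed_le continuous_minkSq continuous_const).inter
    (isClosed_le continuous_const (continuous_const.mul continuous_fst))

theorem dsupport_coneDist_subset {d N : ℕ} (h : 2 * N + 1 ≤ d - 1) (σ : ℝ) {K : ℝ → ℂ}
    (hK : Admissible K) (hK0 : ∀ w, 0 ≤ w → K w = 0) :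
    Distribution.dsupport ⇑(coneDist d σ N K) ⊆ causalCone d σ := by
  refine Set.sInter_subset_of_mem ⟨fun u hu => ?_, isClosed_causalCone d σ⟩
  rw [coneDist_apply h σ hK]
  refine integral_eq_zero_of_ae (.of_forall fun x => ?_)
  by_cases hx : x ∈ causalCone d σ
  · have : eulerIter d N u x = 0 :=
      image_eq_zero_of_notMem_tsupport fun h' => hu (tsupport_eulerIter_subset u N h') hx
    simp [this]
  · rw [Pi.zero_apply]
    by_cases h1 : minkSq x ≤ 0
    · have : ¬ 0 < σ * x.1 := fun h2 => hx ⟨h1, h2.le⟩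
      simp [coneWeight, heaviside, this]
    · simp [coneWeight, hK0 _ (not_le.1 h1).le]

/-! ### Smoothness of translates, and uniqueness. -/

/-- A smooth compactly supported function as a test function. -/
def mkTest {d : ℕ} (f : Mink d → ℝ) (hf : ContDiff ℝ ((⊤ : ℕ∞) : WithTop ℕ∞) f)
    (hc : HasCompactSupport f) : MinkTest d :=
  ⟨f, hf, hc, fun _ _ => trivial⟩

/-- The translate `y ↦ φ(x + y)`. -/
def transTest {d : ℕ} (φ : MinkTest d) (x : Mink d) : MinkTest d :=
  mkTest (fun y => φ (x + y)) (φ.contDiff.comp (contDiff_const.add contDiff_id))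
    (φ.hasCompactSupport.comp_homeomorph (Homeomorph.addLeft x))

theorem transTest_apply {d : ℕ} (φ : MinkTest d) (x y : Mink d) :
    transTest φ x y = φ (x + y) := rfl

theorem tsupport_transTest {d : ℕ} (φ : MinkTest d) {x y : Mink d}
    (h : y ∈ tsupport (transTest φ x)) : x + y ∈ tsupport φ :=
  tsupport_comp_subset_preimage φ (f := fun y => x + y) (by fun_prop) h

theorem transTest_lineDerivOp {d : ℕ} (φ : MinkTest d) (v x : Mink d) :
    transTest (∂_{v} φ) x = ∂_{v} (transTest φ x) := by
  ext y
  rw [transTest_apply, lineDerivOp_test_apply, lineDerivOp_test_apply]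
  have : (transTest φ x : Mink d → ℝ) = fun y => φ (x + y) := rfl
  rw [this, fderiv_comp_add_left]

theorem transTest_boxTest {d : ℕ} (φ : MinkTest d) (x : Mink d) :
    transTest (boxTest φ) x = boxTest (transTest φ x) := by
  simp only [boxTest, ← transTest_lineDerivOp]
  ext y
  have h : ∀ f : Fin (d - 1) → MinkTest d, transTest (∑ i, f i) x = ∑ i, transTest (f i) x := by
    intro f
    let ev : MinkTest d →+ MinkTest d := ⟨⟨fun T => transTest T x, rfl⟩, fun _ _ => rfl⟩
    exact map_sum ev _ _
  rw [← h]
  rfl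

/-- The function `(x, y) ↦ (D_k φ(x + ·))(y)`. -/
def eulerTrans {d : ℕ} (k : ℕ) (φ : MinkTest d) (z : Mink d × Mink d) : ℝ :=
  eulerIter d k (transTest φ z.1) z.2

theorem eulerTrans_zero {d : ℕ} (φ : MinkTest d) :
    eulerTrans 0 φ = fun z => φ (z.1 + z.2) := rfl

theorem eulerTrans_succ {d k : ℕ} {φ : MinkTest d} (h : Differentiable ℝ (eulerTrans k φ))
    (z : Mink d × Mink d) :
    eulerTrans (k + 1) φ z = 1 / 2 * (((d : ℝ) - 3 - 2 * k) * eulerTrans k φ z +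
      fderiv ℝ (eulerTrans k φ) z (0, (0, z.2.2))) := by
  have h1 : eulerTrans (k + 1) φ z =
    eulerStep d ((d : ℝ) - 3 - 2 * k) (eulerIter d k (transTest φ z.1)) z.2 := rfl
  have h2 : HasFDerivAt (fun y => eulerTrans k φ (z.1, y))
      (fderiv ℝ (eulerTrans k φ) z ∘L ContinuousLinearMap.inr ℝ (Mink d) (Mink d)) z.2 :=
    HasFDerivAt.comp (f := fun y => (z.1, y)) z.2 (h z).hasFDerivAt
      (hasFDerivAt_prodMk_right (𝕜 := ℝ) z.1 z.2)
  have h3 : (eulerIter d k (transTest φ z.1) : Mink d → ℝ) = fun y => eulerTrans k φ (z.1, y) := rfl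
  rw [h1, eulerStep_apply, h3, h2.fderiv]
  rfl

theorem contDiff_eulerTrans {d : ℕ} (k : ℕ) (φ : MinkTest d) :
    ContDiff ℝ ((⊤ : ℕ∞) : WithTop ℕ∞) (eulerTrans k φ) := by
  induction k with
  | zero => exact φ.contDiff.comp (contDiff_fst.add contDiff_snd)
  | succ k ih =>
    rw [funext (eulerTrans_succ (ih.differentiable (by simp)))]
    have h1 : ContDiff ℝ ((⊤ : ℕ∞) : WithTop ℕ∞) (fderiv ℝ (eulerTrans k φ)) :=
      ih.fderiv_right (m := ((⊤ : ℕ∞) : WithTop ℕ∞)) (by simp)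
    have h2 : ContDiff ℝ ((⊤ : ℕ∞) : WithTop ℕ∞)
      (fun z : Mink d × Mink d => ((0, (0, z.2.2)) : Mink d × Mink d)) := by fun_prop
    exact contDiff_const.mul ((contDiff_const.mul ih).add (h1.clm_apply h2))

/-- The vector v moves the translation parameter while the Euler operators act in the other
variable; the two commute by symmetry of the second derivative, since the dilation field does not
depend on the first variable. -/
theorem fderiv_eulerTrans {d : ℕ} (k : ℕ) (φ : MinkTest d) (v : Mink d) (z : Mink d × Mink d) :
    fderiv ℝ (eulerTrans k φ) z (v, 0) = eulerTrans k (∂_{v} φ) z := by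
  induction k generalizing z with
  | zero =>
    rw [eulerTrans_zero, eulerTrans_zero]
    simp only [lineDerivOp_test_apply]
    have h1 : HasFDerivAt (fun z : Mink d × Mink d => φ (z.1 + z.2))
        (fderiv ℝ φ (z.1 + z.2) ∘L
          (ContinuousLinearMap.fst ℝ (Mink d) (Mink d) + ContinuousLinearMap.snd ℝ _ _)) z :=
      ((φ.contDiff.differentiable (by simp)) _).hasFDerivAt.comp z
        (hasFDerivAt_fst.add hasFDerivAt_snd)
    rw [h1.fderiv]
    simp
  | succ k ih =>
    have hc := contDiff_eulerTrans k φ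
    have hd := hc.differentiable (by simp)
    have hd2 : Differentiable ℝ (fderiv ℝ (eulerTrans k φ)) :=
      (hc.fderiv_right (m := 1) (by norm_cast)).differentiable (by simp)
    rw [eulerTrans_succ ((contDiff_eulerTrans k (∂_{v} φ)).differentiable (by simp)),
      ← funext ih, funext (eulerTrans_succ hd)]
    set W : Mink d × Mink d →L[ℝ] Mink d × Mink d :=
      ContinuousLinearMap.inr ℝ (Mink d) (Mink d) ∘L ContinuousLinearMap.inr ℝ ℝ _ ∘L
        ContinuousLinearMap.snd ℝ ℝ _ ∘L ContinuousLinearMap.snd ℝ (Mink d) (Mink d) with hW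
    have h1 : HasFDerivAt (fun z : Mink d × Mink d => fderiv ℝ (eulerTrans k φ) z (W z)) _ z :=
      (hd2 z).hasFDerivAt.clm_apply W.hasFDerivAt
    have h2 := (((hd z).hasFDerivAt.const_mul ((d : ℝ) - 3 - 2 * k)).add h1).const_mul (1 / 2)
    have h3 : HasFDerivAt (fun z : Mink d × Mink d => fderiv ℝ (eulerTrans k φ) z (v, 0)) _ z :=
      (hd2 z).hasFDerivAt.clm_apply (hasFDerivAt_const ((v, 0) : Mink d × Mink d) z)
    have hs := hc.contDiffAt.isSymmSndFDerivAt (x := z) (by simp; norm_cast) (v, 0) (W z)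
    refine (DFunLike.congr_fun h2.fderiv (v, 0)).trans ?_
    rw [h3.fderiv]
    have e : ((0, (0, z.2.2)) : Mink d × Mink d) = W z := rfl
    have e2 : W (v, 0) = 0 := by simp [hW]
    rw [e]
    simp [hs, e2, mul_add]

theorem eulerTrans_eq_zero {d : ℕ} (k : ℕ) (φ : MinkTest d) {z : Mink d × Mink d}
    (hz : z.1 + z.2 ∉ tsupport φ) : eulerTrans k φ z = 0 :=
  image_eq_zero_of_notMem_tsupport (f := eulerIter d k (transTest φ z.1)) fun h =>
    hz (tsupport_transTest φ (tsupport_eulerIter_subset _ k h))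

theorem aestronglyMeasurable_smulRight {α E : Type*} [MeasurableSpace α] {μ : Measure α}
    [NormedAddCommGroup E] [NormedSpace ℝ E] {f : α → E →L[ℝ] ℝ} {g : α → ℂ}
    (hf : AEStronglyMeasurable f μ) (hg : AEStronglyMeasurable g μ) :
    AEStronglyMeasurable (fun x => (f x).smulRight (g x)) μ :=
  (ContinuousLinearMap.smulRightL ℝ E ℂ).aestronglyMeasurable_comp₂ hf hg

theorem tsupport_lineDerivOp_subset {d : ℕ} (φ : MinkTest d) (v : Mink d) :
    tsupport (∂_{v} φ : MinkTest d) ⊆ tsupport φ := by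
  refine closure_minimal (fun w hw => ?_) (isClosed_tsupport φ)
  by_contra hw'
  refine hw ((lineDerivOp_test_apply φ v w).trans ?_)
  rw [image_eq_zero_of_notMem_tsupport
    (f := fderiv ℝ φ) fun h' => hw' (tsupport_fderiv_subset ℝ h')]
  rfl

/-- Differentiation under the integral sign. While x runs through the unit ball around x₀, the
integrands live on the compact set supp φ minus this ball, where the derivative is bounded and the
weight integrable. The derivative has the same form with ∂_vφ in place of φ, which is what allows
iteration. -/
theorem hasFDerivAt_coneDist_transTest {d N : ℕ} (h : 2 * N + 1 ≤ d - 1) (σ : ℝ) {K : ℝ → ℂ}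
    (hK : Admissible K) (φ : MinkTest d) (x₀ : Mink d) :
    ∃ L : Mink d →L[ℝ] ℂ, HasFDerivAt (fun x => coneDist d σ N K (transTest φ x)) L x₀ ∧
      ∀ v, L v = coneDist d σ N K (transTest (∂_{v} φ) x₀) := by
  have happ : ∀ (ψ : MinkTest d) x, coneDist d σ N K (transTest ψ x) =
      ∫ y, eulerTrans N ψ (x, y) • coneWeight σ N K y := fun ψ x => by
    rw [coneDist_apply h σ hK]
    refine integral_congr_ae (.of_forall fun y => ?_)
    simp [eulerTrans, mul_comm]
  have hint : ∀ (ψ : MinkTest d) x, Integrable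
      fun y => eulerTrans N ψ (x, y) • coneWeight σ N K y := fun ψ x => by
    refine (integrable_coneWeight_mul h σ hK (eulerIter d N (transTest ψ x))).congr
      (.of_forall fun y => ?_)
    simp [eulerTrans, mul_comm]
  have hc := contDiff_eulerTrans N φ
  have hfc : Continuous (fderiv ℝ (eulerTrans N φ)) := hc.continuous_fderiv (by simp)
  set F' : Mink d → Mink d → Mink d →L[ℝ] ℂ := fun x y =>
    (fderiv ℝ (eulerTrans N φ) (x, y) ∘L ContinuousLinearMap.inl ℝ (Mink d) (Mink d)).smulRight
      (coneWeight σ N K y) with hF'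
  have hKc : IsCompact ((fun p : Mink d × Mink d => p.1 - p.2) ''
      (tsupport φ ×ˢ Metric.closedBall x₀ 1)) :=
    (φ.hasCompactSupport.isCompact.prod (isCompact_closedBall x₀ 1)).image (by fun_prop)
  set S : Set (Mink d) := (fun p : Mink d × Mink d => p.1 - p.2) ''
      (tsupport φ ×ˢ Metric.closedBall x₀ 1) with hS
  obtain ⟨B, hB⟩ := ((isCompact_closedBall x₀ 1).prod hKc).exists_bound_of_continuousOn
    (f := fun z => fderiv ℝ (eulerTrans N φ) z ∘L ContinuousLinearMap.inl ℝ (Mink d) (Mink d))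
    (by fun_prop)
  have hm := measurable_coneWeight (d := d) σ N hK.measurable
  have hcF : ∀ x, Continuous fun y : Mink d => fderiv ℝ (eulerTrans N φ) (x, y) ∘L
    ContinuousLinearMap.inl ℝ (Mink d) (Mink d) := fun x => by fun_prop
  have hF'v : ∀ x y v, F' x y v = eulerTrans N (∂_{v} φ) (x, y) • coneWeight σ N K y :=
    fun x y v => by rw [← fderiv_eulerTrans]; rfl
  have hSm : ∀ x y, x ∈ Metric.closedBall x₀ 1 → x + y ∈ tsupport φ → y ∈ S := fun x y hx h =>
    ⟨(x + y, x), ⟨h, hx⟩, add_sub_cancel_left x y⟩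
  have hF'm : AEStronglyMeasurable (F' x₀) := by
    exact aestronglyMeasurable_smulRight (hcF x₀).aestronglyMeasurable hm.aestronglyMeasurable
  have hbound : ∀ y, ∀ x ∈ Metric.closedBall x₀ 1,
      ‖F' x y‖ ≤ S.indicator (fun y => B * ‖coneWeight σ N K y‖) y := fun y x hx => by
    by_cases hy : y ∈ S
    · rw [Set.indicator_of_mem hy, hF', ContinuousLinearMap.norm_smulRight_apply]
      exact mul_le_mul_of_nonneg_right (hB (x, y) ⟨hx, hy⟩) (norm_nonneg _)
    · have h0 : ∀ v, eulerTrans N (∂_{v} φ) (x, y) = 0 := fun v =>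
        eulerTrans_eq_zero N _ fun h' => hy (hSm x y hx (tsupport_lineDerivOp_subset φ v h'))
      have : F' x y = 0 := ContinuousLinearMap.ext fun v => by
        rw [hF'v, h0, zero_smul, zero_apply]
      rw [this, norm_zero, Set.indicator_of_notMem hy]
  have hbi : Integrable (S.indicator fun y => B * ‖coneWeight σ N K y‖) :=
    (integrable_indicator_iff hKc.measurableSet).2
      ((((locallyIntegrable_coneWeight h σ hK).integrableOn_isCompact hKc).norm).const_mul B)
  have key := hasFDerivAt_integral_of_dominated_of_fderiv_le (𝕜 := ℝ)
    (μ := (volume : Measure (Mink d)))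
    (F := fun x y => eulerTrans N φ (x, y) • coneWeight σ N K y) (F' := F') (x₀ := x₀)
    (bound := S.indicator fun y => B * ‖coneWeight σ N K y‖) (s := Metric.closedBall x₀ 1)
    (Metric.closedBall_mem_nhds x₀ one_pos) (.of_forall fun x => (hint φ x).1) (hint φ x₀)
    hF'm (.of_forall hbound) hbi (.of_forall fun y x _ => by
      have h1 : HasFDerivAt (fun x => eulerTrans N φ (x, y))
          (fderiv ℝ (eulerTrans N φ) (x, y) ∘L ContinuousLinearMap.inl ℝ (Mink d) (Mink d)) x :=
        HasFDerivAt.comp (f := fun x => (x, y)) x (hc.differentiable (by simp) (x, y)).hasFDerivAt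
          (hasFDerivAt_prodMk_left (𝕜 := ℝ) x y)
      exact h1.smul_const _)
  refine ⟨∫ y, F' x₀ y, by simpa only [happ] using key, fun v => ?_⟩
  have hF'i : Integrable (F' x₀) := hbi.mono' hF'm
    (.of_forall fun y => hbound y x₀ (Metric.mem_closedBall_self zero_le_one))
  rw [ContinuousLinearMap.integral_apply hF'i, happ]
  exact integral_congr_ae (.of_forall fun y => hF'v x₀ y v)

theorem contDiff_coneDist_transTest {d N : ℕ} (h : 2 * N + 1 ≤ d - 1) (σ : ℝ) {K : ℝ → ℂ}
    (hK : Admissible K) (φ : MinkTest d) : ContDiff ℝ ((⊤ : ℕ∞) : WithTop ℕ∞)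
      (fun x => coneDist d σ N K (transTest φ x)) := by
  rw [contDiff_infty]
  intro n
  have hd : ∀ φ : MinkTest d, Differentiable ℝ (fun x => coneDist d σ N K (transTest φ x)) :=
    fun φ x => (hasFDerivAt_coneDist_transTest h σ hK φ x).choose_spec.1.differentiableAt
  induction n generalizing φ with
  | zero => exact contDiff_zero.2 (hd φ).continuous
  | succ n ih =>
    push_cast
    rw [contDiff_succ_iff_fderiv]
    refine ⟨hd φ, by simp, contDiff_clm_apply_iff.2 fun v => ?_⟩
    convert ih (∂_{v} φ) using 2 with x
    obtain ⟨L, hL, hv⟩ := hasFDerivAt_coneDist_transTest h σ hK φ x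
    rw [hL.fderiv, hv]

/-- Off the support the distribution vanishes only locally; a smooth partition of unity on the
compact support of u reduces to finitely many such neighbourhoods. -/
theorem eq_zero_of_disjoint_dsupport {d : ℕ} {T : MinkDist d} {u : MinkTest d}
    (h : Disjoint (tsupport u) (Distribution.dsupport ⇑T)) : T u = 0 := by
  have h1 : ∀ x ∈ tsupport u, ∃ s, Distribution.IsVanishingOn (⇑T) s ∧ IsOpen s ∧ x ∈ s :=
    fun x hx => (Distribution.notMem_dsupport_iff x).1 (Set.disjoint_left.1 h hx)
  choose! s hs ho hxs using h1
  obtain ⟨t, hts, ht⟩ := u.hasCompactSupport.isCompact.elim_nhds_subcover s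
    fun x hx => (ho x hx).mem_nhds (hxs x hx)
  obtain ⟨f, hf⟩ := SmoothPartitionOfUnity.exists_isSubordinate
    (modelWithCornersSelf ℝ (Mink d)) (isClosed_tsupport u) (fun i : t => s i)
    (fun i => ho i (hts i i.2)) (fun x hx => by simpa using ht hx)
  have hfs : ∀ i, ContDiff ℝ ((⊤ : ℕ∞) : WithTop ℕ∞) (f i) := fun i =>
    contMDiff_iff_contDiff.1 (f i).contMDiff
  set w : t → MinkTest d := fun i => mkTest (fun x => f i x * u x) ((hfs i).mul u.contDiff)
    u.hasCompactSupport.mul_left with hw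
  have hu : u = ∑ i, w i := by
    ext x
    let ev : MinkTest d →+ ℝ := ⟨⟨fun T => T x, rfl⟩, fun _ _ => rfl⟩
    have hsum : (∑ i, w i) x = ∑ i, f i x * u x := map_sum ev _ _
    rw [hsum, ← Finset.sum_mul]
    by_cases hx : x ∈ tsupport u
    · have := f.sum_eq_one hx
      rw [finsum_eq_sum_of_fintype] at this
      rw [this, one_mul]
    · simp [image_eq_zero_of_notMem_tsupport hx]
  rw [hu, map_sum]
  refine Finset.sum_eq_zero fun i _ => hs i (hts i i.2) _ ?_
  exact (tsupport_mul_subset_left (f := f i) (g := u)).trans (hf i)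

/-- In the cone |x⃗| ≤ σx⁰, and the norm on the product is the maximum. Bounds on time alone
therefore bound points of the cone. -/
theorem norm_le_of_mem_causalCone {d : ℕ} {σ : ℝ} (hσ : σ = 1 ∨ σ = -1) {x : Mink d}
    (hx : x ∈ causalCone d σ) : ‖x‖ ≤ σ * x.1 := by
  have h1 := hx.1
  have h2 : |x.1| = σ * x.1 := by rw [← abs_eq_of_sign hσ, abs_of_nonneg hx.2]
  rw [minkSq_eq] at h1
  refine max_le h2.le ?_
  rw [← h2]
  exact abs_le_of_sq_le_sq (by rw [sq_abs]; linarith) (abs_nonneg _) |>.trans' (le_abs_self _)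

theorem boxTest_lincomb_apply {d : ℕ} (φ : MinkTest d) (x : Mink d) : boxTest φ x =
    -((∂_{((1, 0) : Mink d)} (∂_{((1, 0) : Mink d)} φ)) x) +
    ∑ i : Fin (d - 1), (∂_{((0, EuclideanSpace.single i 1) : Mink d)}
      (∂_{((0, EuclideanSpace.single i 1) : Mink d)} φ)) x := by
  let ev : MinkTest d →+ ℝ := ⟨⟨fun T => T x, rfl⟩, fun _ _ => rfl⟩
  exact congrArg (_ + ·) (map_sum ev _ _)

theorem lineDerivOp_apply_of_eventuallyEq {d : ℕ} {φ : MinkTest d} {g : Mink d → ℝ} {x : Mink d}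
    (h : φ =ᶠ[𝓝 x] g) (v : Mink d) : (∂_{v} φ) x = fderiv ℝ g x v := by
  rw [lineDerivOp_test_apply, h.fderiv_eq]

theorem boxTest_apply_of_eventuallyEq {d : ℕ} {φ : MinkTest d} {Ψ : MinkTest d → Mink d → ℝ}
    (hΨ : ∀ (φ : MinkTest d) (x v : Mink d), fderiv ℝ (Ψ φ) x v = Ψ (∂_{v} φ) x)
    {u : MinkTest d} {x : Mink d} (h : u =ᶠ[𝓝 x] Ψ φ) :
    boxTest u x = -(Ψ (∂_{((1, 0) : Mink d)} (∂_{((1, 0) : Mink d)} φ)) x) +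
    ∑ i : Fin (d - 1), Ψ (∂_{((0, EuclideanSpace.single i 1) : Mink d)}
      (∂_{((0, EuclideanSpace.single i 1) : Mink d)} φ)) x := by
  have key : ∀ v : Mink d, (∂_{v} (∂_{v} u)) x = Ψ (∂_{v} (∂_{v} φ)) x := fun v => by
    have h1 : (∂_{v} u : MinkTest d) =ᶠ[𝓝 x] Ψ (∂_{v} φ) := by
      filter_upwards [h.eventuallyEq_nhds] with y hy
      rw [lineDerivOp_apply_of_eventuallyEq hy, hΨ]
    rw [lineDerivOp_apply_of_eventuallyEq h1, hΨ]
  rw [boxTest_lincomb_apply]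
  simp only [key]

theorem tsupport_boxTest_subset {d : ℕ} (φ : MinkTest d) : tsupport (boxTest φ) ⊆ tsupport φ := by
  refine closure_minimal (fun w hw => ?_) (isClosed_tsupport φ)
  by_contra hw'
  refine hw ?_
  have : ∀ v : Mink d, (∂_{v} (∂_{v} φ)) w = 0 := fun v =>
    image_eq_zero_of_notMem_tsupport fun h =>
      hw' (tsupport_lineDerivOp_subset _ v (tsupport_lineDerivOp_subset _ v h))
  rw [boxTest_lincomb_apply]
  simp [this]

/-- The set is the sum of a compact and a closed set. -/
theorem isClosed_sub_causalCone {d : ℕ} {σ : ℝ} (φ : MinkTest d) :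
    IsClosed {x : Mink d | ∃ y ∈ causalCone d σ, x + y ∈ tsupport φ} := by
  have h := (isClosed_causalCone d σ).neg.add_left_of_isCompact φ.hasCompactSupport.isCompact
  convert h using 1
  ext x
  simp only [Set.mem_ofPred_eq, Set.mem_add, Set.mem_neg]
  constructor
  · rintro ⟨y, hy, hxy⟩
    exact ⟨x + y, hxy, -y, by simpa using hy, by simp⟩
  · rintro ⟨k, hk, y, hy, rfl⟩
    exact ⟨-y, hy, by simpa using hk⟩

/-- A distribution supported in the cone which is annihilated by `c - □` vanishes, provided there
is a Green function `θ(σ x⁰) k(x²)` supported in the cone. -/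
theorem eq_zero_of_dsupport_subset {d N : ℕ} (h : 2 * N + 1 ≤ d - 1) {σ : ℝ} (hσ : σ = 1 ∨ σ = -1)
    {K : ℝ → ℂ} (hK : Admissible K) (hK0 : ∀ w, 0 ≤ w → K w = 0) {c : ℝ}
    (hG : IsGreenFunction c (coneDist d σ N K)) {H : MinkDist d}
    (hH : ∀ φ : MinkTest d, c * H φ - H (boxTest φ) = 0)
    (hHs : ∀ φ : MinkTest d, Disjoint (tsupport φ) (causalCone d σ) → H φ = 0)
    (φ : MinkTest d) : H φ = 0 := by
  set G := coneDist d σ N K with hGdef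
  -- The classical solution with source φ obtained by moving φ under the Green function. The real
  -- part is taken because test functions are real; the equation survives since c and φ are real.
  set Ψ : MinkTest d → Mink d → ℝ := fun φ x => (G (transTest φ x)).re with hΨdef
  have hΨ : ∀ (φ : MinkTest d) (x v : Mink d), fderiv ℝ (Ψ φ) x v = Ψ (∂_{v} φ) x := by
    intro φ x v
    obtain ⟨L, hL, hv⟩ := hasFDerivAt_coneDist_transTest h σ hK φ x
    have h1 : HasFDerivAt (Ψ φ) (Complex.reCLM ∘L L) x := Complex.reCLM.hasFDerivAt.comp x hL
    rw [h1.fderiv, ContinuousLinearMap.comp_apply, hv]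
    rfl
  have hΨc : ContDiff ℝ ((⊤ : ℕ∞) : WithTop ℕ∞) (Ψ φ) :=
    Complex.reCLM.contDiff.comp (contDiff_coneDist_transTest h σ hK φ)
  have hΨg : ∀ x, c * Ψ φ x - Ψ (boxTest φ) x = φ x := fun x => by
    have := congrArg Complex.re (isGreenFunction_iff.1 hG (transTest φ x))
    rw [transTest_apply, add_zero, Complex.ofReal_re, Complex.sub_re, Complex.re_ofReal_mul,
      ← transTest_boxTest] at this
    exact this
  set S : Set (Mink d) := {x : Mink d | ∃ y ∈ causalCone d σ, x + y ∈ tsupport φ} with hS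
  have hSc : IsClosed S := isClosed_sub_causalCone φ
  have hΨS : ∀ x, x ∉ S → Ψ φ x = 0 := fun x hx => by
    have : G (transTest φ x) = 0 := eq_zero_of_disjoint_dsupport
      (Set.disjoint_left.2 fun y hy hy' => hx ⟨y, dsupport_coneDist_subset h σ hK hK0 hy',
        tsupport_transTest φ hy⟩)
    simp [hΨdef, this]
  have hφS : tsupport φ ⊆ S := fun x hx => ⟨0, by simp [causalCone, minkSq, minkProd], by simpa⟩
  obtain ⟨R, hR0, hR⟩ : ∃ R : ℝ, 0 < R ∧ tsupport φ ⊆ Metric.ball 0 R := by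
    obtain ⟨R, hR⟩ := φ.hasCompactSupport.isBounded.subset_ball 0
    exact ⟨max R 1, by positivity, hR.trans (Metric.ball_subset_ball (le_max_left _ _))⟩
  -- If x and y lie in the cone and x + y in supp φ, their times are nonnegative after
  -- multiplication by σ and add up to less than R; hence the norm of x is less than R.
  have hSJ : ∀ x ∈ S, x ∈ causalCone d σ → ‖x‖ < R := by
    rintro x ⟨y, hy, hxy⟩ hx
    have h1 := norm_le_of_mem_causalCone hσ hx
    have h2 : ‖x + y‖ < R := by simpa using hR hxy
    have h3 : σ * (x + y).1 ≤ ‖x + y‖ := by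
      refine (le_abs_self _).trans ?_
      rw [abs_eq_of_sign hσ]
      exact norm_fst_le (x + y)
    have h4 := hy.2
    rw [Prod.fst_add, mul_add] at h3
    linarith
  let χ : ContDiffBump (0 : Mink d) := ⟨R, R + 1, hR0, by linarith⟩
  set u : MinkTest d := mkTest (fun x => χ x * Ψ φ x) (χ.contDiff.mul hΨc)
    χ.hasCompactSupport.mul_right with hu
  have huz : ∀ z, u z = χ z * Ψ φ z := fun _ => rfl
  -- Where the cutoff equals 1 the equation holds exactly, and outside S everything vanishes. The
  -- error is therefore supported in S and off the ball of radius R, hence away from the cone.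
  have hη : H (c • u - boxTest u - φ) = 0 := by
    refine hHs _ (Set.disjoint_left.2 fun x hx hxJ => ?_)
    have h1 : x ∈ S := by
      refine closure_minimal (fun y hy => ?_) hSc hx
      by_contra hyS
      refine hy ?_
      have hus : tsupport u ⊆ S := closure_minimal (fun z hz => by
        by_contra hzS
        exact hz (by simp [huz, hΨS z hzS])) hSc
      have e1 : u y = 0 := image_eq_zero_of_notMem_tsupport fun h => hyS (hus h)
      have e2 : boxTest u y = 0 :=
        image_eq_zero_of_notMem_tsupport fun h => hyS (hus (tsupport_boxTest_subset u h))
      have e3 : φ y = 0 := image_eq_zero_of_notMem_tsupport fun h => hyS (hφS h)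
      have : (c • u - boxTest u - φ) y = c * u y - boxTest u y - φ y := rfl
      rw [this, e1, e2, e3]; simp
    have h2 : x ∉ Metric.ball (0 : Mink d) R := by
      have hcl : tsupport (c • u - boxTest u - φ) ⊆ (Metric.ball (0 : Mink d) R)ᶜ := by
        refine closure_minimal (fun y hy hyR => hy ?_) Metric.isOpen_ball.isClosed_compl
        have hev : u =ᶠ[𝓝 y] Ψ φ := by
          filter_upwards [Metric.isOpen_ball.mem_nhds hyR] with z hz
          have : χ z = 1 := χ.one_of_mem_closedBall (Metric.ball_subset_closedBall hz)
          simp [huz, this]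
        have e0 := boxTest_apply_of_eventuallyEq hΨ hev
        have e1 : boxTest u y = Ψ (boxTest φ) y := by
          rw [e0]
          let ev : MinkTest d →+ ℝ := ⟨⟨fun T => Ψ T y, by
            have : transTest (0 : MinkTest d) y = 0 := rfl
            simp [hΨdef, this]⟩, fun S T => by
              have : transTest (S + T) y = transTest S y + transTest T y := rfl
              simp [hΨdef, this]⟩
          have := map_add ev (-(∂_{((1, 0) : Mink d)} (∂_{((1, 0) : Mink d)} φ)))
            (∑ i : Fin (d - 1), ∂_{((0, EuclideanSpace.single i 1) : Mink d)}
            (∂_{((0, EuclideanSpace.single i 1) : Mink d)} φ))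
          rw [map_neg, map_sum] at this
          exact this.symm
        have : (c • u - boxTest u - φ) y = c * u y - boxTest u y - φ y := rfl
        rw [this, e1, hev.eq_of_nhds, hΨg, sub_self]
      exact hcl hx
    exact h2 (by simpa using hSJ x h1 hxJ)
  have h3 := hH u
  rw [map_sub, map_sub, map_smul, Complex.real_smul, h3] at hη
  simpa using hη

/-! ### Boundary values of functions of the logarithm. -/

/-- The logarithm of `b w + i s ε`. -/
def logReg (b s ε w : ℝ) : ℂ := Complex.log ((b * w : ℝ) + ((s * ε : ℝ) : ℂ) * Complex.I)

/-- The boundary value of the logarithm at `w + i s 0`, `s = ± 1`. -/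
def logBd (s w : ℝ) : ℂ := (Real.log w : ℂ) + if w < 0 then ((s * Real.pi : ℝ) : ℂ) * Complex.I else 0

theorem measurable_logReg (b s ε : ℝ) : Measurable (logReg b s ε) := by
  unfold logReg
  exact Complex.measurable_log.comp (by fun_prop)

theorem measurable_logBd (s : ℝ) : Measurable (logBd s) := by
  unfold logBd
  exact (Complex.measurable_ofReal.comp Real.measurable_log).add
    (Measurable.ite measurableSet_Iio measurable_const measurable_const)

theorem mem_slitPlane_reg {s ε : ℝ} (hs : s = 1 ∨ s = -1) (hε : ε ≠ 0) (x : ℝ) :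
    ((x : ℂ) + ((s * ε : ℝ) : ℂ) * Complex.I) ∈ Complex.slitPlane := by
  refine Or.inr ?_
  rcases hs with rfl | rfl <;> simp [hε]

theorem tendsto_logReg {b s w : ℝ} (hb : 0 < b) (hs : s = 1 ∨ s = -1) (hw : w ≠ 0) :
    Tendsto (fun ε => logReg b s ε w) (𝓝[>] 0) (𝓝 (logBd s (b * w))) := by
  have hc : Continuous fun ε : ℝ => ((b * w : ℝ) : ℂ) + ((s * ε : ℝ) : ℂ) * Complex.I := by fun_prop
  have ht : Tendsto (fun ε : ℝ => ((b * w : ℝ) : ℂ) + ((s * ε : ℝ) : ℂ) * Complex.I) (𝓝[>] 0)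
      (𝓝 ((b * w : ℝ) : ℂ)) := by
    have := (hc.tendsto 0).mono_left (nhdsWithin_le_nhds (s := Set.Ioi 0))
    simpa only [mul_zero, Complex.ofReal_zero, zero_mul, add_zero] using this
  rcases lt_or_gt_of_ne hw with hw' | hw'
  · have hbw : b * w < 0 := mul_neg_of_pos_of_neg hb hw'
    have hre : ((b * w : ℝ) : ℂ).re < 0 := by rwa [Complex.ofReal_re]
    have him : ((b * w : ℝ) : ℂ).im = 0 := Complex.ofReal_im _
    have hn : ‖((b * w : ℝ) : ℂ)‖ = |b * w| := Complex.norm_real _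
    rw [logBd, if_pos hbw, ← Real.log_abs]
    rcases hs with rfl | rfl
    · have h1 := (Complex.tendsto_log_nhdsWithin_im_nonneg_of_re_neg_of_im_zero hre him).comp
        (tendsto_nhdsWithin_iff.2 ⟨ht, by
          filter_upwards [self_mem_nhdsWithin] with ε hε
          have : (0 : ℝ) < ε := hε
          simp [this.le]⟩)
      rw [hn] at h1
      simpa only [one_mul, logReg, Function.comp_def] using! h1
    · have h1 := (Complex.tendsto_log_nhdsWithin_im_neg_of_re_neg_of_im_zero hre him).comp
        (tendsto_nhdsWithin_iff.2 ⟨ht, by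
          filter_upwards [self_mem_nhdsWithin] with ε hε
          have : (0 : ℝ) < ε := hε
          simp [this]⟩)
      rw [hn] at h1
      rw [neg_one_mul, Complex.ofReal_neg, neg_mul]
      exact h1
  · have hbw : 0 < b * w := mul_pos hb hw'
    rw [logBd, if_neg hbw.not_gt, add_zero, Complex.ofReal_log hbw.le]
    exact (continuousAt_clog (Or.inl (by rwa [Complex.ofReal_re]))).tendsto.comp ht

theorem exp_re_log {z : ℂ} (hz : z ≠ 0) : Real.exp (Complex.log z).re = ‖z‖ := by
  rw [Complex.log_re, Real.exp_log (norm_pos_iff.2 hz)]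

theorem exp_logReg {b s ε : ℝ} (hs : s = 1 ∨ s = -1) (hε : ε ≠ 0) (w : ℝ) :
    Complex.exp (logReg b s ε w) = (b * w : ℝ) + ((s * ε : ℝ) : ℂ) * Complex.I :=
  Complex.exp_log (Complex.slitPlane_ne_zero (mem_slitPlane_reg hs hε _))

/-- Local domination by `|z|^{-1/2}` of a function of `log z`. -/
def LogBound (F : ℂ → ℂ) : Prop := ∀ R : ℝ, ∃ C : ℝ, ∀ ζ : ℂ, |ζ.im| ≤ Real.pi →
  Real.exp ζ.re ≤ R → ‖F ζ‖ ≤ C * Real.exp ζ.re ^ (-(1 / 2) : ℝ)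

/-- Since |bw ± iε| ≥ b|w|, a bound by |z|^{-1/2} at the regularized point is a bound by |w|^{-1/2}
uniformly in ε. -/
theorem KernelTendsto.of_log {b s : ℝ} (hb : 0 < b) (hs : s = 1 ∨ s = -1) {F : ℂ → ℂ}
    (hF : Continuous F) (hFb : LogBound F) :
    KernelTendsto (fun ε w => F (logReg b s ε w)) (fun w => F (logBd s (b * w))) := by
  refine ⟨fun ε _ => hF.measurable.comp (measurable_logReg b s ε), fun R => ?_,
    fun w hw => (hF.tendsto _).comp (tendsto_logReg hb hs hw)⟩
  obtain ⟨C, hC⟩ := hFb (b * R + 1)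
  refine ⟨|C| * b ^ (-(1 / 2) : ℝ), fun ε hε w hw h0 => ?_⟩
  have hz := mem_slitPlane_reg hs hε.1.ne' (b * w)
  have hz0 := Complex.slitPlane_ne_zero hz
  have hn := exp_re_log hz0
  have h1 : ‖((b * w : ℝ) : ℂ) + ((s * ε : ℝ) : ℂ) * Complex.I‖ ≤ b * R + 1 := by
    refine (norm_add_le _ _).trans ?_
    rw [norm_mul, Complex.norm_I, mul_one, Complex.norm_real, Complex.norm_real, Real.norm_eq_abs,
      Real.norm_eq_abs, abs_mul, abs_of_pos hb, abs_eq_of_sign hs, abs_of_pos hε.1]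
    have := hε.2
    gcongr
  have h2 : b * |w| ≤ ‖((b * w : ℝ) : ℂ) + ((s * ε : ℝ) : ℂ) * Complex.I‖ := by
    refine le_trans (le_of_eq ?_) (Complex.abs_re_le_norm _)
    simp [abs_mul, abs_of_pos hb]
  refine (hC (logReg b s ε w) ?_ (by rw [logReg, hn]; exact h1)).trans ?_
  · rw [logReg, Complex.log_im]; exact Complex.abs_arg_le_pi _
  · rw [logReg, hn, mul_assoc, ← Real.mul_rpow hb.le (abs_nonneg w)]
    have hp : 0 < b * |w| := by positivity
    refine mul_le_mul (le_abs_self C) ?_ (by positivity) (abs_nonneg C)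
    exact Real.rpow_le_rpow_of_nonpos hp h2 (by norm_num)

/-- In the variable ζ = log z one has d/dz = e^{-ζ}d/dζ, so each level of T is the z-derivative of
the preceding one. For ε > 0 all levels are differentiable in w, and N integrations by parts descend
from level N to level 0, where dominated convergence applies. The chain rule and the sign convention
of ladders give the factor (-1/b)^N. -/
theorem tendsto_integral_tower {d N : ℕ} (h : 2 * N + 1 ≤ d - 1) (σ : ℝ) {b s : ℝ} (hb : 0 < b)
    (hs : s = 1 ∨ s = -1) {T : ℕ → ℂ → ℂ}
    (hT : ∀ i ζ, HasDerivAt (T i) (Complex.exp ζ * T (i + 1) ζ) ζ) (hT0 : LogBound (T 0))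
    (φ : MinkTest d) :
    Tendsto (fun ε => ∫ x : Mink d, (heaviside (σ * x.1) : ℂ) * T N (logReg b s ε (minkSq x)) *
      (φ x : ℂ)) (𝓝[>] 0)
      (𝓝 (coneDist d σ N (fun w => (-(b : ℂ)⁻¹) ^ N * T 0 (logBd s (b * w))) φ)) := by
  have hTc : ∀ i, Continuous (T i) := fun i => continuous_iff_continuousAt.2 fun ζ =>
    (hT i ζ).continuousAt
  have hb0 : (b : ℂ) ≠ 0 := by exact_mod_cast hb.ne'
  have hlad : ∀ ε > 0, IsLadder ∅ N
      (fun i w => (-(b : ℂ)⁻¹) ^ (N - i) * T i (logReg b s ε w)) := by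
    intro ε hε
    have hd : ∀ i w, HasDerivAt (fun w : ℝ => T i (logReg b s ε w)) (b * T (i + 1) (logReg b s ε w)) w := by
      intro i w
      have hz := mem_slitPlane_reg hs hε.ne' (b * w)
      have h1 : HasDerivAt (fun w : ℝ => ((b * w : ℝ) : ℂ) + ((s * ε : ℝ) : ℂ) * Complex.I) (b : ℂ) w := by
        have := ((hasDerivAt_id w).const_mul b).ofReal_comp.add_const (((s * ε : ℝ) : ℂ) * Complex.I)
        simpa using! this
      have h2 := (hT i (logReg b s ε w)).comp w (h1.clog_real hz)
      refine h2.congr_deriv ?_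
      rw [exp_logReg hs hε.ne']
      have := Complex.slitPlane_ne_zero hz
      rw [mul_right_comm, mul_div_cancel₀ _ this]
    have hcont : ∀ i, Continuous fun w : ℝ => T i (logReg b s ε w) := fun i =>
      continuous_iff_continuousAt.2 fun w => (hd i w).continuousAt
    refine ⟨fun i _ => continuous_const.mul (hcont i), fun i hi w _ => ?_,
      .of_continuous (continuous_const.mul (hcont N))⟩
    refine ((hd i w).const_mul _).congr_deriv ?_
    rw [show N - i = N - (i + 1) + 1 by omega, pow_succ]
    field_simp
  have hk := KernelTendsto.of_log hb hs (F := fun ζ => (-(b : ℂ)⁻¹) ^ N * T 0 ζ)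
    (continuous_const.mul (hTc 0)) (fun R => by
      obtain ⟨C, hC⟩ := hT0 R
      refine ⟨‖(-(b : ℂ)⁻¹) ^ N‖ * C, fun ζ h1 h2 => ?_⟩
      rw [norm_mul, mul_assoc]
      exact mul_le_mul_of_nonneg_left (hC ζ h1 h2) (norm_nonneg _))
  have hm : Measurable fun w => (-(b : ℂ)⁻¹) ^ N * T 0 (logBd s (b * w)) :=
    ((hTc 0).measurable.comp ((measurable_logBd s).comp (measurable_const_mul b))).const_mul _
  refine (hk.tendsto_coneDist h σ hm φ).congr' ?_
  filter_upwards [self_mem_nhdsWithin] with ε hε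
  have := (hlad ε hε).integral_eq_coneDist h σ Set.countable_empty φ
  simpa using this.symm

/-- From log u ≤ u at u = r^{1/2} and at u = r^{-1/2}. -/
theorem abs_log_le {r R : ℝ} (hr : 0 < r) (hR : r ≤ R) :
    |Real.log r| ≤ 2 * (R + 1) * r ^ (-(1 / 2) : ℝ) := by
  have h2 : r ^ (1 / 2 : ℝ) = r * r ^ (-(1 / 2) : ℝ) := by
    rw [← Real.rpow_one_add' hr.le (by norm_num)]; norm_num
  have hp : 0 < r ^ (-(1 / 2) : ℝ) := by positivity
  have h3 := Real.log_le_self (x := r ^ (1 / 2 : ℝ)) (by positivity)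
  have h4 := Real.log_le_self (x := r ^ (-(1 / 2) : ℝ)) (by positivity)
  rw [Real.log_rpow hr] at h3 h4
  rw [h2] at h3
  have h5 : r * r ^ (-(1 / 2) : ℝ) ≤ R * r ^ (-(1 / 2) : ℝ) := by gcongr
  have h6 : 0 < R * r ^ (-(1 / 2) : ℝ) := mul_pos (hr.trans_le hR) hp
  rw [abs_le]
  constructor <;> linarith

/-! ### Towers of primitives and their jumps across the negative axis. -/

/-- Successive derivatives of `z^{p - 1/2}`, normalized, in terms of `log z`. -/
def halfTower (p i : ℕ) (ζ : ℂ) : ℂ :=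
  Complex.exp (((p - i - 1 / 2 : ℝ) : ℂ) * ζ) / (Real.Gamma (p - i + 1 / 2) : ℂ)

theorem Gamma_half_ne_zero (p i : ℕ) : Real.Gamma (p - i + 1 / 2) ≠ 0 := by
  refine Real.Gamma_ne_zero fun k hk => ?_
  have h : ((2 * p + 1 + 2 * k : ℕ) : ℝ) = ((2 * i : ℕ) : ℝ) := by push_cast; linarith
  have h' := Nat.cast_injective h
  omega

theorem hasDerivAt_halfTower (p i : ℕ) (ζ : ℂ) :
    HasDerivAt (halfTower p i) (Complex.exp ζ * halfTower p (i + 1) ζ) ζ := by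
  have h1 := ((hasDerivAt_id ζ).const_mul ((p - i - 1 / 2 : ℝ) : ℂ)).cexp.div_const
    (Real.Gamma (p - i + 1 / 2) : ℂ)
  refine h1.congr_deriv ?_
  have hne : (p - i - 1 / 2 : ℝ) ≠ 0 := fun h => by
    have h : ((2 * p : ℕ) : ℝ) = ((2 * i + 1 : ℕ) : ℝ) := by push_cast; linarith
    have h' := Nat.cast_injective h
    omega
  have hG := Real.Gamma_add_one hne
  have e1 : (p - i - 1 / 2 : ℝ) + 1 = p - i + 1 / 2 := by ring
  have e2 : (p - (i + 1 : ℕ) + 1 / 2 : ℝ) = p - i - 1 / 2 := by push_cast; ring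
  rw [e1] at hG
  have hG0 : Real.Gamma (p - i - 1 / 2) ≠ 0 := by rw [← e2]; exact Gamma_half_ne_zero p (i + 1)
  have hG0' : (Real.Gamma (p - i - 1 / 2) : ℂ) ≠ 0 := by exact_mod_cast hG0
  have hne' : ((p - i - 1 / 2 : ℝ) : ℂ) ≠ 0 := by exact_mod_cast hne
  rw [halfTower, e2, ← mul_div_assoc, ← Complex.exp_add, hG, Complex.ofReal_mul]
  have e3 : ζ + ((p - (i + 1 : ℕ) - 1 / 2 : ℝ) : ℂ) * ζ = ((p - i - 1 / 2 : ℝ) : ℂ) * id ζ := by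
    push_cast; simp; ring
  rw [e3]
  rw [mul_one, mul_comm, mul_div_mul_left _ _ hne']

theorem norm_exp_real_mul (x : ℝ) (ζ : ℂ) :
    ‖Complex.exp ((x : ℂ) * ζ)‖ = Real.exp ζ.re ^ x := by
  rw [Complex.norm_exp, Complex.re_ofReal_mul, mul_comm, Real.exp_mul]

theorem logBound_halfTower (p : ℕ) : LogBound (halfTower p 0) := by
  intro R
  refine ⟨R ^ p / ‖(Real.Gamma (p + 1 / 2) : ℂ)‖, fun ζ _ h2 => ?_⟩
  rw [halfTower, norm_div, norm_exp_real_mul]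
  have e : (p - (0 : ℕ) - 1 / 2 : ℝ) = p + -(1 / 2) := by push_cast; ring
  rw [e, Real.rpow_add (Real.exp_pos _), Real.rpow_natCast, Nat.cast_zero, sub_zero, div_mul_eq_mul_div]
  have := Real.exp_pos ζ.re
  gcongr

/-- Successive derivatives of `z^p (log z - H_p) / p!`, in terms of `log z`. -/
def intTower (p i : ℕ) (ζ : ℂ) : ℂ :=
  if i ≤ p then Complex.exp (((p - i : ℕ) : ℂ) * ζ) / ((p - i).factorial : ℂ) *
    (ζ - ((harmonic (p - i) : ℚ) : ℂ))
  else (-1) ^ (i - p - 1) * ((i - p - 1).factorial : ℂ) * Complex.exp (-((i - p : ℕ) : ℂ) * ζ)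

/-- The harmonic number absorbs the term 1/(p+1) from differentiating the logarithm, so the shape is
preserved down to log z itself; from then on the levels are negative powers. -/
theorem hasDerivAt_intTower (p i : ℕ) (ζ : ℂ) :
    HasDerivAt (intTower p i) (Complex.exp ζ * intTower p (i + 1) ζ) ζ := by
  rcases lt_trichotomy i p with h | rfl | h
  · obtain ⟨k, rfl⟩ := Nat.exists_eq_add_of_lt h
    have e : i + k + 1 - i = k + 1 := by omega
    have e' : i + k + 1 - (i + 1) = k := by omega
    have hf : intTower (i + k + 1) i = fun ζ => Complex.exp (((k + 1 : ℕ) : ℂ) * ζ) /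
        ((k + 1).factorial : ℂ) * (ζ - ((harmonic (k + 1) : ℚ) : ℂ)) := by
      ext ζ; rw [intTower, if_pos (by omega), e]
    rw [hf, intTower, if_pos (by omega), e']
    have h1 := (((hasDerivAt_id ζ).const_mul ((k + 1 : ℕ) : ℂ)).cexp.div_const
      ((k + 1).factorial : ℂ)).mul ((hasDerivAt_id ζ).sub_const ((harmonic (k + 1) : ℚ) : ℂ))
    refine h1.congr_deriv ?_
    rw [harmonic_succ, Nat.factorial_succ]
    have hk : ((k : ℂ) + 1) ≠ 0 := by exact_mod_cast Nat.succ_ne_zero k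
    have hfk : (k.factorial : ℂ) ≠ 0 := by exact_mod_cast Nat.factorial_ne_zero k
    have ee : Complex.exp ((k + 1) * ζ) = Complex.exp ζ * Complex.exp (k * ζ) := by
      rw [← Complex.exp_add]; ring_nf
    simp only [id]
    push_cast
    rw [ee]
    field_simp
    ring
  · have hf : intTower i i = fun ζ => ζ := by ext ζ; simp [intTower]
    rw [hf, intTower, if_neg (by omega)]
    refine (hasDerivAt_id ζ).congr_deriv ?_
    simp [← Complex.exp_add]
  · obtain ⟨k, rfl⟩ := Nat.exists_eq_add_of_lt h
    have e : p + k + 1 - p = k + 1 := by omega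
    have e' : p + k + 1 + 1 - p = k + 2 := by omega
    have hf : intTower p (p + k + 1) = fun ζ => (-1) ^ k * (k.factorial : ℂ) *
        Complex.exp (-((k + 1 : ℕ) : ℂ) * ζ) := by
      ext ζ; rw [intTower, if_neg (by omega), e]; simp
    rw [hf, intTower, if_neg (by omega), e']
    have h1 := ((hasDerivAt_id ζ).const_mul (-((k + 1 : ℕ) : ℂ))).cexp.const_mul
      ((-1) ^ k * (k.factorial : ℂ))
    refine h1.congr_deriv ?_
    have ee : Complex.exp (-((k + 1 : ℕ) : ℂ) * ζ) = Complex.exp ζ * Complex.exp (-((k + 2 : ℕ) : ℂ) * ζ) := by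
      rw [← Complex.exp_add]; push_cast; ring_nf
    simp only [id]
    rw [ee, show k + 2 - 1 = k + 1 by omega, Nat.factorial_succ]
    push_cast
    ring

theorem logBound_intTower (p : ℕ) : LogBound (intTower p 0) := by
  intro R
  set A : ℝ := Real.pi + ‖((harmonic p : ℚ) : ℂ)‖ with hA
  refine ⟨R ^ p / p.factorial * (2 * (R + 1) + A * R ^ (1 / 2 : ℝ)), fun ζ h1 h2 => ?_⟩
  set r := Real.exp ζ.re with hr
  have hr0 : 0 < r := Real.exp_pos _
  have e1 : ‖Complex.exp ((p : ℂ) * ζ)‖ = r ^ p := by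
    have := norm_exp_real_mul p ζ
    rw [Real.rpow_natCast] at this
    exact_mod_cast this
  rw [intTower, if_pos (Nat.zero_le p), Nat.sub_zero, norm_mul, norm_div, e1, Complex.norm_natCast,
    mul_assoc]
  have h3 : ‖ζ‖ ≤ |Real.log r| + Real.pi := by
    rw [hr, Real.log_exp]
    exact (Complex.norm_le_abs_re_add_abs_im ζ).trans (by gcongr)
  have h4 := abs_log_le hr0 h2
  have h5 := one_le_mul_abs_rpow (R := R) (w := r) (by rwa [abs_of_pos hr0]) hr0.ne'
  rw [abs_of_pos hr0] at h5
  have h6 : ‖ζ - ((harmonic p : ℚ) : ℂ)‖ ≤ (2 * (R + 1) + A * R ^ (1 / 2 : ℝ)) * r ^ (-(1 / 2) : ℝ) := by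
    have hA0 : 0 ≤ A := by positivity
    have := mul_le_mul_of_nonneg_left h5 hA0
    calc _ ≤ ‖ζ‖ + ‖((harmonic p : ℚ) : ℂ)‖ := norm_sub_le _ _
      _ ≤ 2 * (R + 1) * r ^ (-(1 / 2) : ℝ) + A * 1 := by rw [hA]; linarith
      _ ≤ _ := by rw [add_mul]; linarith
  have hR : 0 ≤ R := hr0.le.trans h2
  gcongr

/-- The smeared boundary value of `(b w + i s ε)^l`. -/
def powInt {d : ℕ} (σ b l s : ℝ) (φ : MinkTest d) (ε : ℝ) : ℂ :=
  ∫ x : Mink d, (heaviside (σ * x.1) : ℂ) * Complex.exp ((l : ℂ) * logReg b s ε (minkSq x)) * (φ x : ℂ)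

theorem coneDist_sub {d N : ℕ} (h : 2 * N + 1 ≤ d - 1) (σ : ℝ) {K L : ℝ → ℂ} (hK : Admissible K)
    (hL : Admissible L) (φ : MinkTest d) :
    coneDist d σ N K φ - coneDist d σ N L φ = coneDist d σ N (fun w => K w - L w) φ := by
  have hKL : Admissible fun w => K w - L w := by
    simpa [sub_eq_add_neg] using hK.add (hL.const_mul (-1))
  rw [coneDist_apply h σ hK, coneDist_apply h σ hL, coneDist_apply h σ hKL, ← integral_sub
    (integrable_coneWeight_mul h σ hK _) (integrable_coneWeight_mul h σ hL _)]
  congr 1; ext x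
  simp only [coneWeight]; ring

theorem coneDist_const_mul {d N : ℕ} (h : 2 * N + 1 ≤ d - 1) (σ : ℝ) {K : ℝ → ℂ}
    (hK : Admissible K) (a : ℂ) (φ : MinkTest d) :
    coneDist d σ N (fun w => a * K w) φ = a * coneDist d σ N K φ := by
  rw [coneDist_apply h σ hK, coneDist_apply h σ (hK.const_mul a), ← integral_const_mul]
  congr 1; ext x
  simp only [coneWeight]; ring

theorem LogBound.admissible {F : ℂ → ℂ} (hF : Continuous F) (hFb : LogBound F) {b s : ℝ}
    (hb : 0 < b) (hs : s = 1 ∨ s = -1) : Admissible (fun w => F (logBd s (b * w))) :=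
  (KernelTendsto.of_log hb hs hF hFb).admissible
    (hF.measurable.comp ((measurable_logBd s).comp (measurable_const_mul b)))

theorem exp_pi_mul_I_nat (p : ℕ) : Complex.exp ((p : ℂ) * (Real.pi * Complex.I)) = (-1) ^ p := by
  rw [Complex.exp_nat_mul, Complex.exp_pi_mul_I]

/-- For w < 0 the two boundary values carry the phases e^{±iπ(p-1/2)} = ∓i(-1)^p; for w ≥ 0 the two
logarithms coincide. -/
theorem halfTower_sub (p : ℕ) (w : ℝ) :
    halfTower p 0 (logBd 1 w) - halfTower p 0 (logBd (-1) w) =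
      -2 * Complex.I * (-1) ^ p * (primPow (p - 1 / 2) w : ℂ) := by
  by_cases hw : w < 0
  · have hw' : 0 < -w := neg_pos.2 hw
    simp only [halfTower, logBd, if_pos hw, primPow]
    have e1 : ∀ s : ℝ, ((p - (0 : ℕ) - 1 / 2 : ℝ) : ℂ) * ((Real.log w : ℂ) + ((s * Real.pi : ℝ) : ℂ) * Complex.I) =
        ((p - 1 / 2 : ℝ) * Real.log w : ℝ) + (s * ((p : ℂ) * (Real.pi * Complex.I)) -
          s * (Real.pi / 2 * Complex.I)) := fun s => by push_cast; ring
    have e2 : ((-w) ^ (p - 1 / 2 : ℝ) : ℝ) = Real.exp ((p - 1 / 2 : ℝ) * Real.log w) := by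
      rw [Real.rpow_def_of_pos hw', Real.log_neg_eq_log, mul_comm]
    have e3 : Complex.exp (((1 : ℝ) : ℂ) * ((p : ℂ) * (Real.pi * Complex.I)) -
        ((1 : ℝ) : ℂ) * (Real.pi / 2 * Complex.I)) = -Complex.I * (-1) ^ p := by
      rw [Complex.exp_sub, Complex.ofReal_one, one_mul, one_mul, exp_pi_mul_I_nat,
        Complex.exp_pi_div_two_mul_I, div_eq_mul_inv, Complex.inv_I, mul_comm]
    have e4 : Complex.exp (((-1 : ℝ) : ℂ) * ((p : ℂ) * (Real.pi * Complex.I)) -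
        ((-1 : ℝ) : ℂ) * (Real.pi / 2 * Complex.I)) = Complex.I * (-1) ^ p := by
      rw [Complex.exp_sub, Complex.ofReal_neg, Complex.ofReal_one, neg_one_mul, neg_one_mul,
        Complex.exp_neg, Complex.exp_neg, exp_pi_mul_I_nat,
        Complex.exp_pi_div_two_mul_I, div_inv_eq_mul, mul_comm, ← inv_pow]
      norm_num
    have e5 : (p - (0 : ℕ) + 1 / 2 : ℝ) = p - 1 / 2 + 1 := by push_cast; ring
    rw [e1, e1, Complex.exp_add, Complex.exp_add, e3, e4, e2, e5]
    push_cast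
    ring
  · simp [halfTower, logBd, primPow, if_neg hw]

/-- Only the logarithm jumps, by 2πi; the integer power is single-valued and the harmonic number
cancels. -/
theorem intTower_sub (p : ℕ) (w : ℝ) :
    intTower p 0 (logBd 1 w) - intTower p 0 (logBd (-1) w) =
      2 * Real.pi * Complex.I * (-1) ^ p * (primPow p w : ℂ) := by
  by_cases hw : w < 0
  · have hw' : 0 < -w := neg_pos.2 hw
    simp only [intTower, logBd, if_pos hw, primPow, if_pos (Nat.zero_le p), Nat.sub_zero]
    have e1 : ∀ s : ℝ, (p : ℂ) * ((Real.log w : ℂ) + ((s * Real.pi : ℝ) : ℂ) * Complex.I) =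
        (p : ℂ) * Real.log w + (s * ((p : ℂ) * (Real.pi * Complex.I))) := fun s => by push_cast; ring
    have e2 : Complex.exp ((p : ℂ) * Real.log w) = ((-w) ^ p : ℝ) := by
      rw [Complex.exp_nat_mul, ← Complex.ofReal_exp, ← Real.log_neg_eq_log, Real.exp_log hw']
      push_cast; rfl
    have e3 : Complex.exp (((1 : ℝ) : ℂ) * ((p : ℂ) * (Real.pi * Complex.I))) = (-1) ^ p := by
      rw [Complex.ofReal_one, one_mul, exp_pi_mul_I_nat]
    have e4 : Complex.exp (((-1 : ℝ) : ℂ) * ((p : ℂ) * (Real.pi * Complex.I))) = (-1) ^ p := by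
      rw [Complex.ofReal_neg, Complex.ofReal_one, neg_one_mul, Complex.exp_neg, exp_pi_mul_I_nat,
        ← inv_pow]
      norm_num
    rw [e1, e1, Complex.exp_add, Complex.exp_add, e3, e4, e2, Real.Gamma_nat_eq_factorial,
      Real.rpow_natCast]
    push_cast
    ring
  · simp [intTower, logBd, primPow, if_neg hw]

/-- A tower having `z^{p - N - a}` at level `N`, up to a constant. -/
theorem exists_tower {N : ℕ} {a : ℝ} (ha : a = 0 ∨ a = 1 / 2) {p : ℕ} (hp : p < N) :
    ∃ (T : ℕ → ℂ → ℂ) (g : ℂ), (∀ i ζ, HasDerivAt (T i) (Complex.exp ζ * T (i + 1) ζ) ζ) ∧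
      LogBound (T 0) ∧ (∀ ζ, Complex.exp (((p - N - a : ℝ) : ℂ) * ζ) = g * T N ζ) ∧
      ∀ w, g * (T 0 (logBd 1 w) - T 0 (logBd (-1) w)) = (-1) ^ N *
        (-2 * Real.pi * Complex.I / (Real.Gamma (N + a - p) : ℂ)) * (primPow (p - a) w : ℂ) := by
  rcases ha with rfl | rfl
  · obtain ⟨k, rfl⟩ := Nat.exists_eq_add_of_lt hp
    have hk : (k.factorial : ℂ) ≠ 0 := by exact_mod_cast Nat.factorial_ne_zero k
    -- Level N = p + k + 1 lies past the logarithm and equals (-1)^k k! z^{-k-1}, whence the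
    -- normalizing constant.
    refine ⟨intTower p, (-1) ^ k / (k.factorial : ℂ), hasDerivAt_intTower p, logBound_intTower p,
      fun ζ => ?_, fun w => ?_⟩
    · rw [intTower, if_neg (by omega), show p + k + 1 - p = k + 1 by omega, Nat.add_sub_cancel]
      have e : ((p - (p + k + 1 : ℕ) - 0 : ℝ) : ℂ) = -((k + 1 : ℕ) : ℂ) := by push_cast; ring
      have e2 : ((-1 : ℂ) ^ k) * (-1) ^ k = 1 := by rw [← mul_pow]; simp
      rw [e, ← mul_assoc, div_mul_eq_mul_div, ← mul_assoc, e2, one_mul, div_self hk, one_mul]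
    · rw [intTower_sub]
      have e : ((p + k + 1 : ℕ) + 0 - p : ℝ) = (k : ℝ) + 1 := by push_cast; ring
      have e2 : ((-1 : ℂ) ^ p) * (-1) ^ p = 1 := by rw [← mul_pow]; simp
      rw [e, Real.Gamma_nat_eq_factorial, sub_zero, pow_succ, pow_add, Complex.ofReal_natCast]
      field_simp
  · refine ⟨halfTower p, (Real.Gamma (p - N + 1 / 2) : ℂ), hasDerivAt_halfTower p,
      logBound_halfTower p, fun ζ => ?_, fun w => ?_⟩
    · have : (Real.Gamma (p - N + 1 / 2) : ℂ) ≠ 0 := by exact_mod_cast Gamma_half_ne_zero p N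
      rw [halfTower, mul_div_cancel₀ _ this]
    · rw [halfTower_sub]
      -- The reflection formula brings the half-integer jump into the same form as the integer one.
      have hr := Real.Gamma_mul_Gamma_one_sub (N + 1 / 2 - p)
      have e1 : (1 - (N + 1 / 2 - p) : ℝ) = p - N + 1 / 2 := by ring
      have hs : Real.sin (Real.pi * (N + 1 / 2 - p)) = (-1) ^ N * (-1) ^ p := by
        have : Real.pi * (N + 1 / 2 - p) = (N * Real.pi - p * Real.pi) + Real.pi / 2 := by ring
        rw [this, Real.sin_add_pi_div_two, Real.cos_sub, Real.cos_nat_mul_pi, Real.cos_nat_mul_pi,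
          Real.sin_nat_mul_pi, zero_mul, add_zero]
      rw [e1, hs] at hr
      have hN2 : ((-1 : ℂ) ^ N) * (-1) ^ N = 1 := by rw [← mul_pow]; simp
      have hp2 : ((-1 : ℂ) ^ p) * (-1) ^ p = 1 := by rw [← mul_pow]; simp
      have hN3 : ((-1 : ℂ) ^ N) ≠ 0 := by simp
      have hp3 : ((-1 : ℂ) ^ p) ≠ 0 := by simp
      have hG : Real.Gamma (N + 1 / 2 - p) ≠ 0 := (Real.Gamma_pos_of_pos (by
        have : (p : ℝ) < N := by exact_mod_cast hp
        linarith)).ne'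
      have hG' : (Real.Gamma (N + 1 / 2 - p) : ℂ) ≠ 0 := by exact_mod_cast hG
      have hr' : (Real.Gamma (N + 1 / 2 - p) : ℂ) * (Real.Gamma (p - N + 1 / 2) : ℂ) =
          Real.pi / ((-1) ^ N * (-1) ^ p) := by exact_mod_cast congrArg ((↑) : ℝ → ℂ) hr
      have hr2 : (Real.Gamma (p - N + 1 / 2) : ℂ) =
          Real.pi * (-1) ^ N * (-1) ^ p / (Real.Gamma (N + 1 / 2 - p) : ℂ) := by
        rw [eq_div_iff hG', mul_comm, hr', div_eq_iff (mul_ne_zero hN3 hp3)]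
        linear_combination -(Real.pi : ℂ) * (-1) ^ p * (-1) ^ p * hN2 - (Real.pi : ℂ) * hp2
      rw [hr2]
      linear_combination (-2 * Complex.I * Real.pi * (-1) ^ N / (Real.Gamma (N + 1 / 2 - p) : ℂ) *
        (primPow (p - 1 / 2) w : ℂ)) * hp2

/-- At level N of the tower stands the wanted power, at level 0 its N-th primitive. Both one-sided
limits exist separately, and their difference is the cone distribution of the jump of the primitive.
-/
theorem tendsto_powInt {d N : ℕ} (h : 2 * N + 1 ≤ d - 1) (σ : ℝ) {a b : ℝ}
    (ha : a = 0 ∨ a = 1 / 2) (hb : 0 < b) {p : ℕ} (hp : p < N) (φ : MinkTest d) :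
    ∃ Q : ℝ → ℂ, (∀ s, s = 1 ∨ s = -1 → Tendsto (powInt σ b (p - N - a) s φ) (𝓝[>] 0) (𝓝 (Q s))) ∧
      Q 1 - Q (-1) = coneDist d σ N (fun w => ((b : ℂ)⁻¹) ^ N *
        (-2 * Real.pi * Complex.I / (Real.Gamma (N + a - p) : ℂ)) * (primPow (p - a) (b * w) : ℂ)) φ := by
  obtain ⟨T, g, hT, hT0, hTN, hj⟩ := exists_tower ha hp
  have hTc : Continuous (T 0) := continuous_iff_continuousAt.2 fun ζ => (hT 0 ζ).continuousAt
  have hadm : ∀ s, s = 1 ∨ s = -1 → Admissible (fun w => g * ((-(b : ℂ)⁻¹) ^ N * T 0 (logBd s (b * w)))) :=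
    fun s hs => ((hT0.admissible hTc hb hs).const_mul _).const_mul _
  refine ⟨fun s => coneDist d σ N (fun w => g * ((-(b : ℂ)⁻¹) ^ N * T 0 (logBd s (b * w)))) φ,
    fun s hs => ?_, ?_⟩
  · beta_reduce
    rw [coneDist_const_mul h σ ((hT0.admissible hTc hb hs).const_mul _)]
    refine ((tendsto_integral_tower h σ hb hs hT hT0 φ).const_mul g).congr fun ε => ?_
    rw [powInt, ← integral_const_mul]
    congr 1; ext x
    rw [hTN]; ring
  · rw [coneDist_sub h σ (hadm 1 (by simp)) (hadm (-1) (by simp))]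
    congr 2
    ext w
    have e2 : ((-1 : ℂ) ^ N) * (-1) ^ N = 1 := by rw [← mul_pow]; simp
    rw [neg_pow]
    have := hj (b * w)
    linear_combination (-1) ^ N * ((b : ℂ)⁻¹) ^ N * this + ((b : ℂ)⁻¹) ^ N *
      (-2 * Real.pi * Complex.I / (Real.Gamma (N + a - p) : ℂ)) * (primPow (p - a) (b * w) : ℂ) * e2

/-! ### Splitting the kernel series at j = N. -/

theorem primPow_eq_max {l : ℝ} (hl : 0 < l) (w : ℝ) :
    primPow l w = max (-w) 0 ^ l / Real.Gamma (l + 1) := by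
  by_cases hw : w < 0
  · rw [primPow, if_pos hw, max_eq_left (by linarith)]
  · rw [primPow, if_neg hw, max_eq_right (by linarith), Real.zero_rpow hl.ne', zero_div]

theorem continuous_primPow {l : ℝ} (hl : 0 < l) : Continuous (primPow l) := by
  rw [funext (primPow_eq_max hl)]
  exact ((continuous_neg.max continuous_const).rpow_const fun _ => Or.inr hl.le).div_const _

/-- The normalization by Γ(l + 1) makes -d/dw a pure shift of the index. -/
theorem hasDerivAt_primPow {l : ℝ} (hl : l + 1 ≠ 0) {w : ℝ} (hw : w ≠ 0) :
    HasDerivAt (primPow (l + 1)) (-primPow l w) w := by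
  rcases lt_or_gt_of_ne hw with hw' | hw'
  · have hp : 0 < -w := by linarith
    have h1 : HasDerivAt (fun w : ℝ => (-w) ^ (l + 1) / Real.Gamma (l + 1 + 1)) _ w :=
      (((hasDerivAt_id w).neg).rpow_const (p := l + 1) (Or.inl hp.ne')).div_const _
    refine (h1.congr_of_eventuallyEq ?_).congr_deriv ?_
    · filter_upwards [gt_mem_nhds hw'] with y hy
      rw [primPow, if_pos hy]
    · rw [primPow, if_pos hw', Real.Gamma_add_one hl, add_sub_cancel_right]
      simp only [Pi.neg_apply, id]
      rw [neg_one_mul, neg_mul, neg_div, mul_div_mul_left _ _ hl]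
  · rw [primPow_of_nonneg l hw'.le, neg_zero]
    refine (hasDerivAt_const w (0 : ℝ)).congr_of_eventuallyEq ?_
    filter_upwards [lt_mem_nhds hw'] with y hy
    rw [primPow_of_nonneg _ hy.le]

/-- The terms `j ≥ N` of the kernel, shifted by `r - N` in the powers of `w_-`. -/
def tailKernel (a : ℝ) (c : ℂ) (N r : ℕ) (w : ℝ) : ℂ :=
  ∑' j : ℕ, c ^ (j + N) / ((j + N).factorial : ℂ) * (primPow ((j + r : ℕ) - a) (w / 4) : ℂ)

theorem norm_tailKernel_term_le {a : ℝ} (ha : a = 0 ∨ a = 1 / 2) (c : ℂ) (N r j : ℕ) {A w : ℝ}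
    (hA1 : 1 ≤ A) (hA : |w / 4| ≤ A) :
    ‖c ^ (j + N) / ((j + N).factorial : ℂ) * (primPow ((j + r : ℕ) - a) (w / 4) : ℂ)‖ ≤
      (‖c‖ * A) ^ (j + N) / (j + N).factorial *
        (A ^ r * |primPow (-a) (w / 4)| * (2 * Real.Gamma (1 - a))) := by
  have hG : 0 < Real.Gamma (1 - a) :=
    Real.Gamma_pos_of_pos (by rcases ha with rfl | rfl <;> norm_num)
  rw [norm_mul, norm_div, norm_pow, Complex.norm_natCast, Complex.norm_real, Real.norm_eq_abs,
    mul_pow]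
  have h1 : |w / 4| ^ (j + r) ≤ A ^ (j + N) * A ^ r := by
    calc |w / 4| ^ (j + r) ≤ A ^ (j + r) := by gcongr
      _ ≤ A ^ (j + N + r) := pow_le_pow_right₀ hA1 (by omega)
      _ = _ := pow_add _ _ _
  calc _ ≤ ‖c‖ ^ (j + N) / (j + N).factorial * (|w / 4| ^ (j + r) * |primPow (-a) (w / 4)| *
        (2 * Real.Gamma (1 - a))) := by gcongr; exact abs_primPow_le ha (j + r) _
    _ ≤ ‖c‖ ^ (j + N) / (j + N).factorial * (A ^ (j + N) * A ^ r * |primPow (-a) (w / 4)| *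
        (2 * Real.Gamma (1 - a))) := by gcongr
    _ = _ := by ring

theorem summable_pow_div_factorial_add (x : ℝ) (N : ℕ) :
    Summable fun j : ℕ => x ^ (j + N) / ((j + N).factorial : ℝ) :=
  (summable_nat_add_iff N).2 (Real.summable_pow_div_factorial x)

theorem hasSum_tailKernel {a : ℝ} (ha : a = 0 ∨ a = 1 / 2) (c : ℂ) (N r : ℕ) (w : ℝ) :
    HasSum (fun j : ℕ => c ^ (j + N) / ((j + N).factorial : ℂ) *
      (primPow ((j + r : ℕ) - a) (w / 4) : ℂ)) (tailKernel a c N r w) :=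
  (Summable.of_norm_bounded ((summable_pow_div_factorial_add _ N).mul_right _) fun j =>
    norm_tailKernel_term_le ha c N r j (le_max_left 1 |w / 4|) (le_max_right _ _)).hasSum

theorem measurable_tailKernel {a : ℝ} (ha : a = 0 ∨ a = 1 / 2) (c : ℂ) (N r : ℕ) :
    Measurable (tailKernel a c N r) := by
  refine measurable_of_tendsto_metrizable (f := fun n w => ∑ j ∈ Finset.range n,
    c ^ (j + N) / ((j + N).factorial : ℂ) * (primPow ((j + r : ℕ) - a) (w / 4) : ℂ)) (fun n => ?_)
    (tendsto_pi_nhds.2 fun w => (hasSum_tailKernel ha c N r w).tendsto_sum_nat)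
  have := fun j : ℕ => measurable_primPow ((j + r : ℕ) - a)
  fun_prop

theorem admissible_tailKernel {a : ℝ} (ha : a = 0 ∨ a = 1 / 2) (c : ℂ) (N r : ℕ) :
    Admissible (tailKernel a c N r) := by
  refine ⟨measurable_tailKernel ha c N r, fun R => ?_⟩
  obtain ⟨C, hC0, hC⟩ := abs_primPow_neg_le ha R
  have hG : 0 < Real.Gamma (1 - a) :=
    Real.Gamma_pos_of_pos (by rcases ha with rfl | rfl <;> norm_num)
  set A := max 1 (R / 4) with hA
  refine ⟨(∑' j : ℕ, (‖c‖ * A) ^ (j + N) / ((j + N).factorial : ℝ)) *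
    (A ^ r * C * (2 * Real.Gamma (1 - a))), fun w hw h0 => ?_⟩
  have h1 : |w / 4| ≤ A := by
    rw [abs_div, abs_of_pos (by norm_num : (0 : ℝ) < 4)]
    exact le_trans (by gcongr) (le_max_right _ _)
  have hs := (summable_pow_div_factorial_add (‖c‖ * A) N).hasSum
  refine (tsum_of_norm_bounded (hs.mul_right _) fun j =>
    norm_tailKernel_term_le ha c N r j (le_max_left _ _) h1).trans ?_
  have hA0 : 0 < A := lt_of_lt_of_le one_pos (le_max_left _ _)
  have h0' : 0 ≤ ∑' j : ℕ, (‖c‖ * A) ^ (j + N) / ((j + N).factorial : ℝ) :=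
    tsum_nonneg fun j => by positivity
  calc _ ≤ (∑' j : ℕ, (‖c‖ * A) ^ (j + N) / ((j + N).factorial : ℝ)) *
      (A ^ r * (C * |w| ^ (-(1 / 2) : ℝ)) * (2 * Real.Gamma (1 - a))) := by
        gcongr; exact hC w hw h0
    _ = _ := by ring

theorem continuous_tailKernel {a : ℝ} (ha : a = 0 ∨ a = 1 / 2) (c : ℂ) (N r : ℕ) :
    Continuous (tailKernel a c N (r + 1)) := by
  refine continuous_iff_continuousAt.2 fun w₀ => ?_
  have hl : ∀ j : ℕ, 0 < (((j + (r + 1) : ℕ) : ℝ) - a) := fun j => by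
    push_cast
    have : (0 : ℝ) ≤ j := Nat.cast_nonneg j
    have : (0 : ℝ) ≤ r := Nat.cast_nonneg r
    rcases ha with rfl | rfl <;> linarith
  set A := |w₀| + 1 with hA
  have hA1 : 1 ≤ A := by rw [hA]; linarith [abs_nonneg w₀]
  have key : ContinuousOn (tailKernel a c N (r + 1)) (Metric.closedBall w₀ 1) := by
    refine continuousOn_tsum (u := fun j => (‖c‖ * A) ^ (j + N) / (j + N).factorial * (A ^ (r + 1) * 2))
      (fun j => ?_) ((summable_pow_div_factorial_add _ N).mul_right _) fun j w hw => ?_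
    · exact (continuous_const.mul (Complex.continuous_ofReal.comp
        ((continuous_primPow (hl j)).comp (continuous_id.div_const 4)))).continuousOn
    · have hw1 : |w| ≤ A := by
        have : |w - w₀| ≤ 1 := by simpa [Real.dist_eq] using hw
        have := abs_sub_abs_le_abs_sub w w₀
        rw [hA]; linarith
      rw [norm_mul, norm_div, norm_pow, Complex.norm_natCast, Complex.norm_real, Real.norm_eq_abs,
        mul_pow, primPow_eq_max (hl j)]
      have hG := half_le_Gamma ha (j + (r + 1))
      have hi : (Real.Gamma (((j + (r + 1) : ℕ) : ℝ) - a + 1))⁻¹ ≤ 2 := by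
        rw [inv_le_comm₀ (by linarith) two_pos]; linarith
      have hm0 : 0 ≤ max (-(w / 4)) 0 := le_max_right _ _
      have hm : max (-(w / 4)) 0 ≤ A := by
        refine max_le ?_ (by linarith)
        have := neg_abs_le w
        linarith [abs_nonneg w]
      have ha0 : 0 ≤ a := by rcases ha with rfl | rfl <;> norm_num
      have h2 : max (-(w / 4)) 0 ^ (((j + (r + 1) : ℕ) : ℝ) - a) ≤ A ^ (j + N) * A ^ (r + 1) := by
        calc _ ≤ A ^ (((j + (r + 1) : ℕ) : ℝ) - a) := Real.rpow_le_rpow hm0 hm (hl j).le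
          _ ≤ A ^ ((j + N + (r + 1) : ℕ) : ℝ) := Real.rpow_le_rpow_of_exponent_le hA1 (by
              push_cast; have : (0 : ℝ) ≤ N := Nat.cast_nonneg N
              linarith)
          _ = _ := by rw [Real.rpow_natCast, pow_add]
      rw [abs_div, abs_of_nonneg (Real.rpow_nonneg hm0 _), abs_of_pos (by linarith),
        div_eq_mul_inv (max _ _ ^ _)]
      have hGp : 0 < Real.Gamma (((j + (r + 1) : ℕ) : ℝ) - a + 1) := by linarith
      calc _ ≤ ‖c‖ ^ (j + N) / (j + N).factorial * ((A ^ (j + N) * A ^ (r + 1)) * 2) := by gcongr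
        _ = _ := by ring
  exact key.continuousAt (Metric.closedBall_mem_nhds _ one_pos)

theorem hasDerivAt_tailKernel {a : ℝ} (ha : a = 0 ∨ a = 1 / 2) (c : ℂ) (N r : ℕ) {w₀ : ℝ}
    (hw₀ : w₀ ≠ 0) :
    HasDerivAt (tailKernel a c N (r + 1)) (-(1 / 4) * tailKernel a c N r w₀) w₀ := by
  rcases lt_or_gt_of_ne hw₀ with hw | hw
  · set t := Set.Ioo (w₀ - 1) (w₀ / 2) with ht
    set A := |w₀| + 1 with hA
    have hA1 : 1 ≤ A := by rw [hA]; linarith [abs_nonneg w₀]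
    obtain ⟨C, hC0, hC⟩ := abs_primPow_neg_le ha (|w₀| + 1)
    have hG : 0 < Real.Gamma (1 - a) :=
      Real.Gamma_pos_of_pos (by rcases ha with rfl | rfl <;> norm_num)
    have hwt : w₀ ∈ t := ⟨by linarith, by linarith⟩
    have hb : ∀ w ∈ t, |w / 4| ≤ A ∧ |primPow (-a) (w / 4)| ≤ C * |w₀ / 2| ^ (-(1 / 2) : ℝ) := by
      intro w hw'
      have h1 : w < 0 := hw'.2.trans (by linarith)
      have h2 : |w| ≤ |w₀| + 1 := by
        rw [abs_of_neg h1, abs_of_neg hw]; linarith [hw'.1]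
      refine ⟨?_, (hC w h2 h1.ne).trans ?_⟩
      · rw [abs_div, abs_of_pos (by norm_num : (0 : ℝ) < 4)]
        linarith [abs_nonneg w]
      · refine mul_le_mul_of_nonneg_left ?_ hC0
        refine Real.rpow_le_rpow_of_nonpos (abs_pos.2 (by linarith)) ?_ (by norm_num)
        rw [abs_of_neg h1, abs_of_neg (by linarith)]
        linarith [hw'.2]
    have key := hasDerivAt_tsum_of_isPreconnected (t := t) (y₀ := w₀) (y := w₀)
      (u := fun j => (‖c‖ * A) ^ (j + N) / (j + N).factorial *
        (A ^ r * (C * |w₀ / 2| ^ (-(1 / 2) : ℝ)) * (2 * Real.Gamma (1 - a))))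
      (g := fun j w => c ^ (j + N) / ((j + N).factorial : ℂ) *
        (primPow ((j + (r + 1) : ℕ) - a) (w / 4) : ℂ))
      (g' := fun j w => -(1 / 4) * (c ^ (j + N) / ((j + N).factorial : ℂ) *
        (primPow ((j + r : ℕ) - a) (w / 4) : ℂ)))
      ((summable_pow_div_factorial_add _ N).mul_right _) isOpen_Ioo isPreconnected_Ioo
      (fun j w hw' => by
        have h1 : w < 0 := hw'.2.trans (by linarith)
        have hl : (((j + r : ℕ) : ℝ) - a) + 1 ≠ 0 := by
          have : (0 : ℝ) ≤ ((j + r : ℕ) : ℝ) := Nat.cast_nonneg _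
          rcases ha with rfl | rfl <;> linarith
        have h2 := (hasDerivAt_primPow hl (w := w / 4) (by linarith)).comp w
          ((hasDerivAt_id w).div_const 4)
        have e : (((j + r : ℕ) : ℝ) - a) + 1 = ((j + (r + 1) : ℕ) : ℝ) - a := by push_cast; ring
        rw [e] at h2
        refine (h2.ofReal_comp.const_mul (c ^ (j + N) / ((j + N).factorial : ℂ))).congr_deriv ?_
        push_cast
        ring)
      (fun j w hw' => by
        obtain ⟨h1, h2⟩ := hb w hw'
        rw [norm_mul]
        have h4 : ‖(-(1 / 4) : ℂ)‖ ≤ 1 := by norm_num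
        refine (mul_le_of_le_one_left (norm_nonneg _) h4).trans ?_
        refine (norm_tailKernel_term_le ha c N r j hA1 h1).trans ?_
        gcongr)
      hwt (hasSum_tailKernel ha c N (r + 1) w₀).summable hwt
    rw [tsum_mul_left] at key
    exact key
  · have h0 : ∀ r w, 0 < w → tailKernel a c N r w = 0 := fun r w hw => by
      have : ∀ j : ℕ, primPow ((j + r : ℕ) - a) (w / 4) = 0 := fun j =>
        primPow_of_nonneg _ (by positivity)
      simp only [tailKernel, this, Complex.ofReal_zero, mul_zero, tsum_zero]
    rw [h0 r w₀ hw, mul_zero]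
    refine (hasDerivAt_const w₀ (0 : ℂ)).congr_of_eventuallyEq ?_
    filter_upwards [lt_mem_nhds hw] with y hy
    rw [h0 _ y hy]

/-- The terms with j ≥ N are already locally integrable after N differentiations. They are connected
with their N-th primitive by the ladder in the shift r, each step costing a factor 4 because the
argument is w/4. -/
theorem integral_tailKernel {d N : ℕ} (h : 2 * N + 1 ≤ d - 1) (σ : ℝ) {a : ℝ}
    (ha : a = 0 ∨ a = 1 / 2) (c : ℂ) (φ : MinkTest d) :
    ∫ x : Mink d, (heaviside (σ * x.1) : ℂ) * tailKernel a c N 0 (minkSq x) * (φ x : ℂ) =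
      4 ^ N * coneDist d σ N (tailKernel a c N N) φ := by
  rw [← coneDist_const_mul h σ (admissible_tailKernel ha c N N)]
  have hlad : IsLadder {0} N (fun i w => 4 ^ (N - i) * tailKernel a c N (N - i) w) := by
    refine ⟨fun i hi => ?_, fun i hi w hw => ?_, ?_⟩
    · obtain ⟨k, hk⟩ : ∃ k, N - i = k + 1 := ⟨N - i - 1, by omega⟩
      rw [hk]
      exact continuous_const.mul (continuous_tailKernel ha c N k)
    · obtain ⟨k, hk⟩ : ∃ k, N - i = k + 1 := ⟨N - i - 1, by omega⟩
      rw [hk, show N - (i + 1) = k by omega]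
      refine ((hasDerivAt_tailKernel ha c N k hw).const_mul _).congr_deriv ?_
      rw [pow_succ]; ring
    · exact (admissible_tailKernel ha c N _).const_mul _
  simpa using hlad.integral_eq_coneDist h σ (Set.countable_singleton 0) φ

theorem coneKernel_eq_add {a : ℝ} (ha : a = 0 ∨ a = 1 / 2) (c : ℂ) (N : ℕ) (w : ℝ) :
    coneKernel a c w = ∑ j ∈ Finset.range N, c ^ j / (j.factorial : ℂ) * (primPow (j - a) (w / 4) : ℂ) +
      tailKernel a c N N w :=
  ((hasSum_coneKernel ha c w).summable.sum_add_tsum_nat_add N).symm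

theorem admissible_primPow {a b : ℝ} (ha : a = 0 ∨ a = 1 / 2) (hb : 0 < b) (p : ℕ) :
    Admissible (fun w => (primPow (p - a) (b * w) : ℂ)) := by
  have hm := measurable_primPow (p - a)
  refine ⟨by fun_prop, fun R => ?_⟩
  obtain ⟨C, hC0, hC⟩ := abs_primPow_neg_le ha (4 * b * R)
  have hG : 0 < Real.Gamma (1 - a) :=
    Real.Gamma_pos_of_pos (by rcases ha with rfl | rfl <;> norm_num)
  refine ⟨(b * R) ^ p * (C * (4 * b) ^ (-(1 / 2) : ℝ)) * (2 * Real.Gamma (1 - a)), fun w hw h0 => ?_⟩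
  have e : b * w = (4 * b * w) / 4 := by ring
  have h1 := abs_primPow_le ha p (b * w)
  have h2 : |primPow (-a) (b * w)| ≤ C * ((4 * b) ^ (-(1 / 2) : ℝ) * |w| ^ (-(1 / 2) : ℝ)) := by
    rw [← Real.mul_rpow (by positivity) (abs_nonneg w), e]
    have := hC (4 * b * w) (by rw [abs_mul, abs_of_pos (by positivity)]; gcongr) (by positivity)
    rwa [abs_mul, abs_of_pos (by positivity : 0 < 4 * b)] at this
  rw [Complex.norm_real, Real.norm_eq_abs]
  have h3 : |b * w| ≤ b * R := by rw [abs_mul, abs_of_pos hb]; gcongr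
  have h4 : 0 ≤ b * R := (abs_nonneg _).trans h3
  calc _ ≤ |b * w| ^ p * |primPow (-a) (b * w)| * (2 * Real.Gamma (1 - a)) := h1
    _ ≤ (b * R) ^ p * (C * ((4 * b) ^ (-(1 / 2) : ℝ) * |w| ^ (-(1 / 2) : ℝ))) *
        (2 * Real.Gamma (1 - a)) := by gcongr
    _ = _ := by ring

theorem coneDist_add {d N : ℕ} (h : 2 * N + 1 ≤ d - 1) (σ : ℝ) {K L : ℝ → ℂ} (hK : Admissible K)
    (hL : Admissible L) (φ : MinkTest d) :
    coneDist d σ N (fun w => K w + L w) φ = coneDist d σ N K φ + coneDist d σ N L φ := by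
  rw [coneDist_apply h σ hK, coneDist_apply h σ hL, coneDist_apply h σ (hK.add hL), ← integral_add
    (integrable_coneWeight_mul h σ hK _) (integrable_coneWeight_mul h σ hL _)]
  congr 1; ext x
  simp only [coneWeight]; ring

theorem coneDist_sum {d N : ℕ} (h : 2 * N + 1 ≤ d - 1) (σ : ℝ) {ι : Type*} (s : Finset ι)
    {K : ι → ℝ → ℂ} (hK : ∀ i ∈ s, Admissible (K i)) (φ : MinkTest d) :
    coneDist d σ N (fun w => ∑ i ∈ s, K i w) φ = ∑ i ∈ s, coneDist d σ N (K i) φ := by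
  rw [coneDist_apply h σ (.sum s hK), Finset.sum_congr rfl fun i hi => coneDist_apply h σ (hK i hi) φ,
    ← integral_finsetSum _ fun i hi => integrable_coneWeight_mul h σ (hK i hi) _]
  congr 1; ext x
  simp only [coneWeight, Finset.mul_sum, Finset.sum_mul]

/-- The constant `2π / (4π)^{d/2}`, `d / 2 = N + 1 + a`. -/
theorem propConst_eq {N : ℕ} {a δ : ℝ} (hδ : δ = N + 1 + a) :
    (2 * 4 ^ a * Real.pi ^ (N + a))⁻¹ = 2 * Real.pi / (4 * Real.pi) ^ δ * 4 ^ N := by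
  have hpi := Real.pi_pos
  have e1 : (4 : ℝ) ^ δ = 4 ^ N * 4 * 4 ^ a := by
    rw [hδ, Real.rpow_add (by norm_num), Real.rpow_add (by norm_num), Real.rpow_one,
      Real.rpow_natCast]
  have e2 : Real.pi ^ δ = Real.pi ^ (N + a) * Real.pi := by
    rw [← Real.rpow_add_one hpi.ne', hδ]; ring_nf
  rw [Real.mul_rpow (by norm_num) hpi.le, e1, e2]
  field_simp
  norm_num

/-- The common target of all explicit formulas: finitely many genuinely singular terms, for which
the integrations by parts are kept, plus an ordinary integral. -/
theorem coneDist_propKernel_eq_add {d N : ℕ} (h : 2 * N + 1 ≤ d - 1) (σ : ℝ) {a δ : ℝ}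
    (ha : a = 0 ∨ a = 1 / 2) (hδ : δ = N + 1 + a) (c : ℂ) (φ : MinkTest d) :
    coneDist d σ N (propKernel N a c) φ =
      ((2 * Real.pi / (4 * Real.pi) ^ δ : ℝ) : ℂ) *
      (∑ j ∈ Finset.range N, c ^ j / (j.factorial : ℂ) *
        (4 ^ N * coneDist d σ N (fun w => (primPow (j - a) (1 / 4 * w) : ℂ)) φ) +
      ∫ x : Mink d, (heaviside (σ * x.1) : ℂ) * tailKernel a c N 0 (minkSq x) * (φ x : ℂ)) := by
  have hk : propKernel N a c = fun w => ((2 * Real.pi / (4 * Real.pi) ^ δ : ℝ) : ℂ) *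
      (4 ^ N * (∑ j ∈ Finset.range N, c ^ j / (j.factorial : ℂ) * (primPow (j - a) (1 / 4 * w) : ℂ) +
      tailKernel a c N N w)) := by
    ext w
    have e : w / 4 = 1 / 4 * w := by ring
    rw [propKernel, coneKernel_eq_add ha c N, propConst_eq hδ, e]
    push_cast
    ring
  have hadm : ∀ j ∈ Finset.range N, Admissible fun w => c ^ j / (j.factorial : ℂ) *
      (primPow (j - a) (1 / 4 * w) : ℂ) := fun j _ =>
    (admissible_primPow ha (by norm_num) j).const_mul _
  have hS := Admissible.sum (Finset.range N) hadm
  have hT := admissible_tailKernel ha c N N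
  rw [hk, coneDist_const_mul h σ ((hS.add hT).const_mul _), coneDist_const_mul h σ (hS.add hT),
    coneDist_add h σ hS hT, coneDist_sum h σ _ hadm, integral_tailKernel h σ ha, mul_add (4 ^ N),
    Finset.mul_sum]
  refine congrArg (_ * ·) (congrArg (· + _) (Finset.sum_congr rfl fun j _ => ?_))
  rw [coneDist_const_mul h σ (admissible_primPow ha (by norm_num) j)]
  ring

/-! ### The jump of U and the series 𝐅. -/

/-- The reflection formula in a form that survives at positive integers: there the sine vanishes,
and Γ takes the value 0 at its pole, so both sides are 0. -/
theorem inv_Gamma_one_sub {x : ℝ} (hx : 0 < x) :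
    (Real.Gamma (1 - x))⁻¹ = Real.Gamma x * Real.sin (Real.pi * x) / Real.pi := by
  have h := Real.Gamma_mul_Gamma_one_sub x
  have hG := (Real.Gamma_pos_of_pos hx).ne'
  by_cases hs : Real.sin (Real.pi * x) = 0
  · rw [hs, div_zero] at h
    rw [hs, (mul_eq_zero.1 h).resolve_left hG]; simp
  · have h1 : Real.Gamma (1 - x) = Real.pi / (Real.sin (Real.pi * x) * Real.Gamma x) := by
      rw [← div_div, ← h, mul_div_cancel_left₀ _ hG]
    rw [h1, inv_div, mul_comm]

/-- The terms `j ≥ N` of the series of `𝐅_{-(N + a)}`. -/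
def boldTail (a : ℝ) (N : ℕ) (y : ℝ) : ℝ :=
  ∑' j : ℕ, y ^ (j + N) / (Real.Gamma (j - a + 1) * ((j + N).factorial : ℝ))

theorem abs_boldTail_term_le {a : ℝ} (ha : a = 0 ∨ a = 1 / 2) (N j : ℕ) (y : ℝ) :
    ‖y ^ (j + N) / (Real.Gamma (j - a + 1) * ((j + N).factorial : ℝ))‖ ≤
      |y| ^ j / j.factorial * (2 * |y| ^ N) := by
  have hG := half_le_Gamma ha j
  have hG0 := Gamma_pos_aux ha j
  have hi : (Real.Gamma (j - a + 1))⁻¹ ≤ 2 := by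
    rw [inv_le_comm₀ hG0 two_pos]; linarith
  have hj : (0 : ℝ) < j.factorial := by exact_mod_cast j.factorial_pos
  have hf : (((j + N).factorial : ℝ))⁻¹ ≤ (j.factorial : ℝ)⁻¹ := by
    refine inv_anti₀ hj ?_
    exact_mod_cast Nat.factorial_le (Nat.le_add_right j N)
  rw [norm_div, norm_pow, norm_mul, Real.norm_eq_abs, Real.norm_of_nonneg hG0.le,
    Real.norm_of_nonneg (by positivity), div_eq_mul_inv, mul_inv, pow_add]
  calc _ ≤ |y| ^ j * |y| ^ N * (2 * (j.factorial : ℝ)⁻¹) := by gcongr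
    _ = _ := by ring

theorem summable_boldTail {a : ℝ} (ha : a = 0 ∨ a = 1 / 2) (N : ℕ) (y : ℝ) :
    Summable fun j : ℕ => y ^ (j + N) / (Real.Gamma (j - a + 1) * ((j + N).factorial : ℝ)) :=
  .of_norm_bounded ((Real.summable_pow_div_factorial |y|).mul_right _)
    fun j => abs_boldTail_term_le ha N j y

theorem abs_boldTail_le {a : ℝ} (ha : a = 0 ∨ a = 1 / 2) (N : ℕ) (y : ℝ) :
    |boldTail a N y| ≤ Real.exp |y| * (2 * |y| ^ N) := by
  have h := (NormedSpace.expSeries_div_hasSum_exp |y|)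
  rw [← Real.exp_eq_exp_ℝ] at h
  exact tsum_of_norm_bounded (h.mul_right _) fun j => abs_boldTail_term_le ha N j y

theorem measurable_boldTail {a : ℝ} (ha : a = 0 ∨ a = 1 / 2) (N : ℕ) : Measurable (boldTail a N) :=
  measurable_of_tendsto_metrizable (f := fun n y => ∑ j ∈ Finset.range n,
    y ^ (j + N) / (Real.Gamma (j - a + 1) * ((j + N).factorial : ℝ))) (fun n => by fun_prop)
    (tendsto_pi_nhds.2 fun y => (summable_boldTail ha N y).hasSum.tendsto_sum_nat)

theorem boldF_eq_add {a : ℝ} (ha : a = 0 ∨ a = 1 / 2) (N : ℕ) (y : ℝ) :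
    boldF (-(N + a)) y = ∑ j ∈ Finset.range N,
      y ^ j / (Real.Gamma (j - (N + a) + 1) * (j.factorial : ℝ)) + boldTail a N y := by
  have e : ∀ j : ℕ, -(N + a) + 1 + ((j + N : ℕ) : ℝ) = j - a + 1 := fun j => by push_cast; ring
  have e' : ∀ j : ℕ, -(N + a) + 1 + (j : ℝ) = j - (N + a) + 1 := fun j => by ring
  have hs : Summable fun j : ℕ => y ^ j / (Real.Gamma (-(N + a) + 1 + j) * (j.factorial : ℝ)) := by
    rw [← summable_nat_add_iff N]
    simpa only [e] using summable_boldTail ha N y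
  rw [boldF, ← hs.sum_add_tsum_nat_add N, boldTail]
  simp only [e, e']

theorem tailKernel_zero_eq (a c : ℝ) (N : ℕ) {w : ℝ} (hw : w < 0) :
    tailKernel a c N 0 w = (((-w / 4) ^ (-(N + a)) * boldTail a N (c * (-w / 4)) : ℝ) : ℂ) := by
  rw [tailKernel, boldTail, ← tsum_mul_left, Complex.ofReal_tsum]
  refine tsum_congr fun j => ?_
  have hp : 0 < -w / 4 := by linarith
  have e : (-w / 4) ^ (j - a) = (-w / 4) ^ (-(N + a)) * (-w / 4) ^ (j + N) := by
    rw [← Real.rpow_natCast, ← Real.rpow_add hp]; congr 1; push_cast; ring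
  rw [primPow, if_pos (by linarith), add_zero, show -(w / 4) = -w / 4 by ring, e, mul_pow]
  push_cast
  ring

theorem tailKernel_of_nonneg (a : ℝ) (c : ℂ) (N r : ℕ) {w : ℝ} (hw : 0 ≤ w) :
    tailKernel a c N r w = 0 := by
  have : ∀ j : ℕ, primPow ((j + r : ℕ) - a) (w / 4) = 0 := fun j =>
    primPow_of_nonneg _ (by positivity)
  simp only [tailKernel, this, Complex.ofReal_zero, mul_zero, tsum_zero]

/-- Exhibits the phase e^{iπ(N+a)}, which is opposite to the one in the monodromy of U, and the
power (m²)^{N+a}, which cancels that of the argument. -/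
theorem tachPrefactor_I {d N : ℕ} (hd : 2 ≤ d) {a : ℝ} (hn : (d : ℝ) = 2 * N + 2 + 2 * a) {m : ℝ}
    (hm : 0 < m) : tachPrefactor d m Complex.I = -Complex.I *
      Complex.exp (Real.pi * ((N + a : ℝ) : ℂ) * Complex.I) *
      ((√Real.pi * (m ^ 2) ^ (N + a) / (4 * Real.pi) ^ ((d : ℝ) / 2) : ℝ) : ℂ) := by
  have h1 : m ^ (d - 2) = (m ^ 2) ^ (N + a) := by
    have : ((d - 2 : ℕ) : ℝ) = 2 * (N + a) := by
      rw [Nat.cast_sub hd, hn]; push_cast; ring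
    rw [← Real.rpow_natCast m (d - 2), this, Real.rpow_mul hm.le, Real.rpow_two]
  have h2 : Complex.I ^ (d + 1) =
      -Complex.I * Complex.exp (Real.pi * ((N + a : ℝ) : ℂ) * Complex.I) := by
    have h3 : Complex.I = Complex.exp (Real.pi / 2 * Complex.I) := Complex.exp_pi_div_two_mul_I.symm
    have h4 : Complex.I ^ d = Complex.exp (Real.pi * ((N + a : ℝ) : ℂ) * Complex.I) * -1 := by
      conv_lhs => rw [h3]
      rw [← Complex.exp_nat_mul, ← Complex.exp_pi_mul_I, ← Complex.exp_add]
      have : (d : ℂ) = 2 * N + 2 + 2 * (a : ℂ) := by exact_mod_cast congrArg ((↑) : ℝ → ℂ) hn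
      rw [this]
      congr 1
      push_cast
      ring
    rw [pow_succ, h4]; ring
  rw [tachPrefactor, h1, h2, mul_comm]

/-- The monodromy formula with the prefactor: phases, powers of m² and square roots of π cancel in
pairs. -/
theorem riemannU_sub_eq {d N : ℕ} (hd : 2 ≤ d) {a : ℝ} (ha : a = 0 ∨ a = 1 / 2)
    (hn : (d : ℝ) = 2 * N + 2 + 2 * a) {m : ℝ} (hm : 0 < m) {w : ℝ} (hw : w < 0) :
    tachPrefactor d m Complex.I *
      (riemannU (N + a) (Real.log (m ^ 2 * (-w) / 4) : ℂ) -
        riemannU (N + a) ((Real.log (m ^ 2 * (-w) / 4) : ℂ) + 2 * Complex.I * (Real.pi : ℂ))) =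
      ((2 * Real.pi / (4 * Real.pi) ^ ((d : ℝ) / 2) * (-w / 4) ^ (-(N + a)) *
        boldF (-(N + a)) (m ^ 2 * (-w / 4)) : ℝ) : ℂ) := by
  have hp : 0 < -w / 4 := by linarith
  have hm2 : 0 < m ^ 2 := by positivity
  have h := riemannU_sub_monodromy ha N (Real.log (m ^ 2 * (-w) / 4))
  rw [show a + (N : ℝ) = N + a by ring, Real.exp_log (by rw [mul_div_assoc]; positivity),
    mul_div_assoc, Real.mul_rpow hm2.le hp.le] at h
  rw [mul_div_assoc, h, tachPrefactor_I hd hn hm]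
  have e1 : Complex.exp (Real.pi * ((N + a : ℝ) : ℂ) * Complex.I) *
      Complex.exp (-(Real.pi * ((N + a : ℝ) : ℂ) * Complex.I)) = 1 := by
    rw [← Complex.exp_add, add_neg_cancel, Complex.exp_zero]
  have e2 : (((m ^ 2) ^ (N + a) : ℝ) : ℂ) * (((m ^ 2) ^ (-(N + a)) : ℝ) : ℂ) = 1 := by
    rw [← Complex.ofReal_mul, ← Real.rpow_add hm2, add_neg_cancel, Real.rpow_zero, Complex.ofReal_one]
  have e3 : ((√Real.pi : ℝ) : ℂ) * ((√Real.pi : ℝ) : ℂ)⁻¹ = 1 :=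
    mul_inv_cancel₀ (by exact_mod_cast (Real.sqrt_pos.2 Real.pi_pos).ne')
  simp only [Complex.ofReal_mul, Complex.ofReal_div]
  generalize (((m ^ 2) ^ (N + a) : ℝ) : ℂ) = X at *
  generalize (((m ^ 2) ^ (-(N + a)) : ℝ) : ℂ) = Y at *
  generalize ((√Real.pi : ℝ) : ℂ) = Z at *
  generalize Complex.exp (Real.pi * ((N + a : ℝ) : ℂ) * Complex.I) = V at *
  generalize Complex.exp (-(Real.pi * ((N + a : ℝ) : ℂ) * Complex.I)) = W at *
  set c1 : ℂ := (((4 * Real.pi) ^ ((d : ℝ) / 2) : ℝ) : ℂ)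
  set c2 : ℂ := (((-w / 4) ^ (-(N + a)) : ℝ) : ℂ)
  set c3 : ℂ := ((boldF (-(N + a)) (m ^ 2 * (-w / 4)) : ℝ) : ℂ)
  have hI := Complex.I_mul_I
  calc _ = -(Complex.I * Complex.I) * (V * W) * (X * Y) * (Z * Z⁻¹) * (2 * Real.pi / c1 * c2 * c3) := by
        ring
    _ = _ := by rw [hI, e1, e2, e3]; push_cast; ring

theorem tachPrefactor_mul_polarCoeff {d N : ℕ} (hd : 2 ≤ d) {a : ℝ}
    (hn : (d : ℝ) = 2 * N + 2 + 2 * a) {m : ℝ} (hm : 0 < m) (j : ℕ) :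
    tachPrefactor d m Complex.I * polarCoeff (N + a) j *
      Complex.exp (((j - (N + a) : ℝ) : ℂ) * (Complex.I * Real.pi)) =
      -Complex.I * ((Real.Gamma (N + a - j) * (m ^ 2) ^ (N + a) / (j.factorial : ℝ) /
        (4 * Real.pi) ^ ((d : ℝ) / 2) : ℝ) : ℂ) := by
  have e1 : Complex.exp (((j - (N + a) : ℝ) : ℂ) * (Complex.I * Real.pi)) = (-1) ^ j *
      Complex.exp (-(Real.pi * ((N + a : ℝ) : ℂ) * Complex.I)) := by
    rw [← exp_pi_mul_I_nat, ← Complex.exp_add]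
    congr 1; push_cast; ring
  have e2 : Complex.exp (Real.pi * ((N + a : ℝ) : ℂ) * Complex.I) *
      Complex.exp (-(Real.pi * ((N + a : ℝ) : ℂ) * Complex.I)) = 1 := by
    rw [← Complex.exp_add, add_neg_cancel, Complex.exp_zero]
  have e3 : ((√Real.pi : ℝ) : ℂ) * ((√Real.pi : ℝ) : ℂ)⁻¹ = 1 :=
    mul_inv_cancel₀ (by exact_mod_cast (Real.sqrt_pos.2 Real.pi_pos).ne')
  have e4 : ((-1 : ℂ) ^ j) * (-1) ^ j = 1 := by rw [← mul_pow]; simp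
  rw [e1, tachPrefactor_I hd hn hm, polarCoeff]
  simp only [Complex.ofReal_mul, Complex.ofReal_div, Complex.ofReal_natCast]
  generalize Complex.exp (Real.pi * ((N + a : ℝ) : ℂ) * Complex.I) = V at *
  generalize Complex.exp (-(Real.pi * ((N + a : ℝ) : ℂ) * Complex.I)) = W at *
  generalize ((√Real.pi : ℝ) : ℂ) = Z at *
  generalize (-1 : ℂ) ^ j = s at *
  set X : ℂ := (((m ^ 2) ^ (N + a) : ℝ) : ℂ)
  set c1 : ℂ := (((4 * Real.pi) ^ ((d : ℝ) / 2) : ℝ) : ℂ)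
  set g : ℂ := (Real.Gamma (N + a - j) : ℂ)
  calc _ = (V * W) * (Z * Z⁻¹) * (s * s) * (-Complex.I * (g * X / j.factorial / c1)) := by ring
    _ = _ := by rw [e2, e3, e4]; ring

/-- Subtract from the monodromy of U that of its polar terms. For z^x with x = j - N - a the latter
involves 1 - e^{2πix}, hence sin π(N + a - j), and the reflection formula identifies the
contribution with the j-th term of 𝐅. Precisely the terms j ≥ N survive. For a = 0 the polar terms
are single-valued and the first N coefficients of 𝐅 vanish, consistently. -/
theorem regU_sub_eq {d N : ℕ} (hd : 2 ≤ d) {a : ℝ} (ha : a = 0 ∨ a = 1 / 2)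
    (hn : (d : ℝ) = 2 * N + 2 + 2 * a) {m : ℝ} (hm : 0 < m) {w : ℝ} (hw : w < 0) :
    tachPrefactor d m Complex.I *
      (regU (N + a) N (Real.log (m ^ 2 * (-w / 4)) : ℂ) -
        regU (N + a) N ((Real.log (m ^ 2 * (-w / 4)) : ℂ) + 2 * Complex.I * (Real.pi : ℂ))) =
      ((2 * Real.pi / (4 * Real.pi) ^ ((d : ℝ) / 2) : ℝ) : ℂ) *
        tailKernel a ((m ^ 2 : ℝ) : ℂ) N 0 w := by
  have hp : 0 < -w / 4 := by linarith
  have hm2 : 0 < m ^ 2 := by positivity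
  have hU := riemannU_sub_eq hd ha hn hm hw
  rw [mul_div_assoc] at hU
  have hpol : ∀ j ∈ Finset.range N, tachPrefactor d m Complex.I * (polarCoeff (N + a) j *
      Complex.exp (((j : ℂ) - ((N + a : ℝ) : ℂ)) * (Real.log (m ^ 2 * (-w / 4)) : ℂ)) -
      polarCoeff (N + a) j * Complex.exp (((j : ℂ) - ((N + a : ℝ) : ℂ)) *
        ((Real.log (m ^ 2 * (-w / 4)) : ℂ) + 2 * Complex.I * (Real.pi : ℂ)))) =
      ((2 * Real.pi / (4 * Real.pi) ^ ((d : ℝ) / 2) * (-w / 4) ^ (-(N + a)) *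
        ((m ^ 2 * (-w / 4)) ^ j / (Real.Gamma (j - (N + a) + 1) * (j.factorial : ℝ))) : ℝ) : ℂ) := by
    intro j hj
    have hjN : (j : ℝ) < N := by exact_mod_cast Finset.mem_range.1 hj
    have ha0 : 0 ≤ a := by rcases ha with rfl | rfl <;> norm_num
    set x : ℝ := j - (N + a) with hx
    have ex : (j : ℂ) - ((N + a : ℝ) : ℂ) = (x : ℂ) := by rw [hx]; push_cast; ring
    have e1 : Complex.exp ((x : ℂ) * (Real.log (m ^ 2 * (-w / 4)) : ℂ)) =
        (((m ^ 2) ^ (-(N + a)) * (-w / 4) ^ (-(N + a)) * (m ^ 2 * (-w / 4)) ^ j : ℝ) : ℂ) := by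
      rw [← Complex.ofReal_mul, ← Complex.ofReal_exp, mul_comm x, ← Real.rpow_def_of_pos (by positivity),
        hx, sub_eq_neg_add, Real.rpow_add (by positivity), Real.rpow_natCast,
        Real.mul_rpow hm2.le hp.le]
    have e2 : Complex.exp ((x : ℂ) * ((Real.log (m ^ 2 * (-w / 4)) : ℂ) +
        2 * Complex.I * (Real.pi : ℂ))) = Complex.exp ((x : ℂ) * (Real.log (m ^ 2 * (-w / 4)) : ℂ)) *
        Complex.exp ((x : ℂ) * (Complex.I * Real.pi)) * Complex.exp ((x : ℂ) * (Complex.I * Real.pi)) := by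
      rw [← Complex.exp_add, ← Complex.exp_add]; congr 1; ring
    -- Pulling out half of the phase turns the monodromy factor into a sine.
    have e3 : 1 - Complex.exp ((x : ℂ) * (Complex.I * Real.pi)) * Complex.exp ((x : ℂ) * (Complex.I * Real.pi)) =
        2 * Complex.I * (Real.sin (Real.pi * (N + a - j)) : ℂ) *
          Complex.exp ((x : ℂ) * (Complex.I * Real.pi)) := by
      have e4 : Real.pi * (N + a - j) = -(x * Real.pi) := by rw [hx]; ring
      rw [e4, Real.sin_neg, Complex.ofReal_neg, Complex.ofReal_sin, Complex.sin]
      have e5 : ((x * Real.pi : ℝ) : ℂ) * Complex.I = (x : ℂ) * (Complex.I * Real.pi) := by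
        push_cast; ring
      rw [neg_mul, e5, Complex.exp_neg]
      have := Complex.exp_ne_zero ((x : ℂ) * (Complex.I * Real.pi))
      field_simp
      rw [Complex.I_sq]; ring
    have e6 : (Real.Gamma (x + 1))⁻¹ =
        Real.Gamma (N + a - j) * Real.sin (Real.pi * (N + a - j)) / Real.pi := by
      rw [← inv_Gamma_one_sub (by linarith), hx]; congr 2; ring
    have e7 : (m ^ 2) ^ (N + a) * (m ^ 2) ^ (-(N + a)) = 1 := by
      rw [← Real.rpow_add hm2, add_neg_cancel, Real.rpow_zero]
    rw [ex, e2, ← mul_sub, mul_assoc (Complex.exp _), ← mul_one_sub, e3]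
    have key := tachPrefactor_mul_polarCoeff hd hn hm (N := N) (a := a) j
    rw [← hx] at key
    have e8 : (m ^ 2 * (-w / 4)) ^ j / (Real.Gamma (x + 1) * (j.factorial : ℝ)) =
        (m ^ 2 * (-w / 4)) ^ j * (Real.Gamma (N + a - j) * Real.sin (Real.pi * (N + a - j)) / Real.pi) /
          j.factorial := by
      rw [← e6]; field_simp
    rw [e8, e1]
    calc _ = (tachPrefactor d m Complex.I * polarCoeff (N + a) j *
          Complex.exp ((x : ℂ) * (Complex.I * Real.pi))) * (2 * Complex.I *
          (Real.sin (Real.pi * (N + a - j)) : ℂ) *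
          (((m ^ 2) ^ (-(N + a)) * (-w / 4) ^ (-(N + a)) * (m ^ 2 * (-w / 4)) ^ j : ℝ) : ℂ)) := by ring
      _ = -(Complex.I * Complex.I) * ((((m ^ 2) ^ (N + a) * (m ^ 2) ^ (-(N + a))) *
          (2 * Real.Gamma (N + a - j) / (j.factorial : ℝ) / (4 * Real.pi) ^ ((d : ℝ) / 2) *
          Real.sin (Real.pi * (N + a - j)) * (-w / 4) ^ (-(N + a)) * (m ^ 2 * (-w / 4)) ^ j) : ℝ) : ℂ) := by
        rw [key]; push_cast; ring
      _ = _ := by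
        rw [Complex.I_mul_I, e7, neg_neg, one_mul, one_mul]
        congr 1
        field_simp
  have hsum := Finset.sum_congr rfl hpol
  rw [← Finset.mul_sum, Finset.sum_sub_distrib] at hsum
  rw [regU, regU, sub_sub_sub_comm, mul_sub, hU, hsum, tailKernel_zero_eq a (m ^ 2) N hw,
    boldF_eq_add ha]
  rw [← Complex.ofReal_sum, ← Finset.mul_sum]
  push_cast
  ring

/-! ### The formulas in terms of U as boundary values. -/

theorem continuous_logReg {b s ε : ℝ} (hs : s = 1 ∨ s = -1) (hε : ε ≠ 0) :
    Continuous (logReg b s ε) := by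
  unfold logReg
  exact Continuous.clog (by fun_prop) fun w => mem_slitPlane_reg hs hε _

/-- For N = 0 the cone distribution is the plain integral. Regularized kernels are continuous, so
sums and multiples of smeared integrals can be handled by linearity of `coneDist`. -/
theorem coneDist_zero_apply {d : ℕ} (hd : 2 ≤ d) (σ : ℝ) {K : ℝ → ℂ} (hK : Admissible K)
    (φ : MinkTest d) : coneDist d σ 0 K φ =
      ∫ x : Mink d, (heaviside (σ * x.1) : ℂ) * K (minkSq x) * (φ x : ℂ) := by
  rw [coneDist_apply (by omega) σ hK]
  simp [coneWeight, eulerIter]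

theorem powInt_eq_coneDist {d : ℕ} (hd : 2 ≤ d) (σ : ℝ) {b l s ε : ℝ} (hs : s = 1 ∨ s = -1)
    (hε : ε ≠ 0) (φ : MinkTest d) : powInt σ b l s φ ε =
      coneDist d σ 0 (fun w => Complex.exp ((l : ℂ) * logReg b s ε w)) φ := by
  have := continuous_logReg (b := b) hs hε
  rw [coneDist_zero_apply hd σ (.of_continuous (by fun_prop)), powInt]

theorem coneDist_congr {d N : ℕ} (h : 2 * N + 1 ≤ d - 1) (σ : ℝ) {K L : ℝ → ℂ} (hK : Admissible K)
    (hL : Admissible L) (hKL : ∀ w, w ≠ 0 → K w = L w) (φ : MinkTest d) :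
    coneDist d σ N K φ = coneDist d σ N L φ := by
  rw [coneDist_apply h σ hK, coneDist_apply h σ hL]
  refine integral_congr_ae ?_
  filter_upwards [ae_minkSq_ne (d := d) (by omega) 0] with x hx
  rw [coneWeight, coneWeight, hKL _ hx]

theorem primPow_mul (l : ℝ) {c : ℝ} (hc : 0 < c) (w : ℝ) :
    primPow l (c * w) = c ^ l * primPow l w := by
  by_cases hw : w < 0
  · have h1 : c * w < 0 := mul_neg_of_pos_of_neg hc hw
    rw [primPow, primPow, if_pos hw, if_pos h1, ← mul_neg, Real.mul_rpow hc.le (by linarith),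
      mul_div_assoc]
  · have h1 : ¬ c * w < 0 := not_lt.2 (mul_nonneg hc.le (not_lt.1 hw))
    rw [primPow, primPow, if_neg hw, if_neg h1, mul_zero]

/-- On the regularized points U_{N+a}(e^{iπ}z) is a sum of powers z^{j-N-a}, j < N, plus F(log z)
with F dominated by |z|^{-1/2}. The powers converge by `tendsto_powInt` and their jumps give the
terms j < N; F converges by dominated convergence and its jump is the tail by `regU_sub_eq`.
Together these are the splitting of `coneDist_propKernel_eq_add`. -/
theorem isConeBoundaryValue_riemannU {d N : ℕ} (hd : 2 ≤ d) {a : ℝ} (ha : a = 0 ∨ a = 1 / 2)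
    (hn : (d : ℝ) = 2 * N + 2 + 2 * a) (hN : 2 * N + 1 ≤ d - 1) {m : ℝ} (hm : 0 < m) (σ : ℝ) :
    IsConeBoundaryValue σ (fun ε w => tachPrefactor d m Complex.I *
        (riemannU (N + a) (Complex.log (((m ^ 2 * w / 4 : ℝ) : ℂ) - Complex.I * (ε : ℂ))
            + Complex.I * (Real.pi : ℂ)) -
          riemannU (N + a) (Complex.log (((m ^ 2 * w / 4 : ℝ) : ℂ) + Complex.I * (ε : ℂ))
            + Complex.I * (Real.pi : ℂ)))) (coneDist d σ N (propKernel N a ((m ^ 2 : ℝ) : ℂ))) := by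
  intro φ
  have ha0 : 0 ≤ a := by rcases ha with rfl | rfl <;> norm_num
  have ha1 : a ≤ 1 / 2 := by rcases ha with rfl | rfl <;> norm_num
  have hα : (0 : ℝ) ≤ N + a := by positivity
  have hm2 : 0 < m ^ 2 := by positivity
  have hb : 0 < m ^ 2 / 4 := by positivity
  have h0 : 2 * 0 + 1 ≤ d - 1 := by omega
  set A := tachPrefactor d m Complex.I with hA
  set b := m ^ 2 / 4 with hbd
  have hlog1 : ∀ ε w : ℝ, Complex.log (((m ^ 2 * w / 4 : ℝ) : ℂ) - Complex.I * (ε : ℂ)) =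
      logReg b (-1) ε w := fun ε w => by
    rw [logReg, hbd]; congr 1; push_cast; ring
  have hlog2 : ∀ ε w : ℝ, Complex.log (((m ^ 2 * w / 4 : ℝ) : ℂ) + Complex.I * (ε : ℂ)) =
      logReg b 1 ε w := fun ε w => by
    rw [logReg, hbd]; congr 1; push_cast; ring
  simp only [hlog1, hlog2]
  set F : ℂ → ℂ := fun ζ => regU (N + a) N (ζ + Complex.I * Real.pi) with hF
  have hFc : Continuous F := (continuous_regU hα N).comp (by fun_prop)
  -- A principal logarithm shifted by iπ has imaginary part at most 2π in modulus, the range in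
  -- which `regU_bound` holds.
  have hFb : LogBound F := fun R => by
    obtain ⟨C, hC⟩ := regU_bound (α := N + a) (N := N) (by linarith) (by linarith) R
    refine ⟨C, fun ζ h1 h2 => ?_⟩
    have := hC (ζ + Complex.I * Real.pi) (by
      have : (ζ + Complex.I * Real.pi).im = ζ.im + Real.pi := by simp
      rw [this]
      refine (abs_add_le _ _).trans ?_
      rw [abs_of_pos Real.pi_pos]; linarith) (by simpa using h2)
    simpa using this
  set e : ℕ → ℂ := fun j => Complex.exp (((j - (N + a) : ℝ) : ℂ) * (Complex.I * Real.pi)) with he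
  have hUc := continuous_riemannU hα
  have hW : ∀ s ε, s = 1 ∨ s = -1 → ε ≠ 0 →
      coneDist d σ 0 (fun w => riemannU (N + a) (logReg b s ε w + Complex.I * Real.pi)) φ =
      ∑ j ∈ Finset.range N, polarCoeff (N + a) j * e j * powInt σ b (j - N - a) s φ ε +
        coneDist d σ 0 (fun w => F (logReg b s ε w)) φ := fun s ε hs hε => by
    have hlc := continuous_logReg (b := b) hs hε
    have hadm : ∀ j ∈ Finset.range N, Admissible fun w =>
        polarCoeff (N + a) j * e j * Complex.exp (((j - N - a : ℝ) : ℂ) * logReg b s ε w) :=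
      fun j _ => .of_continuous (by fun_prop)
    have hk : (fun w => riemannU (N + a) (logReg b s ε w + Complex.I * Real.pi)) = fun w =>
        ∑ j ∈ Finset.range N,
          polarCoeff (N + a) j * e j * Complex.exp (((j - N - a : ℝ) : ℂ) * logReg b s ε w) +
          F (logReg b s ε w) := by
      ext w
      simp only [hF, regU]
      have : ∀ j : ℕ, polarCoeff (N + a) j * Complex.exp (((j : ℂ) - ((N + a : ℝ) : ℂ)) *
          (logReg b s ε w + Complex.I * Real.pi)) =
          polarCoeff (N + a) j * e j * Complex.exp (((j - N - a : ℝ) : ℂ) * logReg b s ε w) := fun j => by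
        rw [he, mul_assoc, ← Complex.exp_add]
        congr 2; push_cast; ring
      simp only [this]
      ring
    have hFl : Admissible fun w => F (logReg b s ε w) := .of_continuous (hFc.comp hlc)
    rw [hk, coneDist_add h0 σ (.sum _ hadm) hFl, coneDist_sum h0 σ _ hadm]
    congr 1
    refine Finset.sum_congr rfl fun j _ => ?_
    rw [coneDist_const_mul h0 σ (.of_continuous (by fun_prop)), powInt_eq_coneDist hd σ hs hε]
  have hQ : ∀ j : ℕ, ∃ Q : ℝ → ℂ, j ∈ Finset.range N →
      (∀ s, s = 1 ∨ s = -1 → Tendsto (powInt σ b (j - N - a) s φ) (𝓝[>] 0) (𝓝 (Q s))) ∧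
      Q 1 - Q (-1) = coneDist d σ N (fun w => ((b : ℂ)⁻¹) ^ N *
        (-2 * Real.pi * Complex.I / (Real.Gamma (N + a - j) : ℂ)) * (primPow (j - a) (b * w) : ℂ)) φ :=
    fun j => by
      by_cases hj : j ∈ Finset.range N
      · obtain ⟨Q, hQ⟩ := tendsto_powInt hN σ ha hb (Finset.mem_range.1 hj) φ
        exact ⟨Q, fun _ => hQ⟩
      -- A dummy outside the range of summation, never used.
      · exact ⟨0, fun h => absurd h hj⟩
  choose Q hQ using hQ
  set R0 : ℝ → ℂ := fun s => coneDist d σ 0 (fun w => F (logBd s (b * w))) φ with hR0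
  have hR : ∀ s, s = 1 ∨ s = -1 → Tendsto (fun ε =>
      coneDist d σ 0 (fun w => riemannU (N + a) (logReg b s ε w + Complex.I * Real.pi)) φ) (𝓝[>] 0)
      (𝓝 (∑ j ∈ Finset.range N, polarCoeff (N + a) j * e j * Q j s + R0 s)) := fun s hs => by
    have h1 := (KernelTendsto.of_log hb hs hFc hFb).tendsto_coneDist h0 σ
      (hFc.measurable.comp ((measurable_logBd s).comp (measurable_const_mul b))) φ
    have h2 := tendsto_finsetSum (Finset.range N) fun j hj =>
      ((hQ j hj).1 s hs).const_mul (polarCoeff (N + a) j * e j)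
    refine (h2.add h1).congr' ?_
    filter_upwards [self_mem_nhdsWithin] with ε hε
    rw [hW s ε hs (ne_of_gt hε)]
  have hlim := ((hR (-1) (by simp)).sub (hR 1 (by simp))).const_mul A
  have hval : A * ((∑ j ∈ Finset.range N, polarCoeff (N + a) j * e j * Q j (-1) + R0 (-1)) -
      (∑ j ∈ Finset.range N, polarCoeff (N + a) j * e j * Q j 1 + R0 1)) =
      coneDist d σ N (propKernel N a ((m ^ 2 : ℝ) : ℂ)) φ := by
    have hδ : (d : ℝ) / 2 = N + 1 + a := by rw [hn]; ring
    have hadm := fun s hs => hFb.admissible hFc (b := b) (s := s) hb hs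
    have hT := admissible_tailKernel ha ((m ^ 2 : ℝ) : ℂ) N 0
    have hreg : A * (R0 (-1) - R0 1) = ((2 * Real.pi / (4 * Real.pi) ^ ((d : ℝ) / 2) : ℝ) : ℂ) *
        ∫ x : Mink d, (heaviside (σ * x.1) : ℂ) * tailKernel a ((m ^ 2 : ℝ) : ℂ) N 0 (minkSq x) * (φ x : ℂ) := by
      rw [← coneDist_zero_apply hd σ hT, ← coneDist_const_mul h0 σ hT, hR0]
      beta_reduce
      have hsub : Admissible fun w => F (logBd (-1) (b * w)) - F (logBd 1 (b * w)) := by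
        simpa [sub_eq_add_neg] using (hadm (-1) (by simp)).add ((hadm 1 (by simp)).const_mul (-1))
      rw [coneDist_sub h0 σ (hadm (-1) (by simp)) (hadm 1 (by simp)), ← coneDist_const_mul h0 σ hsub]
      -- For w < 0 the lower and upper boundary values, shifted by iπ, are log(m²|w|/4) and the same
      -- plus 2πi, that is, two points one full turn apart. For w > 0 they coincide.
      refine coneDist_congr h0 σ (hsub.const_mul _) (hT.const_mul _) (fun w hw => ?_) φ
      rcases lt_or_gt_of_ne hw with hw' | hw'
      · rw [← regU_sub_eq hd ha hn hm hw', hA]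
        have hbw : b * w < 0 := mul_neg_of_pos_of_neg hb hw'
        have el : Real.log (b * w) = Real.log (m ^ 2 * (-w / 4)) := by
          rw [← Real.log_neg_eq_log, hbd]; congr 1; ring
        simp only [hF, logBd, if_pos hbw, el]
        congr 3 <;> push_cast <;> ring
      · have hbw : ¬ b * w < 0 := not_lt.2 (mul_pos hb hw').le
        rw [tailKernel_of_nonneg a _ N 0 hw'.le]
        simp [logBd, if_neg hbw]
    have hpol : ∀ j ∈ Finset.range N, A * (polarCoeff (N + a) j * e j * Q j (-1) -
        polarCoeff (N + a) j * e j * Q j 1) =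
        ((2 * Real.pi / (4 * Real.pi) ^ ((d : ℝ) / 2) : ℝ) : ℂ) *
        ((((m ^ 2 : ℝ) : ℂ)) ^ j / (j.factorial : ℂ) *
        (4 ^ N * coneDist d σ N (fun w => (primPow (j - a) (1 / 4 * w) : ℂ)) φ)) := fun j hj => by
      have hjN : (j : ℝ) < N := by exact_mod_cast Finset.mem_range.1 hj
      have h1 := (hQ j hj).2
      have hG : Real.Gamma (N + a - j) ≠ 0 := (Real.Gamma_pos_of_pos (by linarith)).ne'
      have hG' : (Real.Gamma (N + a - j) : ℂ) ≠ 0 := by exact_mod_cast hG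
      have ep : ∀ w, primPow (j - a) (b * w) = (m ^ 2) ^ (j - a) * primPow (j - a) (1 / 4 * w) := fun w => by
        rw [← primPow_mul _ hm2, hbd]; congr 1; ring
      have ek : (fun w => ((b : ℂ)⁻¹) ^ N * (-2 * Real.pi * Complex.I / (Real.Gamma (N + a - j) : ℂ)) *
          (primPow (j - a) (b * w) : ℂ)) = fun w => (((b : ℂ)⁻¹) ^ N *
          (-2 * Real.pi * Complex.I / (Real.Gamma (N + a - j) : ℂ)) * (((m ^ 2) ^ (j - a) : ℝ) : ℂ)) *
          (primPow (j - a) (1 / 4 * w) : ℂ) := by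
        ext w; rw [ep]; push_cast; ring
      rw [ek, coneDist_const_mul hN σ (admissible_primPow ha (by norm_num) j)] at h1
      set D := coneDist d σ N (fun w => (primPow (j - a) (1 / 4 * w) : ℂ)) φ
      have key := tachPrefactor_mul_polarCoeff hd hn hm j
      rw [← hA] at key
      -- The powers of m² from the prefactor, from the scaled argument and from the factor b⁻¹ =
      -- 4/m² of each integration by parts combine to (m²)^j 4^N.
      have e7 : (m ^ 2) ^ (N + a) * (m ^ 2) ^ (j - a) * (b⁻¹) ^ N = (m ^ 2) ^ j * 4 ^ N := by
        rw [← Real.rpow_add hm2, show (N : ℝ) + a + (j - a) = (N : ℝ) + j by ring, Real.rpow_add hm2,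
          Real.rpow_natCast, Real.rpow_natCast, hbd, inv_div, div_pow]
        field_simp
      have e8 : (((m ^ 2) ^ (N + a) : ℝ) : ℂ) * (((m ^ 2) ^ (j - a) : ℝ) : ℂ) * ((b : ℂ)⁻¹) ^ N =
          ((m ^ 2 : ℝ) : ℂ) ^ j * 4 ^ N := by exact_mod_cast congrArg ((↑) : ℝ → ℂ) e7
      calc _ = -(A * polarCoeff (N + a) j * e j) * (Q j 1 - Q j (-1)) := by ring
        _ = -(Complex.I * Complex.I) * (2 * Real.pi / (((4 * Real.pi) ^ ((d : ℝ) / 2) : ℝ) : ℂ)) *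
            ((Real.Gamma (N + a - j) : ℂ) / (Real.Gamma (N + a - j) : ℂ)) / (j.factorial : ℂ) *
            ((((m ^ 2) ^ (N + a) : ℝ) : ℂ) * (((m ^ 2) ^ (j - a) : ℝ) : ℂ) * ((b : ℂ)⁻¹) ^ N) * D := by
          rw [h1, key]; push_cast; ring
        _ = _ := by rw [Complex.I_mul_I, div_self hG', e8]; push_cast; ring
    rw [coneDist_propKernel_eq_add hN σ ha hδ, mul_add, ← hreg, Finset.mul_sum,
      ← Finset.sum_congr rfl hpol, ← Finset.mul_sum, Finset.sum_sub_distrib]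
    ring
  rw [hval] at hlim
  refine hlim.congr' ?_
  filter_upwards [self_mem_nhdsWithin] with ε hε
  have hc : ∀ s, s = 1 ∨ s = -1 →
      Continuous fun w => riemannU (N + a) (logReg b s ε w + Complex.I * Real.pi) := fun s hs => by
    have := continuous_logReg (b := b) hs (ne_of_gt hε)
    fun_prop
  have hc1 := hc (-1) (by simp)
  have hc2 := hc 1 (by simp)
  have hcs : Admissible fun w => riemannU (N + a) (logReg b (-1) ε w + Complex.I * Real.pi) -
      riemannU (N + a) (logReg b 1 ε w + Complex.I * Real.pi) := .of_continuous (hc1.sub hc2)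
  rw [coneDist_sub h0 σ (.of_continuous hc1) (.of_continuous hc2), ← coneDist_const_mul h0 σ hcs,
    coneDist_zero_apply hd σ (hcs.const_mul A)]

theorem coneDist_conj {d N : ℕ} (h : 2 * N + 1 ≤ d - 1) (σ : ℝ) {K : ℝ → ℂ} (hK : Admissible K)
    (hr : ∀ w, starRingEnd ℂ (K w) = K w) (φ : MinkTest d) :
    starRingEnd ℂ (coneDist d σ N K φ) = coneDist d σ N K φ := by
  rw [coneDist_apply h σ hK, ← integral_conj]
  congr 1; ext x
  simp [coneWeight, hr]

theorem propKernel_conj (N : ℕ) (a c w : ℝ) :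
    starRingEnd ℂ (propKernel N a (c : ℂ) w) = propKernel N a (c : ℂ) w := by
  have : coneKernel a (c : ℂ) w =
      ((∑' j : ℕ, c ^ j / (j.factorial : ℝ) * primPow (j - a) (w / 4) : ℝ) : ℂ) := by
    rw [coneKernel, Complex.ofReal_tsum]
    push_cast; rfl
  rw [propKernel, this, ← Complex.ofReal_mul, Complex.conj_ofReal]

theorem tachPrefactor_conj (d : ℕ) (m : ℝ) :
    starRingEnd ℂ (tachPrefactor d m Complex.I) = tachPrefactor d m (-Complex.I) := by
  rw [tachPrefactor, tachPrefactor, map_mul, Complex.conj_ofReal, map_pow, Complex.conj_I]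

/-- A real distribution is also the limit of the conjugate regularization. -/
theorem IsConeBoundaryValue.conj {d : ℕ} {σ : ℝ} {k k' : ℝ → ℝ → ℂ} {T : MinkDist d}
    (h : IsConeBoundaryValue σ k T) (hT : ∀ φ, starRingEnd ℂ (T φ) = T φ)
    (hk : ∀ ε > 0, ∀ w, k' ε w = starRingEnd ℂ (k ε w)) : IsConeBoundaryValue σ k' T := by
  intro φ
  have h1 := (Complex.continuous_conj.tendsto _).comp (h φ)
  rw [hT] at h1
  refine h1.congr' ?_
  filter_upwards [self_mem_nhdsWithin] with ε hε
  rw [Function.comp_apply, ← integral_conj]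
  congr 1; ext x
  simp [hk ε hε]

/-- Complex conjugation of the first formula. The logarithm commutes with conjugation because for ε
> 0 its argument is off the cut. -/
theorem isConeBoundaryValue_riemannU_conj {d N : ℕ} (hd : 2 ≤ d) {a : ℝ} (ha : a = 0 ∨ a = 1 / 2)
    (hn : (d : ℝ) = 2 * N + 2 + 2 * a) (hN : 2 * N + 1 ≤ d - 1) {m : ℝ} (hm : 0 < m) (σ : ℝ) :
    IsConeBoundaryValue σ (fun ε w => tachPrefactor d m (-Complex.I) *
        (riemannU (N + a) (Complex.log (((m ^ 2 * w / 4 : ℝ) : ℂ) + Complex.I * (ε : ℂ))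
            - Complex.I * (Real.pi : ℂ)) -
          riemannU (N + a) (Complex.log (((m ^ 2 * w / 4 : ℝ) : ℂ) - Complex.I * (ε : ℂ))
            - Complex.I * (Real.pi : ℂ)))) (coneDist d σ N (propKernel N a ((m ^ 2 : ℝ) : ℂ))) := by
  refine (isConeBoundaryValue_riemannU hd ha hn hN hm σ).conj
    (coneDist_conj hN σ (admissible_propKernel N ha _) (propKernel_conj N a _)) fun ε hε w => ?_
  have hl : ∀ s : ℝ, s = 1 ∨ s = -1 →
      starRingEnd ℂ (Complex.log (((m ^ 2 * w / 4 : ℝ) : ℂ) + ((s * ε : ℝ) : ℂ) * Complex.I)) =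
      Complex.log (((m ^ 2 * w / 4 : ℝ) : ℂ) - ((s * ε : ℝ) : ℂ) * Complex.I) := fun s hs => by
    rw [← Complex.log_conj _ (Complex.slitPlane_arg_ne_pi (mem_slitPlane_reg hs (ne_of_gt hε) _))]
    congr 1
    simp [-Complex.ofReal_mul, -Complex.ofReal_div, -Complex.ofReal_pow, sub_eq_add_neg]
  have h1 := hl 1 (by simp)
  have h2 := hl (-1) (by simp)
  rw [map_mul, tachPrefactor_conj, map_sub, ← riemannU_conj, ← riemannU_conj, map_add, map_add, map_mul,
    Complex.conj_I, Complex.conj_ofReal, neg_mul, ← sub_eq_add_neg, ← sub_eq_add_neg]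
  have e1 : ((m ^ 2 * w / 4 : ℝ) : ℂ) + Complex.I * (ε : ℂ) =
      ((m ^ 2 * w / 4 : ℝ) : ℂ) + ((1 * ε : ℝ) : ℂ) * Complex.I := by push_cast; ring
  have e2 : ((m ^ 2 * w / 4 : ℝ) : ℂ) - Complex.I * (ε : ℂ) =
      ((m ^ 2 * w / 4 : ℝ) : ℂ) + ((-1 * ε : ℝ) : ℂ) * Complex.I := by push_cast; ring
  have e3 : ((m ^ 2 * w / 4 : ℝ) : ℂ) + ((1 * ε : ℝ) : ℂ) * Complex.I =
      ((m ^ 2 * w / 4 : ℝ) : ℂ) - ((-1 * ε : ℝ) : ℂ) * Complex.I := by push_cast; ring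
  have e4 : ((m ^ 2 * w / 4 : ℝ) : ℂ) + ((-1 * ε : ℝ) : ℂ) * Complex.I =
      ((m ^ 2 * w / 4 : ℝ) : ℂ) - ((1 * ε : ℝ) : ℂ) * Complex.I := by push_cast; ring
  rw [e1, e2, h1, h2, ← e3, ← e4]

/-! ### The formula in terms of 𝐅 as a boundary value. -/

/-- With z = bw + isε, multiplication by -si is a quarter turn into the right half-plane. No branch
is crossed, so the principal power of ε - sibw is that of z up to the explicit phase. -/
theorem exp_mul_cpow_eq {s ε : ℝ} (hs : s = 1 ∨ s = -1) (hε : 0 < ε) (b l w : ℝ) :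
    Complex.exp (s * (Complex.I * ((Real.pi / 2 * l : ℝ) : ℂ))) *
      (-(s * (Complex.I * ((b * w : ℝ) : ℂ))) + (ε : ℂ)) ^ (l : ℂ) =
      Complex.exp ((l : ℂ) * logReg b s ε w) := by
  have hs2 : (s : ℂ) * s = 1 := by rcases hs with rfl | rfl <;> norm_num
  set z : ℂ := (b * w : ℝ) + ((s * ε : ℝ) : ℂ) * Complex.I with hz
  have hzs : z ∈ Complex.slitPlane := mem_slitPlane_reg hs hε.ne' _
  have hzim : z.im = s * ε := by simp [hz]
  have e1 : -(s * (Complex.I * ((b * w : ℝ) : ℂ))) + (ε : ℂ) =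
      Complex.exp (Complex.log z - s * (Real.pi / 2 * Complex.I)) := by
    have e2 : Complex.exp (-(s * (Real.pi / 2 * Complex.I))) = -s * Complex.I := by
      rcases hs with rfl | rfl
      · rw [Complex.ofReal_one, one_mul, Complex.exp_neg, Complex.exp_pi_div_two_mul_I, Complex.inv_I]
        ring
      · rw [Complex.ofReal_neg, Complex.ofReal_one, neg_one_mul, neg_neg, Complex.exp_pi_div_two_mul_I]
        ring
    rw [sub_eq_add_neg, Complex.exp_add, Complex.exp_log (Complex.slitPlane_ne_zero hzs), e2, hz]
    push_cast
    linear_combination (-(ε : ℂ)) * hs2 + (s : ℂ) * s * ε * Complex.I_mul_I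
  have him : (Complex.log z - s * (Real.pi / 2 * Complex.I)).im = Complex.arg z - s * (Real.pi / 2) := by
    simp [Complex.log_im]
  have hpi := Real.pi_pos
  -- The argument of z lies in [0, π] for s = 1 and in (-π, 0) for s = -1; subtracting sπ/2 keeps it
  -- in the principal range.
  have hr : -Real.pi < Complex.arg z - s * (Real.pi / 2) ∧ Complex.arg z - s * (Real.pi / 2) ≤ Real.pi := by
    have h1 := Complex.neg_pi_lt_arg z
    have h2 := Complex.arg_le_pi z
    rcases hs with rfl | rfl
    · have : 0 ≤ Complex.arg z := Complex.arg_nonneg_iff.2 (by rw [hzim]; linarith)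
      constructor <;> linarith
    · have : Complex.arg z < 0 := Complex.arg_neg_iff.2 (by rw [hzim]; linarith)
      constructor <;> linarith
  have e3 : -(s * (Complex.I * ((b * w : ℝ) : ℂ))) + (ε : ℂ) ≠ 0 := by
    rw [e1]; exact Complex.exp_ne_zero _
  rw [Complex.cpow_def_of_ne_zero e3, e1, Complex.log_exp (by rw [him]; exact hr.1) (by rw [him]; exact hr.2),
    ← Complex.exp_add]
  congr 1
  change _ = (l : ℂ) * Complex.log z
  push_cast
  ring

theorem minusPow_eq {ε : ℝ} (hε : 0 < ε) (b l w : ℝ) :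
    minusPow l ε (b * w) = (2 * Complex.I * (Real.sin (Real.pi * l) : ℂ))⁻¹ *
      (Complex.exp ((l : ℂ) * logReg b 1 ε w) - Complex.exp ((l : ℂ) * logReg b (-1) ε w)) := by
  have h1 := exp_mul_cpow_eq (s := 1) (by simp) hε b l w
  have h2 := exp_mul_cpow_eq (s := -1) (by simp) hε b l w
  simp only [Complex.ofReal_one, one_mul, Complex.ofReal_neg, neg_mul, neg_neg] at h1 h2
  rw [minusPow, h1, h2]
  ring

theorem rhoMinus_eq {ε l : ℝ} (hε : 0 < ε) (hl : l < 0) (b w : ℝ) :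
    rhoMinus l ε (b * w) = (Real.Gamma (-l) : ℂ) * (2 * (Real.pi : ℂ) * Complex.I)⁻¹ *
      (Complex.exp ((l : ℂ) * logReg b (-1) ε w) - Complex.exp ((l : ℂ) * logReg b 1 ε w)) := by
  have h1 := exp_mul_cpow_eq (s := 1) (by simp) hε b l w
  have h2 := exp_mul_cpow_eq (s := -1) (by simp) hε b l w
  simp only [Complex.ofReal_one, one_mul, Complex.ofReal_neg, neg_mul, neg_neg] at h1 h2
  rw [rhoMinus, if_pos hl, h1, h2]

theorem rhoMinus_of_nonneg {l : ℝ} (hl : 0 ≤ l) (ε w : ℝ) : rhoMinus l ε w = (primPow l w : ℂ) := by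
  rw [rhoMinus, if_neg (not_lt.2 hl), primPow]

/-- The first N terms are differences of boundary values of negative integer powers and are handled
by `tendsto_powInt`; the others are not regularized and form the tail for every ε. -/
theorem isConeBoundaryValue_tachKernel_even {d N : ℕ} (hd : 2 ≤ d) (hn : d = 2 * N + 2)
    {a : ℝ} (ha0 : a = 0) (m σ : ℝ) :
    IsConeBoundaryValue σ (fun ε w =>
      ((2 * Real.pi / (4 * Real.pi) ^ ((d : ℝ) / 2) : ℝ) : ℂ) * tachKernel d m ε w)
      (coneDist d σ N (propKernel N a ((m ^ 2 : ℝ) : ℂ))) := by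
  intro φ
  have hN : 2 * N + 1 ≤ d - 1 := by omega
  have h0 : 2 * 0 + 1 ≤ d - 1 := by omega
  have ha : a = 0 ∨ a = 1 / 2 := Or.inl ha0
  have hδ : (d : ℝ) / 2 = N + 1 + a := by rw [hn, ha0]; push_cast; ring
  have hα : 1 - (d : ℝ) / 2 = -N := by rw [hδ, ha0]; ring
  set κ : ℂ := ((2 * Real.pi / (4 * Real.pi) ^ ((d : ℝ) / 2) : ℝ) : ℂ) with hκ
  have hT := admissible_tailKernel ha ((m ^ 2 : ℝ) : ℂ) N 0
  set g : ℕ → ℂ := fun j => ((m ^ 2 : ℝ) : ℂ) ^ j / (j.factorial : ℂ) *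
    ((Real.Gamma (N + a - j) : ℂ) * (2 * (Real.pi : ℂ) * Complex.I)⁻¹) with hg
  have hker : ∀ ε > 0, (fun w => κ * tachKernel d m ε w) = fun w => κ *
      (∑ j ∈ Finset.range N, g j * (Complex.exp (((j - N - a : ℝ) : ℂ) * logReg (1 / 4) (-1) ε w) -
        Complex.exp (((j - N - a : ℝ) : ℂ) * logReg (1 / 4) 1 ε w)) +
        tailKernel a ((m ^ 2 : ℝ) : ℂ) N 0 w) := fun ε hε => by
    ext w
    have hev : Even d := by rw [hn]; exact ⟨N + 1, by ring⟩
    rw [tachKernel, if_pos hev, hα]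
    have htail : ∀ j : ℕ, (((m ^ 2) ^ (j + N) / ((j + N).factorial : ℝ) : ℝ) : ℂ) *
        rhoMinus (-N + ((j + N : ℕ) : ℝ)) ε (w / 4) = ((m ^ 2 : ℝ) : ℂ) ^ (j + N) /
        ((j + N).factorial : ℂ) * (primPow ((j + 0 : ℕ) - a) (w / 4) : ℂ) := fun j => by
      rw [show -(N : ℝ) + ((j + N : ℕ) : ℝ) = ((j + 0 : ℕ) : ℝ) - a by rw [ha0]; push_cast; ring,
        rhoMinus_of_nonneg (by simp [ha0])]
      push_cast; rfl
    have hs := (hasSum_tailKernel ha ((m ^ 2 : ℝ) : ℂ) N 0 w).summable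
    simp only [← htail] at hs
    rw [← Summable.sum_add_tsum_nat_add' (f := fun j : ℕ => (((m ^ 2) ^ j / (j.factorial : ℝ) : ℝ) : ℂ) *
      rhoMinus (-N + (j : ℝ)) ε (w / 4)) (k := N) hs, tailKernel]
    simp only [htail]
    congr 2
    refine Finset.sum_congr rfl fun j hj => ?_
    have hjN : (j : ℝ) < N := by exact_mod_cast Finset.mem_range.1 hj
    rw [show w / 4 = 1 / 4 * w by ring, rhoMinus_eq hε (by linarith), hg,
      show -(-(N : ℝ) + j) = N + a - j by rw [ha0]; ring,
      show -(N : ℝ) + j = j - N - a by rw [ha0]; ring]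
    push_cast; ring
  have hQ : ∀ j : ℕ, ∃ Q : ℝ → ℂ, j ∈ Finset.range N →
      (∀ s, s = 1 ∨ s = -1 → Tendsto (powInt σ (1 / 4) (j - N - a) s φ) (𝓝[>] 0) (𝓝 (Q s))) ∧
      Q 1 - Q (-1) = coneDist d σ N (fun w => (((1 / 4 : ℝ) : ℂ)⁻¹) ^ N *
        (-2 * Real.pi * Complex.I / (Real.Gamma (N + a - j) : ℂ)) *
          (primPow (j - a) (1 / 4 * w) : ℂ)) φ :=
    fun j => by
      by_cases hj : j ∈ Finset.range N
      · obtain ⟨Q, hQ⟩ := tendsto_powInt hN σ ha (b := 1 / 4) (by norm_num) (Finset.mem_range.1 hj) φ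
        exact ⟨Q, fun _ => hQ⟩
      · exact ⟨0, fun h => absurd h hj⟩
  choose Q hQ using hQ
  have hlim := ((tendsto_finsetSum (Finset.range N) fun j hj =>
    (((hQ j hj).1 (-1) (by simp)).sub ((hQ j hj).1 1 (by simp))).const_mul (g j)).add_const
      (coneDist d σ 0 (tailKernel a ((m ^ 2 : ℝ) : ℂ) N 0) φ)).const_mul κ
  rw [coneDist_propKernel_eq_add hN σ ha hδ, ← hκ, ← coneDist_zero_apply hd σ hT]
  have hval : ∀ j ∈ Finset.range N, g j * (Q j (-1) - Q j 1) =
      ((m ^ 2 : ℝ) : ℂ) ^ j / (j.factorial : ℂ) *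
        (4 ^ N * coneDist d σ N (fun w => (primPow (j - a) (1 / 4 * w) : ℂ)) φ) := fun j hj => by
    have hjN : (j : ℝ) < N := by exact_mod_cast Finset.mem_range.1 hj
    have hp : (0 : ℝ) < N + a - j := by rw [ha0]; linarith
    have hG : (Real.Gamma (N + a - j) : ℂ) ≠ 0 := by
      exact_mod_cast (Real.Gamma_pos_of_pos hp).ne'
    have hpi : (Real.pi : ℂ) ≠ 0 := by exact_mod_cast Real.pi_ne_zero
    rw [← neg_sub (Q j 1), (hQ j hj).2, coneDist_const_mul hN σ (admissible_primPow ha (by norm_num) j), hg]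
    have : (((1 / 4 : ℝ) : ℂ)⁻¹) = 4 := by push_cast; norm_num
    rw [this]
    have := Complex.I_ne_zero
    field_simp
  rw [Finset.sum_congr rfl hval] at hlim
  refine hlim.congr' ?_
  filter_upwards [self_mem_nhdsWithin] with ε hε
  have hε' : ε ≠ 0 := ne_of_gt hε
  have hc : ∀ (j : ℕ) (s : ℝ), s = 1 ∨ s = -1 → Admissible fun w =>
      Complex.exp (((j - N - a : ℝ) : ℂ) * logReg (1 / 4) s ε w) := fun j s hs => by
    have := continuous_logReg (b := 1 / 4) hs hε'
    exact .of_continuous (by fun_prop)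
  have hcs : ∀ j : ℕ, Admissible fun w => Complex.exp (((j - N - a : ℝ) : ℂ) * logReg (1 / 4) (-1) ε w) -
        Complex.exp (((j - N - a : ℝ) : ℂ) * logReg (1 / 4) 1 ε w) := fun j => by
    simpa [sub_eq_add_neg] using (hc j (-1) (by simp)).add ((hc j 1 (by simp)).const_mul (-1))
  have hcm := fun j => (hcs j).const_mul (g j)
  have hsum := Admissible.sum (Finset.range N) fun j _ => hcm j
  have hk := hker ε hε
  have hadm : Admissible fun w => κ * tachKernel d m ε w := by
    rw [hk]; exact (hsum.add hT).const_mul κ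
  rw [← coneDist_zero_apply hd σ hadm, hk, coneDist_const_mul h0 σ (hsum.add hT),
    coneDist_add h0 σ hsum hT, coneDist_sum h0 σ _ fun j _ => hcm j]
  congr 2
  refine Finset.sum_congr rfl fun j _ => ?_
  rw [coneDist_const_mul h0 σ (hcs j), ← coneDist_sub h0 σ (hc j (-1) (by simp)) (hc j 1 (by simp)),
    powInt_eq_coneDist hd σ (by simp) hε', powInt_eq_coneDist hd σ (by simp) hε']

theorem continuous_exp_logReg (l : ℂ) {b s ε : ℝ} (hs : s = 1 ∨ s = -1) (hε : ε ≠ 0) :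
    Continuous fun w => Complex.exp (l * logReg b s ε w) := by
  have := continuous_logReg (b := b) hs hε
  fun_prop

/-- Factors `(b w)^j` may be replaced by powers of `b w + i s ε`. -/
theorem tendsto_coneDist_pow_mul_exp {d : ℕ} (hd : 2 ≤ d) (σ : ℝ) {b α s : ℝ}
    (hs : s = 1 ∨ s = -1) {n : ℕ} {φ : MinkTest d} {Q : ℕ → ℂ}
    (hQ : ∀ k < n, Tendsto (powInt σ b (k - α) s φ) (𝓝[>] 0) (𝓝 (Q k))) (j : ℕ) :
    ∀ k, j + k < n → Tendsto (fun ε => coneDist d σ 0 (fun w => ((b * w : ℝ) : ℂ) ^ j *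
      Complex.exp (((k - α : ℝ) : ℂ) * logReg b s ε w)) φ) (𝓝[>] 0) (𝓝 (Q (j + k))) := by
  have h0 : 2 * 0 + 1 ≤ d - 1 := by omega
  induction j with
  | zero =>
    intro k hk
    rw [zero_add]
    refine (hQ k (by omega)).congr' ?_
    filter_upwards [self_mem_nhdsWithin] with ε hε
    simp only [pow_zero, one_mul]
    exact powInt_eq_coneDist hd σ hs (ne_of_gt hε) φ
  | succ j ih =>
    intro k hk
    have h1 := ih (k + 1) (by omega)
    have h2 := ih k (by omega)
    have hε0 : Tendsto (fun ε : ℝ => ((s * ε : ℝ) : ℂ) * Complex.I) (𝓝[>] 0) (𝓝 0) := by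
      have hc : Continuous fun ε : ℝ => ((s * ε : ℝ) : ℂ) * Complex.I := by fun_prop
      have := (hc.tendsto 0).mono_left (nhdsWithin_le_nhds (s := Set.Ioi 0))
      simpa only [mul_zero, Complex.ofReal_zero, zero_mul] using this
    -- Write (bw)^{j+1} = (bw)^j (bw + isε) - isε(bw)^j: the first term raises the exponent of the
    -- boundary value, the second is ε times a convergent quantity.
    have h3 := h1.sub (hε0.mul h2)
    rw [zero_mul, sub_zero, show j + (k + 1) = j + 1 + k by ring] at h3
    refine h3.congr' ?_
    filter_upwards [self_mem_nhdsWithin] with ε hε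
    have hε' : ε ≠ 0 := ne_of_gt hε
    have hc : ∀ (j k : ℕ), Admissible fun w => ((b * w : ℝ) : ℂ) ^ j *
        Complex.exp (((k - α : ℝ) : ℂ) * logReg b s ε w) := fun j k => by
      have := continuous_exp_logReg ((k - α : ℝ) : ℂ) (b := b) hs hε'
      exact .of_continuous (by fun_prop)
    rw [← coneDist_const_mul h0 σ (hc j k), coneDist_sub h0 σ (hc j (k + 1)) ((hc j k).const_mul _)]
    congr 2
    ext w
    have : Complex.exp ((((k + 1 : ℕ) : ℝ) - α : ℝ) * logReg b s ε w) =
        ((b * w : ℝ) + ((s * ε : ℝ) : ℂ) * Complex.I) *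
          Complex.exp (((k - α : ℝ) : ℂ) * logReg b s ε w) := by
      rw [← exp_logReg hs hε', ← Complex.exp_add]
      congr 1; push_cast; ring
    rw [this]
    ring

theorem sin_pi_mul_natCast_add_half (N : ℕ) : Real.sin (Real.pi * (N + 1 / 2)) = (-1) ^ N := by
  rw [show Real.pi * ((N : ℝ) + 1 / 2) = Real.pi / 2 + N * Real.pi by ring, Real.sin_add_nat_mul_pi,
    Real.sin_pi_div_two, mul_one]

/-- The tail of the series of 𝐅 vanishes to order N at w = 0. This lowers the regularized power
|w|^{-N-1/2} to the admissible order, uniformly in ε. For w < 0 the two phases combine to the sine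
in the normalization of w_-. -/
theorem kernelTendsto_odd_tail (N : ℕ) (c : ℝ) :
    KernelTendsto (fun ε w => (2 * Complex.I * (Real.sin (Real.pi * (-(N + 1 / 2))) : ℂ))⁻¹ *
      (Complex.exp (((-(N + 1 / 2) : ℝ) : ℂ) * logReg (1 / 4) 1 ε w) -
        Complex.exp (((-(N + 1 / 2) : ℝ) : ℂ) * logReg (1 / 4) (-1) ε w)) *
      (boldTail (1 / 2) N (-(c * w / 4)) : ℂ)) (tailKernel (1 / 2) (c : ℂ) N 0) := by
  have ha : (1 / 2 : ℝ) = 0 ∨ (1 / 2 : ℝ) = 1 / 2 := Or.inr rfl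
  set α : ℝ := N + 1 / 2 with hα
  have hα0 : 0 < α := by positivity
  set M : ℂ := (2 * Complex.I * (Real.sin (Real.pi * (-α)) : ℂ))⁻¹ with hM
  have hsin : Real.sin (Real.pi * α) = (-1) ^ N := sin_pi_mul_natCast_add_half N
  refine ⟨fun ε hε => ?_, fun R => ?_, fun w hw => ?_⟩
  · have h1 := (continuous_exp_logReg ((-α : ℝ) : ℂ) (b := 1 / 4) (s := 1) (by simp) hε.ne').measurable
    have h2 := (continuous_exp_logReg ((-α : ℝ) : ℂ) (b := 1 / 4) (s := -1) (by simp) hε.ne').measurable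
    have h3 := measurable_boldTail ha N
    fun_prop
  · refine ⟨‖M‖ * (4 ^ α + 4 ^ α) * (Real.exp (|c| * R / 4) * (2 * (|c| / 4) ^ N)),
      fun ε hε w hw h0 => ?_⟩
    have hw0 : 0 < |w| := abs_pos.2 h0
    have he : ∀ s, s = 1 ∨ s = -1 →
        ‖Complex.exp (((-α : ℝ) : ℂ) * logReg (1 / 4) s ε w)‖ ≤ 4 ^ α * |w| ^ (-α) := fun s hs => by
      have hz := mem_slitPlane_reg hs hε.1.ne' (1 / 4 * w)
      have h1 : Real.exp (logReg (1 / 4) s ε w).re =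
          ‖((1 / 4 * w : ℝ) : ℂ) + ((s * ε : ℝ) : ℂ) * Complex.I‖ :=
        exp_re_log (Complex.slitPlane_ne_zero hz)
      have h2 : |w| / 4 ≤ ‖((1 / 4 * w : ℝ) : ℂ) + ((s * ε : ℝ) : ℂ) * Complex.I‖ := by
        refine le_trans (le_of_eq ?_) (Complex.abs_re_le_norm _)
        simp [abs_mul, abs_of_pos]; ring
      rw [Complex.norm_exp, Complex.re_ofReal_mul, mul_comm, Real.exp_mul, h1]
      refine (Real.rpow_le_rpow_of_nonpos (by positivity) h2 (by linarith)).trans (le_of_eq ?_)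
      rw [Real.div_rpow hw0.le (by norm_num), Real.rpow_neg (by norm_num : (0:ℝ) ≤ 4), div_inv_eq_mul, mul_comm]
    have ht := abs_boldTail_le ha N (-(c * w / 4))
    have hab : |(-(c * w / 4))| = |c| / 4 * |w| := by
      rw [abs_neg, abs_div, abs_mul, abs_of_pos (by norm_num : (0:ℝ) < 4)]; ring
    rw [hab, mul_pow] at ht
    have hexp : Real.exp (|c| / 4 * |w|) ≤ Real.exp (|c| * R / 4) := by
      refine Real.exp_le_exp.2 ?_
      have := mul_le_mul_of_nonneg_left hw (abs_nonneg c)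
      linarith
    have hpow : |w| ^ (-α) * |w| ^ N = |w| ^ (-(1 / 2) : ℝ) := by
      rw [← Real.rpow_natCast, ← Real.rpow_add hw0]; congr 1; rw [hα]; ring
    rw [norm_mul, norm_mul, Complex.norm_real, Real.norm_eq_abs]
    calc _ ≤ ‖M‖ * (4 ^ α * |w| ^ (-α) + 4 ^ α * |w| ^ (-α)) *
          (Real.exp (|c| * R / 4) * (2 * ((|c| / 4) ^ N * |w| ^ N))) := by
          gcongr
          · exact (norm_sub_le _ _).trans (add_le_add (he 1 (by simp)) (he (-1) (by simp)))
          · exact ht.trans (by gcongr)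
      _ = ‖M‖ * (4 ^ α + 4 ^ α) * (Real.exp (|c| * R / 4) * (2 * (|c| / 4) ^ N)) *
          (|w| ^ (-α) * |w| ^ N) := by ring
      _ = _ := by rw [hpow]
  · have hl : ∀ s, s = 1 ∨ s = -1 → Tendsto (fun ε => Complex.exp (((-α : ℝ) : ℂ) *
        logReg (1 / 4) s ε w)) (𝓝[>] 0) (𝓝 (Complex.exp (((-α : ℝ) : ℂ) * logBd s (1 / 4 * w)))) :=
      fun s hs => ((tendsto_logReg (by norm_num) hs hw).const_mul _).cexp
    convert (((hl 1 (by simp)).sub (hl (-1) (by simp))).const_mul M).mul_const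
      ((boldTail (1 / 2) N (-(c * w / 4)) : ℂ)) using 2
    rcases lt_or_gt_of_ne hw with hw' | hw'
    · have hbw : 1 / 4 * w < 0 := by linarith
      have hp : 0 < -w / 4 := by linarith
      rw [tailKernel_zero_eq _ _ _ hw']
      simp only [logBd, if_pos hbw]
      have e1 : ∀ s : ℝ, Complex.exp (((-α : ℝ) : ℂ) * ((Real.log (1 / 4 * w) : ℂ) +
          ((s * Real.pi : ℝ) : ℂ) * Complex.I)) =
          (((-w / 4) ^ (-α) : ℝ) : ℂ) * Complex.exp ((-(s * (Real.pi * α)) : ℝ) * Complex.I) := fun s => by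
        rw [Real.rpow_def_of_pos hp, show -w / 4 = -(1 / 4 * w) by ring, Real.log_neg_eq_log,
          Complex.ofReal_exp, ← Complex.exp_add]
        congr 1; push_cast; ring
      have e2 : Complex.exp ((-(1 * (Real.pi * α)) : ℝ) * Complex.I) -
          Complex.exp ((-(-1 * (Real.pi * α)) : ℝ) * Complex.I) =
          2 * Complex.I * (Real.sin (Real.pi * (-α)) : ℂ) := by
        rw [Complex.exp_mul_I, Complex.exp_mul_I, ← Complex.ofReal_cos, ← Complex.ofReal_cos,
          ← Complex.ofReal_sin, ← Complex.ofReal_sin, one_mul, neg_one_mul, neg_neg, Real.cos_neg,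
          mul_neg, Real.sin_neg]
        push_cast; ring
      have hne : (2 * Complex.I * (Real.sin (Real.pi * (-α)) : ℂ)) ≠ 0 := by
        refine mul_ne_zero (mul_ne_zero two_ne_zero Complex.I_ne_zero) ?_
        rw [mul_neg, Real.sin_neg, hsin]
        exact_mod_cast neg_ne_zero.2 (pow_ne_zero N (by norm_num))
      rw [e1, e1, ← mul_sub, e2, mul_left_comm, hM, inv_mul_cancel₀ hne, mul_one, Complex.ofReal_mul,
        show c * (-w / 4) = -(c * w / 4) by ring]
    · have hbw : ¬ 1 / 4 * w < 0 := by linarith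
      rw [tailKernel_of_nonneg _ _ _ _ hw'.le]
      simp only [logBd, if_neg hbw, sub_self, mul_zero, zero_mul]

/-- The smooth factor is a polynomial of degree below N in w plus a tail. The polynomial involves
powers of w and not of w ± iε, which `tendsto_coneDist_pow_mul_exp` shows to be immaterial in the
limit; the tail is `kernelTendsto_odd_tail`. -/
theorem isConeBoundaryValue_tachKernel_odd {d N : ℕ} (hd : 2 ≤ d) (hn : d = 2 * N + 3) (m σ : ℝ) :
    IsConeBoundaryValue σ (fun ε w =>
      ((2 * Real.pi / (4 * Real.pi) ^ ((d : ℝ) / 2) : ℝ) : ℂ) * tachKernel d m ε w)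
      (coneDist d σ N (propKernel N (1 / 2) ((m ^ 2 : ℝ) : ℂ))) := by
  intro φ
  have hN : 2 * N + 1 ≤ d - 1 := by omega
  have h0 : 2 * 0 + 1 ≤ d - 1 := by omega
  have ha : (1 / 2 : ℝ) = 0 ∨ (1 / 2 : ℝ) = 1 / 2 := Or.inr rfl
  have hδ : (d : ℝ) / 2 = N + 1 + 1 / 2 := by rw [hn]; push_cast; ring
  have hα : 1 - (d : ℝ) / 2 = -(N + 1 / 2) := by rw [hδ]; ring
  set κ : ℂ := ((2 * Real.pi / (4 * Real.pi) ^ ((d : ℝ) / 2) : ℝ) : ℂ) with hκ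
  have hT := admissible_tailKernel ha ((m ^ 2 : ℝ) : ℂ) N 0
  have hKT := kernelTendsto_odd_tail N (m ^ 2)
  set S : ℝ := Real.sin (Real.pi * (-(N + 1 / 2))) with hS
  set M : ℂ := (2 * Complex.I * (S : ℂ))⁻¹ with hM
  have hSv : S = -(-1) ^ N := by
    rw [hS, mul_neg, Real.sin_neg, sin_pi_mul_natCast_add_half]
  set E : ℝ → ℝ → ℝ → ℂ := fun s ε w =>
    Complex.exp (((-(N + 1 / 2) : ℝ) : ℂ) * logReg (1 / 4) s ε w) with hE
  set T : ℝ → ℝ → ℂ := fun ε w => M * (E 1 ε w - E (-1) ε w) *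
      (boldTail (1 / 2) N (-(m ^ 2 * w / 4)) : ℂ) with hTdef
  set g : ℕ → ℂ := fun j => M * (((-(m ^ 2)) ^ j /
    (Real.Gamma (j - (N + 1 / 2) + 1) * (j.factorial : ℝ)) : ℝ) : ℂ) with hg
  have hker : ∀ ε > 0, (fun w => κ * tachKernel d m ε w) = fun w => κ *
      (∑ j ∈ Finset.range N, g j * (((1 / 4 * w : ℝ) : ℂ) ^ j * E 1 ε w -
        ((1 / 4 * w : ℝ) : ℂ) ^ j * E (-1) ε w) + T ε w) := fun ε hε => by
    ext w
    have hev : ¬ Even d := by rw [hn, Nat.not_even_iff_odd]; exact ⟨N + 1, by ring⟩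
    rw [tachKernel, if_neg hev, hα, show w / 4 = 1 / 4 * w by ring, minusPow_eq hε,
      boldF_eq_add ha, hTdef]
    have e1 : ∀ j : ℕ, (-(m ^ 2 * w / 4)) ^ j /
        (Real.Gamma (j - (N + 1 / 2) + 1) * (j.factorial : ℝ)) =
        (1 / 4 * w) ^ j * ((-(m ^ 2)) ^ j /
          (Real.Gamma (j - (N + 1 / 2) + 1) * (j.factorial : ℝ))) := fun j => by
      rw [show -(m ^ 2 * w / 4) = 1 / 4 * w * -(m ^ 2) by ring, mul_pow, mul_div_assoc]
    simp only [e1]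
    rw [Complex.ofReal_add, mul_add, Complex.ofReal_sum, Finset.mul_sum]
    congr 2
    refine Finset.sum_congr rfl fun j _ => ?_
    rw [hg]
    simp only [Complex.ofReal_mul, Complex.ofReal_pow]
    ring
  have hQ : ∀ j : ℕ, ∃ Q : ℝ → ℂ, j < N →
      (∀ s, s = 1 ∨ s = -1 → Tendsto (powInt σ (1 / 4) (j - (N + 1 / 2)) s φ) (𝓝[>] 0) (𝓝 (Q s))) ∧
      Q 1 - Q (-1) = coneDist d σ N (fun w => (((1 / 4 : ℝ) : ℂ)⁻¹) ^ N *
        (-2 * Real.pi * Complex.I / (Real.Gamma (N + 1 / 2 - j) : ℂ)) *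
          (primPow (j - 1 / 2) (1 / 4 * w) : ℂ)) φ :=
    fun j => by
      by_cases hj : j < N
      · obtain ⟨Q, hQ⟩ := tendsto_powInt hN σ ha (b := 1 / 4) (by norm_num) hj φ
        rw [sub_sub] at hQ
        exact ⟨Q, fun _ => hQ⟩
      · exact ⟨0, fun h => absurd h hj⟩
  choose Q hQ using hQ
  have hx : ∀ s, s = 1 ∨ s = -1 → ∀ j ∈ Finset.range N, Tendsto (fun ε =>
      coneDist d σ 0 (fun w => ((1 / 4 * w : ℝ) : ℂ) ^ j * E s ε w) φ) (𝓝[>] 0) (𝓝 (Q j s)) :=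
    fun s hs j hj => by
      have := tendsto_coneDist_pow_mul_exp hd σ hs (Q := fun k => Q k s)
        (fun k hk => (hQ k hk).1 s hs) j 0 (Finset.mem_range.1 hj)
      simpa only [Nat.cast_zero, zero_sub, add_zero] using this
  have hlim := ((tendsto_finsetSum (Finset.range N) fun j hj =>
    ((hx 1 (by simp) j hj).sub (hx (-1) (by simp) j hj)).const_mul (g j)).add
      (hKT.tendsto_coneDist h0 σ hT.measurable φ)).const_mul κ
  rw [coneDist_propKernel_eq_add hN σ ha hδ, ← hκ, ← coneDist_zero_apply hd σ hT]
  -- The sign (-1)^j from the argument -m²w of 𝐅 is compensated by that of sin π(N + 1/2 - j) in the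
  -- reflection formula.
  have hval : ∀ j ∈ Finset.range N, g j * (Q j 1 - Q j (-1)) =
      ((m ^ 2 : ℝ) : ℂ) ^ j / (j.factorial : ℂ) *
        (4 ^ N * coneDist d σ N (fun w => (primPow (j - 1 / 2) (1 / 4 * w) : ℂ)) φ) := fun j hj => by
    have hjN : (j : ℝ) < N := by exact_mod_cast Finset.mem_range.1 hj
    have hG : Real.Gamma (N + 1 / 2 - j) ≠ 0 := (Real.Gamma_pos_of_pos (by linarith)).ne'
    have hG' : (Real.Gamma (N + 1 / 2 - j) : ℂ) ≠ 0 := by exact_mod_cast hG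
    have hpi : (Real.pi : ℂ) ≠ 0 := by exact_mod_cast Real.pi_ne_zero
    have h4 : (((1 / 4 : ℝ) : ℂ)⁻¹) = 4 := by push_cast; norm_num
    have hr := inv_Gamma_one_sub (x := N + 1 / 2 - j) (by linarith)
    have hsn : Real.sin (Real.pi * (N + 1 / 2 - j)) = (-1) ^ N * (-1) ^ j := by
      rw [show Real.pi * ((N : ℝ) + 1 / 2 - j) = Real.pi * (N + 1 / 2) - j * Real.pi by ring,
        Real.sin_sub_nat_mul_pi, sin_pi_mul_natCast_add_half, mul_comm]
    have hN1 : ((-1 : ℂ) ^ N) ≠ 0 := pow_ne_zero N (by norm_num)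
    have hj1 : ((-1 : ℂ) ^ j) * (-1) ^ j = 1 := by rw [← mul_pow]; norm_num
    rw [(hQ j (Finset.mem_range.1 hj)).2, coneDist_const_mul hN σ (admissible_primPow ha (by norm_num) j),
      h4, hg]
    beta_reduce
    rw [hM, hSv, ← div_div, div_eq_mul_inv _ (Real.Gamma _),
      show (j : ℝ) - (N + 1 / 2) + 1 = 1 - (N + 1 / 2 - j) by ring, hr, hsn, neg_pow (m ^ 2)]
    simp only [Complex.ofReal_mul, Complex.ofReal_div, Complex.ofReal_pow, Complex.ofReal_neg,
      Complex.ofReal_one, Complex.ofReal_natCast]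
    generalize (coneDist d σ N fun w => (primPow (j - 1 / 2) (1 / 4 * w) : ℂ)) φ = D
    generalize (Real.Gamma (N + 1 / 2 - j) : ℂ) = Γ at hG' ⊢
    have := Complex.I_ne_zero
    have hf : (j.factorial : ℂ) ≠ 0 := by exact_mod_cast j.factorial_ne_zero
    field_simp
    linear_combination ((m : ℂ) ^ 2) ^ j * D * hj1
  rw [Finset.sum_congr rfl hval] at hlim
  refine hlim.congr' ?_
  filter_upwards [Ioc_mem_nhdsGT (one_pos (α := ℝ))] with ε hε
  have hε' : ε ≠ 0 := hε.1.ne'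
  have hc : ∀ (j : ℕ) (s : ℝ), s = 1 ∨ s = -1 → Admissible fun w =>
      ((1 / 4 * w : ℝ) : ℂ) ^ j * E s ε w := fun j s hs => by
    have := continuous_exp_logReg ((-(N + 1 / 2) : ℝ) : ℂ) (b := 1 / 4) hs hε'
    exact .of_continuous (by fun_prop)
  have hcs : ∀ j : ℕ, Admissible fun w => ((1 / 4 * w : ℝ) : ℂ) ^ j * E 1 ε w -
      ((1 / 4 * w : ℝ) : ℂ) ^ j * E (-1) ε w := fun j => by
    simpa [sub_eq_add_neg] using (hc j 1 (by simp)).add ((hc j (-1) (by simp)).const_mul (-1))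
  have hcm := fun j => (hcs j).const_mul (g j)
  have hsum := Admissible.sum (Finset.range N) fun j _ => hcm j
  have hTε : Admissible fun w => T ε w := hKT.admissible_of_pos hε
  have hk := hker ε hε.1
  have hadm : Admissible fun w => κ * tachKernel d m ε w := by
    rw [hk]; exact (hsum.add hTε).const_mul κ
  rw [← coneDist_zero_apply hd σ hadm, hk, coneDist_const_mul h0 σ (hsum.add hTε),
    coneDist_add h0 σ hsum hTε, coneDist_sum h0 σ _ fun j _ => hcm j]
  congr 2
  refine Finset.sum_congr rfl fun j _ => ?_
  rw [coneDist_const_mul h0 σ (hcs j), ← coneDist_sub h0 σ (hc j 1 (by simp)) (hc j (-1) (by simp))]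

/-! ### Singular and regular part, odd dimension. -/

theorem isRegularDist_coneDist {d : ℕ} (hd : 2 ≤ d) (σ : ℝ) {K : ℝ → ℂ} (hK : Admissible K)
    {f : Mink d → ℝ} (hf : ∀ x, (f x : ℂ) = (heaviside (σ * x.1) : ℂ) * K (minkSq x)) :
    IsRegularDist f (coneDist d σ 0 K) := by
  refine ⟨?_, fun φ => ?_⟩
  · have h := locallyIntegrable_coneWeight (N := 0) (by omega : 2 * 0 + 1 ≤ d - 1) σ hK
    have e : f = fun x => (coneWeight σ 0 K x).re := by
      ext x; simp only [coneWeight]; rw [← hf]; simp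
    rw [e]
    exact fun x => (h x).imp fun s hs => ⟨hs.1, hs.2.re⟩
  · rw [coneDist_zero_apply hd σ hK, ← integral_complex_ofReal]
    congr 1; ext x
    rw [← hf]; push_cast; rfl

theorem coneConst_eq {d N : ℕ} {a : ℝ} (hn : (d : ℝ) / 2 = N + 1 + a) (r : ℝ) :
    2 * Real.pi / (4 * Real.pi) ^ ((d : ℝ) / 2) * (1 / 4) ^ r =
      (1 / 4) ^ ((N : ℝ) + a + r) / (2 * Real.pi ^ ((d : ℝ) / 2 - 1)) := by
  have hp := Real.pi_pos
  rw [Real.mul_rpow (by norm_num) hp.le, Real.rpow_sub_one hp.ne', hn, Real.rpow_add (by norm_num) _ r,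
    show (N : ℝ) + a = (N + 1 + a) - 1 by ring, Real.rpow_sub_one (by norm_num),
    show (1 / 4 : ℝ) = 4⁻¹ by norm_num, Real.inv_rpow (by norm_num), Real.inv_rpow (by norm_num)]
  have : (0 : ℝ) < 4 ^ ((N : ℝ) + 1 + a) := by positivity
  have : (0 : ℝ) < 4 ^ r := by positivity
  have : (0 : ℝ) < Real.pi ^ ((N : ℝ) + 1 + a) := by positivity
  field_simp
  norm_num

theorem oddCoeff_mul_rpow {d N : ℕ} (hn : d = 2 * N + 3) (m : ℝ) (k : ℕ) {w : ℝ} (hw : w < 0) :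
    ((oddCoeff d m (N + k) * (-w) ^ (1 - (d : ℝ) / 2 + ((N + k : ℕ) : ℝ)) : ℝ) : ℂ) =
      ((2 * Real.pi / (4 * Real.pi) ^ ((d : ℝ) / 2) : ℝ) : ℂ) *
      ((((m ^ 2 : ℝ) : ℂ)) ^ (k + N) / ((k + N).factorial : ℂ) *
        (primPow ((k + 0 : ℕ) - 1 / 2) (w / 4) : ℂ)) := by
  have hδ : (d : ℝ) / 2 = N + 1 + 1 / 2 := by rw [hn]; push_cast; ring
  have h1 := coneConst_eq hδ (k - 1 / 2)
  rw [show (N : ℝ) + 1 / 2 + (k - 1 / 2) = ((N + k : ℕ) : ℝ) by push_cast; ring, Real.rpow_natCast] at h1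
  rw [show w / 4 = 1 / 4 * w by ring, primPow_mul _ (by norm_num), primPow, if_pos hw, oddCoeff, add_zero,
    show 1 - (d : ℝ) / 2 + ((N + k : ℕ) : ℝ) = k - 1 / 2 by rw [hδ]; push_cast; ring,
    show 2 - (d : ℝ) / 2 + ((N + k : ℕ) : ℝ) = k - 1 / 2 + 1 by rw [hδ]; push_cast; ring,
    add_comm k N]
  norm_cast
  calc _ = (m ^ 2) ^ (N + k) / ((N + k).factorial : ℝ) * ((-w) ^ ((k : ℝ) - 1 / 2) /
        Real.Gamma (k - 1 / 2 + 1)) * ((1 / 4) ^ (N + k) / (2 * Real.pi ^ ((d : ℝ) / 2 - 1))) := by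
        rw [div_pow, div_pow, one_pow]
        simp only [div_eq_mul_inv, mul_inv]
        ring
    _ = _ := by rw [← h1]; ring

theorem hasSum_oddCoeff {d N : ℕ} (hn : d = 2 * N + 3) (m : ℝ) {w : ℝ} (hw : w < 0) :
    HasSum (fun k : ℕ => ((oddCoeff d m (N + k) * (-w) ^ (1 - (d : ℝ) / 2 + ((N + k : ℕ) : ℝ)) : ℝ) : ℂ))
      (((2 * Real.pi / (4 * Real.pi) ^ ((d : ℝ) / 2) : ℝ) : ℂ) *
        tailKernel (1 / 2) ((m ^ 2 : ℝ) : ℂ) N 0 w) := by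
  simp only [oddCoeff_mul_rpow hn m _ hw]
  exact (hasSum_tailKernel (Or.inr rfl) _ N 0 w).mul_left _

theorem isRegularDist_oddRegular {d N : ℕ} (hd : 2 ≤ d) (hn : d = 2 * N + 3) (m σ : ℝ) :
    IsRegularDist (oddRegular d m σ) (coneDist d σ 0 (fun w =>
      ((2 * Real.pi / (4 * Real.pi) ^ ((d : ℝ) / 2) : ℝ) : ℂ) *
        tailKernel (1 / 2) ((m ^ 2 : ℝ) : ℂ) N 0 w)) := by
  refine isRegularDist_coneDist hd σ ((admissible_tailKernel (Or.inr rfl) _ N 0).const_mul _) fun x => ?_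
  have hN : (d - 3) / 2 = N := by omega
  rw [oddRegular, hN]
  by_cases hw : minkSq x < 0
  · rw [← (hasSum_oddCoeff hn m hw).tsum_eq, heaviside, heaviside, if_pos (neg_pos.2 hw), mul_one,
      ← Complex.ofReal_tsum, Complex.ofReal_mul]
  · rw [tailKernel_of_nonneg _ _ _ _ (not_lt.1 hw), heaviside, heaviside,
      if_neg (show ¬ 0 < -minkSq x by linarith)]
    simp

/-- The jump of the tower yields w_- to the power l divided by Γ(l + 1); by the reflection formula
the factor 1/(2i sin πl) of the regularization restores exactly Γ(l + 1), with l + 1 = 2 - d/2 + j.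
-/
theorem isConeBoundaryValue_minusPow {d N j : ℕ} (hd : 2 ≤ d) (hn : d = 2 * N + 3) (hj : j < N) (σ : ℝ) :
    IsConeBoundaryValue σ (fun ε w => minusPow (1 - (d : ℝ) / 2 + j) ε w)
      (coneDist d σ N (fun w => (Real.Gamma (2 - (d : ℝ) / 2 + j) : ℂ) *
        (primPow (j - 1 / 2) (1 * w) : ℂ))) := by
  intro φ
  have hN : 2 * N + 1 ≤ d - 1 := by omega
  have h0 : 2 * 0 + 1 ≤ d - 1 := by omega
  have ha : (1 / 2 : ℝ) = 0 ∨ (1 / 2 : ℝ) = 1 / 2 := Or.inr rfl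
  have hδ : (d : ℝ) / 2 = N + 1 + 1 / 2 := by rw [hn]; push_cast; ring
  have hjN : (j : ℝ) < N := by exact_mod_cast hj
  have hx : 0 < (N : ℝ) + 1 / 2 - j := by linarith
  set l : ℝ := j - N - 1 / 2 with hl
  have hl1 : 1 - (d : ℝ) / 2 + j = l := by rw [hδ]; ring
  set M : ℂ := (2 * Complex.I * (Real.sin (Real.pi * l) : ℂ))⁻¹ with hM
  obtain ⟨Q, hQ, hQ2⟩ := tendsto_powInt hN σ ha (b := 1) one_pos hj φ
  have hlim := ((hQ 1 (by simp)).sub (hQ (-1) (by simp))).const_mul M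
  have hval : M * (Q 1 - Q (-1)) = coneDist d σ N (fun w => (Real.Gamma (2 - (d : ℝ) / 2 + j) : ℂ) *
        (primPow (j - 1 / 2) (1 * w) : ℂ)) φ := by
    have hadm := admissible_primPow ha one_pos j
    rw [hQ2, coneDist_const_mul hN σ hadm, coneDist_const_mul hN σ hadm, ← mul_assoc]
    congr 1
    have hG : (Real.Gamma (N + 1 / 2 - j) : ℂ) ≠ 0 := by exact_mod_cast (Real.Gamma_pos_of_pos hx).ne'
    have hr := inv_Gamma_one_sub hx
    have hs : Real.sin (Real.pi * l) = -Real.sin (Real.pi * (N + 1 / 2 - j)) := by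
      rw [← Real.sin_neg]; congr 1; rw [hl]; ring
    have hsn : Real.sin (Real.pi * ((N : ℝ) + 1 / 2 - j)) ≠ 0 := by
      rw [show Real.pi * ((N : ℝ) + 1 / 2 - j) = Real.pi * (N + 1 / 2) - j * Real.pi by ring,
        Real.sin_sub_nat_mul_pi, sin_pi_mul_natCast_add_half]
      exact mul_ne_zero (pow_ne_zero _ (by norm_num)) (pow_ne_zero _ (by norm_num))
    have hsn' : (Real.sin (Real.pi * ((N : ℝ) + 1 / 2 - j)) : ℂ) ≠ 0 := by exact_mod_cast hsn
    have hg : Real.Gamma (2 - (d : ℝ) / 2 + j) = Real.pi /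
        (Real.Gamma (N + 1 / 2 - j) * Real.sin (Real.pi * (N + 1 / 2 - j))) := by
      rw [show 2 - (d : ℝ) / 2 + j = 1 - (N + 1 / 2 - j) by rw [hδ]; ring, ← inv_inv (Real.Gamma (1 - _)),
        hr, inv_div]
    rw [hg, hM, hs, Complex.ofReal_one, inv_one, one_pow, one_mul, Complex.ofReal_div, Complex.ofReal_mul,
      Complex.ofReal_neg]
    generalize (Real.Gamma (N + 1 / 2 - j) : ℂ) = Γ at hG ⊢
    generalize (Real.sin (Real.pi * (N + 1 / 2 - j)) : ℂ) = S at hsn' ⊢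
    have := Complex.I_ne_zero
    field_simp
  rw [hval] at hlim
  refine hlim.congr' ?_
  filter_upwards [self_mem_nhdsWithin] with ε hε
  have hε' : ε ≠ 0 := ne_of_gt hε
  have hc : ∀ s : ℝ, s = 1 ∨ s = -1 → Admissible fun w =>
      Complex.exp ((l : ℂ) * logReg 1 s ε w) := fun s hs =>
    .of_continuous (continuous_exp_logReg _ hs hε')
  have hcs : Admissible fun w => Complex.exp ((l : ℂ) * logReg 1 1 ε w) -
      Complex.exp ((l : ℂ) * logReg 1 (-1) ε w) := by
    simpa [sub_eq_add_neg] using (hc 1 (by simp)).add ((hc (-1) (by simp)).const_mul (-1))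
  rw [powInt_eq_coneDist hd σ (by simp) hε', powInt_eq_coneDist hd σ (by simp) hε',
    coneDist_sub h0 σ (hc 1 (by simp)) (hc (-1) (by simp)), ← coneDist_const_mul h0 σ hcs,
    coneDist_zero_apply hd σ (hcs.const_mul M), hl1]
  congr 1; ext x
  have := minusPow_eq (Set.mem_Ioi.1 hε) 1 l (minkSq x)
  rw [one_mul] at this
  rw [this]

/-- With N = (d - 3)/2 the split is that of `coneDist_propKernel_eq_add`; only the powers of 4 and π
have to be matched. -/
theorem odd_decomposition {d N : ℕ} (hd : 2 ≤ d) (hn : d = 2 * N + 3) (m σ : ℝ) :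
    ∃ (P : ℕ → MinkDist d) (Gsing Greg : MinkDist d),
      (∀ j < N, IsConeBoundaryValue σ (fun ε w => minusPow (1 - (d : ℝ) / 2 + j) ε w) (P j)) ∧
      Gsing = ∑ j ∈ Finset.range N, oddCoeff d m j • P j ∧
      (∀ w : ℝ, w < 0 → Summable fun k : ℕ => oddCoeff d m (N + k) *
        (-w) ^ (1 - (d : ℝ) / 2 + ((N + k : ℕ) : ℝ))) ∧
      IsRegularDist (oddRegular d m σ) Greg ∧
      coneDist d σ N (propKernel N (1 / 2) ((m ^ 2 : ℝ) : ℂ)) = Gsing + Greg := by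
  refine ⟨_, _, _, fun j hj => isConeBoundaryValue_minusPow hd hn hj σ, rfl, fun w hw => ?_,
    isRegularDist_oddRegular hd hn m σ, ?_⟩
  · exact Complex.summable_ofReal.1 (hasSum_oddCoeff hn m hw).summable
  have hN : 2 * N + 1 ≤ d - 1 := by omega
  have h0 : 2 * 0 + 1 ≤ d - 1 := by omega
  have ha : (1 / 2 : ℝ) = 0 ∨ (1 / 2 : ℝ) = 1 / 2 := Or.inr rfl
  have hδ : (d : ℝ) / 2 = N + 1 + 1 / 2 := by rw [hn]; push_cast; ring
  have hT := admissible_tailKernel ha ((m ^ 2 : ℝ) : ℂ) N 0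
  ext φ
  rw [coneDist_propKernel_eq_add hN σ ha hδ, add_apply, sum_apply, coneDist_const_mul h0 σ hT,
    coneDist_zero_apply hd σ hT, mul_add, Finset.mul_sum]
  congr 1
  refine Finset.sum_congr rfl fun j hj => ?_
  have hjN : (j : ℝ) < N := by exact_mod_cast Finset.mem_range.1 hj
  rw [smul_apply, coneDist_const_mul hN σ (admissible_primPow ha one_pos j)]
  have hp : (fun w => (primPow (j - 1 / 2) (1 / 4 * w) : ℂ)) =
      fun w => (((1 / 4) ^ ((j : ℝ) - 1 / 2) : ℝ) : ℂ) * (primPow (j - 1 / 2) (1 * w) : ℂ) := by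
    ext w; rw [primPow_mul _ (by norm_num), one_mul, Complex.ofReal_mul]
  rw [hp, coneDist_const_mul hN σ (admissible_primPow ha one_pos j)]
  have h1 := coneConst_eq hδ (j - 1 / 2)
  rw [show (N : ℝ) + 1 / 2 + (j - 1 / 2) = ((N + j : ℕ) : ℝ) by push_cast; ring, Real.rpow_natCast] at h1
  -- The argument is a half-integer and never a pole, so the factor Γ may be cancelled against the
  -- one in `oddCoeff`.
  have hG : Real.Gamma (2 - (d : ℝ) / 2 + j) ≠ 0 := by
    rw [hδ]
    refine Real.Gamma_ne_zero fun n h => ?_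
    have h2 : (2 * N : ℤ) = 1 + 2 * (j + n) := by
      have : (2 * N : ℝ) = 1 + 2 * (j + n) := by linarith
      exact_mod_cast this
    omega
  have hkey : 2 * Real.pi / (4 * Real.pi) ^ ((d : ℝ) / 2) * ((m ^ 2) ^ j / (j.factorial : ℝ) *
      (4 ^ N * (1 / 4) ^ ((j : ℝ) - 1 / 2))) = oddCoeff d m j * Real.Gamma (2 - (d : ℝ) / 2 + j) := by
    calc _ = (m ^ 2) ^ j / (j.factorial : ℝ) * 4 ^ N * (2 * Real.pi / (4 * Real.pi) ^ ((d : ℝ) / 2) *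
          (1 / 4) ^ ((j : ℝ) - 1 / 2)) := by ring
      _ = _ := by
        rw [h1, oddCoeff, pow_add, div_pow, div_pow, div_pow, one_pow, one_pow]
        generalize Real.Gamma (2 - (d : ℝ) / 2 + j) = Γ at hG ⊢
        field_simp
  generalize coneDist d σ N (fun w => (primPow (j - 1 / 2) (1 * w) : ℂ)) φ = D
  rw [Complex.real_smul, ← mul_assoc (oddCoeff d m j : ℂ), ← Complex.ofReal_mul, ← hkey]
  push_cast
  ring

/-! ### Derivatives of δ(x²) and the even dimension. -/

theorem primPow_natCast {p : ℕ} (hp : p ≠ 0) (w : ℝ) :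
    primPow p w = max (-w) 0 ^ p / (p.factorial : ℝ) := by
  rw [primPow_eq_max (by positivity), Real.rpow_natCast, Real.Gamma_nat_eq_factorial]

theorem primPow_zero {w : ℝ} : primPow ((0 : ℕ) : ℝ) w = if w < 0 then 1 else 0 := by
  simp [primPow]

theorem abs_primPow_natCast_le {p : ℕ} {w A : ℝ} (hw : |w| ≤ A) : |primPow p w| ≤ A ^ p := by
  have hA : 0 ≤ A := (abs_nonneg w).trans hw
  rw [primPow]
  split_ifs with h
  · rw [Real.rpow_natCast, Real.Gamma_nat_eq_factorial, abs_div, abs_pow, abs_neg, Nat.abs_cast]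
    refine (div_le_self (by positivity) (by exact_mod_cast p.factorial_pos)).trans ?_
    gcongr
  · rw [abs_zero]; positivity

theorem abs_primPow_succ_sub_le {p : ℕ} {v w A : ℝ} (hv : |v| ≤ A) (hw : |w| ≤ A) :
    |primPow ((p + 1 : ℕ) : ℝ) v - primPow ((p + 1 : ℕ) : ℝ) w| ≤ (p + 1) * A ^ p * |v - w| := by
  have hA : 0 ≤ A := (abs_nonneg w).trans hw
  have hm : ∀ u : ℝ, |u| ≤ A → |max (-u) 0| ≤ A := fun u hu => by
    rw [abs_of_nonneg (le_max_right _ _)]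
    exact max_le ((neg_le_abs u).trans hu) hA
  rw [primPow_natCast p.succ_ne_zero, primPow_natCast p.succ_ne_zero, ← sub_div, abs_div, Nat.abs_cast]
  refine (div_le_self (abs_nonneg _) (by exact_mod_cast (p + 1).factorial_pos)).trans ?_
  refine (abs_pow_sub_pow_le _ _ _).trans ?_
  have h1 : |max (-v) 0 - max (-w) 0| ≤ |v - w| := by
    refine (abs_max_sub_max_le_abs _ _ _).trans (le_of_eq ?_)
    rw [← abs_neg]; congr 1; ring
  rw [Nat.succ_sub_one]
  calc _ ≤ |v - w| * ((p + 1 : ℕ) : ℝ) * A ^ p := by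
        gcongr
        exact max_le (hm v hv) (hm w hw)
    _ = _ := by push_cast; ring

theorem admissible_primPow_sub (p : ℕ) (s : ℝ) : Admissible fun w => (primPow p (w - s) : ℂ) := by
  refine .of_bounded ?_ fun R => ⟨(R + |s|) ^ p, fun w hw _ => ?_⟩
  · have := measurable_primPow p
    fun_prop
  · rw [Complex.norm_real]
    exact abs_primPow_natCast_le ((abs_sub w s).trans (add_le_add_left hw _))

theorem continuousAt_primPow (l : ℝ) {w : ℝ} (hw : w ≠ 0) : ContinuousAt (primPow l) w := by
  rcases lt_or_gt_of_ne hw with hw' | hw'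
  · have hp : -w ≠ 0 := neg_ne_zero.2 hw
    have h : ContinuousAt (fun w : ℝ => (-w) ^ l / Real.Gamma (l + 1)) w :=
      (continuousAt_id.neg.rpow_const (Or.inl hp)).div_const _
    refine h.congr ?_
    filter_upwards [gt_mem_nhds hw'] with y hy
    rw [primPow, if_pos hy]
  · refine (continuousAt_const (y := (0 : ℝ))).congr ?_
    filter_upwards [lt_mem_nhds hw'] with y hy
    rw [primPow_of_nonneg _ hy.le]

/-- The density against which `K(x²)` is integrated in `coneDist d σ N K φ`. -/
def coneDensity {d : ℕ} (σ : ℝ) (N : ℕ) (φ : MinkTest d) (x : Mink d) : ℂ :=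
  coneWeight σ N (fun _ => 1) x * (eulerIter d N φ x : ℂ)

theorem integrable_coneDensity {d N : ℕ} (h : 2 * N + 1 ≤ d - 1) (σ : ℝ) (φ : MinkTest d) :
    Integrable (coneDensity σ N φ) :=
  integrable_coneWeight_mul h σ (.of_continuous continuous_const) _

theorem coneDist_eq_integral_coneDensity {d N : ℕ} (h : 2 * N + 1 ≤ d - 1) (σ : ℝ) {K : ℝ → ℂ}
    (hK : Admissible K) (φ : MinkTest d) :
    coneDist d σ N K φ = ∫ x, K (minkSq x) * coneDensity σ N φ x := by
  rw [coneDist_apply h σ hK]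
  congr 1; ext x
  simp only [coneDensity, coneWeight]; ring

theorem exists_coneDensity_eq_zero {d : ℕ} (σ : ℝ) (N : ℕ) (φ : MinkTest d) :
    ∃ R : ℝ, 0 ≤ R ∧ ∀ x, R < |minkSq x| → coneDensity σ N φ x = 0 := by
  obtain ⟨R, hR⟩ := (eulerIter d N φ).hasCompactSupport.isBounded.subset_closedBall 0
  refine ⟨R ^ 2, sq_nonneg R, fun x hx => ?_⟩
  have h0 : eulerIter d N φ x = 0 := image_eq_zero_of_notMem_tsupport fun hx' =>
    absurd (abs_minkSq_le (mem_closedBall_zero_iff.1 (hR hx'))) (not_le.2 hx)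
  rw [coneDensity, h0, Complex.ofReal_zero, mul_zero]

/-- Shifting the kernel by s turns -d/dw into d/ds. The shifted power is Lipschitz in s on the
support of the density, and the pointwise derivative exists off the null set x² = s₀; this covers p
= 0 too, where the derivative is a step function. -/
theorem hasDerivAt_coneDist_primPow {d N : ℕ} (h : 2 * N + 1 ≤ d - 1) (σ : ℝ) (p : ℕ)
    (φ : MinkTest d) (s₀ : ℝ) :
    HasDerivAt (fun s : ℝ => coneDist d σ N (fun w => (primPow ((p + 1 : ℕ) : ℝ) (w - s) : ℂ)) φ)
      (coneDist d σ N (fun w => (primPow p (w - s₀) : ℂ)) φ) s₀ := by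
  simp only [coneDist_eq_integral_coneDensity h σ (admissible_primPow_sub _ _)]
  obtain ⟨R, hR0, hR⟩ := exists_coneDensity_eq_zero σ N φ
  have hB := integrable_coneDensity h σ φ
  have hmeas : ∀ (p : ℕ) (s : ℝ), AEStronglyMeasurable (fun x : Mink d =>
      (primPow p (minkSq x - s) : ℂ) * coneDensity σ N φ x) := fun p s => by
    refine AEStronglyMeasurable.mul ?_ hB.1
    have h1 := measurable_primPow p
    have h2 := (continuous_minkSq (d := d)).measurable
    exact Measurable.aestronglyMeasurable (by fun_prop)
  have hint : Integrable (fun x : Mink d =>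
      (primPow ((p + 1 : ℕ) : ℝ) (minkSq x - s₀) : ℂ) * coneDensity σ N φ x) := by
    have := integrable_coneWeight_mul h σ (admissible_primPow_sub (p + 1) s₀) (eulerIter d N φ)
    refine this.congr (.of_forall fun x => ?_)
    simp only [coneDensity, coneWeight]; ring
  set A := R + |s₀| + 1 with hA
  have hA0 : 0 ≤ A := by positivity
  refine (hasDerivAt_integral_of_dominated_loc_of_lip (Metric.ball_mem_nhds s₀ one_pos)
    (bound := fun x => (p + 1) * A ^ p * ‖coneDensity σ N φ x‖)
    (.of_forall fun s => hmeas _ s) hint (hmeas p s₀) (.of_forall fun x => ?_)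
    (hB.norm.const_mul _) ?_).2
  · rw [Real.nnabs_of_nonneg (by positivity)]
    refine LipschitzOnWith.of_dist_le_mul fun s hs t ht => ?_
    rw [Real.coe_toNNReal _ (by positivity), dist_eq_norm, ← sub_mul, norm_mul, ← Complex.ofReal_sub,
      Complex.norm_real, Real.norm_eq_abs]
    by_cases hx : R < |minkSq x|
    · simp [hR x hx]
    · have hb : ∀ s ∈ Metric.ball s₀ 1, |minkSq x - s| ≤ A := fun s hs => by
        have h1 : |s - s₀| < 1 := by simpa [Real.dist_eq] using hs
        have h2 := abs_sub (minkSq x) s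
        have h3 : |s| ≤ |s₀| + |s - s₀| := by
          have := abs_add_le s₀ (s - s₀); rwa [add_sub_cancel] at this
        rw [hA]; linarith
      have := abs_primPow_succ_sub_le (p := p) (hb s hs) (hb t ht)
      rw [sub_sub_sub_cancel_left, abs_sub_comm t s] at this
      rw [Real.dist_eq]
      calc _ ≤ (p + 1) * A ^ p * |s - t| * ‖coneDensity σ N φ x‖ := by gcongr
        _ = _ := by ring
  · filter_upwards [ae_minkSq_ne (d := d) (by omega) s₀] with x hx
    have h1 : HasDerivAt (fun s => primPow ((p : ℝ) + 1) (minkSq x - s)) (primPow p (minkSq x - s₀)) s₀ := by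
      have := (hasDerivAt_primPow (l := p) (by positivity) (sub_ne_zero.2 hx)).comp_const_sub (minkSq x) s₀
      rwa [neg_neg] at this
    rw [Nat.cast_succ]
    exact h1.ofReal_comp.mul_const _

/-- The bottom of the ladder in s: the step function is bounded by 1 and continuous in s at every x
with x² ≠ s₀. -/
theorem continuous_coneDist_primPow_zero {d N : ℕ} (h : 2 * N + 1 ≤ d - 1) (σ : ℝ) (φ : MinkTest d) :
    Continuous fun s : ℝ => coneDist d σ N (fun w => (primPow ((0 : ℕ) : ℝ) (w - s) : ℂ)) φ := by
  simp only [coneDist_eq_integral_coneDensity h σ (admissible_primPow_sub _ _)]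
  have hB := integrable_coneDensity h σ φ
  refine continuous_iff_continuousAt.2 fun s₀ => continuousAt_of_dominated
    (bound := fun x => ‖coneDensity σ N φ x‖) (.of_forall fun s => ?_)
    (.of_forall fun s => .of_forall fun x => ?_) hB.norm ?_
  · refine AEStronglyMeasurable.mul ?_ hB.1
    have h1 := measurable_primPow ((0 : ℕ) : ℝ)
    have h2 := (continuous_minkSq (d := d)).measurable
    exact Measurable.aestronglyMeasurable (by fun_prop)
  · rw [norm_mul, Complex.norm_real]
    refine mul_le_of_le_one_left (norm_nonneg _) ?_
    simpa using abs_primPow_natCast_le (p := 0) (le_refl |minkSq x - s|)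
  · filter_upwards [ae_minkSq_ne (d := d) (by omega) s₀] with x hx
    have h1 : ContinuousAt (fun s => primPow ((0 : ℕ) : ℝ) (minkSq x - s)) s₀ :=
      ContinuousAt.comp (f := fun s => minkSq x - s) (continuousAt_primPow _ (sub_ne_zero.2 hx)) (by fun_prop)
    exact (Complex.continuous_ofReal.continuousAt.comp h1).mul continuousAt_const

theorem contDiff_of_hasDerivAt_seq {g : ℕ → ℝ → ℝ} (h0 : Continuous (g 0))
    (hg : ∀ p s, HasDerivAt (g (p + 1)) (g p s) s) (p : ℕ) : ContDiff ℝ p (g p) := by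
  induction p with
  | zero => exact contDiff_zero.2 h0
  | succ p ih =>
    have hd : deriv (g (p + 1)) = g p := funext fun s => (hg p s).deriv
    rw [Nat.cast_succ, contDiff_succ_iff_deriv, hd]
    exact ⟨fun s => (hg p s).differentiableAt, by simp, ih⟩

theorem iteratedDeriv_of_hasDerivAt_seq {g : ℕ → ℝ → ℝ}
    (hg : ∀ p s, HasDerivAt (g (p + 1)) (g p s) s) (p k : ℕ) : iteratedDeriv k (g (p + k)) = g p := by
  induction k with
  | zero => simp
  | succ k ih =>
    have hd : deriv (g (p + k + 1)) = g (p + k) := funext fun s => (hg _ s).deriv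
    rw [iteratedDeriv_succ', ← add_assoc, hd, ih]

/-- The indicator of x² < s is the step function of w - s, whose N-fold primitive is (w - s)_-^N/N!;
the ladder between them is descended by integration by parts. -/
theorem setIntegral_eq_coneDist {d N : ℕ} (h : 2 * N + 1 ≤ d - 1) (σ s : ℝ) (φ : MinkTest d) :
    ((∫ x in {x : Mink d | minkSq x < s ∧ 0 < σ * x.1}, φ x : ℝ) : ℂ) =
      coneDist d σ N (fun w => (primPow N (w - s) : ℂ)) φ := by
  set f : ℕ → ℝ → ℂ := fun i w => (primPow ((N : ℝ) - i) (w - s) : ℂ) with hf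
  have hl : IsLadder {s} N f := by
    refine ⟨fun i hi => ?_, fun i hi w hw => ?_, ?_⟩
    · have hi' : (i : ℝ) < N := by exact_mod_cast hi
      have := continuous_primPow (l := (N : ℝ) - i) (by linarith)
      simp only [hf]; fun_prop
    · have hi' : ((i + 1 : ℕ) : ℝ) ≤ N := by exact_mod_cast hi
      have hne : (N : ℝ) - (i + 1 : ℕ) + 1 ≠ 0 := by linarith
      have h1 := (hasDerivAt_primPow hne (sub_ne_zero.2 (by simpa using hw) : w - s ≠ 0)).comp_sub_const w s
      have e : (N : ℝ) - (i + 1 : ℕ) + 1 = N - i := by push_cast; ring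
      rw [e] at h1
      simpa only [hf, Complex.ofReal_neg] using h1.ofReal_comp
    · have := admissible_primPow_sub 0 s
      simpa [hf] using this
  have hmeas : MeasurableSet {x : Mink d | minkSq x < s ∧ 0 < σ * x.1} :=
    (measurableSet_lt continuous_minkSq.measurable measurable_const).inter
      (measurableSet_lt measurable_const (by fun_prop : Measurable fun x : Mink d => σ * x.1))
  have h1 := hl.integral_eq_coneDist h σ (Set.countable_singleton s) φ
  have e0 : f 0 = fun w => (primPow N (w - s) : ℂ) := by simp [hf]
  rw [e0] at h1
  rw [← h1, ← integral_indicator hmeas, ← integral_complex_ofReal]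
  congr 1; ext x
  have e1 : f N (minkSq x) = (primPow ((0 : ℕ) : ℝ) (minkSq x - s) : ℂ) := by simp [hf]
  rw [e1, primPow_zero, heaviside]
  by_cases h2 : minkSq x < s <;> by_cases h3 : 0 < σ * x.1 <;> simp [Set.indicator, h2, h3]

/-- Each derivative in s lowers the index N by one, so j + 1 ≤ N of them exist, the last being
continuous, and at s = 0 the index N - 1 - j is left. -/
theorem isConeDelta_coneDist {d N j : ℕ} (h : 2 * N + 1 ≤ d - 1) (σ : ℝ) (hj : j < N) :
    IsConeDelta σ j (coneDist d σ N (fun w => (-1) ^ j * (primPow ((N - 1 - j : ℕ) : ℝ) w : ℂ))) := by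
  intro φ
  set g : ℕ → ℝ → ℝ := fun p s => (coneDist d σ N (fun w => (primPow p (w - s) : ℂ)) φ).re with hg
  have hder : ∀ p s, HasDerivAt (g (p + 1)) (g p s) s := fun p s =>
    Complex.reCLM.hasFDerivAt.comp_hasDerivAt s (hasDerivAt_coneDist_primPow h σ p φ s)
  have h0 : Continuous (g 0) := Complex.continuous_re.comp (continuous_coneDist_primPow_zero h σ φ)
  have hI : (fun s : ℝ => ∫ x in {x : Mink d | minkSq x < s ∧ 0 < σ * x.1}, φ x) = g N := by
    ext s
    simp only [hg]
    rw [← setIntegral_eq_coneDist h σ s φ, Complex.ofReal_re]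
  rw [hI]
  refine ⟨((contDiff_of_hasDerivAt_seq h0 hder N).of_le (by exact_mod_cast hj)).contDiffAt, ?_⟩
  obtain ⟨q, rfl⟩ : ∃ q, N = q + (j + 1) := ⟨N - (j + 1), by omega⟩
  have e : q + (j + 1) - 1 - j = q := by omega
  have hadm : Admissible fun w => (primPow (q : ℝ) w : ℂ) := by
    simpa using admissible_primPow_sub q 0
  rw [iteratedDeriv_of_hasDerivAt_seq hder, e, coneDist_const_mul h σ hadm, hg]
  simp only [sub_zero]
  have hr : starRingEnd ℂ (coneDist d σ (q + (j + 1)) (fun w => (primPow (q : ℝ) w : ℂ)) φ) = _ :=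
    coneDist_conj h σ hadm (fun w => Complex.conj_ofReal _) φ
  rw [Complex.ofReal_mul, Complex.conj_eq_iff_re.1 hr]
  push_cast; rfl

/-- At integers the factorial (j + N)! and the Gamma value j! exchange roles: the terms of index at
least N of 𝐅_{-N} are z^N 𝐅_N. -/
theorem tailKernel_zero_natCast {a : ℝ} (ha : a = 0) (m : ℝ) (N : ℕ) {w : ℝ} (hw : w < 0) :
    tailKernel a ((m ^ 2 : ℝ) : ℂ) N 0 w = (((m ^ 2) ^ N * boldF N (m ^ 2 * |w| / 4) : ℝ) : ℂ) := by
  rw [tailKernel, boldF, ← tsum_mul_left, Complex.ofReal_tsum]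
  refine tsum_congr fun j => ?_
  have e : (j + N).factorial = Real.Gamma (N + 1 + j) := by
    rw [← Real.Gamma_nat_eq_factorial]; congr 1; push_cast; ring
  rw [primPow, if_pos (by linarith), ← e, ha, add_zero, sub_zero, Real.rpow_natCast,
    Real.Gamma_nat_eq_factorial, abs_of_neg hw, show m ^ 2 * -w / 4 = m ^ 2 * -(w / 4) by ring, mul_pow,
    pow_add]
  push_cast
  ring

theorem isRegularDist_evenRegular {d N : ℕ} (hd : 2 ≤ d) (hn : d = 2 * N + 2) {a : ℝ} (ha : a = 0)
    (m σ : ℝ) : IsRegularDist (evenRegular d m σ) (coneDist d σ 0 (fun w =>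
      ((2 * Real.pi / (4 * Real.pi) ^ ((d : ℝ) / 2) : ℝ) : ℂ) *
        tailKernel a ((m ^ 2 : ℝ) : ℂ) N 0 w)) := by
  refine isRegularDist_coneDist hd σ ((admissible_tailKernel (Or.inl ha) _ N 0).const_mul _) fun x => ?_
  have h1 : d - 2 = 2 * N := by omega
  have h2 : (d : ℝ) / 2 - 1 = N := by rw [hn]; push_cast; ring
  rw [evenRegular, h2, h1]
  by_cases hw : minkSq x < 0
  · rw [tailKernel_zero_natCast ha m N hw, heaviside, heaviside, if_pos (neg_pos.2 hw), mul_one, pow_mul]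
    push_cast
    ring
  · rw [tailKernel_of_nonneg _ _ _ _ (not_lt.1 hw), heaviside, heaviside,
      if_neg (show ¬ 0 < -minkSq x by linarith)]
    simp

theorem even_decomposition {d N : ℕ} (hd : 2 ≤ d) (hn : d = 2 * N + 2) {a : ℝ} (ha0 : a = 0) (m σ : ℝ) :
    ∃ (D : ℕ → MinkDist d) (Gsing Greg : MinkDist d),
      (∀ j < N, IsConeDelta σ j (D j)) ∧
      Gsing = ∑ j ∈ Finset.range N, evenCoeff d m j • D j ∧
      IsRegularDist (evenRegular d m σ) Greg ∧
      coneDist d σ N (propKernel N a ((m ^ 2 : ℝ) : ℂ)) = Gsing + Greg := by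
  have hN : 2 * N + 1 ≤ d - 1 := by omega
  have h0 : 2 * 0 + 1 ≤ d - 1 := by omega
  refine ⟨_, _, _, fun j hj => isConeDelta_coneDist hN σ hj, rfl,
    isRegularDist_evenRegular hd hn ha0 m σ, ?_⟩
  have ha : a = 0 ∨ a = 1 / 2 := Or.inl ha0
  have hδ : (d : ℝ) / 2 = N + 1 + a := by rw [hn, ha0]; push_cast; ring
  have hT := admissible_tailKernel ha ((m ^ 2 : ℝ) : ℂ) N 0
  ext φ
  rw [coneDist_propKernel_eq_add hN σ ha hδ, add_apply, sum_apply, coneDist_const_mul h0 σ hT,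
    coneDist_zero_apply hd σ hT, mul_add, Finset.mul_sum, ← Finset.sum_range_reflect]
  congr 1
  refine Finset.sum_congr rfl fun j hj => ?_
  have hjN := Finset.mem_range.1 hj
  -- The sum was reflected: the power of m² runs opposite to the order of the derivative of δ, since
  -- the index N - 1 - j of w_- belongs to δ^{(j)}.
  set k := N - 1 - j with hk
  have hadm : Admissible fun w => (primPow (k : ℝ) w : ℂ) := by
    simpa using admissible_primPow_sub k 0
  have hp : (fun w => (primPow (k - a) (1 / 4 * w) : ℂ)) =
      fun w => (((1 / 4) ^ k : ℝ) : ℂ) * (primPow (k : ℝ) w : ℂ) := by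
    ext w; rw [ha0, sub_zero, primPow_mul _ (by norm_num), Real.rpow_natCast, Complex.ofReal_mul]
  rw [hp, smul_apply, coneDist_const_mul hN σ hadm, coneDist_const_mul hN σ hadm]
  have h1 := coneConst_eq hδ k
  rw [show (N : ℝ) + a + k = ((N + k : ℕ) : ℝ) by rw [ha0]; push_cast; ring, Real.rpow_natCast,
    Real.rpow_natCast] at h1
  have hdk : d / 2 - 2 - j = k := by omega
  have hkey : 2 * Real.pi / (4 * Real.pi) ^ ((d : ℝ) / 2) * ((m ^ 2) ^ k / (k.factorial : ℝ) *
      (4 ^ N * (1 / 4) ^ k)) = evenCoeff d m j * (-1) ^ j := by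
    have hs : ((-1 : ℝ) ^ j) * (-1) ^ j = 1 := by rw [← mul_pow]; norm_num
    calc _ = (m ^ 2) ^ k / (k.factorial : ℝ) * 4 ^ N * (2 * Real.pi / (4 * Real.pi) ^ ((d : ℝ) / 2) *
          (1 / 4) ^ k) := by ring
      _ = ((-1 : ℝ) ^ j * (-1) ^ j) * ((m ^ 2 / 4) ^ k /
          (2 * Real.pi ^ ((d : ℝ) / 2 - 1) * (k.factorial : ℝ))) := by
        rw [h1, hs, pow_add, div_pow, div_pow, div_pow, one_pow, one_pow]
        field_simp
      _ = _ := by rw [evenCoeff, hdk]; ring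
  generalize coneDist d σ N (fun w => (primPow (k : ℝ) w : ℂ)) φ = D
  have hkey' := congrArg ((↑) : ℝ → ℂ) hkey
  rw [Complex.real_smul]
  push_cast at hkey' ⊢
  linear_combination D * hkey'

/-! ### Conclusion. -/

theorem riemannU_sub_eq_conj {d N : ℕ} (hd : 2 ≤ d) {a : ℝ} (ha : a = 0 ∨ a = 1 / 2)
    (hn : (d : ℝ) = 2 * N + 2 + 2 * a) {m : ℝ} (hm : 0 < m) {w : ℝ} (hw : w < 0) :
    tachPrefactor d m (-Complex.I) *
      (riemannU (N + a) (Real.log (m ^ 2 * (-w) / 4) : ℂ) -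
        riemannU (N + a) ((Real.log (m ^ 2 * (-w) / 4) : ℂ) - 2 * Complex.I * (Real.pi : ℂ))) =
      ((2 * Real.pi / (4 * Real.pi) ^ ((d : ℝ) / 2) * (-w / 4) ^ (-(N + a)) *
        boldF (-(N + a)) (m ^ 2 * (-w / 4)) : ℝ) : ℂ) := by
  have h := congrArg (starRingEnd ℂ) (riemannU_sub_eq hd ha hn hm hw)
  rw [Complex.conj_ofReal, map_mul, tachPrefactor_conj, map_sub, ← riemannU_conj, ← riemannU_conj, map_add,
    Complex.conj_ofReal, map_mul, map_mul, Complex.conj_I, Complex.conj_ofReal,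
    Complex.conj_ofNat] at h
  rw [← h]
  congr 3
  ring_nf

theorem eq_of_isGreenFunction {d N : ℕ} (h : 2 * N + 1 ≤ d - 1) {σ : ℝ} (hσ : σ = 1 ∨ σ = -1)
    {K : ℝ → ℂ} (hK : Admissible K) (hK0 : ∀ w, 0 ≤ w → K w = 0) {c : ℝ}
    (hG : IsGreenFunction c (coneDist d σ N K)) {G' : MinkDist d} (hG' : IsGreenFunction c G')
    (hs : Distribution.dsupport ⇑G' ⊆ causalCone d σ) : G' = coneDist d σ N K := by
  ext φ
  refine sub_eq_zero.1 (eq_zero_of_dsupport_subset h hσ hK hK0 hG (H := G' - coneDist d σ N K)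
    (fun φ => ?_) (fun φ hφ => ?_) φ)
  · have h1 := isGreenFunction_iff.1 hG φ
    have h2 := isGreenFunction_iff.1 hG' φ
    rw [sub_apply, sub_apply]
    linear_combination h2 - h1
  · rw [sub_apply, eq_zero_of_disjoint_dsupport (hφ.mono_right hs),
      eq_zero_of_disjoint_dsupport (hφ.mono_right (dsupport_coneDist_subset h σ hK hK0)), sub_zero]

end

theorem mainTheorem8 (d : ℕ) (hd : 2 ≤ d) (m : ℝ) (hm : 0 < m)
    (σ : ℝ) (hσ : σ = 1 ∨ σ = -1) :
    ∃ G : MinkDist d,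
      -- the unique Green function of `-m² - □` supported in the cone
      IsGreenFunction (-m ^ 2) G ∧ Distribution.dsupport ⇑G ⊆ causalCone d σ ∧
      (∀ G' : MinkDist d, IsGreenFunction (-m ^ 2) G' →
        Distribution.dsupport ⇑G' ⊆ causalCone d σ → G' = G) ∧
      -- analytic continuation of the massive propagators in the mass, along both directions
      (∃ 𝒢 : ℂ → MinkDist d,
        (∀ φ : MinkTest d, Differentiable ℂ (fun z => 𝒢 z φ)) ∧
        (∀ M : ℝ, 0 < M → IsMassivePropagator σ M (𝒢 (M : ℂ))) ∧
        𝒢 (Complex.exp (Complex.I * (Real.pi : ℂ) / 2) * (m : ℂ)) = G ∧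
        𝒢 (Complex.exp (-(Complex.I * (Real.pi : ℂ) / 2)) * (m : ℂ)) = G) ∧
      -- the two formulas in terms of `U`, as distributions
      IsConeBoundaryValue σ (fun ε w => tachPrefactor d m Complex.I *
        (riemannU ((d : ℝ) / 2 - 1) (Complex.log (((m ^ 2 * w / 4 : ℝ) : ℂ) - Complex.I * (ε : ℂ))
            + Complex.I * (Real.pi : ℂ)) -
          riemannU ((d : ℝ) / 2 - 1) (Complex.log (((m ^ 2 * w / 4 : ℝ) : ℂ) + Complex.I * (ε : ℂ))
            + Complex.I * (Real.pi : ℂ)))) G ∧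
      IsConeBoundaryValue σ (fun ε w => tachPrefactor d m (-Complex.I) *
        (riemannU ((d : ℝ) / 2 - 1) (Complex.log (((m ^ 2 * w / 4 : ℝ) : ℂ) + Complex.I * (ε : ℂ))
            - Complex.I * (Real.pi : ℂ)) -
          riemannU ((d : ℝ) / 2 - 1) (Complex.log (((m ^ 2 * w / 4 : ℝ) : ℂ) - Complex.I * (ε : ℂ))
            - Complex.I * (Real.pi : ℂ)))) G ∧
      -- the formula in terms of `𝐅`, as distributions
      IsConeBoundaryValue σ (fun ε w =>
        ((2 * Real.pi / (4 * Real.pi) ^ ((d : ℝ) / 2) : ℝ) : ℂ) * tachKernel d m ε w) G ∧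
      -- the three expressions agree as functions of `w = x² < 0`
      (∀ w : ℝ, w < 0 →
        tachPrefactor d m Complex.I *
            (riemannU ((d : ℝ) / 2 - 1) (Real.log (m ^ 2 * (-w) / 4) : ℂ) -
              riemannU ((d : ℝ) / 2 - 1)
                ((Real.log (m ^ 2 * (-w) / 4) : ℂ) + 2 * Complex.I * (Real.pi : ℂ))) =
          ((2 * Real.pi / (4 * Real.pi) ^ ((d : ℝ) / 2) * (-w / 4) ^ (1 - (d : ℝ) / 2) *
            boldF (1 - (d : ℝ) / 2) (m ^ 2 * |w| / 4) : ℝ) : ℂ) ∧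
        tachPrefactor d m (-Complex.I) *
            (riemannU ((d : ℝ) / 2 - 1) (Real.log (m ^ 2 * (-w) / 4) : ℂ) -
              riemannU ((d : ℝ) / 2 - 1)
                ((Real.log (m ^ 2 * (-w) / 4) : ℂ) - 2 * Complex.I * (Real.pi : ℂ))) =
          ((2 * Real.pi / (4 * Real.pi) ^ ((d : ℝ) / 2) * (-w / 4) ^ (1 - (d : ℝ) / 2) *
            boldF (1 - (d : ℝ) / 2) (m ^ 2 * |w| / 4) : ℝ) : ℂ)) ∧
      -- singular and regular part, `d` odd
      (Odd d → ∃ (P : ℕ → MinkDist d) (Gsing Greg : MinkDist d),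
        (∀ j < (d - 3) / 2,
          IsConeBoundaryValue σ (fun ε w => minusPow (1 - (d : ℝ) / 2 + j) ε w) (P j)) ∧
        Gsing = ∑ j ∈ Finset.range ((d - 3) / 2), oddCoeff d m j • P j ∧
        (∀ w : ℝ, w < 0 → Summable fun k : ℕ => oddCoeff d m ((d - 3) / 2 + k) *
          (-w) ^ (1 - (d : ℝ) / 2 + (((d - 3) / 2 + k : ℕ) : ℝ))) ∧
        IsRegularDist (oddRegular d m σ) Greg ∧
        G = Gsing + Greg) ∧
      -- singular and regular part, `d` even
      (Even d → ∃ (D : ℕ → MinkDist d) (Gsing Greg : MinkDist d),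
        (∀ j < d / 2 - 1, IsConeDelta σ j (D j)) ∧
        Gsing = ∑ j ∈ Finset.range (d / 2 - 1), evenCoeff d m j • D j ∧
        IsRegularDist (evenRegular d m σ) Greg ∧
        G = Gsing + Greg) := by

  -- The two parities are merged here: d/2 - 1 = N + a with a = 0 or a = 1/2. Only the formula in
  -- terms of 𝐅 and the final decomposition need the parity itself.
  obtain ⟨N, a, ha, hn, hN, htach, hodd, heven⟩ : ∃ (N : ℕ) (a : ℝ), (a = 0 ∨ a = 1 / 2) ∧
      (d : ℝ) = 2 * N + 2 + 2 * a ∧ 2 * N + 1 ≤ d - 1 ∧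
      IsConeBoundaryValue σ (fun ε w =>
        ((2 * Real.pi / (4 * Real.pi) ^ ((d : ℝ) / 2) : ℝ) : ℂ) * tachKernel d m ε w)
        (coneDist d σ N (propKernel N a ((m ^ 2 : ℝ) : ℂ))) ∧
      (Odd d → d = 2 * N + 3 ∧ a = 1 / 2) ∧ (Even d → d = 2 * N + 2 ∧ a = 0) := by
    rcases Nat.even_or_odd d with h | h
    · obtain ⟨k, hk⟩ := h
      have hn : d = 2 * (k - 1) + 2 := by omega
      refine ⟨k - 1, 0, Or.inl rfl, ?_, by omega, isConeBoundaryValue_tachKernel_even hd hn rfl m σ,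
        fun h => ?_, fun _ => ⟨hn, rfl⟩⟩
      · rw [mul_zero, add_zero]; exact_mod_cast hn
      · obtain ⟨l, hl⟩ := h; omega
    · obtain ⟨k, hk⟩ := h
      have hn : d = 2 * (k - 1) + 3 := by omega
      refine ⟨k - 1, 1 / 2, Or.inr rfl, ?_, by omega, isConeBoundaryValue_tachKernel_odd hd hn m σ,
        fun _ => ⟨hn, rfl⟩, fun h => ?_⟩
      · rw [mul_one_div_cancel two_ne_zero, add_assoc, show (2 : ℝ) + 1 = 3 by norm_num]
        exact_mod_cast hn
      · obtain ⟨l, hl⟩ := h; omega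
  have hα : (d : ℝ) / 2 - 1 = N + a := by rw [hn]; ring
  have hα' : 1 - (d : ℝ) / 2 = -(N + a) := by rw [hn]; ring
  have hK := admissible_propKernel N ha ((m ^ 2 : ℝ) : ℂ)
  have hK0 : ∀ w, 0 ≤ w → propKernel N a ((m ^ 2 : ℝ) : ℂ) w = 0 := fun w => propKernel_of_nonneg N a _
  have hG : IsGreenFunction (-m ^ 2) (coneDist d σ N (propKernel N a ((m ^ 2 : ℝ) : ℂ))) := by
    have := isGreenFunction_coneDist hd ha hn hN hσ (-m ^ 2)
    rwa [show -(((-m ^ 2 : ℝ)) : ℂ) = ((m ^ 2 : ℝ) : ℂ) by push_cast; ring] at this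
  -- Only the square of the complex mass enters the kernel, so continuation along either direction
  -- ends at the same distribution.
  have hI : ∀ z : ℂ, z ^ 2 = -1 → -(z * (m : ℂ)) ^ 2 = ((m ^ 2 : ℝ) : ℂ) := fun z hz => by
    rw [mul_pow, hz]; push_cast; ring
  refine ⟨coneDist d σ N (propKernel N a ((m ^ 2 : ℝ) : ℂ)), hG, dsupport_coneDist_subset hN σ hK hK0,
    fun G' h1 h2 => eq_of_isGreenFunction hN hσ hK hK0 hG h1 h2,
    ⟨fun z => coneDist d σ N (propKernel N a (-z ^ 2)), fun φ => ?_, fun M hM =>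
      isMassivePropagator_coneDist hd ha hn hN hσ hM, ?_, ?_⟩, ?_, ?_, htach, fun w hw => ⟨?_, ?_⟩,
    fun h => ?_, fun h => ?_⟩
  · exact (differentiable_coneDist_propKernel hN σ ha φ).comp (differentiable_id.pow 2).neg
  · beta_reduce
    rw [hI _ (by rw [← Complex.exp_nat_mul, ← Complex.exp_pi_mul_I]; congr 1; push_cast; ring)]
  · beta_reduce
    rw [hI _ (by
      rw [← Complex.exp_nat_mul, ← inv_inv (-1 : ℂ), ← Complex.exp_pi_mul_I, ← Complex.exp_neg,
        ← Complex.exp_neg, neg_neg, Complex.exp_pi_mul_I, ← inv_inj, ← Complex.exp_neg, inv_neg, inv_one,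
        ← Complex.exp_pi_mul_I]
      congr 1; push_cast; ring)]
  · rw [hα]; exact isConeBoundaryValue_riemannU hd ha hn hN hm σ
  · rw [hα]; exact isConeBoundaryValue_riemannU_conj hd ha hn hN hm σ
  · rw [hα, hα', abs_of_neg hw, riemannU_sub_eq hd ha hn hm hw, mul_div_assoc (m ^ 2)]
  · rw [hα, hα', abs_of_neg hw, riemannU_sub_eq_conj hd ha hn hm hw, mul_div_assoc (m ^ 2)]
  · obtain ⟨hdN, rfl⟩ := hodd h
    rw [show (d - 3) / 2 = N by omega]
    exact odd_decomposition hd hdN m σ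
  · obtain ⟨hdN, ha0⟩ := heven h
    rw [show d / 2 - 1 = N by omega]
    exact even_decomposition hd hdN ha0 m σ
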